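/- A *knotoid diagram* (on the sphere) is a smooth immersion $K:[0,1]\to S^2$ whose only singularities are transversal double points, distinct from the end-points $K(0)$ and $K(1)$, each endowed with over/undercrossing data; diagrams are taken up to orientation-preserving reparametrization of $[0,1]$. The sphere $S^2$ is oriented, and $K$ is oriented from $K(0)$ to $K(1)$. The *writhe* $\mathrm{writhe}(K)\in\mathbb{Z}$ is the sum of the signs of the crossings of $K$, where the sign of a crossing is $+1$ if the tangent vectors (overcrossing strand, undercrossing strand) form a positively oriented frame of $S^2$, and $-1$ otherwise. A *Reidemeister move* replaces the part of a diagram inside a smoothly embedded closed disc in $S^2$ that does not contain the end-points of the diagram: - R1 creates or deletes a loop, i.e. it exchanges a single strand without self-crossings and a single strand with exactly one self-crossing (of either sign); - R1′ (the weakened first move) exchanges a single strand with exactly one self-crossing and another such strand whose self-crossing has the same sign (so the loop may change sides); - R2 exchanges two disjoint strands without self-crossings and two strands without self-crossings which cross each other exactly twice, with opposite signs, the same strand being over at both crossings; - R3 exchanges two configurations of three strands without self-crossings, any two of which cross exactly once, such that in both configurations the first strand is over the second and the third and the second is over the third, and the crossing of any two given strands has the same sign in both configurations. A *knotoid* is an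 equivalence class of knotoid diagrams under the equivalence relation generated by ambient isotopies of $S^2$ and the moves R1, R2, R3. A *framed knotoid* is an equivalence class of knotoid diagrams under the equivalence relation generated by ambient isotopies of $S^2$ and the moves R1′, R2, R3. **Lemma.** The assignment $K\mapsto (K,\mathrm{writhe}(K))$ on knotoid diagrams induces a well-defined map $$\{\text{framed knotoids}\}\longrightarrow\{\text{knotoids}\}\times\mathbb{Z},$$ and this map is a bijection. -/

import Mathlib

open scoped Manifold ContDiff

/-- Euclidean 3-space. -/
abbrev E3 : Type := EuclideanSpace ℝ (Fin 3)

/-- The 2-sphere, with Mathlib's smooth structure. It is oriented by the outward normal. -/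
abbrev S2 : Type := Metric.sphere (0 : E3) 1

/-- The velocity in `ℝ³` of a curve on the sphere. -/
noncomputable def velocity (γ : ℝ → S2) (t : ℝ) : E3 :=
  deriv (fun u => (γ u : E3)) t

/-- The determinant of three vectors of `ℝ³`. If `x` is a point of the sphere and `y`, `z` are
tangent vectors at `x`, it is positive exactly when `(y, z)` is a positive (counterclockwise, as
seen from outside) frame of the tangent plane at `x`. -/
noncomputable def det3 (x y z : E3) : ℝ :=
  (Matrix.of fun i j : Fin 3 => (![x, y, z] i) j).det

/-- A (spherical) knotoid diagram: a smooth immersion of `[0, 1]` in the 2-sphere whose only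
singularities are transversal double points, away from the two end-points, each of them endowed
with over/undercrossing data.

The curve is given as a smooth function on the real line (every smooth curve on the closed
interval `[0, 1]` extends to one), but only its restriction to `[0, 1]` is meaningful. Each double
point has exactly two parameters `s` and `t` in `[0, 1]`; the set `upper` says which of the two
belongs to the overcrossing strand, and is meaningful at parameters of double points only. -/
structure KnotoidDiagram where
  /-- the immersed curve, from the leg `curve 0` to the head `curve 1` -/
  curve : ℝ → S2
  /-- the parameters of overcrossing strands -/
  upper : Set ℝ
  smooth : ContDiff ℝ ∞ (fun t => (curve t : E3))
  immersion : ∀ t ∈ Set.Icc (0 : ℝ) 1, velocity curve t ≠ 0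
  /-- the end-points of the curve are not multiple points -/
  endpoints : ∀ s ∈ Set.Icc (0 : ℝ) 1, ∀ t ∈ Set.Icc (0 : ℝ) 1, s ≠ t → curve s = curve t →
    s ∈ Set.Ioo (0 : ℝ) 1 ∧ t ∈ Set.Ioo (0 : ℝ) 1
  /-- multiple points are at most double -/
  double : ∀ s ∈ Set.Icc (0 : ℝ) 1, ∀ t ∈ Set.Icc (0 : ℝ) 1, ∀ u ∈ Set.Icc (0 : ℝ) 1,
    curve s = curve t → curve t = curve u → s = t ∨ t = u ∨ s = u
  /-- double points are transversal -/
  transversal : ∀ s ∈ Set.Icc (0 : ℝ) 1, ∀ t ∈ Set.Icc (0 : ℝ) 1, s ≠ t → curve s = curve t →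
    LinearIndependent ℝ ![velocity curve s, velocity curve t]
  /-- at a double point exactly one of the two strands is the overcrossing one -/
  upper_iff : ∀ s ∈ Set.Icc (0 : ℝ) 1, ∀ t ∈ Set.Icc (0 : ℝ) 1, s ≠ t → curve s = curve t →
    (s ∈ upper ↔ t ∉ upper)

namespace KnotoidDiagram

/-- `t` is one of the two parameters of a double point of `K`. -/
def IsDoubleParam (K : KnotoidDiagram) (t : ℝ) : Prop :=
  t ∈ Set.Icc (0 : ℝ) 1 ∧ ∃ s ∈ Set.Icc (0 : ℝ) 1, s ≠ t ∧ K.curve s = K.curve t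

/-- The crossings of `K`, each recorded once, as the pair
(parameter of the overcrossing strand, parameter of the undercrossing strand). -/
def crossings (K : KnotoidDiagram) : Set (ℝ × ℝ) :=
  {p | p.1 ∈ Set.Icc (0 : ℝ) 1 ∧ p.2 ∈ Set.Icc (0 : ℝ) 1 ∧ p.1 ≠ p.2 ∧
    K.curve p.1 = K.curve p.2 ∧ p.1 ∈ K.upper}

/-- The sign of a crossing: `1` if (direction of the overcrossing strand, direction of the
undercrossing strand) is a positive frame of the oriented sphere, and `-1` if it is a negative
one. -/
noncomputable def crossingSign (K : KnotoidDiagram) (p : ℝ × ℝ) : ℤ :=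
  (SignType.sign
    (det3 (K.curve p.1) (velocity K.curve p.1) (velocity K.curve p.2)) : SignType)

/-- The writhe: the sum of the signs of all crossings. (There are only finitely many crossings,
since the double points are transversal.) -/
noncomputable def writhe (K : KnotoidDiagram) : ℤ :=
  ∑ᶠ p ∈ K.crossings, K.crossingSign p

/-- `K` and `L` agree up to an ambient isotopy of the sphere and an orientation-preserving
reparametrization `σ` of `[0, 1]`, over/undercrossings being preserved. The isotopy `H` is a smooth
one-parameter family of diffeomorphisms that starts at the identity; `H 1` is what is applied to
the curve. -/
def Isotopic (K L : KnotoidDiagram) : Prop :=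
  ∃ (H : ℝ → (S2 ≃ₘ⟮𝓡 2, 𝓡 2⟯ S2)) (σ : ℝ → ℝ),
    ContMDiff (𝓘(ℝ, ℝ).prod (𝓡 2)) (𝓡 2) ∞ (fun p : ℝ × S2 => H p.1 p.2) ∧
    (∀ x, H 0 x = x) ∧
    ContDiff ℝ ∞ σ ∧ σ 0 = 0 ∧ σ 1 = 1 ∧ (∀ t ∈ Set.Icc (0 : ℝ) 1, 0 < deriv σ t) ∧
    (∀ t ∈ Set.Icc (0 : ℝ) 1, L.curve t = H 1 (K.curve (σ t))) ∧
    (∀ t, L.IsDoubleParam t → (t ∈ L.upper ↔ σ t ∈ K.upper))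

end KnotoidDiagram

/-- The place of a Reidemeister move that involves `n` strands: a smoothly embedded closed disc in
the sphere, given as the image of the closed unit disc under a smooth embedding of the plane, and
`n` disjoint parameter intervals `[a i, b i]` inside `(0, 1)`. -/
structure Window (n : ℕ) where
  chart : EuclideanSpace ℝ (Fin 2) → S2
  a : Fin n → ℝ
  b : Fin n → ℝ
  chart_smooth : ContDiff ℝ ∞ (fun x => (chart x : E3))
  chart_injective : Function.Injective chart
  chart_immersion : ∀ x, Function.Injective (fderiv ℝ (fun y => (chart y : E3)) x)
  a_pos : ∀ i, 0 < a i
  a_lt_b : ∀ i, a i < b i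
  b_lt_one : ∀ i, b i < 1
  disjoint : ∀ i j, i ≠ j → Disjoint (Set.Icc (a i) (b i)) (Set.Icc (a j) (b j))

namespace Window

variable {n : ℕ}

/-- The diagram `K` meets the disc of `W` in the `n` strands of `W`: the part of `K` in the closed
disc is parametrized by the intervals `[a i, b i]`, the part in its interior by the intervals
`(a i, b i)`, and no double point lies on the boundary circle. In particular the end-points of `K`
lie outside the disc. -/
def Meets (W : Window n) (K : KnotoidDiagram) : Prop :=
  (∀ t ∈ Set.Icc (0 : ℝ) 1,
    K.curve t ∈ W.chart '' Metric.closedBall 0 1 ↔ ∃ i, t ∈ Set.Icc (W.a i) (W.b i)) ∧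
  (∀ t ∈ Set.Icc (0 : ℝ) 1,
    K.curve t ∈ W.chart '' Metric.ball 0 1 ↔ ∃ i, t ∈ Set.Ioo (W.a i) (W.b i)) ∧
  (∀ i, ¬ K.IsDoubleParam (W.a i) ∧ ¬ K.IsDoubleParam (W.b i))

/-- `K` and `L` both meet the disc of `W` in the strands of `W`, and they are identical outside the
disc, including the over/undercrossing data. -/
def Replaces (W : Window n) (K L : KnotoidDiagram) : Prop :=
  W.Meets K ∧ W.Meets L ∧
  ∀ t ∈ Set.Icc (0 : ℝ) 1, (∀ i, t ∉ Set.Ioo (W.a i) (W.b i)) →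
    K.curve t = L.curve t ∧ (K.IsDoubleParam t → (t ∈ K.upper ↔ t ∈ L.upper))

/-- The crossings of `K` in the disc of `W` at which strand `i` passes over strand `j`. -/
def crossings (W : Window n) (K : KnotoidDiagram) (i j : Fin n) : Set (ℝ × ℝ) :=
  {p ∈ K.crossings | p.1 ∈ Set.Ioo (W.a i) (W.b i) ∧ p.2 ∈ Set.Ioo (W.a j) (W.b j)}

end Window

/-- First Reidemeister move: in some disc, a single strand without self-crossings is replaced by a
single strand with exactly one self-crossing, that is, a loop of either sign on either side is
created. -/
def Reidemeister1 (K L : KnotoidDiagram) : Prop :=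
  ∃ W : Window 1, W.Replaces K L ∧ W.crossings K 0 0 = ∅ ∧ ∃ p, W.crossings L 0 0 = {p}

/-- Weakened first Reidemeister move: in some disc, a single strand with exactly one self-crossing
is replaced by another one whose self-crossing has the same sign, so that the loop may change the
side of the strand on which it lies. -/
def Reidemeister1' (K L : KnotoidDiagram) : Prop :=
  ∃ W : Window 1, W.Replaces K L ∧ ∃ p q, W.crossings K 0 0 = {p} ∧ W.crossings L 0 0 = {q} ∧
    K.crossingSign p = L.crossingSign q

/-- Second Reidemeister move: in some disc, two strands without crossings are replaced by two
strands without self-crossings that cross each other exactly twice, the first strand being over at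
both crossings; one of the two crossings is positive and the other one negative. -/
def Reidemeister2 (K L : KnotoidDiagram) : Prop :=
  ∃ W : Window 2, W.Replaces K L ∧ (∀ i j, W.crossings K i j = ∅) ∧
    (∀ i j, (i, j) ≠ (0, 1) → W.crossings L i j = ∅) ∧
    ∃ p q, W.crossings L 0 1 = {p, q} ∧ L.crossingSign p = 1 ∧ L.crossingSign q = -1

/-- Third Reidemeister move: in some disc, three strands without self-crossings, any two of which
cross exactly once, are replaced by three such strands, where on either side the first strand
passes over the second and the third one, and the second one over the third; the crossing of two
given strands has the same sign before and after the move. -/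
def Reidemeister3 (K L : KnotoidDiagram) : Prop :=
  ∃ W : Window 3, W.Replaces K L ∧
    (∀ i j, j ≤ i → W.crossings K i j = ∅ ∧ W.crossings L i j = ∅) ∧
    ∀ i j, i < j → ∃ p q, W.crossings K i j = {p} ∧ W.crossings L i j = {q} ∧
      K.crossingSign p = L.crossingSign q

/-- One step in the equivalence of knotoid diagrams. -/
def KnotoidMove (K L : KnotoidDiagram) : Prop :=
  K.Isotopic L ∨ Reidemeister1 K L ∨ Reidemeister2 K L ∨ Reidemeister3 K L

/-- One step in the equivalence of framed knotoid diagrams. -/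
def FramedKnotoidMove (K L : KnotoidDiagram) : Prop :=
  K.Isotopic L ∨ Reidemeister1' K L ∨ Reidemeister2 K L ∨ Reidemeister3 K L

/-- Knotoids: knotoid diagrams modulo the equivalence relation generated by isotopies and the
moves R1, R2, R3. -/
def Knotoid : Type := Quotient (Relation.EqvGen.setoid KnotoidMove)

/-- Framed knotoids: knotoid diagrams modulo the equivalence relation generated by isotopies and
the moves R1', R2, R3. -/
def FramedKnotoid : Type := Quotient (Relation.EqvGen.setoid FramedKnotoidMove)

/-- The knotoid represented by a diagram. -/
def KnotoidDiagram.toKnotoid (K : KnotoidDiagram) : Knotoid :=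
  Quotient.mk (Relation.EqvGen.setoid KnotoidMove) K

/-- The framed knotoid represented by a diagram. -/
def KnotoidDiagram.toFramedKnotoid (K : KnotoidDiagram) : FramedKnotoid :=
  Quotient.mk (Relation.EqvGen.setoid FramedKnotoidMove) K

/-!
# Framed knotoids are knotoids with an integer

The creation of a kink of sign `ε = ±1` somewhere on a diagram is a first Reidemeister move that
changes the writhe by `ε` (`Kinked.writhe_eq`). The heart of the matter is that it is a well-defined
and invertible operation on *framed* knotoids.

* The place does not matter (`Kinked.toFramedKnotoid_eq`). At a given place, two kinks of the same
  sign differ by moves R1', because both can be exchanged for one and the same small kink in a disc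
  contained in both of the given ones (`KinkAt.toFramedKnotoid_eq`); hence the result depends
  locally constantly on the place as long as no double point is met. A kink slides through a
  crossing by moves R2 and R3 (`exists_kinkNear_of_isDoubleParam`), so by connectedness of `(0, 1)`
  the result is constant.
* It is compatible with the framed moves (`FramedKnotoidMove.kinked_toFramedKnotoid_eq`): the kink
  can be created outside the disc of the move, and isotopies carry kinks along. So there is a map
  `kinkMap` on framed knotoids.
* Kinks of opposite signs cancel (`kinkMap_kinkMap`): a kink on the loop of another kink of opposite
  sign is the result of a move R2.

Framed moves do not change the writhe, as they replace the crossings in a disc by crossings with the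
same sum of signs, and they do not change the knotoid: a move R1' is the deletion of a loop, followed
by the creation of another one (`Reidemeister1'.exists_reidemeister1`). This gives the map. If two
diagrams represent the same knotoid, then as framed knotoids they differ by a power of the
invertible operation `kinkEquiv`, since a move R1 is one application of it or of its inverse; this
power is the difference of the writhes. Hence the map is injective, and adding kinks shows that it
is surjective.

All moves are carried out in *local models* (`LocalModel`): coordinates on the sphere in which a
strand of the diagram is the parabola `τ ↦ (5τ, -τ²)`, and a second strand, if there is one, the
vertical axis. The parabola is replaced by `τ ↦ (p τ, -τ²)` for suitable functions `p` (`Flat`). Its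
self-crossings are then the solutions of `p τ = p (-τ)`, and its crossings with the axis the zeros
of `p`, so that everything reduces to the calculus of functions of one variable. The discs of the
moves are bounded by ellipses in these coordinates.
-/

open Set Filter Topology

/-! ### Determinants of triples of vectors -/

lemma det3_eq (x y z : E3) : det3 x y z =
    x 0 * (y 1 * z 2 - y 2 * z 1) - x 1 * (y 0 * z 2 - y 2 * z 0)
      + x 2 * (y 0 * z 1 - y 1 * z 0) := by
  simp [det3, Matrix.det_fin_three]
  ring

lemma det3_comb (x v w : E3) (a b c d : ℝ) :
    det3 x (a • v + b • w) (c • v + d • w) = (a * d - b * c) * det3 x v w := by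
  simp only [det3_eq, PiLp.add_apply, PiLp.smul_apply, smul_eq_mul]
  ring

lemma continuousAt_det3 {X : Type*} [TopologicalSpace X] {f g h : X → E3} {x : X}
    (hf : ContinuousAt f x) (hg : ContinuousAt g x) (hh : ContinuousAt h x) :
    ContinuousAt (fun x => det3 (f x) (g x) (h x)) x := by
  simp only [det3_eq]
  fun_prop

lemma linearIndependent_of_det3_ne_zero {x v w : E3} (h : det3 x v w ≠ 0) :
    LinearIndependent ℝ ![v, w] := by
  rw [LinearIndependent.pair_iff]
  intro a b hab
  constructor
  · by_contra ha
    have h1 : det3 x (a • v + b • w) ((0 : ℝ) • v + (1 : ℝ) • w) = 0 := by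
      rw [hab]; simp [det3_eq]
    rw [det3_comb] at h1
    simp [ha, h] at h1
  · by_contra hb
    have h1 : det3 x (a • v + b • w) ((1 : ℝ) • v + (0 : ℝ) • w) = 0 := by
      rw [hab]; simp [det3_eq]
    rw [det3_comb] at h1
    simp [hb, h] at h1

lemma inner_eq_sum3 (x y : E3) : inner ℝ x y = x 0 * y 0 + x 1 * y 1 + x 2 * y 2 := by
  simp [PiLp.inner_apply, Fin.sum_univ_three, mul_comm]

/-- The cross product of a point of the sphere with a tangent vector: the tangent vector turned
by a quarter turn. -/
noncomputable def turn (x v : E3) : E3 :=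
  WithLp.toLp 2 ![x 1 * v 2 - x 2 * v 1, x 2 * v 0 - x 0 * v 2, x 0 * v 1 - x 1 * v 0]

lemma inner_turn (x v : E3) : inner ℝ x (turn x v) = 0 := by
  simp [inner_eq_sum3, turn]; ring

lemma det3_turn {x v : E3} (hx : inner ℝ x x = (1 : ℝ)) (hv : inner ℝ x v = (0 : ℝ)) :
    det3 x v (turn x v) = inner ℝ v v := by
  simp only [inner_eq_sum3] at *
  simp only [det3_eq, turn, Matrix.cons_val_zero, Matrix.cons_val_one, Matrix.cons_val]
  linear_combination (v 0 * v 0 + v 1 * v 1 + v 2 * v 2) * hx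
    - (x 0 * v 0 + x 1 * v 1 + x 2 * v 2) * hv

/-- Independent tangent vectors of the sphere span a frame of nonzero orientation. -/
lemma det3_ne_zero_of_linearIndependent {x v w : E3} (hx : inner ℝ x x = (1 : ℝ))
    (hv : inner ℝ x v = (0 : ℝ)) (hw : inner ℝ x w = (0 : ℝ))
    (h : LinearIndependent ℝ ![v, w]) : det3 x v w ≠ 0 := by
  intro h0
  rw [LinearIndependent.pair_iff] at h
  have hvv : inner ℝ v v ≠ (0 : ℝ) := by
    intro h1
    have : v = 0 := inner_self_eq_zero.1 h1
    have := h 1 0 (by simp [this])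
    simp at this
  -- The turned vector is orthogonal to `w`, so `w` is a multiple of `v`.
  have key : (inner ℝ v w : ℝ) • v + (-(inner ℝ v v : ℝ)) • w = 0 := by
    ext i
    simp only [inner_eq_sum3, det3_eq] at *
    simp only [PiLp.add_apply, PiLp.smul_apply, smul_eq_mul, PiLp.zero_apply]
    -- `v × (v × w) = (v·w) v - (v·v) w`, and `v × w` is parallel to `x`.
    fin_cases i
    · simp only [Fin.zero_eta]
      have h1 : v 0 * w 1 - v 1 * w 0 = 0 + (x 2) * (x 0 * (v 1 * w 2 - v 2 * w 1) - x 1 * (v 0 * w 2 - v 2 * w 0)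
      + x 2 * (v 0 * w 1 - v 1 * w 0)) := by
        linear_combination (-(v 0 * w 1 - v 1 * w 0)) * hx
          + (x 0 * w 1 - x 1 * w 0) * hv - (x 0 * v 1 - x 1 * v 0) * hw
      have h2 : v 0 * w 2 - v 2 * w 0 = 0 - (x 1) * (x 0 * (v 1 * w 2 - v 2 * w 1) - x 1 * (v 0 * w 2 - v 2 * w 0)
      + x 2 * (v 0 * w 1 - v 1 * w 0)) := by
        linear_combination (-(v 0 * w 2 - v 2 * w 0)) * hx
          + (x 0 * w 2 - x 2 * w 0) * hv - (x 0 * v 2 - x 2 * v 0) * hw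
      rw [h0] at h1 h2
      linear_combination (v 1) * h1 + (v 2) * h2
    · simp only [Fin.mk_one]
      have h1 : v 0 * w 1 - v 1 * w 0 = 0 + (x 2) * (x 0 * (v 1 * w 2 - v 2 * w 1) - x 1 * (v 0 * w 2 - v 2 * w 0)
      + x 2 * (v 0 * w 1 - v 1 * w 0)) := by
        linear_combination (-(v 0 * w 1 - v 1 * w 0)) * hx
          + (x 0 * w 1 - x 1 * w 0) * hv - (x 0 * v 1 - x 1 * v 0) * hw
      have h2 : v 1 * w 2 - v 2 * w 1 = 0 + (x 0) * (x 0 * (v 1 * w 2 - v 2 * w 1) - x 1 * (v 0 * w 2 - v 2 * w 0)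
      + x 2 * (v 0 * w 1 - v 1 * w 0)) := by
        linear_combination (-(v 1 * w 2 - v 2 * w 1)) * hx
          + (x 1 * w 2 - x 2 * w 1) * hv - (x 1 * v 2 - x 2 * v 1) * hw
      rw [h0] at h1 h2
      linear_combination (-v 0) * h1 + (v 2) * h2
    · simp only [Fin.reduceFinMk]
      have h1 : v 0 * w 2 - v 2 * w 0 = 0 - (x 1) * (x 0 * (v 1 * w 2 - v 2 * w 1) - x 1 * (v 0 * w 2 - v 2 * w 0)
      + x 2 * (v 0 * w 1 - v 1 * w 0)) := by
        linear_combination (-(v 0 * w 2 - v 2 * w 0)) * hx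
          + (x 0 * w 2 - x 2 * w 0) * hv - (x 0 * v 2 - x 2 * v 0) * hw
      have h2 : v 1 * w 2 - v 2 * w 1 = 0 + (x 0) * (x 0 * (v 1 * w 2 - v 2 * w 1) - x 1 * (v 0 * w 2 - v 2 * w 0)
      + x 2 * (v 0 * w 1 - v 1 * w 0)) := by
        linear_combination (-(v 1 * w 2 - v 2 * w 1)) * hx
          + (x 1 * w 2 - x 2 * w 1) * hv - (x 1 * v 2 - x 2 * v 1) * hw
      rw [h0] at h1 h2
      linear_combination (-v 0) * h1 + (-v 1) * h2
  have := (h _ _ key).2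
  exact hvv (neg_eq_zero.1 this)

lemma S2.inner_self (x : S2) : inner ℝ (x : E3) (x : E3) = (1 : ℝ) := by
  have h : ‖(x : E3)‖ = 1 := by simp
  rw [real_inner_self_eq_norm_sq, h]; norm_num

lemma inner_eq_zero_of_hasDerivAt {γ : ℝ → S2} {v : E3} {t : ℝ}
    (h : HasDerivAt (fun u => (γ u : E3)) v t) : inner ℝ (γ t : E3) v = (0 : ℝ) := by
  have h1 := h.inner ℝ h
  have h2 : (fun u => inner ℝ (γ u : E3) (γ u : E3)) = fun _ => (1 : ℝ) :=
    funext fun u => S2.inner_self _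
  rw [h2] at h1
  have h3 := h1.unique (hasDerivAt_const t (1 : ℝ))
  rw [real_inner_comm (γ t : E3) v] at h3
  linarith

/-- A map with injective strict derivative, on a finite-dimensional space, is locally injective. -/
lemma HasStrictFDerivAt.exists_injOn {E F : Type*} [NormedAddCommGroup E] [NormedSpace ℝ E]
    [FiniteDimensional ℝ E] [NormedAddCommGroup F] [NormedSpace ℝ F] {f : E → F} {f' : E →L[ℝ] F}
    {a : E} (h : HasStrictFDerivAt f f' a) (hf' : Function.Injective f') :
    ∃ s ∈ 𝓝 a, InjOn f s := by
  obtain ⟨C, hC, hanti⟩ := (f' : E →ₗ[ℝ] F).exists_antilipschitzWith (LinearMap.ker_eq_bot.2 hf')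
  have hC' : (0 : ℝ) < C := by exact_mod_cast hC
  have hc : (0 : ℝ) < (2 * (C : ℝ))⁻¹ := by positivity
  have h1 := h.isLittleO.def hc
  rw [nhds_prod_eq] at h1
  obtain ⟨s, hs, hs'⟩ := Filter.mem_prod_self_iff.1 h1
  refine ⟨s, hs, fun x hx y hy hxy => ?_⟩
  have h2 : ‖f x - f y - f' (x - y)‖ ≤ (2 * C : ℝ)⁻¹ * ‖x - y‖ := hs' (mk_mem_prod hx hy)
  simp only [hxy, sub_self, zero_sub, norm_neg] at h2
  have h3 : ‖x - y‖ ≤ C * ‖f' (x - y)‖ := by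
    have := hanti.le_mul_dist x y
    simpa [dist_eq_norm] using this
  have h4 : C * ‖f' (x - y)‖ ≤ C * ((2 * (C : ℝ))⁻¹ * ‖x - y‖) := by gcongr
  have h5 : (C : ℝ) * ((2 * (C : ℝ))⁻¹ * ‖x - y‖) = ‖x - y‖ / 2 := by field_simp
  have h6 : ‖x - y‖ ≤ 0 := by linarith
  exact sub_eq_zero.1 (norm_le_zero_iff.1 h6)

lemma sign_eq_of_mul_pos {a b : ℝ} (h : 0 < a * b) : SignType.sign a = SignType.sign b := by
  rcases pos_and_pos_or_neg_and_neg_of_mul_pos h with ⟨ha, hb⟩ | ⟨ha, hb⟩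
  · rw [sign_pos ha, sign_pos hb]
  · rw [sign_neg ha, sign_neg hb]

/-! ### Crossings of a diagram -/

namespace KnotoidDiagram

variable (K : KnotoidDiagram)

lemma hasDerivAt (t : ℝ) : HasDerivAt (fun u => (K.curve u : E3)) (velocity K.curve t) t :=
  (K.smooth.differentiable (by simp) t).hasDerivAt

lemma continuous_curve : Continuous K.curve :=
  continuous_induced_rng.2 K.smooth.continuous

lemma inner_velocity (t : ℝ) : inner ℝ (K.curve t : E3) (velocity K.curve t) = (0 : ℝ) :=
  inner_eq_zero_of_hasDerivAt (K.hasDerivAt t)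

lemma hasStrictDerivAt (t : ℝ) :
    HasStrictDerivAt (fun u => (K.curve u : E3)) (velocity K.curve t) t :=
  K.smooth.contDiffAt.hasStrictDerivAt (by simp)

lemma exists_injOn {t : ℝ} (ht : t ∈ Icc (0 : ℝ) 1) : ∃ s ∈ 𝓝 t, InjOn K.curve s := by
  obtain ⟨s, hs, h⟩ := (K.hasStrictDerivAt t).hasStrictFDerivAt.exists_injOn (by
    intro a b hab
    simp only [ContinuousLinearMap.toSpanSingleton_apply] at hab
    exact smul_left_injective ℝ (K.immersion t ht) hab)
  exact ⟨s, hs, fun x hx y hy hxy => h hx hy (by simp [hxy])⟩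

lemma det3_velocity_ne_zero {s t : ℝ} (hs : s ∈ Icc (0 : ℝ) 1) (ht : t ∈ Icc (0 : ℝ) 1)
    (hst : s ≠ t) (h : K.curve s = K.curve t) :
    det3 (K.curve s) (velocity K.curve s) (velocity K.curve t) ≠ 0 :=
  det3_ne_zero_of_linearIndependent (S2.inner_self _) (K.inner_velocity s)
    (h ▸ K.inner_velocity t) (K.transversal s hs t ht hst h)

/-- The ordered pairs of distinct parameters in `[0, 1]` with the same image. -/
def doublePairs : Set (ℝ × ℝ) :=
  {p | p.1 ∈ Icc (0 : ℝ) 1 ∧ p.2 ∈ Icc (0 : ℝ) 1 ∧ p.1 ≠ p.2 ∧ K.curve p.1 = K.curve p.2}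

/-- Double points are isolated by transversality and stay away from the diagonal because the curve
is an immersion; so there are finitely many of them, by compactness. -/
lemma finite_doublePairs : K.doublePairs.Finite := by
  by_contra hinf
  have hsub : K.doublePairs ⊆ Icc (0 : ℝ) 1 ×ˢ Icc (0 : ℝ) 1 := fun p hp => ⟨hp.1, hp.2.1⟩
  obtain ⟨⟨s, t⟩, hz, hacc⟩ := Set.Infinite.exists_accPt_of_subset_isCompact hinf
    (isCompact_Icc.prod isCompact_Icc) hsub
  rw [accPt_iff_frequently] at hacc
  have hs : s ∈ Icc (0 : ℝ) 1 := hz.1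
  have ht : t ∈ Icc (0 : ℝ) 1 := hz.2
  -- The limit is again a pair with the same image.
  have hclosed : K.curve s = K.curve t := by
    have hc : IsClosed {p : ℝ × ℝ | K.curve p.1 = K.curve p.2} :=
      isClosed_eq (K.continuous_curve.comp continuous_fst) (K.continuous_curve.comp continuous_snd)
    exact hc.mem_of_frequently_of_tendsto (hacc.mono fun p hp => hp.2.2.2.2) tendsto_id
  by_cases hst : s = t
  · subst hst
    obtain ⟨N, hN, hinj⟩ := K.exists_injOn hs
    obtain ⟨p, hp, hpN⟩ := (hacc.and_eventually (prod_mem_nhds hN hN)).exists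
    exact hp.2.2.2.1 (hinj hpN.1 hpN.2 hp.2.2.2.2)
  · have h1 : HasStrictFDerivAt (fun p : ℝ × ℝ => (K.curve p.1 : E3) - K.curve p.2)
        (((ContinuousLinearMap.toSpanSingleton ℝ (velocity K.curve s)).comp
          (ContinuousLinearMap.fst ℝ ℝ ℝ)) -
        ((ContinuousLinearMap.toSpanSingleton ℝ (velocity K.curve t)).comp
          (ContinuousLinearMap.snd ℝ ℝ ℝ))) (s, t) :=
      (HasStrictFDerivAt.comp (s, t) (g := fun u => (K.curve u : E3))
        (K.hasStrictDerivAt s).hasStrictFDerivAt hasStrictFDerivAt_fst).sub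
      (HasStrictFDerivAt.comp (s, t) (g := fun u => (K.curve u : E3))
        (K.hasStrictDerivAt t).hasStrictFDerivAt hasStrictFDerivAt_snd)
    obtain ⟨N, hN, hinj⟩ := h1.exists_injOn (by
      rw [injective_iff_map_eq_zero]
      rintro ⟨a, b⟩ hab
      have := LinearIndependent.pair_iff.1 (K.transversal s hs t ht hst hclosed) a (-b)
        (by simpa [sub_eq_add_neg] using hab)
      ext
      · exact this.1
      · simpa using this.2)
    obtain ⟨p, hp, hpN⟩ := (hacc.and_eventually hN).exists
    exact hp.1 (hinj hpN (mem_of_mem_nhds hN) (by simp [hp.2.2.2.2, hclosed]))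

lemma finite_crossings : K.crossings.Finite :=
  K.finite_doublePairs.subset fun _ hp => ⟨hp.1, hp.2.1, hp.2.2.1, hp.2.2.2.1⟩

lemma finite_isDoubleParam : {t | K.IsDoubleParam t}.Finite := by
  refine (K.finite_doublePairs.image Prod.fst).subset ?_
  rintro t ⟨ht, s, hs, hst, h⟩
  exact ⟨(t, s), ⟨ht, hs, hst.symm, h.symm⟩, rfl⟩

variable {K}

lemma IsDoubleParam.mem_Ioo {t : ℝ} (h : K.IsDoubleParam t) : t ∈ Ioo (0 : ℝ) 1 := by
  obtain ⟨ht, s, hs, hst, h⟩ := h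
  exact (K.endpoints s hs t ht hst h).2

lemma isDoubleParam_fst {p : ℝ × ℝ} (h : p ∈ K.crossings) : K.IsDoubleParam p.1 :=
  ⟨h.1, p.2, h.2.1, h.2.2.1.symm, h.2.2.2.1.symm⟩

lemma isDoubleParam_snd {p : ℝ × ℝ} (h : p ∈ K.crossings) : K.IsDoubleParam p.2 :=
  ⟨h.2.1, p.1, h.1, h.2.2.1, h.2.2.2.1⟩

end KnotoidDiagram

/-! ### The effect of a replacement in a disc on the writhe -/

lemma velocity_congr {γ δ : ℝ → S2} {t : ℝ} (h : γ =ᶠ[𝓝 t] δ) : velocity γ t = velocity δ t :=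
  Filter.EventuallyEq.deriv_eq (h.mono fun _ hu => by simp [hu])

lemma KnotoidDiagram.crossingSign_congr {K L : KnotoidDiagram} {p : ℝ × ℝ}
    (h₁ : K.curve =ᶠ[𝓝 p.1] L.curve) (h₂ : K.curve =ᶠ[𝓝 p.2] L.curve) :
    K.crossingSign p = L.crossingSign p := by
  simp only [KnotoidDiagram.crossingSign, velocity_congr h₁, velocity_congr h₂, h₁.eq_of_nhds]

namespace Window

variable {n : ℕ} {W : Window n} {K L M : KnotoidDiagram}

lemma Icc_subset (W : Window n) {t : ℝ} {i : Fin n} (h : t ∈ Icc (W.a i) (W.b i)) :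
    t ∈ Ioo (0 : ℝ) 1 :=
  ⟨(W.a_pos i).trans_le h.1, h.2.trans_lt (W.b_lt_one i)⟩

lemma Ioo_subset (W : Window n) {t : ℝ} {i : Fin n} (h : t ∈ Ioo (W.a i) (W.b i)) :
    t ∈ Icc (0 : ℝ) 1 :=
  Ioo_subset_Icc_self (W.Icc_subset (Ioo_subset_Icc_self h))

lemma Meets.mem_Ioo_iff (h : W.Meets K) {s t : ℝ} (hs : s ∈ Icc (0 : ℝ) 1)
    (ht : t ∈ Icc (0 : ℝ) 1) (hst : K.curve s = K.curve t) :
    (∃ i, s ∈ Ioo (W.a i) (W.b i)) ↔ ∃ i, t ∈ Ioo (W.a i) (W.b i) := by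
  rw [← h.2.1 s hs, ← h.2.1 t ht, hst]

/-- Near a double point outside the disc, the two diagrams of a replacement agree. -/
lemma Replaces.eventuallyEq (h : W.Replaces K L) {t : ℝ} (ht : K.IsDoubleParam t)
    (hW : ∀ i, t ∉ Ioo (W.a i) (W.b i)) : K.curve =ᶠ[𝓝 t] L.curve := by
  have h1 : ∀ i, ∀ᶠ u in 𝓝 t, u ∉ Icc (W.a i) (W.b i) := by
    intro i
    refine isClosed_Icc.isOpen_compl.mem_nhds fun hi => ?_
    rcases eq_endpoints_or_mem_Ioo_of_mem_Icc hi with h2 | h2 | h2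
    · exact (h.1.2.2 i).1 (h2 ▸ ht)
    · exact (h.1.2.2 i).2 (h2 ▸ ht)
    · exact hW i h2
  filter_upwards [eventually_all.2 h1, Ioo_mem_nhds ht.mem_Ioo.1 ht.mem_Ioo.2] with u hu hu'
  exact (h.2.2 u (Ioo_subset_Icc_self hu') fun i hi => hu i (Ioo_subset_Icc_self hi)).1

lemma Replaces.isDoubleParam (h : W.Replaces K L) {t : ℝ} (ht : K.IsDoubleParam t)
    (hW : ∀ i, t ∉ Ioo (W.a i) (W.b i)) : L.IsDoubleParam t := by
  obtain ⟨ht', s, hs, hst, hK⟩ := ht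
  have hs' : ∀ i, s ∉ Ioo (W.a i) (W.b i) := by
    simpa using mt (h.1.mem_Ioo_iff hs ht' hK).1 (by simpa using hW)
  exact ⟨ht', s, hs, hst, by rw [← (h.2.2 s hs hs').1, ← (h.2.2 t ht' hW).1, hK]⟩

lemma Replaces.symm (h : W.Replaces K L) : W.Replaces L K := by
  refine ⟨h.2.1, h.1, fun t ht hW => ⟨(h.2.2 t ht hW).1.symm, fun hd => ?_⟩⟩
  obtain ⟨ht', s, hs, hst, hL⟩ := hd
  have hs' : ∀ i, s ∉ Ioo (W.a i) (W.b i) := by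
    simpa using mt (h.2.1.mem_Ioo_iff hs ht' hL).1 (by simpa using hW)
  exact ((h.2.2 t ht hW).2
    ⟨ht', s, hs, hst, by rw [(h.2.2 s hs hs').1, (h.2.2 t ht' hW).1, hL]⟩).symm

lemma Replaces.trans (h : W.Replaces K L) (h' : W.Replaces L M) : W.Replaces K M :=
  ⟨h.1, h'.2.1, fun t ht hW => ⟨(h.2.2 t ht hW).1.trans (h'.2.2 t ht hW).1, fun hd =>
    ((h.2.2 t ht hW).2 hd).trans ((h'.2.2 t ht hW).2 (h.isDoubleParam hd hW))⟩⟩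

/-- The crossings of `K` outside the disc of `W`. -/
def outside (W : Window n) (K : KnotoidDiagram) : Set (ℝ × ℝ) :=
  {p ∈ K.crossings | ∀ i, p.1 ∉ Ioo (W.a i) (W.b i)}

lemma outside_snd (h : W.Meets K) {p : ℝ × ℝ} (hp : p ∈ W.outside K) :
    ∀ i, p.2 ∉ Ioo (W.a i) (W.b i) := by
  simpa using mt (h.mem_Ioo_iff hp.1.2.1 hp.1.1 hp.1.2.2.2.1.symm).1 (by simpa using hp.2)

lemma Replaces.outside_subset (h : W.Replaces K L) : W.outside K ⊆ W.outside L := by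
  intro p hp
  have hp2 := outside_snd h.1 hp
  obtain ⟨⟨h1, h2, h3, h4, h5⟩, h6⟩ := hp
  refine ⟨⟨h1, h2, h3, ?_, ?_⟩, h6⟩
  · rw [← (h.2.2 _ h1 h6).1, ← (h.2.2 _ h2 hp2).1, h4]
  · exact ((h.2.2 _ h1 h6).2 ⟨h1, p.2, h2, h3.symm, h4.symm⟩).1 h5

lemma Replaces.sum_outside (h : W.Replaces K L) :
    ∑ᶠ p ∈ W.outside K, K.crossingSign p = ∑ᶠ p ∈ W.outside L, L.crossingSign p := by
  rw [h.outside_subset.antisymm h.symm.outside_subset]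
  refine finsum_mem_congr rfl fun p hp => ?_
  have hp' := h.symm.outside_subset hp
  exact KnotoidDiagram.crossingSign_congr
    (h.eventuallyEq (KnotoidDiagram.isDoubleParam_fst hp'.1) hp'.2)
    (h.eventuallyEq (KnotoidDiagram.isDoubleParam_snd hp'.1) (outside_snd h.1 hp'))

lemma eq_of_mem_Ioo (W : Window n) {t : ℝ} {i j : Fin n} (hi : t ∈ Ioo (W.a i) (W.b i))
    (hj : t ∈ Ioo (W.a j) (W.b j)) : i = j := by
  by_contra hij
  exact (Set.disjoint_left.1 (W.disjoint i j hij)) (Ioo_subset_Icc_self hi)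
    (Ioo_subset_Icc_self hj)

lemma finite_crossings (W : Window n) (K : KnotoidDiagram) (i j : Fin n) :
    (W.crossings K i j).Finite := K.finite_crossings.subset fun _ hp => hp.1

lemma Meets.writhe_eq (h : W.Meets K) : K.writhe =
    ∑ᶠ p ∈ W.outside K, K.crossingSign p +
      ∑ i, ∑ j, ∑ᶠ p ∈ W.crossings K i j, K.crossingSign p := by
  have h1 : K.crossings = W.outside K ∪ ⋃ q : Fin n × Fin n, W.crossings K q.1 q.2 := by
    ext p
    simp only [outside, mem_union, mem_ofPred_eq, mem_iUnion, Window.crossings, Prod.exists]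
    constructor
    · intro hp
      by_cases h1 : ∃ i, p.1 ∈ Ioo (W.a i) (W.b i)
      · obtain ⟨i, hi⟩ := h1
        obtain ⟨j, hj⟩ := (h.mem_Ioo_iff hp.1 hp.2.1 hp.2.2.2.1).1 ⟨i, hi⟩
        exact Or.inr ⟨i, j, hp, hi, hj⟩
      · exact Or.inl ⟨hp, by simpa using h1⟩
    · rintro (hp | ⟨i, j, hp, -⟩)
      exacts [hp.1, hp]
  have hfin : ∀ q : Fin n × Fin n, (W.crossings K q.1 q.2).Finite := fun q =>
    W.finite_crossings K q.1 q.2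
  rw [KnotoidDiagram.writhe, h1, finsum_mem_union, finsum_mem_iUnion, finsum_eq_sum_of_fintype (α := Fin n × Fin n),
    Fintype.sum_prod_type]
  · rintro ⟨i, j⟩ ⟨i', j'⟩ hne
    refine Set.disjoint_left.2 fun p hp hp' => hne ?_
    rw [Prod.mk.injEq]
    exact ⟨W.eq_of_mem_Ioo hp.2.1 hp'.2.1, W.eq_of_mem_Ioo hp.2.2 hp'.2.2⟩
  · exact hfin
  · refine Set.disjoint_left.2 fun p hp hp' => ?_
    obtain ⟨q, hq⟩ := mem_iUnion.1 hp'
    exact hp.2 _ hq.2.1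
  · exact K.finite_crossings.subset fun _ hp => hp.1
  · exact Set.finite_iUnion hfin

end Window

variable {K L : KnotoidDiagram}

lemma Reidemeister1'.writhe_eq (h : Reidemeister1' K L) : K.writhe = L.writhe := by
  obtain ⟨W, hW, p, q, hp, hq, hpq⟩ := h
  rw [hW.1.writhe_eq, hW.2.1.writhe_eq, hW.sum_outside]
  simp [hp, hq, hpq]

lemma Reidemeister2.writhe_eq (h : Reidemeister2 K L) : K.writhe = L.writhe := by
  obtain ⟨W, hW, hK, hL, p, q, hpq, hp, hq⟩ := h
  have hne : p ≠ q := by rintro rfl; rw [hp] at hq; exact absurd hq (by decide)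
  rw [hW.1.writhe_eq, hW.2.1.writhe_eq, hW.sum_outside]
  have h1 : ∑ i, ∑ j, ∑ᶠ p ∈ W.crossings L i j, L.crossingSign p = 0 := by
    simp only [Fin.sum_univ_two]
    rw [hL 0 0 (by decide), hL 1 0 (by decide), hL 1 1 (by decide), hpq, finsum_mem_pair hne]
    simp [hp, hq]
  rw [h1]
  simp [hK]

lemma Reidemeister3.writhe_eq (h : Reidemeister3 K L) : K.writhe = L.writhe := by
  obtain ⟨W, hW, h1, h2⟩ := h
  rw [hW.1.writhe_eq, hW.2.1.writhe_eq, hW.sum_outside]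
  congr 1
  refine Finset.sum_congr rfl fun i _ => Finset.sum_congr rfl fun j _ => ?_
  rcases le_or_gt j i with hij | hij
  · rw [(h1 i j hij).1, (h1 i j hij).2]; simp
  · obtain ⟨p, q, hp, hq, hpq⟩ := h2 i j hij
    simp [hp, hq, hpq]

/-- In the disc of `W`, a strand without self-crossings is replaced by a strand with one
self-crossing of sign `ε`. -/
def Window.Kink (W : Window 1) (ε : ℤ) (K L : KnotoidDiagram) : Prop :=
  W.Replaces K L ∧ W.crossings K 0 0 = ∅ ∧ ∃ p, W.crossings L 0 0 = {p} ∧ L.crossingSign p = ε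

/-- In the disc of `W`, a second Reidemeister move takes place. -/
def Window.Bigon (W : Window 2) (K L : KnotoidDiagram) : Prop :=
  W.Replaces K L ∧ (∀ i j, W.crossings K i j = ∅) ∧
    (∀ i j, (i, j) ≠ (0, 1) → W.crossings L i j = ∅) ∧
    ∃ p q, W.crossings L 0 1 = {p, q} ∧ L.crossingSign p = 1 ∧ L.crossingSign q = -1

/-- `L` arises from `K` by adding a loop of sign `ε`: a first Reidemeister move. -/
def Kinked (ε : ℤ) (K L : KnotoidDiagram) : Prop := ∃ W : Window 1, W.Kink ε K L

/-- `L` arises from `K` by adding a loop of sign `ε`, at a place that contains the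
parameter `s`. -/
def KinkAt (ε : ℤ) (K : KnotoidDiagram) (s : ℝ) (L : KnotoidDiagram) : Prop :=
  ∃ W : Window 1, s ∈ Ioo (W.a 0) (W.b 0) ∧ W.Kink ε K L

lemma KinkAt.kinked {ε : ℤ} {s : ℝ} (h : KinkAt ε K s L) : Kinked ε K L :=
  h.imp fun _ h => h.2

lemma Kinked.exists_kinkAt {ε : ℤ} (h : Kinked ε K L) : ∃ s, KinkAt ε K s L :=
  let ⟨W, h⟩ := h
  let ⟨s, hs⟩ := exists_between (W.a_lt_b 0)
  ⟨s, W, hs, h⟩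

lemma Kinked.reidemeister1 {ε : ℤ} (h : Kinked ε K L) : Reidemeister1 K L := by
  obtain ⟨W, hW, hK, p, hp, -⟩ := h
  exact ⟨W, hW, hK, p, hp⟩

lemma Kinked.writhe_eq {ε : ℤ} (h : Kinked ε K L) : L.writhe = K.writhe + ε := by
  obtain ⟨W, hW, hK, p, hp, hε⟩ := h
  rw [hW.1.writhe_eq, hW.2.1.writhe_eq, hW.sum_outside]
  simp [hp, hK, hε]

lemma KnotoidDiagram.crossingSign_eq_or {p : ℝ × ℝ} (hp : p ∈ K.crossings) :
    K.crossingSign p = 1 ∨ K.crossingSign p = -1 := by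
  have h := K.det3_velocity_ne_zero hp.1 hp.2.1 hp.2.2.1 hp.2.2.2.1
  rcases lt_or_gt_of_ne h with h | h
  · right; simp [KnotoidDiagram.crossingSign, sign_neg h]
  · left; simp [KnotoidDiagram.crossingSign, sign_pos h]

lemma Reidemeister1.exists_kinked (h : Reidemeister1 K L) : Kinked 1 K L ∨ Kinked (-1) K L := by
  obtain ⟨W, hW, hK, p, hp⟩ := h
  have hpL : p ∈ L.crossings := (hp.symm ▸ mem_singleton p : p ∈ W.crossings L 0 0).1
  rcases KnotoidDiagram.crossingSign_eq_or hpL with h | h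
  exacts [Or.inl ⟨W, hW, hK, p, hp, h⟩, Or.inr ⟨W, hW, hK, p, hp, h⟩]

/-! ### Smooth maps of the sphere in ambient coordinates -/

lemma contDiffAt_normalize {x : E3} (hx : x ≠ 0) :
    ContDiffAt ℝ ∞ (fun z : E3 => ‖z‖⁻¹ • z) x :=
  ((contDiffAt_norm ℝ hx).inv (norm_ne_zero_iff.2 hx)).smul contDiffAt_id

lemma normalize_mem {x : E3} (hx : x ≠ 0) : ‖x‖⁻¹ • x ∈ Metric.sphere (0 : E3) 1 := by
  simp [norm_smul, norm_ne_zero_iff.2 hx]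

instance fact_finrank_E3 : Fact (Module.finrank ℝ E3 = 2 + 1) := ⟨by simp⟩

lemma S2.norm_coe (x : S2) : ‖(x : E3)‖ = 1 := by simp

lemma contMDiff_of_contDiff_coe {E : Type*} [NormedAddCommGroup E] [NormedSpace ℝ E] {f : E → S2}
    (h : ContDiff ℝ ∞ fun x => (f x : E3)) : ContMDiff 𝓘(ℝ, E) (𝓡 2) ∞ f :=
  ContMDiff.codRestrict_sphere h.contMDiff fun x => (f x).2

/-- Near a point of the sphere, a smooth map of the sphere extends to a smooth map of `ℝ³`. -/
lemma exists_contDiff_extension {g : S2 → S2} (hg : ContMDiff (𝓡 2) (𝓡 2) ∞ g) (y : S2) :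
    ∃ G : E3 → E3, ContDiff ℝ ∞ G ∧ ∀ᶠ z : S2 in 𝓝 y, G (z : E3) = (g z : E3) := by
  -- a smooth retraction `ν` of `ℝ³` to the sphere near `y`, extended with values in the sphere
  let ρ : ContDiffBump (y : E3) := ⟨1 / 4, 1 / 2, by norm_num, by norm_num⟩
  have hne : ∀ z : E3, (y : E3) + ρ z • (z - y) ≠ 0 := by
    intro z h0
    have h1 : ‖ρ z • (z - (y : E3))‖ < 1 := by
      rcases lt_or_ge (dist z (y : E3)) (1 / 2) with hz | hz
      · rw [norm_smul, ← dist_eq_norm, Real.norm_of_nonneg ρ.nonneg]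
        have := ρ.le_one (x := z)
        nlinarith [dist_nonneg (x := z) (y := (y : E3)), ρ.nonneg (x := z)]
      · rw [ρ.zero_of_le_dist hz]; simp
    rw [← neg_eq_of_add_eq_zero_right h0, norm_neg, S2.norm_coe] at h1
    exact lt_irrefl _ h1
  let ν : E3 → S2 := fun z => ⟨_, normalize_mem (hne z)⟩
  have hν : ContMDiff 𝓘(ℝ, E3) (𝓡 2) ∞ ν := by
    have h1 : ContDiff ℝ ∞ fun z : E3 => (y : E3) + ρ z • (z - y) :=
      contDiff_const.add (ρ.contDiff.smul (contDiff_id.sub contDiff_const))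
    have h2 : ContDiff ℝ ∞ fun z : E3 => ((ν z : S2) : E3) :=
      contDiff_iff_contDiffAt.2 fun z =>
        ContDiffAt.comp (g := fun z : E3 => ‖z‖⁻¹ • z) z (contDiffAt_normalize (hne z)) h1.contDiffAt
    exact contMDiff_of_contDiff_coe h2
  refine ⟨fun z => g (ν z), ?_, ?_⟩
  · exact contMDiff_iff_contDiff.1 (contMDiff_coe_sphere.comp (hg.comp hν))
  · have h2 : ∀ᶠ z : S2 in 𝓝 y, (z : E3) ∈ Metric.ball (y : E3) (1 / 4) :=
      continuous_subtype_val.continuousAt.eventually_mem (Metric.ball_mem_nhds _ (by norm_num))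
    filter_upwards [h2] with z hz
    have h3 : ρ (z : E3) = 1 := ρ.one_of_mem_closedBall (Metric.ball_subset_closedBall hz)
    have h4 : ν z = z := by
      ext1
      simp [ν, h3]
    simp [h4]

/-- The derivative of a smooth map of the sphere acts on the derivatives of maps to the sphere. -/
lemma exists_hasFDerivAt_comp {g : S2 → S2} (hg : ContMDiff (𝓡 2) (𝓡 2) ∞ g) (y : S2) :
    ∃ D : E3 →L[ℝ] E3, ∀ {E : Type} [NormedAddCommGroup E] [NormedSpace ℝ E] {f : E → S2} {z : E}
      {f' : E →L[ℝ] E3}, f z = y → HasFDerivAt (fun u => (f u : E3)) f' z →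
      HasFDerivAt (fun u => (g (f u) : E3)) (D.comp f') z := by
  obtain ⟨G, hG, hGg⟩ := exists_contDiff_extension hg y
  refine ⟨fderiv ℝ G y, ?_⟩
  intro E _ _ f z f' hz hf
  have h1 : ContinuousAt f z := IsInducing.subtypeVal.continuousAt_iff.2 hf.continuousAt
  have h2 : HasFDerivAt G (fderiv ℝ G y) ((f z : S2) : E3) := by
    rw [hz]; exact (hG.differentiable (by simp) _).hasFDerivAt
  refine (h2.comp z hf).congr_of_eventuallyEq ?_
  filter_upwards [h1.eventually (hz ▸ hGg)] with u hu
  exact hu.symm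

lemma exists_velocity_comp {g : S2 → S2} (hg : ContMDiff (𝓡 2) (𝓡 2) ∞ g) (y : S2) :
    ∃ D : E3 →L[ℝ] E3, ∀ {γ : ℝ → S2} {t : ℝ} {v : E3}, γ t = y →
      HasDerivAt (fun u => (γ u : E3)) v t → HasDerivAt (fun u => (g (γ u) : E3)) (D v) t := by
  obtain ⟨D, hD⟩ := exists_hasFDerivAt_comp hg y
  refine ⟨D, fun ht h => ?_⟩
  have := (hD ht h.hasFDerivAt).hasDerivAt
  simpa using this

lemma contDiff_comp_of_contMDiff {E : Type*} [NormedAddCommGroup E] [NormedSpace ℝ E]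
    {g : S2 → S2} (hg : ContMDiff (𝓡 2) (𝓡 2) ∞ g) {f : E → S2}
    (hf : ContDiff ℝ ∞ fun x => (f x : E3)) : ContDiff ℝ ∞ fun x => (g (f x) : E3) :=
  contMDiff_iff_contDiff.1 (contMDiff_coe_sphere.comp (hg.comp (contMDiff_of_contDiff_coe hf)))

/-! ### Isotopies -/

section Isotopy

variable {H : ℝ → (S2 ≃ₘ⟮𝓡 2, 𝓡 2⟯ S2)}

/-- A diffeomorphism of the sphere keeps tangent vectors independent. -/
lemma linearIndependent_comp (Φ : S2 ≃ₘ⟮𝓡 2, 𝓡 2⟯ S2) {γ δ : ℝ → S2} {s t : ℝ} {v w v' w' : E3}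
    (hst : γ s = δ t)
    (hv' : HasDerivAt (fun u => (Φ (γ u) : E3)) v' s)
    (hw' : HasDerivAt (fun u => (Φ (δ u) : E3)) w' t)
    (hv : HasDerivAt (fun u => (γ u : E3)) v s) (hw : HasDerivAt (fun u => (δ u : E3)) w t)
    (h : LinearIndependent ℝ ![v, w]) : LinearIndependent ℝ ![v', w'] := by
  obtain ⟨D, hD⟩ := exists_velocity_comp Φ.symm.contMDiff (Φ (γ s))
  have h1 := hD (γ := fun u => Φ (γ u)) rfl hv'
  have h2 := hD (γ := fun u => Φ (δ u)) (by simp [hst]) hw'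
  simp only [Diffeomorph.symm_apply_apply] at h1 h2
  rw [LinearIndependent.pair_iff] at h ⊢
  intro a b hab
  apply h
  rw [hv.unique h1, hw.unique h2, ← map_smul, ← map_smul, ← map_add, hab, map_zero]

lemma velocity_comp_ne_zero (Φ : S2 ≃ₘ⟮𝓡 2, 𝓡 2⟯ S2) {γ : ℝ → S2} {t : ℝ} {v v' : E3}
    (hv' : HasDerivAt (fun u => (Φ (γ u) : E3)) v' t) (hv : HasDerivAt (fun u => (γ u : E3)) v t)
    (h : v ≠ 0) : v' ≠ 0 := by
  obtain ⟨D, hD⟩ := exists_velocity_comp Φ.symm.contMDiff (Φ (γ t))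
  have h1 := hD (γ := fun u => Φ (γ u)) rfl hv'
  simp only [Diffeomorph.symm_apply_apply] at h1
  rintro rfl
  exact h (by rw [hv.unique h1, map_zero])

/-- The end of an isotopy preserves the orientation of the frames at double points: the determinant
varies continuously and never vanishes. -/
lemma det3_isotopy_pos (hH : ContMDiff (𝓘(ℝ, ℝ).prod (𝓡 2)) (𝓡 2) ∞ (fun p : ℝ × S2 => H p.1 p.2))
    (hH0 : ∀ x, H 0 x = x) (K : KnotoidDiagram) {s t : ℝ} (hs : s ∈ Icc (0 : ℝ) 1)
    (ht : t ∈ Icc (0 : ℝ) 1) (hne : s ≠ t) (hst : K.curve s = K.curve t) :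
    0 < det3 (K.curve s) (velocity K.curve s) (velocity K.curve t) *
      det3 (H 1 (K.curve s)) (velocity (fun u => H 1 (K.curve u)) s)
        (velocity (fun u => H 1 (K.curve u)) t) := by
  let φ : ℝ × ℝ → E3 := fun q => H q.1 (K.curve q.2)
  have hφ : ContDiff ℝ ∞ φ := by
    have h1 : ContMDiff 𝓘(ℝ, ℝ × ℝ) (𝓡 2) ∞ fun q : ℝ × ℝ => K.curve q.2 :=
      contMDiff_of_contDiff_coe (K.smooth.comp contDiff_snd)
    have h2 : ContMDiff 𝓘(ℝ, ℝ × ℝ) 𝓘(ℝ, ℝ) ∞ fun q : ℝ × ℝ => q.1 := contDiff_fst.contMDiff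
    exact contMDiff_iff_contDiff.1 (contMDiff_coe_sphere.comp (hH.comp (h2.prodMk h1)))
  have hder : ∀ r u, HasDerivAt (fun u => (H r (K.curve u) : E3)) (fderiv ℝ φ (r, u) (0, 1)) u := by
    intro r u
    have h1 : HasDerivAt (fun u : ℝ => ((r, u) : ℝ × ℝ)) (0, 1) u :=
      (hasDerivAt_const u r).prodMk (hasDerivAt_id u)
    exact ((hφ.differentiable (by simp) (r, u)).hasFDerivAt).comp_hasDerivAt u h1
  have hvel : ∀ r u, velocity (fun u => H r (K.curve u)) u = fderiv ℝ φ (r, u) (0, 1) :=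
    fun r u => (hder r u).deriv
  let J : ℝ → ℝ := fun r => det3 (φ (r, s)) (fderiv ℝ φ (r, s) (0, 1)) (fderiv ℝ φ (r, t) (0, 1))
  have hJc : Continuous J := by
    have h1 : Continuous (fderiv ℝ φ) := hφ.continuous_fderiv (by simp)
    have h2 := hφ.continuous
    have h3 : ∀ u : ℝ, Continuous fun r : ℝ => fderiv ℝ φ (r, u) (0, 1) := fun u =>
      (h1.comp (Continuous.prodMk_left u)).clm_apply continuous_const
    have h4 : Continuous fun r : ℝ => φ (r, s) := h2.comp (Continuous.prodMk_left s)
    exact continuous_iff_continuousAt.2 fun r =>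
      continuousAt_det3 h4.continuousAt (h3 s).continuousAt (h3 t).continuousAt
  have hJ : ∀ r, J r ≠ 0 := by
    intro r
    have hrs : H r (K.curve s) = H r (K.curve t) := by rw [hst]
    refine det3_ne_zero_of_linearIndependent (S2.inner_self _)
      (inner_eq_zero_of_hasDerivAt (hder r s)) ?_
      (linearIndependent_comp (H r) hst (hder r s) (hder r t) (K.hasDerivAt s) (K.hasDerivAt t)
        (K.transversal s hs t ht hne hst))
    have := inner_eq_zero_of_hasDerivAt (hder r t)
    rw [← hrs] at this
    exact this
  have hJ0 : J 0 = det3 (K.curve s) (velocity K.curve s) (velocity K.curve t) := by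
    simp only [J, φ, ← hvel, hH0]
  have hJ1 : J 1 = det3 (H 1 (K.curve s)) (velocity (fun u => H 1 (K.curve u)) s)
        (velocity (fun u => H 1 (K.curve u)) t) := by
    simp only [J, φ, ← hvel]
  rw [← hJ0, ← hJ1]
  by_contra hcon
  have h0 : (0 : ℝ) ∈ range J := by
    rcases lt_or_gt_of_ne (hJ 0) with h | h
    · refine mem_range_of_exists_le_of_exists_ge hJc ⟨0, h.le⟩ ⟨1, ?_⟩
      by_contra h1
      exact hcon (mul_pos_of_neg_of_neg h (not_le.1 h1))
    · refine mem_range_of_exists_le_of_exists_ge hJc ⟨1, ?_⟩ ⟨0, h.le⟩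
      by_contra h1
      exact hcon (mul_pos h (not_le.1 h1))
  obtain ⟨r, hr⟩ := h0
  exact hJ r hr

end Isotopy

namespace KnotoidDiagram

/-- The data of an isotopy from `K` to `L`: the ambient isotopy `H` and the reparametrization
`σ`. -/
structure IsotopicVia (H : ℝ → (S2 ≃ₘ⟮𝓡 2, 𝓡 2⟯ S2)) (σ : ℝ → ℝ) (K L : KnotoidDiagram) : Prop where
  smooth : ContMDiff (𝓘(ℝ, ℝ).prod (𝓡 2)) (𝓡 2) ∞ (fun p : ℝ × S2 => H p.1 p.2)
  start : ∀ x, H 0 x = x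
  smooth_param : ContDiff ℝ ∞ σ
  param_zero : σ 0 = 0
  param_one : σ 1 = 1
  deriv_pos : ∀ t ∈ Icc (0 : ℝ) 1, 0 < deriv σ t
  curve_eq : ∀ t ∈ Icc (0 : ℝ) 1, L.curve t = H 1 (K.curve (σ t))
  upper_iff : ∀ t, L.IsDoubleParam t → (t ∈ L.upper ↔ σ t ∈ K.upper)

variable {H : ℝ → (S2 ≃ₘ⟮𝓡 2, 𝓡 2⟯ S2)} {σ : ℝ → ℝ} {K L : KnotoidDiagram}

lemma isotopic_iff : K.Isotopic L ↔ ∃ H σ, IsotopicVia H σ K L := by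
  constructor
  · rintro ⟨H, σ, h1, h2, h3, h4, h5, h6, h7, h8⟩
    exact ⟨H, σ, h1, h2, h3, h4, h5, h6, h7, h8⟩
  · rintro ⟨H, σ, h⟩
    exact ⟨H, σ, h.1, h.2, h.3, h.4, h.5, h.6, h.7, h.8⟩

lemma strictMonoOn_of_deriv_pos' (hs : ContDiff ℝ ∞ σ)
    (hd : ∀ t ∈ Icc (0 : ℝ) 1, 0 < deriv σ t) : StrictMonoOn σ (Icc 0 1) :=
  strictMonoOn_of_deriv_pos (convex_Icc 0 1) hs.continuous.continuousOn fun t ht =>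
    hd t (interior_subset ht)

lemma IsotopicVia.strictMonoOn (h : IsotopicVia H σ K L) : StrictMonoOn σ (Icc 0 1) :=
  strictMonoOn_of_deriv_pos' h.smooth_param h.deriv_pos

lemma IsotopicVia.bijOn (h : IsotopicVia H σ K L) : BijOn σ (Icc 0 1) (Icc 0 1) := by
  have hm := h.strictMonoOn
  refine ⟨fun t ht => ?_, hm.injOn, ?_⟩
  · constructor
    · rw [← h.param_zero]; exact hm.monotoneOn (by simp) ht ht.1
    · rw [← h.param_one]; exact hm.monotoneOn ht (by simp) ht.2
  · have := intermediate_value_Icc (zero_le_one' ℝ) h.smooth_param.continuous.continuousOn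
    rw [h.param_zero, h.param_one] at this
    exact this

lemma IsotopicVia.hasDerivAt (h : IsotopicVia H σ K L) {t : ℝ} (ht : t ∈ Ioo (0 : ℝ) 1) :
    HasDerivAt (fun u => (L.curve u : E3))
      (deriv σ t • velocity (fun u => H 1 (K.curve u)) (σ t)) t := by
  have h1 : HasDerivAt (fun u => (H 1 (K.curve u) : E3))
      (velocity (fun u => H 1 (K.curve u)) (σ t)) (σ t) :=
    ((contDiff_comp_of_contMDiff (H 1).contMDiff K.smooth).differentiable (by simp) _).hasDerivAt
  have h2 := h1.scomp t (h.smooth_param.differentiable (by simp) t).hasDerivAt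
  refine h2.congr_of_eventuallyEq ?_
  filter_upwards [Ioo_mem_nhds ht.1 ht.2] with u hu
  rw [h.curve_eq u (Ioo_subset_Icc_self hu)]
  rfl

lemma IsotopicVia.mem_crossings_iff (h : IsotopicVia H σ K L) {p : ℝ × ℝ}
    (h1 : p.1 ∈ Icc (0 : ℝ) 1) (h2 : p.2 ∈ Icc (0 : ℝ) 1) :
    p ∈ L.crossings ↔ (σ p.1, σ p.2) ∈ K.crossings := by
  have e1 : L.curve p.1 = L.curve p.2 ↔ K.curve (σ p.1) = K.curve (σ p.2) := by
    rw [h.curve_eq _ h1, h.curve_eq _ h2]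
    exact (H 1).injective.eq_iff
  have e2 : p.1 ≠ p.2 ↔ σ p.1 ≠ σ p.2 := (h.bijOn.injOn.ne_iff h1 h2).symm
  constructor
  · rintro ⟨-, -, h3, h4, h5⟩
    exact ⟨h.bijOn.mapsTo h1, h.bijOn.mapsTo h2, e2.1 h3, e1.1 h4,
      (h.upper_iff _ ⟨h1, p.2, h2, h3.symm, h4.symm⟩).1 h5⟩
  · rintro ⟨-, -, h3, h4, h5⟩
    exact ⟨h1, h2, e2.2 h3, e1.2 h4,
      (h.upper_iff _ ⟨h1, p.2, h2, (e2.2 h3).symm, (e1.2 h4).symm⟩).2 h5⟩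

lemma IsotopicVia.crossingSign_eq (h : IsotopicVia H σ K L) {p : ℝ × ℝ} (hp : p ∈ L.crossings) :
    L.crossingSign p = K.crossingSign (σ p.1, σ p.2) := by
  have hK := (h.mem_crossings_iff hp.1 hp.2.1).1 hp
  have hp1 := (isDoubleParam_fst hp).mem_Ioo
  have hp2 := (isDoubleParam_snd hp).mem_Ioo
  have hpos := det3_isotopy_pos h.smooth h.start K hK.1 hK.2.1 hK.2.2.1 hK.2.2.2.1
  simp only [crossingSign]
  refine congrArg _ (sign_eq_of_mul_pos ?_).symm
  have e1 : velocity L.curve p.1 = _ := (h.hasDerivAt hp1).deriv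
  have e2 : velocity L.curve p.2 = _ := (h.hasDerivAt hp2).deriv
  have e3 := det3_comb (H 1 (K.curve (σ p.1))) (velocity (fun u => H 1 (K.curve u)) (σ p.1))
    (velocity (fun u => H 1 (K.curve u)) (σ p.2)) (deriv σ p.1) 0 0 (deriv σ p.2)
  simp only [zero_smul, add_zero, zero_add, mul_zero, sub_zero] at e3
  rw [e1, e2, h.curve_eq _ hp.1, e3]
  have d1 := h.deriv_pos _ hp.1
  have d2 := h.deriv_pos _ hp.2.1
  have := mul_pos (mul_pos d1 d2) hpos
  nlinarith

lemma IsotopicVia.bijOn_crossings (h : IsotopicVia H σ K L) :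
    BijOn (Prod.map σ σ) L.crossings K.crossings := by
  refine ⟨fun p hp => (h.mem_crossings_iff hp.1 hp.2.1).1 hp, fun p hp q hq hpq => ?_, ?_⟩
  · have := Prod.mk.inj hpq
    exact Prod.ext (h.bijOn.injOn hp.1 hq.1 this.1) (h.bijOn.injOn hp.2.1 hq.2.1 this.2)
  · rintro ⟨s, t⟩ hp
    obtain ⟨s', hs, rfl⟩ := h.bijOn.surjOn hp.1
    obtain ⟨t', ht, rfl⟩ := h.bijOn.surjOn hp.2.1
    exact ⟨(s', t'), (h.mem_crossings_iff (p := (s', t')) hs ht).2 hp, rfl⟩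

lemma Isotopic.writhe_eq (h : K.Isotopic L) : K.writhe = L.writhe := by
  obtain ⟨H, σ, h⟩ := isotopic_iff.1 h
  exact (finsum_mem_eq_of_bijOn _ h.bijOn_crossings fun p hp => h.crossingSign_eq hp).symm

/-- The image of a diagram under a diffeomorphism of the sphere and a reparametrization. -/
noncomputable def transport (K : KnotoidDiagram) (Φ : S2 ≃ₘ⟮𝓡 2, 𝓡 2⟯ S2) (σ : ℝ → ℝ)
    (hs : ContDiff ℝ ∞ σ) (h0 : σ 0 = 0) (h1 : σ 1 = 1)
    (hd : ∀ t ∈ Icc (0 : ℝ) 1, 0 < deriv σ t) : KnotoidDiagram :=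
  have hm : StrictMonoOn σ (Icc 0 1) := strictMonoOn_of_deriv_pos' hs hd
  have hmaps : ∀ {t}, t ∈ Icc (0 : ℝ) 1 → σ t ∈ Icc (0 : ℝ) 1 := fun {t} ht =>
    ⟨h0 ▸ hm.monotoneOn (by simp) ht ht.1, h1 ▸ hm.monotoneOn ht (by simp) ht.2⟩
  have hder : ∀ t, HasDerivAt (fun u => (Φ (K.curve (σ u)) : E3))
      (deriv σ t • velocity (fun u => Φ (K.curve u)) (σ t)) t := fun t =>
    HasDerivAt.scomp (g₁ := fun u => (Φ (K.curve u) : E3)) t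
      ((contDiff_comp_of_contMDiff Φ.contMDiff K.smooth).differentiable (by simp) _).hasDerivAt
      (hs.differentiable (by simp) t).hasDerivAt
  have hder' : ∀ t, HasDerivAt (fun u => (K.curve (σ u) : E3))
      (deriv σ t • velocity K.curve (σ t)) t := fun t =>
    HasDerivAt.scomp (g₁ := fun u => (K.curve u : E3)) t (K.hasDerivAt _)
      (hs.differentiable (by simp) t).hasDerivAt
  { curve := fun t => Φ (K.curve (σ t))
    upper := σ ⁻¹' K.upper
    smooth := contDiff_comp_of_contMDiff Φ.contMDiff (K.smooth.comp hs)
    immersion := by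
      intro t ht
      refine velocity_comp_ne_zero Φ (γ := fun t => K.curve (σ t))
        (hder t).differentiableAt.hasDerivAt (hder' t) ?_
      exact smul_ne_zero (hd t ht).ne' (K.immersion _ (hmaps ht))
    endpoints := by
      intro s hs t ht hst h
      have := K.endpoints _ (hmaps hs) _ (hmaps ht) (hm.injOn.ne hs ht hst) (Φ.injective h)
      constructor
      · refine ⟨lt_of_le_of_ne hs.1 ?_, lt_of_le_of_ne hs.2 ?_⟩
        · rintro rfl; rw [h0] at this; exact lt_irrefl _ this.1.1
        · rintro rfl; rw [h1] at this; exact lt_irrefl _ this.1.2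
      · refine ⟨lt_of_le_of_ne ht.1 ?_, lt_of_le_of_ne ht.2 ?_⟩
        · rintro rfl; rw [h0] at this; exact lt_irrefl _ this.2.1
        · rintro rfl; rw [h1] at this; exact lt_irrefl _ this.2.2
    double := by
      intro s hs t ht u hu h h'
      rcases K.double _ (hmaps hs) _ (hmaps ht) _ (hmaps hu) (Φ.injective h) (Φ.injective h')
        with e | e | e
      exacts [Or.inl (hm.injOn hs ht e), Or.inr (Or.inl (hm.injOn ht hu e)),
        Or.inr (Or.inr (hm.injOn hs hu e))]
    transversal := by
      intro s hs t ht hst h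
      refine linearIndependent_comp Φ (γ := fun t => K.curve (σ t)) (δ := fun t => K.curve (σ t))
        (Φ.injective h)
        (hder s).differentiableAt.hasDerivAt (hder t).differentiableAt.hasDerivAt
        (hder' s) (hder' t) ?_
      have h2 := K.transversal _ (hmaps hs) _ (hmaps ht) (hm.injOn.ne hs ht hst) (Φ.injective h)
      rw [LinearIndependent.pair_iff] at h2 ⊢
      intro a b hab
      rw [smul_smul, smul_smul] at hab
      have := h2 _ _ hab
      exact ⟨(mul_eq_zero.1 this.1).resolve_right (hd s hs).ne',
        (mul_eq_zero.1 this.2).resolve_right (hd t ht).ne'⟩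
    upper_iff := by
      intro s hs t ht hst h
      exact K.upper_iff _ (hmaps hs) _ (hmaps ht) (hm.injOn.ne hs ht hst) (Φ.injective h) }

end KnotoidDiagram

open KnotoidDiagram

/-- `K` and `L` differ at most in meaningless data: in the curve outside `[0, 1]`, and in
`upper` at parameters that are not those of double points. -/
structure KnotoidDiagram.Same (K L : KnotoidDiagram) : Prop where
  curve_eq : ∀ t ∈ Icc (0 : ℝ) 1, L.curve t = K.curve t
  upper_iff : ∀ t, L.IsDoubleParam t → (t ∈ L.upper ↔ t ∈ K.upper)

namespace KnotoidDiagram.Same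

variable {K L : KnotoidDiagram}

/-- The isotopy is constant, the identity of the sphere. -/
lemma isotopic (h : K.Same L) : K.Isotopic L :=
  isotopic_iff.2 ⟨fun _ => Diffeomorph.refl (𝓡 2) S2 ∞, id, contMDiff_snd, fun _ => rfl,
    contDiff_id, rfl, rfl, fun t _ => by simp, h.curve_eq, h.upper_iff⟩

lemma isDoubleParam_iff (h : K.Same L) (t : ℝ) : L.IsDoubleParam t ↔ K.IsDoubleParam t := by
  refine and_congr_right fun ht => exists_congr fun s => and_congr_right fun hs => ?_
  rw [h.curve_eq t ht, h.curve_eq s hs]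

lemma kinkAt (h : K.Same L) {ε : ℤ} {s : ℝ} {K' : KnotoidDiagram}
    (hK : KinkAt ε L s K') : KinkAt ε K s K' := by
  obtain ⟨W, hs, ⟨h1, h2, h3⟩, hc, hp⟩ := hK
  refine ⟨W, hs, ⟨⟨fun t ht => ?_, fun t ht => ?_, fun i => ?_⟩, h2, fun t ht hi => ⟨?_, fun hd => ?_⟩⟩,
    eq_empty_of_forall_notMem fun q hq => ?_, hp⟩
  · rw [← h.curve_eq t ht, h1.1 t ht]
  · rw [← h.curve_eq t ht, h1.2.1 t ht]
  · rw [← h.isDoubleParam_iff, ← h.isDoubleParam_iff]; exact h1.2.2 i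
  · rw [← h.curve_eq t ht, (h3 t ht hi).1]
  · rw [← h.isDoubleParam_iff] at hd
    rw [← h.upper_iff t hd, (h3 t ht hi).2 hd]
  · have hd := (h.isDoubleParam_iff _).2 (isDoubleParam_fst hq.1)
    obtain ⟨⟨q1, q2, q3, q4, q5⟩, q6⟩ := hq
    have : q ∈ W.crossings L 0 0 :=
      ⟨⟨q1, q2, q3, by rw [h.curve_eq _ q1, h.curve_eq _ q2, q4], (h.upper_iff _ hd).2 q5⟩, q6⟩
    rw [hc] at this
    exact this

end KnotoidDiagram.Same

/-- The image of a window under a diffeomorphism, with new parameter intervals. -/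
noncomputable def Window.transport {n : ℕ} (W : Window n) (Φ : S2 ≃ₘ⟮𝓡 2, 𝓡 2⟯ S2)
    (a b : Fin n → ℝ) (ha : ∀ i, 0 < a i) (hab : ∀ i, a i < b i) (hb : ∀ i, b i < 1)
    (hd : ∀ i j, i ≠ j → Disjoint (Icc (a i) (b i)) (Icc (a j) (b j))) : Window n where
  chart x := Φ (W.chart x)
  a := a
  b := b
  chart_smooth := contDiff_comp_of_contMDiff Φ.contMDiff W.chart_smooth
  chart_injective := Φ.injective.comp W.chart_injective
  chart_immersion := by
    intro x
    obtain ⟨D, hD⟩ := exists_hasFDerivAt_comp Φ.symm.contMDiff (Φ (W.chart x))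
    have h1 : HasFDerivAt (fun y => (Φ (W.chart y) : E3))
        (fderiv ℝ (fun y => (Φ (W.chart y) : E3)) x) x :=
      ((contDiff_comp_of_contMDiff Φ.contMDiff W.chart_smooth).differentiable (by simp)
        x).hasFDerivAt
    have h2 := hD (f := fun y => Φ (W.chart y)) rfl h1
    simp only [Diffeomorph.symm_apply_apply] at h2
    have h3 := W.chart_immersion x
    rw [h2.fderiv] at h3
    exact Function.Injective.of_comp (f := D) (by exact h3)
  a_pos := ha
  a_lt_b := hab
  b_lt_one := hb
  disjoint := hd

lemma Kinked.exists_isotopic {ε : ℤ} {K K' L : KnotoidDiagram} (hK : Kinked ε K K')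
    (h : K.Isotopic L) : ∃ L', Kinked ε L L' ∧ K'.Isotopic L' := by
  obtain ⟨H, σ, h⟩ := isotopic_iff.1 h
  obtain ⟨W, hW, hKc, p, hp, hpε⟩ := hK
  let L' := K'.transport (H 1) σ h.smooth_param h.param_zero h.param_one h.deriv_pos
  have h' : IsotopicVia H σ K' L' :=
    ⟨h.1, h.2, h.3, h.4, h.5, h.6, fun _ _ => rfl, fun _ _ => Iff.rfl⟩
  have haI : ∀ i, W.a i ∈ Icc (0 : ℝ) 1 := fun i =>
    ⟨(W.a_pos i).le, ((W.a_lt_b i).trans (W.b_lt_one i)).le⟩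
  have hbI : ∀ i, W.b i ∈ Icc (0 : ℝ) 1 := fun i =>
    ⟨((W.a_pos i).trans (W.a_lt_b i)).le, (W.b_lt_one i).le⟩
  choose a haI' ha using fun i => h.bijOn.surjOn (haI i)
  choose b hbI' hb using fun i => h.bijOn.surjOn (hbI i)
  have hm := h.strictMonoOn
  have h01 : (0 : ℝ) ∈ Icc (0 : ℝ) 1 := by simp
  have h11 : (1 : ℝ) ∈ Icc (0 : ℝ) 1 := by simp
  have hIcc : ∀ i t, t ∈ Icc (0 : ℝ) 1 →
      (t ∈ Icc (a i) (b i) ↔ σ t ∈ Icc (W.a i) (W.b i)) := fun i t ht => by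
    rw [mem_Icc, mem_Icc, ← ha, ← hb, hm.le_iff_le (haI' i) ht, hm.le_iff_le ht (hbI' i)]
  have hIoo : ∀ i t, t ∈ Icc (0 : ℝ) 1 →
      (t ∈ Ioo (a i) (b i) ↔ σ t ∈ Ioo (W.a i) (W.b i)) := fun i t ht => by
    rw [mem_Ioo, mem_Ioo, ← ha, ← hb, hm.lt_iff_lt (haI' i) ht, hm.lt_iff_lt ht (hbI' i)]
  let W' : Window 1 := W.transport (H 1) a b
    (fun i => (hm.lt_iff_lt h01 (haI' i)).1 (by rw [ha, h.param_zero]; exact W.a_pos i))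
    (fun i => (hm.lt_iff_lt (haI' i) (hbI' i)).1 (by rw [ha, hb]; exact W.a_lt_b i))
    (fun i => (hm.lt_iff_lt (hbI' i) h11).1 (by rw [hb, h.param_one]; exact W.b_lt_one i))
    (fun i j hij => absurd (Subsingleton.elim i j) hij)
  have hmeet : ∀ {M N : KnotoidDiagram}, IsotopicVia H σ M N → W.Meets M → W'.Meets N := by
    intro M N hMN hM
    have hmem : ∀ (s : Set (EuclideanSpace ℝ (Fin 2))) (t : ℝ), t ∈ Icc (0 : ℝ) 1 →
        (N.curve t ∈ W'.chart '' s ↔ M.curve (σ t) ∈ W.chart '' s) := by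
      intro s t ht
      rw [hMN.curve_eq t ht]
      constructor
      · rintro ⟨x, hx, hx'⟩; exact ⟨x, hx, (H 1).injective hx'⟩
      · rintro ⟨x, hx, hx'⟩; exact ⟨x, hx, congrArg (H 1) hx'⟩
    refine ⟨fun t ht => ?_, fun t ht => ?_, fun i => ?_⟩
    · rw [hmem _ t ht, hM.1 _ (h.bijOn.mapsTo ht)]
      exact exists_congr fun i => (hIcc i t ht).symm
    · rw [hmem _ t ht, hM.2.1 _ (h.bijOn.mapsTo ht)]
      exact exists_congr fun i => (hIoo i t ht).symm
    · have key : ∀ t, N.IsDoubleParam t → M.IsDoubleParam (σ t) := by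
        rintro t ⟨ht, s, hs, hst, hc⟩
        rw [hMN.curve_eq t ht, hMN.curve_eq s hs] at hc
        exact ⟨h.bijOn.mapsTo ht, σ s, h.bijOn.mapsTo hs, h.bijOn.injOn.ne hs ht hst,
          (H 1).injective hc⟩
      constructor
      · intro hd; exact (hM.2.2 i).1 (ha i ▸ key _ hd)
      · intro hd; exact (hM.2.2 i).2 (hb i ▸ key _ hd)
  have hcross : ∀ {M N : KnotoidDiagram}, IsotopicVia H σ M N → ∀ q : ℝ × ℝ,
      q.1 ∈ Icc (0 : ℝ) 1 → q.2 ∈ Icc (0 : ℝ) 1 →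
      (q ∈ W'.crossings N 0 0 ↔ (σ q.1, σ q.2) ∈ W.crossings M 0 0) := by
    intro M N hMN q h1 h2
    exact and_congr (hMN.mem_crossings_iff h1 h2) (and_congr (hIoo 0 _ h1) (hIoo 0 _ h2))
  refine ⟨L', ⟨W', ⟨hmeet h hW.1, hmeet h' hW.2.1, fun t ht hti => ?_⟩, ?_, ?_⟩,
    isotopic_iff.2 ⟨H, σ, h'⟩⟩
  · have h1 := hW.2.2 (σ t) (h.bijOn.mapsTo ht) fun i hi => hti i ((hIoo i t ht).2 hi)
    refine ⟨by rw [h.curve_eq t ht, h1.1]; rfl, fun hd => (h.upper_iff t hd).trans (h1.2 ?_)⟩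
    obtain ⟨-, s, hs, hst, hc⟩ := hd
    rw [h.curve_eq t ht, h.curve_eq s hs] at hc
    exact ⟨h.bijOn.mapsTo ht, σ s, h.bijOn.mapsTo hs, h.bijOn.injOn.ne hs ht hst,
      (H 1).injective hc⟩
  · rw [eq_empty_iff_forall_notMem]
    intro q hq
    have := (hcross h q hq.1.1 hq.1.2.1).1 hq
    rw [hKc] at this
    exact this
  · have hpK : p ∈ W.crossings K' 0 0 := hp ▸ mem_singleton p
    obtain ⟨q, hq, hqp⟩ := h'.bijOn_crossings.surjOn hpK.1
    have hqW : q ∈ W'.crossings L' 0 0 := (hcross h' q hq.1 hq.2.1).2 (by rw [← hqp] at hpK; exact hpK)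
    refine ⟨q, eq_singleton_iff_unique_mem.2 ⟨hqW, fun q' hq' => ?_⟩, ?_⟩
    · have h1 : (σ q'.1, σ q'.2) ∈ W.crossings K' 0 0 := (hcross h' q' hq'.1.1 hq'.1.2.1).1 hq'
      rw [hp, mem_singleton_iff, ← hqp] at h1
      exact h'.bijOn_crossings.injOn hq'.1 hq h1
    · rw [h'.crossingSign_eq hq, ← hpε, ← hqp]; rfl

/-! ### Local models of a diagram and their flat modifications -/

/-- The open square in the plane on which local models are defined. -/
def box : Set (ℝ × ℝ) := Ioo (-25) 25 ×ˢ Ioo (-25) 25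

lemma isOpen_box : IsOpen box := isOpen_Ioo.prod isOpen_Ioo

lemma mem_box {x y : ℝ} : (x, y) ∈ box ↔ |x| < 25 ∧ |y| < 25 := by
  simp [box, abs_lt]

/-- Plane coordinates `G` on the sphere in which a piece of the diagram `K` is standard: `K` passes
through the square once along the parabola `τ ↦ (5τ, -τ²)` (strand `A`, with parameter
`t₀ + lam τ`), and, if `hasB` holds, once more along the vertical axis `v ↦ (0, v)` (strand `B`,
with parameter `tB + mu v`). The scales `lam` and `mu` may be negative, that is, the strands of `K`
may be directed either way. The sign of `orient` tells whether `G` preserves the orientation. -/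
structure LocalModel (K : KnotoidDiagram) where
  G : ℝ × ℝ → S2
  smooth : ContDiffOn ℝ ∞ (fun z => (G z : E3)) box
  inj : InjOn G box
  orient : ℝ
  orient_pos : ∀ z ∈ box, 0 < orient * det3 (G z) (fderiv ℝ (fun z => (G z : E3)) z (1, 0))
    (fderiv ℝ (fun z => (G z : E3)) z (0, 1))
  t₀ : ℝ
  lam : ℝ
  lam_ne : lam ≠ 0
  hasB : Prop
  tB : ℝ
  mu : ℝ
  mu_ne : mu ≠ 0
  A_mem : ∀ τ, |τ| < 5 → t₀ + lam * τ ∈ Ioo (0 : ℝ) 1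
  A_curve : ∀ τ, |τ| < 5 → K.curve (t₀ + lam * τ) = G (5 * τ, -τ ^ 2)
  B_mem : hasB → ∀ v, |v| < 25 → tB + mu * v ∈ Ioo (0 : ℝ) 1
  B_curve : hasB → ∀ v, |v| < 25 → K.curve (tB + mu * v) = G (0, v)
  A_ne_B : hasB → ∀ τ v, |τ| < 5 → |v| < 25 → t₀ + lam * τ ≠ tB + mu * v
  rest : ∀ t ∈ Icc (0 : ℝ) 1, K.curve t ∈ G '' box →
    (∃ τ, |τ| < 5 ∧ t = t₀ + lam * τ) ∨ (hasB ∧ ∃ v, |v| < 25 ∧ t = tB + mu * v)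

/-- A flat function `p` describes the strand `τ ↦ (p τ, -τ²)`, which is to replace the standard
strand `A`. Since the height `-τ²` is even and injective on half-lines, the strand crosses itself
where `p τ = p (-τ)`, and it crosses the vertical axis where `p τ = 0`. The conditions say that
replacing yields a knotoid diagram; those on the vertical axis are needed if there is a strand
`B`, that is, if `b` holds. -/
structure Flat (b : Prop) (p : ℝ → ℝ) : Prop where
  smooth : ContDiff ℝ ∞ p
  base : ∀ τ, 2 ≤ |τ| → p τ = 5 * τ
  bound : ∀ τ, |τ| ≤ 2 → |p τ| < 25
  apex : deriv p 0 ≠ 0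
  self : ∀ τ, 0 < τ → p τ = p (-τ) → deriv p τ + deriv p (-τ) ≠ 0
  zero : b → ∀ τ, p τ = 0 → deriv p τ ≠ 0
  triple : b → ∀ τ, τ ≠ 0 → p τ = p (-τ) → p τ ≠ 0

lemma Flat.mem_box {b : Prop} {p : ℝ → ℝ} (hp : Flat b p) {τ : ℝ} (hτ : |τ| < 5) :
    (p τ, -τ ^ 2) ∈ box := by
  rw [_root_.mem_box]
  constructor
  · rcases le_total |τ| 2 with h | h
    · exact hp.bound τ h
    · rw [hp.base τ h, abs_mul, abs_of_pos (by norm_num : (0 : ℝ) < 5)]; linarith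
  · rw [abs_neg, abs_pow]; nlinarith [abs_nonneg τ]

lemma Flat.hasDerivAt {b : Prop} {p : ℝ → ℝ} (hp : Flat b p) (τ : ℝ) :
    HasDerivAt p (deriv p τ) τ := (hp.smooth.differentiable (by simp) τ).hasDerivAt

namespace LocalModel

variable {K : KnotoidDiagram} (M : LocalModel K)

/-- The parameter of a point of the strand `A`. -/
def A (τ : ℝ) : ℝ := M.t₀ + M.lam * τ

/-- The parameter of a point of the strand `B`. -/
def B (v : ℝ) : ℝ := M.tB + M.mu * v

/-- The coordinate along the strand `A` of a parameter. -/
noncomputable def invA (t : ℝ) : ℝ := (t - M.t₀) / M.lam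

/-- The parameters of the part of the diagram outside the model. -/
def Out (t : ℝ) : Prop := (∀ τ, |τ| < 5 → t ≠ M.A τ) ∧ (M.hasB → ∀ v, |v| < 25 → t ≠ M.B v)

@[simp] lemma invA_A (τ : ℝ) : M.invA (M.A τ) = τ := by
  have := M.lam_ne
  simp [invA, A, this]

@[simp] lemma A_invA (t : ℝ) : M.A (M.invA t) = t := by
  have := M.lam_ne
  simp only [invA, A]; field_simp; ring

lemma A_injective : Function.Injective M.A := Function.LeftInverse.injective M.invA_A

lemma B_injective : Function.Injective M.B := fun v w h => by
  have := M.mu_ne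
  simpa [B, this] using h

lemma continuous_invA : Continuous M.invA := by unfold invA; fun_prop

lemma mem_Icc_A {τ : ℝ} (hτ : |τ| < 5) : M.A τ ∈ Icc (0 : ℝ) 1 := Ioo_subset_Icc_self (M.A_mem τ hτ)

lemma cases (t : ℝ) : (∃ τ, |τ| < 5 ∧ t = M.A τ) ∨ (M.hasB ∧ ∃ v, |v| < 25 ∧ t = M.B v) ∨
    M.Out t := by
  by_cases h1 : ∃ τ, |τ| < 5 ∧ t = M.A τ
  · exact Or.inl h1
  by_cases h2 : M.hasB ∧ ∃ v, |v| < 25 ∧ t = M.B v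
  · exact Or.inr (Or.inl h2)
  · push Not at h1 h2
    exact Or.inr (Or.inr ⟨h1, h2⟩)

lemma Out.notMem {M : LocalModel K} {t : ℝ} (h : M.Out t) (ht : t ∈ Icc (0 : ℝ) 1) :
    K.curve t ∉ M.G '' box := by
  intro hG
  rcases M.rest t ht hG with ⟨τ, h1, h2⟩ | ⟨hb, v, h1, h2⟩
  exacts [h.1 τ h1 h2, h.2 hb v h1 h2]

/-- The derivative of the coordinates of a local model. -/
noncomputable def DG (z : ℝ × ℝ) : ℝ × ℝ →L[ℝ] E3 := fderiv ℝ (fun z => (M.G z : E3)) z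

lemma hasFDerivAt {z : ℝ × ℝ} (hz : z ∈ box) :
    HasFDerivAt (fun z => (M.G z : E3)) (M.DG z) z :=
  ((M.smooth.contDiffAt (isOpen_box.mem_nhds hz)).differentiableAt (by simp)).hasFDerivAt

lemma det3_DG (z : ℝ × ℝ) (a b c d : ℝ) : det3 (M.G z) (M.DG z (a, b)) (M.DG z (c, d)) =
    (a * d - b * c) * det3 (M.G z) (M.DG z (1, 0)) (M.DG z (0, 1)) := by
  rw [← det3_comb]
  congr 1
  all_goals
    rw [← map_smul, ← map_smul, ← map_add]
    simp

lemma DG_det_ne {z : ℝ × ℝ} (hz : z ∈ box) :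
    det3 (M.G z) (M.DG z (1, 0)) (M.DG z (0, 1)) ≠ 0 :=
  right_ne_zero_of_mul (M.orient_pos z hz).ne'

lemma DG_ne_zero {z : ℝ × ℝ} (hz : z ∈ box) {a b : ℝ} (h : a ≠ 0 ∨ b ≠ 0) :
    M.DG z (a, b) ≠ 0 := by
  intro h0
  have h1 := M.det3_DG z a b 1 0
  have h2 := M.det3_DG z a b 0 1
  rw [h0] at h1 h2
  have h3 : ∀ x y : E3, det3 x 0 y = 0 := fun x y => by simp [det3_eq]
  rw [h3] at h1 h2
  have := M.DG_det_ne hz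
  rcases h with h | h
  · exact mul_ne_zero (by simpa using h) this h2.symm
  · exact mul_ne_zero (by simpa using h) this h1.symm

lemma sign_det3_DG {z : ℝ × ℝ} (hz : z ∈ box) (a b c d : ℝ) :
    SignType.sign (det3 (M.G z) (M.DG z (a, b)) (M.DG z (c, d))) =
      SignType.sign (M.orient * (a * d - b * c)) := by
  have h : SignType.sign M.orient = SignType.sign (det3 (M.G z) (M.DG z (1, 0)) (M.DG z (0, 1))) :=
    sign_eq_of_mul_pos (M.orient_pos z hz)
  rw [det3_DG, sign_mul, sign_mul, mul_comm, h]

/-- The curve of `K` with the strand `A` replaced by the one of a flat function. -/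
noncomputable def modCurve (p : ℝ → ℝ) (t : ℝ) : S2 :=
  if |M.invA t| < 4 then M.G (p (M.invA t), -(M.invA t) ^ 2) else K.curve t

variable {M} {p : ℝ → ℝ}

lemma modCurve_of_le (hp : Flat M.hasB p) {t : ℝ} (h : 2 ≤ |M.invA t|) :
    M.modCurve p t = K.curve t := by
  unfold modCurve
  split_ifs with h1
  · rw [hp.base _ h, ← M.A_curve _ (by linarith)]
    exact congrArg K.curve (M.A_invA t)
  · rfl

lemma modCurve_A (hp : Flat M.hasB p) {τ : ℝ} (h : |τ| < 5) :
    M.modCurve p (M.A τ) = M.G (p τ, -τ ^ 2) := by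
  rcases le_total 2 |τ| with h2 | h2
  · rw [modCurve_of_le hp (by simpa using h2), hp.base τ h2, ← M.A_curve τ h]; rfl
  · simp [modCurve, h2.trans_lt (by norm_num : (2 : ℝ) < 4)]

lemma four_lt_of_ne {t : ℝ} (h : ∀ τ, |τ| < 5 → t ≠ M.A τ) : 4 < |M.invA t| := by
  by_contra hc
  exact h (M.invA t) (by linarith) (M.A_invA t).symm

lemma modCurve_eventuallyEq_of_lt (hp : Flat M.hasB p) {t : ℝ} (h : 2 < |M.invA t|) :
    M.modCurve p =ᶠ[𝓝 t] K.curve := by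
  have : ∀ᶠ u in 𝓝 t, 2 < |M.invA u| :=
    (M.continuous_invA.abs.continuousAt).eventually_const_lt h
  filter_upwards [this] with u hu
  exact modCurve_of_le hp hu.le

lemma modCurve_eventuallyEq (hp : Flat M.hasB p) {t : ℝ} (h : ∀ τ, |τ| < 5 → t ≠ M.A τ) :
    M.modCurve p =ᶠ[𝓝 t] K.curve :=
  modCurve_eventuallyEq_of_lt hp (by linarith [four_lt_of_ne h])

lemma Out.modCurve_eventuallyEq (hp : Flat M.hasB p) {t : ℝ} (h : M.Out t) :
    M.modCurve p =ᶠ[𝓝 t] K.curve := LocalModel.modCurve_eventuallyEq hp h.1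

lemma B_ne_A (hb : M.hasB) {v : ℝ} (hv : |v| < 25) : ∀ τ, |τ| < 5 → M.B v ≠ M.A τ :=
  fun τ hτ h => M.A_ne_B hb τ v hτ hv h.symm

lemma modCurve_B (hp : Flat M.hasB p) (hb : M.hasB) {v : ℝ} (hv : |v| < 25) :
    M.modCurve p (M.B v) = M.G (0, v) :=
  (LocalModel.modCurve_eventuallyEq hp (B_ne_A hb hv)).eq_of_nhds.trans (M.B_curve hb v hv)

lemma eventually_lt_A {τ : ℝ} (h : |τ| < 5) : ∀ᶠ u in 𝓝 (M.A τ), |M.invA u| < 5 :=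
  M.continuous_invA.abs.continuousAt.eventually_lt_const (by simpa using h)

lemma modCurve_eventuallyEq_A (hp : Flat M.hasB p) {τ : ℝ} (h : |τ| < 5) :
    M.modCurve p =ᶠ[𝓝 (M.A τ)] fun u => M.G (p (M.invA u), -(M.invA u) ^ 2) := by
  filter_upwards [eventually_lt_A h] with u hu
  have := modCurve_A hp hu
  rwa [M.A_invA] at this

lemma hasDerivAt_invA (t : ℝ) : HasDerivAt M.invA M.lam⁻¹ t := by
  have := ((hasDerivAt_id t).sub_const M.t₀).div_const M.lam
  rw [one_div] at this
  exact this

lemma hasDerivAt_modCurve_A (hp : Flat M.hasB p) {τ : ℝ} (h : |τ| < 5) :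
    HasDerivAt (fun u => (M.modCurve p u : E3))
      (M.DG (p τ, -τ ^ 2) (deriv p τ * M.lam⁻¹, -(2 * τ) * M.lam⁻¹)) (M.A τ) := by
  have h1 : HasDerivAt (fun u => (p (M.invA u), -(M.invA u) ^ 2))
      (deriv p τ * M.lam⁻¹, -(2 * τ) * M.lam⁻¹) (M.A τ) := by
    refine HasDerivAt.prodMk ?_ ?_
    · refine HasDerivAt.comp (M.A τ) ?_ (hasDerivAt_invA _)
      simpa using hp.hasDerivAt τ
    · have := ((hasDerivAt_invA (M := M) (M.A τ)).pow 2).neg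
      refine this.congr_deriv ?_
      rw [M.invA_A]; norm_num
  have h2 : HasFDerivAt (fun z => (M.G z : E3)) (M.DG (p τ, -τ ^ 2))
      ((fun u => (p (M.invA u), -(M.invA u) ^ 2)) (M.A τ)) := by
    simpa using M.hasFDerivAt (hp.mem_box h)
  refine (HasFDerivAt.comp_hasDerivAt (f := fun u => (p (M.invA u), -(M.invA u) ^ 2)) _ h2
    h1).congr_of_eventuallyEq ?_
  filter_upwards [modCurve_eventuallyEq_A hp h] with u hu
  simp [hu]

lemma hasDerivAt_modCurve_B (hp : Flat M.hasB p) (hb : M.hasB) {v : ℝ} (hv : |v| < 25) :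
    HasDerivAt (fun u => (M.modCurve p u : E3)) (M.DG (0, v) (0, M.mu⁻¹)) (M.B v) := by
  have hmu := M.mu_ne
  have h1 : HasDerivAt (fun u : ℝ => ((0 : ℝ), (u - M.tB) / M.mu)) (0, M.mu⁻¹) (M.B v) := by
    refine (hasDerivAt_const _ _).prodMk ?_
    simpa using ((hasDerivAt_id (M.B v)).sub_const M.tB).div_const M.mu
  have h0 : (M.B v - M.tB) / M.mu = v := by simp [B, hmu]
  have h2 : HasFDerivAt (fun z => (M.G z : E3)) (M.DG (0, v))
      ((fun u : ℝ => ((0 : ℝ), (u - M.tB) / M.mu)) (M.B v)) := by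
    simp only [h0]
    exact M.hasFDerivAt (by rw [_root_.mem_box]; simpa using hv)
  refine (HasFDerivAt.comp_hasDerivAt (f := fun u : ℝ => ((0 : ℝ), (u - M.tB) / M.mu)) _ h2
    h1).congr_of_eventuallyEq ?_
  have h3 : ∀ᶠ u in 𝓝 (M.B v), |(u - M.tB) / M.mu| < 25 := by
    have : Continuous fun u => |(u - M.tB) / M.mu| := by fun_prop
    exact this.continuousAt.eventually_lt_const (by simpa only [h0] using hv)
  filter_upwards [LocalModel.modCurve_eventuallyEq hp (B_ne_A hb hv), h3] with u hu hu3
  have h4 := M.B_curve hb _ hu3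
  have h5 : M.tB + M.mu * ((u - M.tB) / M.mu) = u := by field_simp; ring
  rw [h5] at h4
  simp [hu, h4]

lemma smooth_modCurve (hp : Flat M.hasB p) : ContDiff ℝ ∞ fun t => (M.modCurve p t : E3) := by
  rw [contDiff_iff_contDiffAt]
  intro t
  by_cases h : |M.invA t| < 5
  · have hb := hp.mem_box h
    have h1 : ContDiffAt ℝ ∞ (fun u => (p (M.invA u), -(M.invA u) ^ 2)) t := by
      have : ContDiff ℝ ∞ M.invA := by unfold invA; fun_prop
      exact ((hp.smooth.comp this).prodMk ((this.pow 2).neg)).contDiffAt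
    have h2 := ContDiffAt.comp (g := fun z => (M.G z : E3)) t
      (M.smooth.contDiffAt (isOpen_box.mem_nhds hb)) h1
    refine h2.congr_of_eventuallyEq ?_
    have h3 := modCurve_eventuallyEq_A hp h
    rw [M.A_invA] at h3
    filter_upwards [h3] with u hu
    simp [hu]
  · refine K.smooth.contDiffAt.congr_of_eventuallyEq ?_
    filter_upwards [modCurve_eventuallyEq_of_lt hp (by linarith : 2 < |M.invA t|)] with u hu
    rw [hu]

/-- The coincidences of the modified curve. -/
lemma modCurve_coincidence (hp : Flat M.hasB p) {s t : ℝ} (hs : s ∈ Icc (0 : ℝ) 1)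
    (ht : t ∈ Icc (0 : ℝ) 1) (hne : s ≠ t) (h : M.modCurve p s = M.modCurve p t) :
    (∃ τ, |τ| < 5 ∧ τ ≠ 0 ∧ p τ = p (-τ) ∧ s = M.A τ ∧ t = M.A (-τ)) ∨
    (M.hasB ∧ ∃ τ, |τ| < 5 ∧ p τ = 0 ∧ s = M.A τ ∧ t = M.B (-τ ^ 2)) ∨
    (M.hasB ∧ ∃ τ, |τ| < 5 ∧ p τ = 0 ∧ s = M.B (-τ ^ 2) ∧ t = M.A τ) ∨
    (M.Out s ∧ M.Out t ∧ K.curve s = K.curve t) := by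
  have hbox0 : ∀ {v : ℝ}, |v| < 25 → ((0 : ℝ), v) ∈ box := fun hv => by
    rw [_root_.mem_box]; simpa using hv
  rcases M.cases s with ⟨τ, hτ, rfl⟩ | ⟨hb, v, hv, rfl⟩ | hso
  · rw [modCurve_A hp hτ] at h
    rcases M.cases t with ⟨τ', hτ', rfl⟩ | ⟨hb, v, hv, rfl⟩ | hto
    · rw [modCurve_A hp hτ'] at h
      have := M.inj (hp.mem_box hτ) (hp.mem_box hτ') h
      obtain ⟨h1, h2⟩ := Prod.mk.inj this
      rcases sq_eq_sq_iff_eq_or_eq_neg.1 (neg_injective h2) with h3 | h3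
      · exact absurd (congrArg M.A h3) hne
      · have h4 : τ' = -τ := by linarith
        subst h4
        refine Or.inl ⟨τ, hτ, ?_, h1, rfl, rfl⟩
        rintro rfl
        simp at hne
    · rw [modCurve_B hp hb hv] at h
      obtain ⟨h1, h2⟩ := Prod.mk.inj (M.inj (hp.mem_box hτ) (hbox0 hv) h)
      exact Or.inr (Or.inl ⟨hb, τ, hτ, h1, rfl, by rw [h2]⟩)
    · rw [(hto.modCurve_eventuallyEq hp).eq_of_nhds] at h
      exact absurd ⟨_, hp.mem_box hτ, h⟩ (hto.notMem ht)
  · rw [modCurve_B hp hb hv] at h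
    rcases M.cases t with ⟨τ', hτ', rfl⟩ | ⟨hb, v', hv', rfl⟩ | hto
    · rw [modCurve_A hp hτ'] at h
      obtain ⟨h1, h2⟩ := Prod.mk.inj (M.inj (hbox0 hv) (hp.mem_box hτ') h)
      exact Or.inr (Or.inr (Or.inl ⟨hb, τ', hτ', h1.symm, by rw [h2], rfl⟩))
    · rw [modCurve_B hp hb hv'] at h
      obtain ⟨h1, h2⟩ := Prod.mk.inj (M.inj (hbox0 hv) (hbox0 hv') h)
      exact absurd (congrArg M.B h2) hne
    · rw [(hto.modCurve_eventuallyEq hp).eq_of_nhds] at h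
      exact absurd ⟨_, hbox0 hv, h⟩ (hto.notMem ht)
  · rw [(hso.modCurve_eventuallyEq hp).eq_of_nhds] at h
    rcases M.cases t with ⟨τ', hτ', rfl⟩ | ⟨hb, v', hv', rfl⟩ | hto
    · rw [modCurve_A hp hτ'] at h
      exact absurd ⟨_, hp.mem_box hτ', h.symm⟩ (hso.notMem hs)
    · rw [modCurve_B hp hb hv'] at h
      exact absurd ⟨_, hbox0 hv', h.symm⟩ (hso.notMem hs)
    · rw [(hto.modCurve_eventuallyEq hp).eq_of_nhds] at h
      exact Or.inr (Or.inr (Or.inr ⟨hso, hto, h⟩))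

variable (M) in
/-- The overcrossing parameters after a modification. At a self-crossing of the new strand, the
part with positive coordinate is the upper one if `o` is positive, and the lower one otherwise. At a
crossing with the strand `B`, the strand `A` is over or under as it was in `K`. -/
def modUpper (p : ℝ → ℝ) (o : ℝˣ) : Set ℝ :=
  {t | (∃ τ, |τ| < 5 ∧ t = M.A τ ∧ ((τ ≠ 0 ∧ p τ = p (-τ) ∧ 0 < (o : ℝ) * τ) ∨
      (¬ (τ ≠ 0 ∧ p τ = p (-τ)) ∧ M.t₀ ∈ K.upper))) ∨
    (M.hasB ∧ (∃ v, |v| < 25 ∧ t = M.B v) ∧ M.t₀ ∉ K.upper) ∨ (M.Out t ∧ t ∈ K.upper)}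

lemma A_mem_modUpper (o : ℝˣ) {τ : ℝ} (h : |τ| < 5) : M.A τ ∈ M.modUpper p o ↔
    (τ ≠ 0 ∧ p τ = p (-τ) ∧ 0 < (o : ℝ) * τ) ∨ (¬ (τ ≠ 0 ∧ p τ = p (-τ)) ∧ M.t₀ ∈ K.upper) := by
  constructor
  · rintro (⟨τ', h', h1, h2⟩ | ⟨hb, ⟨v, hv, h1⟩, h2⟩ | ⟨h1, -⟩)
    · rwa [M.A_injective h1]
    · exact absurd h1.symm (B_ne_A hb hv τ h)
    · exact absurd rfl (h1.1 τ h)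
  · exact fun h1 => Or.inl ⟨τ, h, rfl, h1⟩

lemma B_mem_modUpper (o : ℝˣ) (hb : M.hasB) {v : ℝ} (h : |v| < 25) :
    M.B v ∈ M.modUpper p o ↔ M.t₀ ∉ K.upper := by
  constructor
  · rintro (⟨τ', h', h1, h2⟩ | ⟨hb, -, h2⟩ | ⟨h1, -⟩)
    · exact absurd h1 (B_ne_A hb h τ' h')
    · exact h2
    · exact absurd rfl (h1.2 hb v h)
  · exact fun h1 => Or.inr (Or.inl ⟨hb, ⟨v, h, rfl⟩, h1⟩)

lemma Out.mem_modUpper (o : ℝˣ) {t : ℝ} (h : M.Out t) : t ∈ M.modUpper p o ↔ t ∈ K.upper := by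
  constructor
  · rintro (⟨τ', h', h1, h2⟩ | ⟨hb, ⟨v, hv, h1⟩, h2⟩ | ⟨-, h1⟩)
    · exact absurd h1 (h.1 τ' h')
    · exact absurd h1 (h.2 hb v hv)
    · exact h1
  · exact fun h1 => Or.inr (Or.inr ⟨h, h1⟩)

lemma sq_lt_25 {τ : ℝ} (h : |τ| < 5) : |-τ ^ 2| < 25 := by
  rw [abs_neg, abs_pow]; nlinarith [abs_nonneg τ]

lemma velocity_modCurve_A (hp : Flat M.hasB p) {τ : ℝ} (h : |τ| < 5) :
    velocity (M.modCurve p) (M.A τ) =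
      M.DG (p τ, -τ ^ 2) (deriv p τ * M.lam⁻¹, -(2 * τ) * M.lam⁻¹) :=
  (hasDerivAt_modCurve_A hp h).deriv

lemma velocity_modCurve_B (hp : Flat M.hasB p) (hb : M.hasB) {v : ℝ} (hv : |v| < 25) :
    velocity (M.modCurve p) (M.B v) = M.DG (0, v) (0, M.mu⁻¹) :=
  (hasDerivAt_modCurve_B hp hb hv).deriv

lemma self_deriv_ne (hp : Flat M.hasB p) {τ : ℝ} (h0 : τ ≠ 0) (h : p τ = p (-τ)) :
    deriv p τ + deriv p (-τ) ≠ 0 := by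
  rcases lt_or_gt_of_ne h0 with h1 | h1
  · have := hp.self (-τ) (by linarith) (by rw [neg_neg]; exact h.symm)
    rw [neg_neg, add_comm] at this
    exact this
  · exact hp.self τ h1 h

/-- The diagram `K` with the strand `A` replaced by the one of a flat function. -/
noncomputable def mod (M : LocalModel K) (p : ℝ → ℝ) (hp : Flat M.hasB p) (o : ℝˣ) :
    KnotoidDiagram where
  curve := M.modCurve p
  upper := M.modUpper p o
  smooth := smooth_modCurve hp
  immersion := by
    intro t ht
    have hl := inv_ne_zero M.lam_ne
    rcases M.cases t with ⟨τ, hτ, rfl⟩ | ⟨hb, v, hv, rfl⟩ | hto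
    · rw [velocity_modCurve_A hp hτ]
      refine M.DG_ne_zero (hp.mem_box hτ) ?_
      by_cases h0 : τ = 0
      · left; rw [h0]; exact mul_ne_zero hp.apex hl
      · right; exact mul_ne_zero (by simpa using h0) hl
    · rw [velocity_modCurve_B hp hb hv]
      exact M.DG_ne_zero (by rw [_root_.mem_box]; simpa using hv) (Or.inr (inv_ne_zero M.mu_ne))
    · rw [velocity_congr (hto.modCurve_eventuallyEq hp)]
      exact K.immersion t ht
  endpoints := by
    intro s hs t ht hne h
    rcases modCurve_coincidence hp hs ht hne h with ⟨τ, hτ, -, -, rfl, rfl⟩ |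
      ⟨hb, τ, hτ, -, rfl, rfl⟩ | ⟨hb, τ, hτ, -, rfl, rfl⟩ | ⟨-, -, h⟩
    · exact ⟨M.A_mem _ hτ, M.A_mem _ (by rwa [abs_neg])⟩
    · exact ⟨M.A_mem _ hτ, M.B_mem hb _ (sq_lt_25 hτ)⟩
    · exact ⟨M.B_mem hb _ (sq_lt_25 hτ), M.A_mem _ hτ⟩
    · exact K.endpoints s hs t ht hne h
  double := by
    intro s hs t ht u hu h h'
    by_contra hcon
    push Not at hcon
    obtain ⟨h1, h2, h3⟩ := hcon
    rcases modCurve_coincidence hp hs ht h1 h with ⟨τ, hτ, hτ0, hpτ, rfl, rfl⟩ |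
      ⟨hb, τ, hτ, hpτ, rfl, rfl⟩ | ⟨hb, τ, hτ, hpτ, rfl, rfl⟩ | ⟨hs', ht', h⟩
    · rcases modCurve_coincidence hp ht hu h2 h' with ⟨τ', hτ', -, -, e1, rfl⟩ |
        ⟨hb, τ', hτ', hpτ', e1, rfl⟩ | ⟨hb, τ', hτ', -, e1, rfl⟩ | ⟨ht', -, -⟩
      · exact h3 (by rw [← M.A_injective e1, neg_neg])
      · have := M.A_injective e1
        subst this
        exact hp.triple hb τ hτ0 hpτ (hpτ.trans hpτ')
      · exact B_ne_A hb (sq_lt_25 hτ') _ (by rwa [abs_neg]) e1.symm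
      · exact ht'.1 _ (by rwa [abs_neg]) rfl
    · rcases modCurve_coincidence hp ht hu h2 h' with ⟨τ', hτ', -, -, e1, rfl⟩ |
        ⟨hb, τ', hτ', -, e1, rfl⟩ | ⟨hb, τ', hτ', hpτ', e1, rfl⟩ | ⟨ht', -, -⟩
      · exact B_ne_A hb (sq_lt_25 hτ) _ hτ' e1
      · exact B_ne_A hb (sq_lt_25 hτ) _ hτ' e1
      · have e2 := M.B_injective e1
        rcases sq_eq_sq_iff_eq_or_eq_neg.1 (neg_injective e2) with e3 | e3
        · exact h3 (by rw [e3])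
        · subst e3
          refine hp.triple hb τ' ?_ (hpτ'.trans hpτ.symm) hpτ'
          rintro rfl
          simp at h3
      · exact ht'.2 hb _ (sq_lt_25 hτ) rfl
    · rcases modCurve_coincidence hp ht hu h2 h' with ⟨τ', hτ', hτ0, hpτ', e1, rfl⟩ |
        ⟨hb, τ', hτ', -, e1, rfl⟩ | ⟨hb, τ', hτ', hpτ', e1, rfl⟩ | ⟨ht', -, -⟩
      · have := M.A_injective e1
        subst this
        exact hp.triple hb τ hτ0 hpτ' hpτ
      · rw [M.A_injective e1] at h3; exact h3 rfl
      · exact B_ne_A hb (sq_lt_25 hτ') _ hτ e1.symm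
      · exact ht'.1 _ hτ rfl
    · rcases modCurve_coincidence hp ht hu h2 h' with ⟨τ', hτ', -, -, rfl, -⟩ |
        ⟨hb, τ', hτ', -, rfl, -⟩ | ⟨hb, τ', hτ', -, rfl, -⟩ | ⟨-, -, h'⟩
      · exact ht'.1 _ hτ' rfl
      · exact ht'.1 _ hτ' rfl
      · exact ht'.2 hb _ (sq_lt_25 hτ') rfl
      · rcases K.double s hs t ht u hu h h' with h | h | h
        exacts [h1 h, h2 h, h3 h]
  transversal := by
    intro s hs t ht hne h
    apply linearIndependent_of_det3_ne_zero (x := (M.modCurve p s : E3))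
    have hl := M.lam_ne
    have hm := M.mu_ne
    rcases modCurve_coincidence hp hs ht hne h with ⟨τ, hτ, h0, hpτ, rfl, rfl⟩ |
      ⟨hb, τ, hτ, hpτ, rfl, rfl⟩ | ⟨hb, τ, hτ, hpτ, rfl, rfl⟩ | ⟨hs', ht', h⟩
    · have e : (p (-τ), -(-τ) ^ 2) = (p τ, -τ ^ 2) := by rw [hpτ]; ring_nf
      rw [velocity_modCurve_A hp hτ, velocity_modCurve_A hp (by rwa [abs_neg]), e,
        modCurve_A hp hτ, det3_DG]
      refine mul_ne_zero ?_ (M.DG_det_ne (hp.mem_box hτ))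
      have := mul_ne_zero (mul_ne_zero (two_ne_zero (α := ℝ)) h0) (self_deriv_ne hp h0 hpτ)
      have h2 := mul_ne_zero this (mul_ne_zero (inv_ne_zero hl) (inv_ne_zero hl))
      convert h2 using 1; ring
    · have e : (0, -τ ^ 2) = (p τ, -τ ^ 2) := by rw [hpτ]
      rw [velocity_modCurve_A hp hτ, velocity_modCurve_B hp hb (sq_lt_25 hτ), e,
        modCurve_A hp hτ, det3_DG]
      refine mul_ne_zero ?_ (M.DG_det_ne (hp.mem_box hτ))
      have := mul_ne_zero (mul_ne_zero (hp.zero hb τ hpτ) (inv_ne_zero hl)) (inv_ne_zero hm)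
      simpa using this
    · have e : (0, -τ ^ 2) = (p τ, -τ ^ 2) := by rw [hpτ]
      rw [velocity_modCurve_A hp hτ, velocity_modCurve_B hp hb (sq_lt_25 hτ), e,
        modCurve_B hp hb (sq_lt_25 hτ), e, det3_DG]
      refine mul_ne_zero ?_ (M.DG_det_ne (hp.mem_box hτ))
      have := mul_ne_zero (mul_ne_zero (hp.zero hb τ hpτ) (inv_ne_zero hl)) (inv_ne_zero hm)
      rw [zero_mul, zero_sub, neg_ne_zero]
      convert this using 1; ring
    · have e1 := hs'.modCurve_eventuallyEq hp
      have e2 := ht'.modCurve_eventuallyEq hp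
      rw [velocity_congr e1, velocity_congr e2, e1.eq_of_nhds]
      exact K.det3_velocity_ne_zero hs ht hne h
  upper_iff := by
    intro s hs t ht hne h
    rcases modCurve_coincidence hp hs ht hne h with ⟨τ, hτ, h0, hpτ, rfl, rfl⟩ |
      ⟨hb, τ, hτ, hpτ, rfl, rfl⟩ | ⟨hb, τ, hτ, hpτ, rfl, rfl⟩ | ⟨hs', ht', h⟩
    · rw [A_mem_modUpper o hτ, A_mem_modUpper o (by rwa [abs_neg] : |-τ| < 5)]
      have h2 : 0 < (o : ℝ) * -τ ↔ ¬ 0 < (o : ℝ) * τ := by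
        have h3 := mul_ne_zero o.ne_zero h0
        rw [mul_neg, neg_pos, not_lt]
        exact ⟨le_of_lt, fun h => lt_of_le_of_ne h h3⟩
      rw [neg_neg, h2]
      have h3 : -τ ≠ 0 := neg_ne_zero.2 h0
      simp only [hpτ, h0, h3, ne_eq, not_false_eq_true, true_and, not_true_eq_false, false_and,
        or_false]
      tauto
    · have hns : ¬ (τ ≠ 0 ∧ p τ = p (-τ)) := fun hh => hp.triple hb τ hh.1 hh.2 hpτ
      rw [A_mem_modUpper o hτ, B_mem_modUpper o hb (sq_lt_25 hτ)]
      tauto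
    · have hns : ¬ (τ ≠ 0 ∧ p τ = p (-τ)) := fun hh => hp.triple hb τ hh.1 hh.2 hpτ
      rw [A_mem_modUpper o hτ, B_mem_modUpper o hb (sq_lt_25 hτ)]
      tauto
    · rw [hs'.mem_modUpper, ht'.mem_modUpper]
      exact K.upper_iff s hs t ht hne h

end LocalModel

namespace LocalModel

variable {K : KnotoidDiagram} {M : LocalModel K} {p p' : ℝ → ℝ}

/-- The crossings of a modification: the self-crossings of the strand of `p` (where the sign of `o`
decides which half of the strand is over), its crossings with the strand `B` (where the strand that
is over in `K` stays over), and the crossings of `K` outside the model. -/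
lemma mem_crossings_mod (hp : Flat M.hasB p) (o : ℝˣ) (q : ℝ × ℝ) :
    q ∈ (M.mod p hp o).crossings ↔
      (∃ τ, |τ| < 5 ∧ τ ≠ 0 ∧ p τ = p (-τ) ∧ 0 < (o : ℝ) * τ ∧ q = (M.A τ, M.A (-τ))) ∨
      (M.hasB ∧ M.t₀ ∈ K.upper ∧ ∃ τ, |τ| < 5 ∧ p τ = 0 ∧ q = (M.A τ, M.B (-τ ^ 2))) ∨
      (M.hasB ∧ M.t₀ ∉ K.upper ∧ ∃ τ, |τ| < 5 ∧ p τ = 0 ∧ q = (M.B (-τ ^ 2), M.A τ)) ∨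
      (M.Out q.1 ∧ M.Out q.2 ∧ q ∈ K.crossings) := by
  obtain ⟨s, t⟩ := q
  have hns : M.hasB → ∀ τ, p τ = 0 → ¬ (τ ≠ 0 ∧ p τ = p (-τ)) :=
    fun hb τ hpτ hh => hp.triple hb τ hh.1 hh.2 hpτ
  constructor
  · rintro ⟨h1, h2, h3, h4, h5⟩
    rcases modCurve_coincidence hp h1 h2 h3 h4 with ⟨τ, hτ, h0, hpτ, e1, e2⟩ |
      ⟨hb, τ, hτ, hpτ, e1, e2⟩ | ⟨hb, τ, hτ, hpτ, e1, e2⟩ | ⟨hs', ht', h⟩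
    · simp only at e1 e2
      subst e1 e2
      left
      rcases (A_mem_modUpper o hτ).1 h5 with h6 | h6
      · exact ⟨τ, hτ, h0, hpτ, h6.2.2, rfl⟩
      · exact absurd ⟨h0, hpτ⟩ h6.1
    · simp only at e1 e2
      subst e1 e2
      have h6 := (A_mem_modUpper o hτ).1 h5
      have := hns hb τ hpτ
      exact Or.inr (Or.inl ⟨hb, by tauto, τ, hτ, hpτ, rfl⟩)
    · simp only at e1 e2
      subst e1 e2
      exact Or.inr (Or.inr (Or.inl ⟨hb, (B_mem_modUpper o hb (sq_lt_25 hτ)).1 h5, τ, hτ, hpτ,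
        rfl⟩))
    · exact Or.inr (Or.inr (Or.inr ⟨hs', ht', h1, h2, h3, h, (hs'.mem_modUpper o).1 h5⟩))
  · rintro (⟨τ, hτ, h0, hpτ, ho, e⟩ | ⟨hb, hu, τ, hτ, hpτ, e⟩ | ⟨hb, hu, τ, hτ, hpτ, e⟩ |
      ⟨hs', ht', h⟩)
    · obtain ⟨rfl, rfl⟩ := Prod.mk.inj e
      have hτ' : |-τ| < 5 := by rwa [abs_neg]
      refine ⟨M.mem_Icc_A hτ, M.mem_Icc_A hτ', fun h => h0 ?_, ?_,
        (A_mem_modUpper o hτ).2 (Or.inl ⟨h0, hpτ, ho⟩)⟩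
      · have := M.A_injective h; linarith
      · show M.modCurve p _ = M.modCurve p _
        rw [modCurve_A hp hτ, modCurve_A hp hτ', ← hpτ]; ring_nf
    · obtain ⟨rfl, rfl⟩ := Prod.mk.inj e
      refine ⟨M.mem_Icc_A hτ, Ioo_subset_Icc_self (M.B_mem hb _ (sq_lt_25 hτ)),
        M.A_ne_B hb _ _ hτ (sq_lt_25 hτ), ?_, (A_mem_modUpper o hτ).2 (Or.inr ⟨hns hb τ hpτ, hu⟩)⟩
      show M.modCurve p _ = M.modCurve p _
      rw [modCurve_A hp hτ, modCurve_B hp hb (sq_lt_25 hτ), hpτ]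
    · obtain ⟨rfl, rfl⟩ := Prod.mk.inj e
      refine ⟨Ioo_subset_Icc_self (M.B_mem hb _ (sq_lt_25 hτ)), M.mem_Icc_A hτ,
        (M.A_ne_B hb _ _ hτ (sq_lt_25 hτ)).symm, ?_, (B_mem_modUpper o hb (sq_lt_25 hτ)).2 hu⟩
      show M.modCurve p _ = M.modCurve p _
      rw [modCurve_A hp hτ, modCurve_B hp hb (sq_lt_25 hτ), hpτ]
    · obtain ⟨h1, h2, h3, h4, h5⟩ := h
      refine ⟨h1, h2, h3, ?_, (hs'.mem_modUpper o).2 h5⟩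
      show M.modCurve p _ = M.modCurve p _
      rw [(hs'.modCurve_eventuallyEq hp).eq_of_nhds, (ht'.modCurve_eventuallyEq hp).eq_of_nhds, h4]

/-- At a self-crossing the velocities of the strand of `p` are `(p' τ, -2τ)` and `(p' (-τ), 2τ)`,
with determinant `2τ (p' τ + p' (-τ))`. -/
lemma crossingSign_self (hp : Flat M.hasB p) (o : ℝˣ) {τ : ℝ} (hτ : |τ| < 5) (h : p τ = p (-τ))
    (ho : 0 < (o : ℝ) * τ) : (M.mod p hp o).crossingSign (M.A τ, M.A (-τ)) =
      (SignType.sign (M.orient * (o * (deriv p τ + deriv p (-τ)))) : SignType) := by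
  simp only [KnotoidDiagram.crossingSign]
  have hl := M.lam_ne
  have e : (p (-τ), -(-τ) ^ 2) = (p τ, -τ ^ 2) := by rw [h]; ring_nf
  show ((SignType.sign (det3 (M.modCurve p _) (velocity (M.modCurve p) _)
    (velocity (M.modCurve p) _)) : SignType) : ℤ) = _
  rw [velocity_modCurve_A hp hτ, velocity_modCurve_A hp (by rwa [abs_neg]), e,
    modCurve_A hp hτ, sign_det3_DG _ (hp.mem_box hτ)]
  congr 1
  have h2 : (0 : ℝ) < M.lam⁻¹ ^ 2 := by positivity
  have h3 : M.orient * (deriv p τ * M.lam⁻¹ * (-(2 * -τ) * M.lam⁻¹) -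
      -(2 * τ) * M.lam⁻¹ * (deriv p (-τ) * M.lam⁻¹)) =
      (2 * M.lam⁻¹ ^ 2) * (τ * (M.orient * (deriv p τ + deriv p (-τ)))) := by ring
  have h4 : M.orient * (o * (deriv p τ + deriv p (-τ))) =
      o * (M.orient * (deriv p τ + deriv p (-τ))) := by ring
  have h5 : SignType.sign (o : ℝ) = SignType.sign τ := sign_eq_of_mul_pos ho
  rw [h3, h4, sign_mul, sign_mul τ, sign_mul (o : ℝ), h5, sign_pos (by positivity), one_mul]

lemma crossingSign_AB (hp : Flat M.hasB p) (o : ℝˣ) (hb : M.hasB) {τ : ℝ} (hτ : |τ| < 5)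
    (h : p τ = 0) : (M.mod p hp o).crossingSign (M.A τ, M.B (-τ ^ 2)) =
      (SignType.sign (M.orient * M.lam * M.mu * deriv p τ) : SignType) := by
  simp only [KnotoidDiagram.crossingSign]
  have hl := M.lam_ne
  have hm := M.mu_ne
  have e : (0, -τ ^ 2) = (p τ, -τ ^ 2) := by rw [h]
  show ((SignType.sign (det3 (M.modCurve p _) (velocity (M.modCurve p) _)
    (velocity (M.modCurve p) _)) : SignType) : ℤ) = _
  rw [velocity_modCurve_A hp hτ, velocity_modCurve_B hp hb (sq_lt_25 hτ), e,
    modCurve_A hp hτ, sign_det3_DG _ (hp.mem_box hτ)]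
  congr 1
  have h2 : 0 < (M.lam⁻¹ * M.mu⁻¹) ^ 2 := by positivity
  have h3 : M.orient * (deriv p τ * M.lam⁻¹ * M.mu⁻¹ - -(2 * τ) * M.lam⁻¹ * 0) =
      (M.lam⁻¹ * M.mu⁻¹) ^ 2 * (M.orient * M.lam * M.mu * deriv p τ) := by
    field_simp; ring
  rw [h3, sign_mul, sign_pos h2, one_mul]

lemma crossingSign_BA (hp : Flat M.hasB p) (o : ℝˣ) (hb : M.hasB) {τ : ℝ} (hτ : |τ| < 5)
    (h : p τ = 0) : (M.mod p hp o).crossingSign (M.B (-τ ^ 2), M.A τ) =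
      (SignType.sign (-(M.orient * M.lam * M.mu * deriv p τ)) : SignType) := by
  simp only [KnotoidDiagram.crossingSign]
  have hl := M.lam_ne
  have hm := M.mu_ne
  have e : (0, -τ ^ 2) = (p τ, -τ ^ 2) := by rw [h]
  show ((SignType.sign (det3 (M.modCurve p _) (velocity (M.modCurve p) _)
    (velocity (M.modCurve p) _)) : SignType) : ℤ) = _
  rw [velocity_modCurve_A hp hτ, velocity_modCurve_B hp hb (sq_lt_25 hτ), e,
    modCurve_B hp hb (sq_lt_25 hτ), e, sign_det3_DG _ (hp.mem_box hτ)]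
  congr 1
  have h2 : 0 < (M.lam⁻¹ * M.mu⁻¹) ^ 2 := by positivity
  have h3 : M.orient * (0 * (-(2 * τ) * M.lam⁻¹) - M.mu⁻¹ * (deriv p τ * M.lam⁻¹)) =
      (M.lam⁻¹ * M.mu⁻¹) ^ 2 * (-(M.orient * M.lam * M.mu * deriv p τ)) := by
    field_simp; ring
  rw [h3, sign_mul, sign_pos h2, one_mul]

end LocalModel

/-! ### Elliptical discs as windows -/

/-- An ellipse with axes parallel to the coordinate axes, inside the square `box`. -/
structure Ellipse where
  X : ℝ
  Y : ℝ
  w : ℝ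
  h : ℝ
  w_pos : 0 < w
  h_pos : 0 < h
  X_lt : |X| + w < 25
  Y_lt : |Y| + h < 25

namespace Ellipse

/-- The quadratic function that is `1` on the ellipse and smaller inside. -/
noncomputable def E (D : Ellipse) (x y : ℝ) : ℝ := ((x - D.X) / D.w) ^ 2 + ((y - D.Y) / D.h) ^ 2

variable (D : Ellipse)

/-- The plane is embedded in the square so that the unit disc becomes the disc bounded by the
ellipse: a radial contraction of the plane that is the identity on the unit circle, followed by an
affine map. -/
lemma exists_chart {K : KnotoidDiagram} (M : LocalModel K) :
    ∃ c : EuclideanSpace ℝ (Fin 2) → S2, ContDiff ℝ ∞ (fun x => (c x : E3)) ∧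
      Function.Injective c ∧ (∀ x, Function.Injective (fderiv ℝ (fun y => (c y : E3)) x)) ∧
      c '' Metric.closedBall 0 1 = M.G '' {z | D.E z.1 z.2 ≤ 1} ∧
      c '' Metric.ball 0 1 = M.G '' {z | D.E z.1 z.2 < 1} := by
  have hw := D.w_pos
  have hh := D.h_pos
  -- the contraction is `x ↦ r x / √(r² - 1 + |x|²)` with `r > 1` close to `1`
  obtain ⟨r, hr1, hrX, hrY⟩ : ∃ r : ℝ, 1 < r ∧ |D.X| + r * D.w < 25 ∧ |D.Y| + r * D.h < 25 := by
    have h1 : ∀ᶠ r in 𝓝[>] (1 : ℝ), |D.X| + r * D.w < 25 :=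
      ((by fun_prop : Continuous fun r : ℝ => |D.X| + r * D.w).continuousAt.eventually_lt_const
        (by simpa using D.X_lt)).filter_mono nhdsWithin_le_nhds
    have h2 : ∀ᶠ r in 𝓝[>] (1 : ℝ), |D.Y| + r * D.h < 25 :=
      ((by fun_prop : Continuous fun r : ℝ => |D.Y| + r * D.h).continuousAt.eventually_lt_const
        (by simpa using D.Y_lt)).filter_mono nhdsWithin_le_nhds
    obtain ⟨r, h3, h4, h5⟩ := (h1.and (h2.and self_mem_nhdsWithin)).exists
    exact ⟨r, h5, h3, h4⟩
  have hr0 : 0 < r := by linarith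
  set k : ℝ := r ^ 2 - 1 with hk
  have hk0 : 0 < k := by nlinarith
  let n : EuclideanSpace ℝ (Fin 2) → ℝ := fun x => x 0 ^ 2 + x 1 ^ 2
  have hn0 : ∀ x, 0 ≤ n x := fun x => by positivity
  have hnn : ∀ x : EuclideanSpace ℝ (Fin 2), n x = ‖x‖ ^ 2 := fun x => by
    simp [n, EuclideanSpace.norm_sq_eq, Fin.sum_univ_two]
  let f : EuclideanSpace ℝ (Fin 2) → ℝ := fun x => r / √(k + n x)
  have hs : ∀ x, 0 < √(k + n x) := fun x => Real.sqrt_pos.2 (by have := hn0 x; linarith)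
  have hf0 : ∀ x, 0 < f x := fun x => div_pos hr0 (hs x)
  have hfsq : ∀ x, f x ^ 2 * (k + n x) = r ^ 2 := fun x => by
    have h1 := Real.sq_sqrt (by have := hn0 x; linarith : 0 ≤ k + n x)
    have h2 := (hs x).ne'
    simp only [f, div_pow, h1]
    have : k + n x ≠ 0 := by have := hn0 x; linarith
    field_simp
  have hcomp : ∀ (x : EuclideanSpace ℝ (Fin 2)) (i), |f x * x i| ≤ r := fun x i => by
    apply abs_le_of_sq_le_sq _ hr0.le
    have h1 : x i ^ 2 ≤ n x := by
      fin_cases i <;> simp [n] <;> positivity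
    have h2 := hfsq x
    rw [mul_pow]
    nlinarith [sq_nonneg (f x)]
  let P : EuclideanSpace ℝ (Fin 2) → ℝ × ℝ := fun x =>
    (D.X + D.w * (f x * x 0), D.Y + D.h * (f x * x 1))
  have hPbox : ∀ x, P x ∈ box := fun x => by
    rw [mem_box]
    constructor
    · calc |D.X + D.w * (f x * x 0)| ≤ |D.X| + |D.w * (f x * x 0)| := abs_add_le _ _
        _ = |D.X| + D.w * |f x * x 0| := by rw [abs_mul D.w, abs_of_pos hw]
        _ ≤ |D.X| + D.w * r := by gcongr; exact hcomp x 0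
        _ < 25 := by linarith
    · calc |D.Y + D.h * (f x * x 1)| ≤ |D.Y| + |D.h * (f x * x 1)| := abs_add_le _ _
        _ = |D.Y| + D.h * |f x * x 1| := by rw [abs_mul D.h, abs_of_pos hh]
        _ ≤ |D.Y| + D.h * r := by gcongr; exact hcomp x 1
        _ < 25 := by linarith
  have hE : ∀ x, D.E (P x).1 (P x).2 = f x ^ 2 * n x := fun x => by
    simp only [E, P, n]; field_simp; ring
  have hEle : ∀ x, D.E (P x).1 (P x).2 ≤ 1 ↔ ‖x‖ ≤ 1 := fun x => by
    have h1 := hfsq x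
    have h2 : 0 < f x ^ 2 := pow_pos (hf0 x) 2
    rw [hE, ← sq_le_one_iff₀ (norm_nonneg x), ← hnn]
    constructor
    · intro h; by_contra hc; nlinarith
    · intro h
      by_contra hc
      push Not at hc
      have h3 : 1 < f x ^ 2 := hc.trans_le (by nlinarith)
      nlinarith [mul_lt_mul_of_pos_right h3 hk0]
  have hElt : ∀ x, D.E (P x).1 (P x).2 < 1 ↔ ‖x‖ < 1 := fun x => by
    have h1 := hfsq x
    have h2 : 0 < f x ^ 2 := pow_pos (hf0 x) 2
    rw [hE, ← sq_lt_one_iff₀ (norm_nonneg x), ← hnn]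
    constructor
    · intro h; by_contra hc; nlinarith
    · intro h
      by_contra hc
      push Not at hc
      have h3 : 1 < f x ^ 2 := by
        by_contra h4
        push Not at h4
        nlinarith [hn0 x, mul_le_mul_of_nonneg_right h4 (hn0 x)]
      nlinarith [mul_lt_mul_of_pos_right h3 hk0]
  -- every point of the closed elliptical disc is in the image
  have hsurj : ∀ z : ℝ × ℝ, D.E z.1 z.2 ≤ 1 → ∃ x, P x = z := by
    intro z hz
    set u : ℝ := (z.1 - D.X) / D.w with hu
    set v : ℝ := (z.2 - D.Y) / D.h with hv
    have huv : u ^ 2 + v ^ 2 ≤ 1 := hz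
    have hpos : 0 < r ^ 2 - (u ^ 2 + v ^ 2) := by nlinarith
    set g : ℝ := √(k / (r ^ 2 - (u ^ 2 + v ^ 2))) with hg
    have hg0 : 0 < g := Real.sqrt_pos.2 (div_pos hk0 hpos)
    have hgsq : g ^ 2 * (r ^ 2 - (u ^ 2 + v ^ 2)) = k := by
      rw [hg, Real.sq_sqrt (by positivity)]; field_simp
    let x : EuclideanSpace ℝ (Fin 2) := !₂[g * u, g * v]
    have hnx : n x = g ^ 2 * (u ^ 2 + v ^ 2) := by simp [n, x]; ring
    have hfx : f x * g = 1 := by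
      have h1 : k + n x = (g * r) ^ 2 := by rw [hnx]; linear_combination -hgsq
      simp only [f]
      rw [h1, Real.sqrt_sq (by positivity)]
      field_simp
    refine ⟨x, Prod.ext ?_ ?_⟩
    · have h1 : D.X + D.w * (f x * (g * u)) = z.1 := by
        rw [← mul_assoc (f x), hfx, hu]; field_simp; ring
      exact h1
    · have h1 : D.Y + D.h * (f x * (g * v)) = z.2 := by
        rw [← mul_assoc (f x), hfx, hv]; field_simp; ring
      exact h1
  have hPinj : Function.Injective P := by
    intro x y hxy
    obtain ⟨h1, h2⟩ := Prod.mk.inj hxy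
    have h1' : f x * x 0 = f y * y 0 := by
      have := mul_left_cancel₀ hw.ne' (add_left_cancel h1); exact this
    have h2' : f x * x 1 = f y * y 1 := by
      have := mul_left_cancel₀ hh.ne' (add_left_cancel h2); exact this
    have h3 : f x ^ 2 * n x = f y ^ 2 * n y := by
      have : (f x * x 0) ^ 2 + (f x * x 1) ^ 2 = (f y * y 0) ^ 2 + (f y * y 1) ^ 2 := by
        rw [h1', h2']
      simp only [n]; linear_combination this
    have h4 : f x ^ 2 = f y ^ 2 := by
      have h5 := hfsq x
      have h6 := hfsq y
      have : k * (f x ^ 2 - f y ^ 2) = 0 := by linear_combination h5 - h6 - h3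
      rcases mul_eq_zero.1 this with h | h
      · exact absurd h hk0.ne'
      · linarith
    have h5 : f x = f y := (pow_left_inj₀ (hf0 x).le (hf0 y).le two_ne_zero).1 h4
    rw [h5] at h1' h2'
    ext i
    fin_cases i
    · exact mul_left_cancel₀ (hf0 y).ne' h1'
    · exact mul_left_cancel₀ (hf0 y).ne' h2'
  have hfs : ContDiff ℝ ∞ f := by
    have h1 : ContDiff ℝ ∞ fun x : EuclideanSpace ℝ (Fin 2) => k + n x := by fun_prop
    refine contDiff_const.div (contDiff_iff_contDiffAt.2 fun x => ?_) fun x => (hs x).ne'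
    exact (h1.contDiffAt).sqrt (by have := hn0 x; linarith)
  have hPs : ContDiff ℝ ∞ P := by
    have h0 : ∀ i : Fin 2, ContDiff ℝ ∞ fun x : EuclideanSpace ℝ (Fin 2) => x i := fun i => by
      fun_prop
    exact (contDiff_const.add (contDiff_const.mul (hfs.mul (h0 0)))).prodMk
      (contDiff_const.add (contDiff_const.mul (hfs.mul (h0 1))))
  -- the derivative of the contraction is injective, because `x ↦ x` can be recovered smoothly
  have hPimm : ∀ x, Function.Injective (fderiv ℝ P x) := by
    intro x
    rw [injective_iff_map_eq_zero]
    intro y hy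
    have hc : HasDerivAt (fun s : ℝ => x + s • y) y 0 := by
      simpa using ((hasDerivAt_id (0 : ℝ)).smul_const y).const_add x
    have hfd : HasDerivAt (fun s : ℝ => f (x + s • y)) (fderiv ℝ f x y) 0 := by
      have h1 : HasFDerivAt f (fderiv ℝ f x) (x + (0 : ℝ) • y) := by
        simpa using (hfs.differentiable (by simp) x).hasFDerivAt
      exact h1.comp_hasDerivAt (0 : ℝ) hc
    have hPd : HasDerivAt (fun s : ℝ => P (x + s • y)) 0 0 := by
      have h1 : HasFDerivAt P (fderiv ℝ P x) (x + (0 : ℝ) • y) := by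
        simpa using (hPs.differentiable (by simp) x).hasFDerivAt
      have := h1.comp_hasDerivAt (0 : ℝ) hc
      rw [hy] at this
      exact this
    set f' := fderiv ℝ f x y
    have hi : ∀ i, HasDerivAt (fun s : ℝ => (x + s • y) i) (y i) 0 := fun i => by
      have h1 : HasDerivAt (fun s : ℝ => x i + s * y i) (y i) 0 := by
        simpa using ((hasDerivAt_id (0 : ℝ)).mul_const (y i)).const_add (x i)
      exact h1
    have e0 : f' * x 0 + f x * y 0 = 0 := by
      have h1 := ((hfd.mul (hi 0)).const_mul D.w).const_add D.X
      have h2 := hPd.fst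
      have h3 := h1.unique h2
      simp only [zero_smul, add_zero] at h3
      exact (mul_eq_zero.1 h3).resolve_left hw.ne'
    have e1 : f' * x 1 + f x * y 1 = 0 := by
      have h1 := ((hfd.mul (hi 1)).const_mul D.h).const_add D.Y
      have h2 := hPd.snd
      have h3 := h1.unique h2
      simp only [zero_smul, add_zero] at h3
      exact (mul_eq_zero.1 h3).resolve_left hh.ne'
    have e2 : 2 * f x * f' * (k + n x) + f x ^ 2 * (2 * x 0 * y 0 + 2 * x 1 * y 1) = 0 := by
      have h1 := (hfd.pow 2).mul ((((hi 0).pow 2).add ((hi 1).pow 2)).const_add k)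
      have h2 : HasDerivAt (fun s : ℝ => f (x + s • y) ^ 2 * (k + n (x + s • y))) 0 0 := by
        simp only [hfsq]; exact hasDerivAt_const _ _
      have h3 := h1.unique h2
      simp only [zero_smul, add_zero] at h3
      simp only [n]
      simp at h3
      linear_combination h3
    have hfx := (hf0 x).ne'
    have e3 : f' * k = 0 := by
      have : f x * (f' * k) = 0 := by
        simp only [n] at e2
        linear_combination e2 / 2 - f x * x 0 * e0 - f x * x 1 * e1
      exact (mul_eq_zero.1 this).resolve_left hfx
    have e4 : f' = 0 := (mul_eq_zero.1 e3).resolve_right hk0.ne'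
    rw [e4] at e0 e1
    ext i
    fin_cases i
    · simpa [hfx] using e0
    · simpa [hfx] using e1
  refine ⟨fun x => M.G (P x), ?_, fun x y h => hPinj (M.inj (hPbox x) (hPbox y) h), ?_, ?_, ?_⟩
  · exact M.smooth.comp_contDiff hPs hPbox
  · intro x
    have h1 : HasFDerivAt (fun x => (M.G (P x) : E3)) ((M.DG (P x)).comp (fderiv ℝ P x)) x :=
      HasFDerivAt.comp (g := fun z => (M.G z : E3)) x (M.hasFDerivAt (hPbox x))
        (hPs.differentiable (by simp) x).hasFDerivAt
    rw [h1.fderiv, ContinuousLinearMap.coe_comp]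
    refine Function.Injective.comp ?_ (hPimm x)
    rw [injective_iff_map_eq_zero]
    rintro ⟨a, b⟩ h
    by_contra hc
    refine M.DG_ne_zero (hPbox x) ?_ h
    by_contra hc'
    push Not at hc'
    exact hc (Prod.ext hc'.1 hc'.2)
  · ext y
    constructor
    · rintro ⟨x, hx, rfl⟩
      exact ⟨P x, (hEle x).2 (by simpa using hx), rfl⟩
    · rintro ⟨z, hz, rfl⟩
      obtain ⟨x, rfl⟩ := hsurj z hz
      exact ⟨x, by simpa using (hEle x).1 hz, rfl⟩
  · ext y
    constructor
    · rintro ⟨x, hx, rfl⟩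
      exact ⟨P x, (hElt x).2 (by simpa using hx), rfl⟩
    · rintro ⟨z, hz, rfl⟩
      obtain ⟨x, rfl⟩ := hsurj z (le_of_lt hz)
      exact ⟨x, by simpa using (hElt x).1 hz, rfl⟩

lemma mem_box_of_le {z : ℝ × ℝ} (hz : D.E z.1 z.2 ≤ 1) : z ∈ box := by
  have hw := D.w_pos
  have hh := D.h_pos
  have h1 : |(z.1 - D.X) / D.w| ≤ 1 := abs_le_of_sq_le_sq (by
    unfold E at hz; nlinarith [sq_nonneg ((z.2 - D.Y) / D.h)]) zero_le_one
  have h2 : |(z.2 - D.Y) / D.h| ≤ 1 := abs_le_of_sq_le_sq (by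
    unfold E at hz; nlinarith [sq_nonneg ((z.1 - D.X) / D.w)]) zero_le_one
  rw [abs_div, abs_of_pos hw, div_le_one hw] at h1
  rw [abs_div, abs_of_pos hh, div_le_one hh] at h2
  have e1 : |z.1| ≤ |z.1 - D.X| + |D.X| := by simpa using abs_add_le (z.1 - D.X) D.X
  have e2 : |z.2| ≤ |z.2 - D.Y| + |D.Y| := by simpa using abs_add_le (z.2 - D.Y) D.Y
  have := D.X_lt
  have := D.Y_lt
  exact mem_box.2 ⟨by linarith, by linarith⟩

end Ellipse

/-- Intervals of the coordinates on the strands `A` (where `k` is true) and `B` (where `k` is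
false) of a local model, which are to be the strands of a window whose disc is bounded by the
ellipse `D`. The strand `B` is always the vertical axis, so that its part in the disc is known; for
the strand `A` see `Strands.Fits`. -/
structure Strands (b : Prop) (D : Ellipse) (n : ℕ) where
  k : Fin n → Bool
  α : Fin n → ℝ
  β : Fin n → ℝ
  lt : ∀ i, α i < β i
  rangeA : ∀ i, k i = true → -5 < α i ∧ β i < 5
  rangeB : ∀ i, k i = false → b ∧ -25 < α i ∧ β i < 25
  disj : ∀ i j, i ≠ j → k i = k j → Disjoint (Icc (α i) (β i)) (Icc (α j) (β j))
  B_le : b → ∀ v, |v| < 25 → (D.E 0 v ≤ 1 ↔ ∃ i, k i = false ∧ v ∈ Icc (α i) (β i))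
  B_lt : b → ∀ v, |v| < 25 → (D.E 0 v < 1 ↔ ∃ i, k i = false ∧ v ∈ Ioo (α i) (β i))

namespace Strands

variable {b : Prop} {D : Ellipse} {n : ℕ}

/-- The strand of the flat function `p` meets the disc in the intervals of `S`, and there are no
double points on the ellipse. -/
structure Fits (S : Strands b D n) (p : ℝ → ℝ) : Prop where
  le : ∀ τ, |τ| < 5 → (D.E (p τ) (-τ ^ 2) ≤ 1 ↔ ∃ i, S.k i = true ∧ τ ∈ Icc (S.α i) (S.β i))
  lt : ∀ τ, |τ| < 5 → (D.E (p τ) (-τ ^ 2) < 1 ↔ ∃ i, S.k i = true ∧ τ ∈ Ioo (S.α i) (S.β i))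
  self_ne : ∀ τ, |τ| < 5 → D.E (p τ) (-τ ^ 2) = 1 → τ ≠ 0 → p τ ≠ p (-τ)
  zero_ne : b → ∀ τ, |τ| < 5 → D.E (p τ) (-τ ^ 2) = 1 → p τ ≠ 0

/-- The two flat functions agree outside the strands of `S`. -/
def Agree (S : Strands b D n) (p p' : ℝ → ℝ) : Prop :=
  ∀ τ, |τ| < 5 → (∀ i, S.k i = true → τ ∉ Ioo (S.α i) (S.β i)) → p τ = p' τ

/-- The same strands in another order. -/
def reindex (S : Strands b D n) (e : Equiv.Perm (Fin n)) : Strands b D n where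
  k := S.k ∘ e
  α := S.α ∘ e
  β := S.β ∘ e
  lt i := S.lt (e i)
  rangeA i := S.rangeA (e i)
  rangeB i := S.rangeB (e i)
  disj i j h := S.disj (e i) (e j) fun h' => h (e.injective h')
  B_le hb v hv := (S.B_le hb v hv).trans
    ⟨fun ⟨i, h⟩ => ⟨e.symm i, by simpa using h⟩, fun ⟨i, h⟩ => ⟨e i, h⟩⟩
  B_lt hb v hv := (S.B_lt hb v hv).trans
    ⟨fun ⟨i, h⟩ => ⟨e.symm i, by simpa using h⟩, fun ⟨i, h⟩ => ⟨e i, h⟩⟩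

lemma Fits.reindex {S : Strands b D n} {p : ℝ → ℝ} (h : S.Fits p) (e : Equiv.Perm (Fin n)) :
    (S.reindex e).Fits p where
  le τ hτ := (h.le τ hτ).trans
    ⟨fun ⟨i, h⟩ => ⟨e.symm i, by simpa [Strands.reindex] using h⟩, fun ⟨i, h⟩ => ⟨e i, h⟩⟩
  lt τ hτ := (h.lt τ hτ).trans
    ⟨fun ⟨i, h⟩ => ⟨e.symm i, by simpa [Strands.reindex] using h⟩, fun ⟨i, h⟩ => ⟨e i, h⟩⟩
  self_ne := h.self_ne
  zero_ne := h.zero_ne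

lemma Agree.reindex {S : Strands b D n} {p p' : ℝ → ℝ} (h : S.Agree p p')
    (e : Equiv.Perm (Fin n)) : (S.reindex e).Agree p p' :=
  fun τ hτ hi => h τ hτ fun i hk => by simpa [Strands.reindex] using hi (e.symm i) (by simpa [Strands.reindex] using hk)

end Strands

/-- The image of an interval under an affine map, which may reverse the orientation. -/
lemma exists_affine_interval (c : ℝ) {l α β : ℝ} (hl : l ≠ 0) (h : α < β) : ∃ a b : ℝ, a < b ∧
    (∀ t, t ∈ Icc a b ↔ ∃ τ ∈ Icc α β, t = c + l * τ) ∧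
    (∀ t, t ∈ Ioo a b ↔ ∃ τ ∈ Ioo α β, t = c + l * τ) ∧
    (a = c + l * α ∧ b = c + l * β ∨ a = c + l * β ∧ b = c + l * α) := by
  have e : ∀ t, t = c + l * ((t - c) / l) := fun t => by field_simp; ring
  rcases lt_or_gt_of_ne hl with hl | hl
  · refine ⟨c + l * β, c + l * α, by nlinarith, fun t => ⟨fun ht => ⟨(t - c) / l, ⟨?_, ?_⟩, e t⟩, ?_⟩,
      fun t => ⟨fun ht => ⟨(t - c) / l, ⟨?_, ?_⟩, e t⟩, ?_⟩, Or.inr ⟨rfl, rfl⟩⟩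
    · rw [le_div_iff_of_neg hl]; linarith [ht.2]
    · rw [div_le_iff_of_neg hl]; linarith [ht.1]
    · rintro ⟨τ, h1, rfl⟩
      exact ⟨by nlinarith [h1.2], by nlinarith [h1.1]⟩
    · rw [lt_div_iff_of_neg hl]; linarith [ht.2]
    · rw [div_lt_iff_of_neg hl]; linarith [ht.1]
    · rintro ⟨τ, h1, rfl⟩
      exact ⟨by nlinarith [h1.2], by nlinarith [h1.1]⟩
  · refine ⟨c + l * α, c + l * β, by nlinarith, fun t => ⟨fun ht => ⟨(t - c) / l, ⟨?_, ?_⟩, e t⟩, ?_⟩,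
      fun t => ⟨fun ht => ⟨(t - c) / l, ⟨?_, ?_⟩, e t⟩, ?_⟩, Or.inl ⟨rfl, rfl⟩⟩
    · rw [le_div_iff₀ hl]; linarith [ht.1]
    · rw [div_le_iff₀ hl]; linarith [ht.2]
    · rintro ⟨τ, h1, rfl⟩
      exact ⟨by nlinarith [h1.1], by nlinarith [h1.2]⟩
    · rw [lt_div_iff₀ hl]; linarith [ht.1]
    · rw [div_lt_iff₀ hl]; linarith [ht.2]
    · rintro ⟨τ, h1, rfl⟩
      exact ⟨by nlinarith [h1.1], by nlinarith [h1.2]⟩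

namespace LocalModel

variable {K : KnotoidDiagram} (M : LocalModel K) {p p' : ℝ → ℝ} {n : ℕ} {D : Ellipse}

/-- The parameter of a point on the strand `A` or `B`. -/
def par (k : Bool) (τ : ℝ) : ℝ := if k then M.A τ else M.B τ

variable {M}

lemma not_isDoubleParam_A (hp : Flat M.hasB p) (o : ℝˣ) {τ : ℝ} (hτ : |τ| < 5)
    (h1 : τ ≠ 0 → p τ ≠ p (-τ)) (h2 : M.hasB → p τ ≠ 0) :
    ¬ (M.mod p hp o).IsDoubleParam (M.A τ) := by
  rintro ⟨ht, s, hs, hne, h⟩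
  rcases modCurve_coincidence hp ht hs hne.symm h.symm with ⟨τ', hτ', h0, hpτ, e1, rfl⟩ |
    ⟨hb, τ', hτ', hpτ, e1, rfl⟩ | ⟨hb, τ', hτ', hpτ, e1, rfl⟩ | ⟨ho, -, -⟩
  · rw [← M.A_injective e1] at h0 hpτ; exact h1 h0 hpτ
  · rw [← M.A_injective e1] at hpτ; exact h2 hb hpτ
  · exact B_ne_A hb (sq_lt_25 hτ') _ hτ e1.symm
  · exact ho.1 τ hτ rfl

lemma not_isDoubleParam_B (hp : Flat M.hasB p) (o : ℝˣ) (hb : M.hasB) {v : ℝ} (hv : |v| < 25)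
    (h : ∀ τ, |τ| < 5 → v = -τ ^ 2 → p τ ≠ 0) : ¬ (M.mod p hp o).IsDoubleParam (M.B v) := by
  rintro ⟨ht, s, hs, hne, h'⟩
  rcases modCurve_coincidence hp ht hs hne.symm h'.symm with ⟨τ', hτ', h0, hpτ, e1, rfl⟩ |
    ⟨hb, τ', hτ', hpτ, e1, rfl⟩ | ⟨hb, τ', hτ', hpτ, e1, rfl⟩ | ⟨ho, -, -⟩
  · exact B_ne_A hb hv _ hτ' e1
  · exact B_ne_A hb hv _ hτ' e1
  · exact h τ' hτ' (M.B_injective e1) hpτ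
  · exact ho.2 hb v hv rfl

/-- If `A` and `B` meet a subset of the square in given intervals, then so does the modified
diagram, since nothing else of it lies in the square. -/
lemma mem_modCurve_image_iff (hp : Flat M.hasB p) {Z : Set (ℝ × ℝ)} (hZ : Z ⊆ box)
    {k : Fin n → Bool} {I : Fin n → Set ℝ} (hIA : ∀ i, k i = true → ∀ τ ∈ I i, |τ| < 5)
    (hIB : ∀ i, k i = false → M.hasB ∧ ∀ τ ∈ I i, |τ| < 25)
    (hA : ∀ τ, |τ| < 5 → ((p τ, -τ ^ 2) ∈ Z ↔ ∃ i, k i = true ∧ τ ∈ I i))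
    (hB : M.hasB → ∀ v, |v| < 25 → ((0, v) ∈ Z ↔ ∃ i, k i = false ∧ v ∈ I i))
    {t : ℝ} (ht : t ∈ Icc (0 : ℝ) 1) :
    M.modCurve p t ∈ M.G '' Z ↔ ∃ i, ∃ τ ∈ I i, t = M.par (k i) τ := by
  have hG : ∀ z ∈ box, (M.G z ∈ M.G '' Z ↔ z ∈ Z) := fun z hz => M.inj.mem_image_iff hZ hz
  rcases M.cases t with ⟨τ, hτ, rfl⟩ | ⟨hb, v, hv, rfl⟩ | hto
  · rw [modCurve_A hp hτ, hG _ (hp.mem_box hτ), hA τ hτ]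
    constructor
    · rintro ⟨i, hk, hi⟩
      exact ⟨i, τ, hi, by simp [par, hk]⟩
    · rintro ⟨i, τ', hi, e⟩
      cases hk : k i
      · obtain ⟨hb, h⟩ := hIB i hk
        simp only [par, hk] at e
        exact absurd e.symm (B_ne_A hb (h _ hi) τ hτ)
      · simp only [par, hk, if_true] at e
        rw [← M.A_injective e] at hi
        exact ⟨i, hk, hi⟩
  · rw [modCurve_B hp hb hv, hG _ (by rw [_root_.mem_box]; simpa using hv), hB hb v hv]
    constructor
    · rintro ⟨i, hk, hi⟩
      exact ⟨i, v, hi, by simp [par, hk]⟩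
    · rintro ⟨i, τ', hi, e⟩
      cases hk : k i
      · simp only [par, hk] at e
        rw [← M.B_injective e] at hi
        exact ⟨i, hk, hi⟩
      · simp only [par, hk, if_true] at e
        exact absurd e (B_ne_A hb hv _ (hIA i hk _ hi))
  · rw [(hto.modCurve_eventuallyEq hp).eq_of_nhds]
    refine iff_of_false (fun h => hto.notMem ht (image_mono hZ h)) ?_
    rintro ⟨i, τ', hi, e⟩
    cases hk : k i
    · obtain ⟨hb, h⟩ := hIB i hk
      simp only [par, hk] at e
      exact hto.2 hb _ (h _ hi) e
    · simp only [par, hk, if_true] at e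
      exact hto.1 _ (hIA i hk _ hi) e

lemma par_injective (k : Bool) : Function.Injective (M.par k) := by
  cases k
  · exact M.B_injective
  · exact M.A_injective

lemma par_eq_par {S : Strands M.hasB D n} {i j : Fin n} {τ τ' : ℝ} (h1 : τ ∈ Icc (S.α i) (S.β i))
    (h2 : τ' ∈ Icc (S.α j) (S.β j)) (h : M.par (S.k i) τ = M.par (S.k j) τ') :
    i = j ∧ τ = τ' := by
  by_cases hk : S.k i = S.k j
  · rw [hk] at h
    have := M.par_injective _ h
    subst this
    refine ⟨?_, rfl⟩
    by_contra hne
    exact (disjoint_left.1 (S.disj i j hne hk)) h1 h2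
  · exfalso
    cases hi : S.k i <;> cases hj : S.k j
    · simp [hi, hj] at hk
    · obtain ⟨hb, r1, r2⟩ := S.rangeB i hi
      obtain ⟨r3, r4⟩ := S.rangeA j hj
      simp only [par, hi, hj] at h
      exact B_ne_A hb (abs_lt.2 ⟨r1.trans_le h1.1, h1.2.trans_lt r2⟩) _
        (abs_lt.2 ⟨r3.trans_le h2.1, h2.2.trans_lt r4⟩) h
    · obtain ⟨hb, r1, r2⟩ := S.rangeB j hj
      obtain ⟨r3, r4⟩ := S.rangeA i hi
      simp only [par, hi, hj] at h
      exact B_ne_A hb (abs_lt.2 ⟨r1.trans_le h2.1, h2.2.trans_lt r2⟩) _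
        (abs_lt.2 ⟨r3.trans_le h1.1, h1.2.trans_lt r4⟩) h.symm
    · simp [hi, hj] at hk

variable (M) in
/-- The disc bounded by an ellipse, with strands that fit, is a window for the modifications of a
diagram. -/
lemma exists_window (S : Strands M.hasB D n) : ∃ W : Window n,
    (∀ p (hp : Flat M.hasB p) p' (hp' : Flat M.hasB p') (o : ℝˣ), S.Fits p → S.Fits p' →
      S.Agree p p' → W.Replaces (M.mod p hp o) (M.mod p' hp' o)) ∧
    (∀ i t, t ∈ Ioo (W.a i) (W.b i) ↔ ∃ τ ∈ Ioo (S.α i) (S.β i), t = M.par (S.k i) τ) ∧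
    ∀ τ, |τ| < 5 → (∀ i, S.k i = true → τ ∉ Icc (S.α i) (S.β i)) →
      ∀ i, M.A τ ∉ Icc (W.a i) (W.b i) := by
  obtain ⟨c, c1, c2, c3, c4, c5⟩ := D.exists_chart M
  have hab : ∀ i, ∃ a b : ℝ, a < b ∧
      (∀ t, t ∈ Icc a b ↔ ∃ τ ∈ Icc (S.α i) (S.β i), t = M.par (S.k i) τ) ∧
      (∀ t, t ∈ Ioo a b ↔ ∃ τ ∈ Ioo (S.α i) (S.β i), t = M.par (S.k i) τ) ∧
      (a = M.par (S.k i) (S.α i) ∧ b = M.par (S.k i) (S.β i) ∨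
        a = M.par (S.k i) (S.β i) ∧ b = M.par (S.k i) (S.α i)) := fun i => by
    cases hk : S.k i
    · exact exists_affine_interval M.tB M.mu_ne (S.lt i)
    · exact exists_affine_interval M.t₀ M.lam_ne (S.lt i)
  choose a b h1 h2 h3 h4 using hab
  have hIA : ∀ i, S.k i = true → ∀ τ ∈ Icc (S.α i) (S.β i), |τ| < 5 := fun i hk τ hτ =>
    abs_lt.2 ⟨(S.rangeA i hk).1.trans_le hτ.1, hτ.2.trans_lt (S.rangeA i hk).2⟩
  have hIB : ∀ i, S.k i = false → M.hasB ∧ ∀ τ ∈ Icc (S.α i) (S.β i), |τ| < 25 := fun i hk =>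
    ⟨(S.rangeB i hk).1, fun τ hτ =>
      abs_lt.2 ⟨(S.rangeB i hk).2.1.trans_le hτ.1, hτ.2.trans_lt (S.rangeB i hk).2.2⟩⟩
  have hpar : ∀ i, ∀ τ ∈ Icc (S.α i) (S.β i), M.par (S.k i) τ ∈ Ioo (0 : ℝ) 1 := fun i τ hτ => by
    cases hk : S.k i
    · exact M.B_mem (hIB i hk).1 _ ((hIB i hk).2 τ hτ)
    · exact M.A_mem _ (hIA i hk τ hτ)
  have hα : ∀ i, S.α i ∈ Icc (S.α i) (S.β i) := fun i => left_mem_Icc.2 (S.lt i).le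
  have hβ : ∀ i, S.β i ∈ Icc (S.α i) (S.β i) := fun i => right_mem_Icc.2 (S.lt i).le
  let W : Window n :=
    { chart := c
      a := a
      b := b
      chart_smooth := c1
      chart_injective := c2
      chart_immersion := c3
      a_pos := fun i => by
        rcases h4 i with ⟨e, -⟩ | ⟨e, -⟩ <;> rw [e]
        exacts [(hpar i _ (hα i)).1, (hpar i _ (hβ i)).1]
      a_lt_b := h1
      b_lt_one := fun i => by
        rcases h4 i with ⟨-, e⟩ | ⟨-, e⟩ <;> rw [e]
        exacts [(hpar i _ (hβ i)).2, (hpar i _ (hα i)).2]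
      disjoint := fun i j hij => by
        rw [disjoint_left]
        intro t hi hj
        obtain ⟨τ, hτ, e⟩ := (h2 i t).1 hi
        obtain ⟨τ', hτ', e'⟩ := (h2 j t).1 hj
        exact hij (par_eq_par hτ hτ' (e.symm.trans e')).1 }
  have meets : ∀ p (hp : Flat M.hasB p) (o : ℝˣ), S.Fits p → W.Meets (M.mod p hp o) := by
    intro p hp o hf
    refine ⟨fun t ht => ?_, fun t ht => ?_, fun i => ?_⟩
    · show M.modCurve p t ∈ c '' _ ↔ ∃ i, t ∈ Icc (a i) (b i)
      rw [c4, mem_modCurve_image_iff hp (Z := {z | D.E z.1 z.2 ≤ 1}) (k := S.k) (I := fun i => Icc (S.α i) (S.β i))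
        (fun z hz => D.mem_box_of_le hz) hIA hIB hf.le S.B_le ht]
      simp only [h2]
    · show M.modCurve p t ∈ c '' _ ↔ ∃ i, t ∈ Ioo (a i) (b i)
      rw [c5, mem_modCurve_image_iff hp (Z := {z | D.E z.1 z.2 < 1}) (k := S.k) (I := fun i => Ioo (S.α i) (S.β i))
        (fun z hz => D.mem_box_of_le (le_of_lt hz))
        (fun i hk τ hτ => hIA i hk τ (Ioo_subset_Icc_self hτ))
        (fun i hk => ⟨(hIB i hk).1, fun τ hτ => (hIB i hk).2 τ (Ioo_subset_Icc_self hτ)⟩)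
        hf.lt S.B_lt ht]
      simp only [h3]
    · have key : ∀ τ ∈ Icc (S.α i) (S.β i), τ ∉ Ioo (S.α i) (S.β i) →
          ¬ (M.mod p hp o).IsDoubleParam (M.par (S.k i) τ) := by
        intro τ hτ hn
        cases hk : S.k i
        · have hb := (hIB i hk).1
          have hv := (hIB i hk).2 τ hτ
          refine not_isDoubleParam_B hp o hb hv fun σ hσ e hpσ => ?_
          have e1 : D.E 0 τ = 1 := by
            refine le_antisymm ((S.B_le hb τ hv).2 ⟨i, hk, hτ⟩) (not_lt.1 fun h => ?_)
            obtain ⟨j, hj, hj'⟩ := (S.B_lt hb τ hv).1 h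
            have : i = j := (par_eq_par (M := M) (S := S) hτ (Ioo_subset_Icc_self hj')
              (by rw [hk, hj])).1
            subst this
            exact hn hj'
          rw [e, ← hpσ] at e1
          exact hf.zero_ne hb σ hσ e1 hpσ
        · have hv := hIA i hk τ hτ
          have e1 : D.E (p τ) (-τ ^ 2) = 1 := by
            refine le_antisymm ((hf.le τ hv).2 ⟨i, hk, hτ⟩) (not_lt.1 fun h => ?_)
            obtain ⟨j, hj, hj'⟩ := (hf.lt τ hv).1 h
            have : i = j := (par_eq_par (M := M) (S := S) hτ (Ioo_subset_Icc_self hj')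
              (by rw [hk, hj])).1
            subst this
            exact hn hj'
          exact not_isDoubleParam_A hp o hv (hf.self_ne τ hv e1) fun hb => hf.zero_ne hb τ hv e1
      have kα := key _ (hα i) fun h => lt_irrefl _ h.1
      have kβ := key _ (hβ i) fun h => lt_irrefl _ h.2
      show ¬ (M.mod p hp o).IsDoubleParam (a i) ∧ ¬ (M.mod p hp o).IsDoubleParam (b i)
      rcases h4 i with ⟨e, e'⟩ | ⟨e, e'⟩ <;> rw [e, e']
      exacts [⟨kα, kβ⟩, ⟨kβ, kα⟩]
  -- the disc is symmetric in the height, so outside the strands both functions have the same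
  -- self-crossings, on which the over/undercrossing data depend
  have hneg : ∀ {p p' : ℝ → ℝ}, S.Fits p → S.Agree p p' → ∀ {τ}, |τ| < 5 →
      (∀ i, S.k i = true → τ ∉ Ioo (S.α i) (S.β i)) → p τ = p (-τ) → p' τ = p' (-τ) := by
    intro p p' hf hag τ hτ hi hs
    rw [← hag τ hτ hi, hs]
    refine hag (-τ) (by rwa [abs_neg]) fun i hk hm => ?_
    have h5 := (hf.lt (-τ) (by rwa [abs_neg])).2 ⟨i, hk, hm⟩
    rw [← hs, neg_sq] at h5
    obtain ⟨j, hj, hj'⟩ := (hf.lt τ hτ).1 h5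
    exact hi j hj hj'
  refine ⟨W, fun p hp p' hp' o hf hf' hag => ⟨meets p hp o hf, meets p' hp' o hf', ?_⟩, h3,
    fun τ hτ hi i h => ?_⟩
  swap
  · obtain ⟨τ', hτ', e⟩ := (h2 i _).1 h
    cases hk : S.k i
    · rw [hk] at e
      exact B_ne_A (hIB i hk).1 ((hIB i hk).2 τ' hτ') τ hτ e.symm
    · rw [hk] at e
      exact hi i hk (M.A_injective e ▸ hτ')
  intro t ht hi
  show M.modCurve p t = M.modCurve p' t ∧ (_ → (t ∈ M.modUpper p o ↔ t ∈ M.modUpper p' o))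
  have hi' : ∀ i, ∀ τ ∈ Ioo (S.α i) (S.β i), t ≠ M.par (S.k i) τ := fun i τ hτ e =>
    hi i ((h3 i t).2 ⟨τ, hτ, e⟩)
  rcases M.cases t with ⟨τ, hτ, rfl⟩ | ⟨hb, v, hv, rfl⟩ | hto
  · have hA : ∀ i, S.k i = true → τ ∉ Ioo (S.α i) (S.β i) := fun i hk hm =>
      hi' i τ hm (by simp [par, hk])
    have e1 : p τ = p' τ := hag τ hτ hA
    refine ⟨by rw [modCurve_A hp hτ, modCurve_A hp' hτ, e1], fun _ => ?_⟩
    have e2 : p τ = p (-τ) ↔ p' τ = p' (-τ) :=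
      ⟨hneg hf hag hτ hA, hneg hf' (fun σ hσ h => (hag σ hσ h).symm) hτ hA⟩
    rw [A_mem_modUpper o hτ, A_mem_modUpper o hτ, e2]
  · refine ⟨by rw [modCurve_B hp hb hv, modCurve_B hp' hb hv], fun _ => ?_⟩
    rw [B_mem_modUpper o hb hv, B_mem_modUpper o hb hv]
  · refine ⟨?_, fun _ => by rw [hto.mem_modUpper, hto.mem_modUpper]⟩
    rw [(hto.modCurve_eventuallyEq hp).eq_of_nhds, (hto.modCurve_eventuallyEq hp').eq_of_nhds]

end LocalModel

/-! ### Reidemeister moves between modifications -/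

namespace LocalModel

variable {K : KnotoidDiagram} {M : LocalModel K} {p p' : ℝ → ℝ} {n : ℕ} {D : Ellipse}

/-- The crossings of a modification at which strand `i` of `S` passes over strand `j`. -/
def cross (S : Strands M.hasB D n) (hp : Flat M.hasB p) (o : ℝˣ) (i j : Fin n) : Set (ℝ × ℝ) :=
  {q ∈ (M.mod p hp o).crossings | (∃ τ ∈ Ioo (S.α i) (S.β i), q.1 = M.par (S.k i) τ) ∧
    ∃ τ ∈ Ioo (S.α j) (S.β j), q.2 = M.par (S.k j) τ}

lemma abs_lt_of_mem (S : Strands M.hasB D n) {i : Fin n} (hk : S.k i = true) {τ : ℝ}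
    (h : τ ∈ Ioo (S.α i) (S.β i)) : |τ| < 5 :=
  abs_lt.2 ⟨(S.rangeA i hk).1.trans h.1, h.2.trans (S.rangeA i hk).2⟩

lemma mem_cross_AA (S : Strands M.hasB D n) (hp : Flat M.hasB p) (o : ℝˣ) {i j : Fin n}
    (hi : S.k i = true) (hj : S.k j = true) (q : ℝ × ℝ) : q ∈ cross S hp o i j ↔
      ∃ τ ∈ Ioo (S.α i) (S.β i), -τ ∈ Ioo (S.α j) (S.β j) ∧ τ ≠ 0 ∧ p τ = p (-τ) ∧
        0 < (o : ℝ) * τ ∧ q = (M.A τ, M.A (-τ)) := by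
  constructor
  · rintro ⟨hq, ⟨τ, h1, h2⟩, τ', h3, h4⟩
    simp only [par, hi, hj, if_true] at h2 h4
    have a1 := abs_lt_of_mem S hi h1
    have a3 := abs_lt_of_mem S hj h3
    rcases (mem_crossings_mod hp o q).1 hq with ⟨σ, -, h0, hpσ, ho, rfl⟩ |
      ⟨hb, -, σ, hσ, hpσ, rfl⟩ | ⟨hb, -, σ, hσ, hpσ, rfl⟩ | ⟨hO, -⟩
    · have e1 := M.A_injective h2
      have e2 := M.A_injective h4
      subst e1 e2
      exact ⟨σ, h1, h3, h0, hpσ, ho, rfl⟩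
    · exact absurd h4 (B_ne_A hb (sq_lt_25 hσ) _ a3)
    · exact absurd h2 (B_ne_A hb (sq_lt_25 hσ) _ a1)
    · exact absurd h2 (hO.1 _ a1)
  · rintro ⟨τ, h1, h2, h0, hpτ, ho, rfl⟩
    exact ⟨(mem_crossings_mod hp o _).2 (Or.inl ⟨τ, abs_lt_of_mem S hi h1, h0, hpτ, ho, rfl⟩),
      ⟨τ, h1, by simp [par, hi]⟩, -τ, h2, by simp [par, hj]⟩

lemma mem_cross_AB (S : Strands M.hasB D n) (hp : Flat M.hasB p) (o : ℝˣ) {i j : Fin n}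
    (hi : S.k i = true) (hj : S.k j = false) (q : ℝ × ℝ) : q ∈ cross S hp o i j ↔
      M.t₀ ∈ K.upper ∧ ∃ τ ∈ Ioo (S.α i) (S.β i), -τ ^ 2 ∈ Ioo (S.α j) (S.β j) ∧ p τ = 0 ∧
        q = (M.A τ, M.B (-τ ^ 2)) := by
  constructor
  · rintro ⟨hq, ⟨τ, h1, h2⟩, τ', h3, h4⟩
    have a1 := abs_lt_of_mem S hi h1
    obtain ⟨hb, r1, r2⟩ := S.rangeB j hj
    have a3 : |τ'| < 25 := abs_lt.2 ⟨r1.trans h3.1, h3.2.trans r2⟩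
    simp only [par, hi, hj] at h2 h4
    rcases (mem_crossings_mod hp o q).1 hq with ⟨σ, hσ, h0, hpσ, ho, rfl⟩ |
      ⟨hb, hu, σ, hσ, hpσ, rfl⟩ | ⟨hb, -, σ, hσ, hpσ, rfl⟩ | ⟨hO, -⟩
    · exact absurd h4.symm (B_ne_A hb a3 _ (by rwa [abs_neg]))
    · have e1 := M.A_injective h2
      have e2 := M.B_injective h4
      subst e1 e2
      exact ⟨hu, σ, h1, h3, hpσ, rfl⟩
    · exact absurd h2 (B_ne_A hb (sq_lt_25 hσ) _ a1)
    · exact absurd h2 (hO.1 _ a1)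
  · rintro ⟨hu, τ, h1, h2, hpτ, rfl⟩
    exact ⟨(mem_crossings_mod hp o _).2 (Or.inr (Or.inl ⟨(S.rangeB j hj).1, hu, τ,
      abs_lt_of_mem S hi h1, hpτ, rfl⟩)), ⟨τ, h1, by simp [par, hi]⟩, _, h2, by simp [par, hj]⟩

lemma mem_cross_BA (S : Strands M.hasB D n) (hp : Flat M.hasB p) (o : ℝˣ) {i j : Fin n}
    (hi : S.k i = true) (hj : S.k j = false) (q : ℝ × ℝ) : q ∈ cross S hp o j i ↔
      M.t₀ ∉ K.upper ∧ ∃ τ ∈ Ioo (S.α i) (S.β i), -τ ^ 2 ∈ Ioo (S.α j) (S.β j) ∧ p τ = 0 ∧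
        q = (M.B (-τ ^ 2), M.A τ) := by
  constructor
  · rintro ⟨hq, ⟨τ', h3, h4⟩, τ, h1, h2⟩
    have a1 := abs_lt_of_mem S hi h1
    obtain ⟨hb, r1, r2⟩ := S.rangeB j hj
    have a3 : |τ'| < 25 := abs_lt.2 ⟨r1.trans h3.1, h3.2.trans r2⟩
    simp only [par, hi, hj] at h2 h4
    rcases (mem_crossings_mod hp o q).1 hq with ⟨σ, hσ, h0, hpσ, ho, rfl⟩ |
      ⟨hb, hu, σ, hσ, hpσ, rfl⟩ | ⟨hb, hu, σ, hσ, hpσ, rfl⟩ | ⟨-, hO, -⟩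
    · exact absurd h4.symm (B_ne_A hb a3 _ hσ)
    · exact absurd h2 (B_ne_A hb (sq_lt_25 hσ) _ a1)
    · have e1 := M.A_injective h2
      have e2 := M.B_injective h4
      subst e1 e2
      exact ⟨hu, σ, h1, h3, hpσ, rfl⟩
    · exact absurd h2 (hO.1 _ a1)
  · rintro ⟨hu, τ, h1, h2, hpτ, rfl⟩
    exact ⟨(mem_crossings_mod hp o _).2 (Or.inr (Or.inr (Or.inl ⟨(S.rangeB j hj).1, hu, τ,
      abs_lt_of_mem S hi h1, hpτ, rfl⟩))), ⟨_, h2, by simp [par, hj]⟩, τ, h1, by simp [par, hi]⟩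

lemma cross_BB (S : Strands M.hasB D n) (hp : Flat M.hasB p) (o : ℝˣ) {i j : Fin n}
    (hi : S.k i = false) (hj : S.k j = false) : cross S hp o i j = ∅ := by
  refine eq_empty_of_forall_notMem ?_
  rintro q ⟨hq, ⟨τ, h3, h4⟩, τ', h1, h2⟩
  obtain ⟨hb, r1, r2⟩ := S.rangeB i hi
  have a3 : |τ| < 25 := abs_lt.2 ⟨r1.trans h3.1, h3.2.trans r2⟩
  obtain ⟨-, r1, r2⟩ := S.rangeB j hj
  have a4 : |τ'| < 25 := abs_lt.2 ⟨r1.trans h1.1, h1.2.trans r2⟩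
  simp only [par, hi, hj] at h2 h4
  rcases (mem_crossings_mod hp o q).1 hq with ⟨σ, hσ, h0, hpσ, ho, rfl⟩ |
      ⟨hb, hu, σ, hσ, hpσ, rfl⟩ | ⟨hb, hu, σ, hσ, hpσ, rfl⟩ | ⟨hO, -, -⟩
  · exact absurd h4.symm (B_ne_A hb a3 _ hσ)
  · exact absurd h4.symm (B_ne_A hb a3 _ hσ)
  · exact absurd h2.symm (B_ne_A hb a4 _ hσ)
  · exact absurd h4 (hO.2 hb _ a3)

variable (M) in
/-- Flat functions that agree outside the strands of `S` yield a replacement in a window whose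
strands are those of `S`, numbered by means of `e`. -/
lemma exists_replaces (S : Strands M.hasB D n) (e : Equiv.Perm (Fin n)) (hp : Flat M.hasB p)
    (hp' : Flat M.hasB p') (o : ℝˣ) (hf : S.Fits p) (hf' : S.Fits p') (h : S.Agree p p') :
    ∃ W : Window n, W.Replaces (M.mod p hp o) (M.mod p' hp' o) ∧
      (∀ i j, W.crossings (M.mod p hp o) i j = cross S hp o (e i) (e j)) ∧
      (∀ i j, W.crossings (M.mod p' hp' o) i j = cross S hp' o (e i) (e j)) ∧
      (∀ i t, t ∈ Ioo (W.a i) (W.b i) ↔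
        ∃ τ ∈ Ioo (S.α (e i)) (S.β (e i)), t = M.par (S.k (e i)) τ) ∧
      ∀ τ, |τ| < 5 → (∀ i, S.k i = true → τ ∉ Icc (S.α i) (S.β i)) →
        ∀ i, M.A τ ∉ Icc (W.a i) (W.b i) := by
  obtain ⟨W, h1, h2, h3⟩ := M.exists_window (S.reindex e)
  refine ⟨W, h1 p hp p' hp' o (hf.reindex e) (hf'.reindex e) (h.reindex e), fun i j => ?_,
    fun i j => ?_, h2, fun τ hτ h i => h3 τ hτ (fun i => h (e i)) i⟩ <;>
  · ext q
    simp only [Window.crossings, h2]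
    rfl

/-- A strand `A` that crosses itself once, at `±σ`, instead of never. -/
lemma kinked_mod (S : Strands M.hasB D 1) (hk : S.k 0 = true) (hp : Flat M.hasB p)
    (hp' : Flat M.hasB p') (o : ℝˣ) (hf : S.Fits p) (hf' : S.Fits p') (h : S.Agree p p')
    (h1 : ∀ τ ∈ Ioo (S.α 0) (S.β 0), -τ ∈ Ioo (S.α 0) (S.β 0) → 0 < τ → p τ ≠ p (-τ))
    {σ : ℝ} (h0 : 0 < σ) (hσ : σ ∈ Ioo (S.α 0) (S.β 0)) (hσ' : -σ ∈ Ioo (S.α 0) (S.β 0))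
    (h2 : ∀ τ ∈ Ioo (S.α 0) (S.β 0), -τ ∈ Ioo (S.α 0) (S.β 0) → 0 < τ →
      (p' τ = p' (-τ) ↔ τ = σ)) :
    KinkAt (SignType.sign (M.orient * (o * (deriv p' σ + deriv p' (-σ)))) : SignType)
      (M.mod p hp o) M.t₀ (M.mod p' hp' o) := by
  obtain ⟨W, hW, hc, hc', hI, -⟩ := M.exists_replaces S (Equiv.refl _) hp hp' o hf hf' h
  have a5 := abs_lt_of_mem S hk hσ
  have a0 : (0 : ℝ) ∈ Ioo (S.α 0) (S.β 0) := ⟨by linarith [hσ'.1], by linarith [hσ.2]⟩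
  refine ⟨W, (hI 0 _).2 ⟨0, a0, by simp [par, hk, A]⟩,
    hW, ?_, ?_⟩
  · rw [hc]
    refine eq_empty_of_forall_notMem fun q hq => ?_
    obtain ⟨τ, m1, m2, n0, hpτ, -⟩ := (mem_cross_AA S hp o hk hk q).1 hq
    rcases lt_or_gt_of_ne n0 with hn | hn
    · exact h1 (-τ) m2 (by rwa [neg_neg]) (by linarith) (by rw [neg_neg, hpτ])
    · exact h1 τ m1 m2 hn hpτ
  · have hself := (h2 σ hσ hσ' h0).2 rfl
    rw [hc']
    rcases lt_or_gt_of_ne o.ne_zero with ho | ho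
    · refine ⟨(M.A (-σ), M.A σ), ?_, ?_⟩
      · ext q
        refine (mem_cross_AA S hp' o hk hk q).trans ⟨?_, ?_⟩
        · rintro ⟨τ, m1, m2, n0, hpτ, hoτ, rfl⟩
          have hτ : τ < 0 := by by_contra hc; push Not at hc; nlinarith
          have := (h2 (-τ) m2 (by rwa [neg_neg]) (by linarith)).1 (by rw [neg_neg, hpτ])
          rw [← this, neg_neg]; rfl
        · rintro rfl
          exact ⟨-σ, hσ', by rwa [neg_neg], by linarith, by rw [neg_neg, hself], by nlinarith,
            by rw [neg_neg]⟩
      · have := crossingSign_self hp' o (τ := -σ) (by rwa [abs_neg]) (by rw [neg_neg, hself])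
          (by nlinarith)
        rw [neg_neg, add_comm (deriv p' _)] at this
        exact this
    · refine ⟨(M.A σ, M.A (-σ)), ?_, ?_⟩
      · ext q
        refine (mem_cross_AA S hp' o hk hk q).trans ⟨?_, ?_⟩
        · rintro ⟨τ, m1, m2, n0, hpτ, hoτ, rfl⟩
          have hτ : 0 < τ := by by_contra hc; push Not at hc; nlinarith
          rw [(h2 τ m1 m2 hτ).1 hpτ]; rfl
        · rintro rfl
          exact ⟨σ, hσ, hσ', by linarith, hself, by nlinarith, rfl⟩
      · exact crossingSign_self hp' o a5 hself (by nlinarith)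

/-- Two crossings at which the relevant derivatives have opposite signs can be listed as a positive
and a negative one. -/
lemma exists_signs {c : ℝ} (hc : c ≠ 0) {f : ℝ × ℝ → ℤ} {q q' : ℝ × ℝ} {d d' : ℝ} (hd : 0 < d)
    (hd' : d' < 0) (h : f q = (SignType.sign (c * d) : SignType))
    (h' : f q' = (SignType.sign (c * d') : SignType)) :
    ∃ r r', ({q, q'} : Set (ℝ × ℝ)) = {r, r'} ∧ f r = 1 ∧ f r' = -1 := by
  rcases lt_or_gt_of_ne hc with hc | hc
  · refine ⟨q', q, pair_comm _ _, ?_, ?_⟩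
    · rw [h', sign_pos (mul_pos_of_neg_of_neg hc hd')]; rfl
    · rw [h, sign_neg (mul_neg_of_neg_of_pos hc hd)]; rfl
  · refine ⟨q, q', rfl, ?_, ?_⟩
    · rw [h, sign_pos (mul_pos hc hd)]; rfl
    · rw [h', sign_neg (mul_neg_of_pos_of_neg hc hd')]; rfl

lemma orient_ne (M : LocalModel K) : M.orient ≠ 0 :=
  left_ne_zero_of_mul (M.orient_pos (0, 0) (by simp [_root_.mem_box])).ne'

/-- A strand `A` that crosses `B` at two more places than before. -/
lemma reidemeister2_AB (S : Strands M.hasB D 2) (hk : S.k 0 = true) (hk' : S.k 1 = false)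
    (hp : Flat M.hasB p) (hp' : Flat M.hasB p') (o : ℝˣ) (hf : S.Fits p) (hf' : S.Fits p')
    (h : S.Agree p p')
    (h1 : ∀ τ ∈ Ioo (S.α 0) (S.β 0), -τ ∈ Ioo (S.α 0) (S.β 0) → τ ≠ 0 →
      p τ ≠ p (-τ) ∧ p' τ ≠ p' (-τ))
    (h2 : ∀ τ ∈ Ioo (S.α 0) (S.β 0), p τ ≠ 0) {z z' : ℝ}
    (h3 : ∀ τ, τ ∈ Ioo (S.α 0) (S.β 0) ∧ -τ ^ 2 ∈ Ioo (S.α 1) (S.β 1) ∧ p' τ = 0 ↔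
      τ = z ∨ τ = z')
    (h4 : 0 < deriv p' z) (h5 : deriv p' z' < 0) :
    ∃ W : Window 2, W.Bigon (M.mod p hp o) (M.mod p' hp' o) ∧
      ∀ τ, |τ| < 5 → τ ∉ Icc (S.α 0) (S.β 0) → ∀ i, M.A τ ∉ Icc (W.a i) (W.b i) := by
  have hI : ∀ τ, τ ∉ Icc (S.α 0) (S.β 0) → ∀ i, S.k i = true → τ ∉ Icc (S.α i) (S.β i) := by
    intro τ h i hi
    fin_cases i
    exacts [h, absurd hi (by simp [hk'])]
  have hb := (S.rangeB 1 hk').1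
  obtain ⟨z1, z2, z3⟩ := (h3 z).2 (Or.inl rfl)
  obtain ⟨z1', z2', z3'⟩ := (h3 z').2 (Or.inr rfl)
  have hz := abs_lt_of_mem S hk z1
  have hz' := abs_lt_of_mem S hk z1'
  have hc : M.orient * M.lam * M.mu ≠ 0 := mul_ne_zero (mul_ne_zero M.orient_ne M.lam_ne) M.mu_ne
  have e00 : cross S hp o 0 0 = ∅ := eq_empty_of_forall_notMem fun q hq => by
    obtain ⟨τ, m1, m2, n0, hpτ, -⟩ := (mem_cross_AA S hp o hk hk q).1 hq
    exact (h1 τ m1 m2 n0).1 hpτ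
  have e00' : cross S hp' o 0 0 = ∅ := eq_empty_of_forall_notMem fun q hq => by
    obtain ⟨τ, m1, m2, n0, hpτ, -⟩ := (mem_cross_AA S hp' o hk hk q).1 hq
    exact (h1 τ m1 m2 n0).2 hpτ
  have e11 := cross_BB S hp o hk' hk'
  have e11' := cross_BB S hp' o hk' hk'
  have e01 : cross S hp o 0 1 = ∅ := eq_empty_of_forall_notMem fun q hq => by
    obtain ⟨-, τ, m1, m2, hpτ, -⟩ := (mem_cross_AB S hp o hk hk' q).1 hq
    exact h2 τ m1 hpτ
  have e10 : cross S hp o 1 0 = ∅ := eq_empty_of_forall_notMem fun q hq => by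
    obtain ⟨-, τ, m1, m2, hpτ, -⟩ := (mem_cross_BA S hp o hk hk' q).1 hq
    exact h2 τ m1 hpτ
  by_cases hu : M.t₀ ∈ K.upper
  · obtain ⟨W, hW, hc1, hc', -, hl⟩ := M.exists_replaces S (Equiv.refl _) hp hp' o hf hf' h
    have e10' : cross S hp' o 1 0 = ∅ := eq_empty_of_forall_notMem fun q hq =>
      ((mem_cross_BA S hp' o hk hk' q).1 hq).1 hu
    have e01' : cross S hp' o 0 1 = {(M.A z, M.B (-z ^ 2)), (M.A z', M.B (-z' ^ 2))} := by
      ext q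
      refine (mem_cross_AB S hp' o hk hk' q).trans ⟨?_, ?_⟩
      · rintro ⟨-, τ, m1, m2, m3, rfl⟩
        rcases (h3 τ).1 ⟨m1, m2, m3⟩ with rfl | rfl
        exacts [Or.inl rfl, Or.inr rfl]
      · rintro (rfl | rfl)
        exacts [⟨hu, z, z1, z2, z3, rfl⟩, ⟨hu, z', z1', z2', z3', rfl⟩]
    refine ⟨W, ⟨hW, ?_, ?_, ?_⟩, fun τ hτ h => hl τ hτ (hI τ h)⟩
    · intro i j
      rw [hc1]
      fin_cases i <;> fin_cases j
      exacts [e00, e01, e10, e11]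
    · intro i j hij
      rw [hc']
      fin_cases i <;> fin_cases j
      exacts [e00', absurd rfl hij, e10', e11']
    · obtain ⟨r, r', h6, h7, h8⟩ := exists_signs hc h4 h5 (crossingSign_AB hp' o hb hz z3)
        (crossingSign_AB hp' o hb hz' z3')
      exact ⟨r, r', by rw [hc', ← h6]; exact e01', h7, h8⟩
  · obtain ⟨W, hW, hc1, hc', -, hl⟩ := M.exists_replaces S (Equiv.swap 0 1) hp hp' o hf hf' h
    have e01' : cross S hp' o 0 1 = ∅ := eq_empty_of_forall_notMem fun q hq =>
      hu ((mem_cross_AB S hp' o hk hk' q).1 hq).1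
    have e10' : cross S hp' o 1 0 = {(M.B (-z ^ 2), M.A z), (M.B (-z' ^ 2), M.A z')} := by
      ext q
      refine (mem_cross_BA S hp' o hk hk' q).trans ⟨?_, ?_⟩
      · rintro ⟨-, τ, m1, m2, m3, rfl⟩
        rcases (h3 τ).1 ⟨m1, m2, m3⟩ with rfl | rfl
        exacts [Or.inl rfl, Or.inr rfl]
      · rintro (rfl | rfl)
        exacts [⟨hu, z, z1, z2, z3, rfl⟩, ⟨hu, z', z1', z2', z3', rfl⟩]
    refine ⟨W, ⟨hW, ?_, ?_, ?_⟩, fun τ hτ h => hl τ hτ (hI τ h)⟩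
    · intro i j
      rw [hc1]
      fin_cases i <;> fin_cases j
      exacts [e11, e10, e01, e00]
    · intro i j hij
      rw [hc']
      fin_cases i <;> fin_cases j
      exacts [e11', absurd rfl hij, e01', e00']
    · have s1 := crossingSign_BA hp' o hb hz z3
      have s2 := crossingSign_BA hp' o hb hz' z3'
      rw [← neg_mul] at s1 s2
      obtain ⟨r, r', h6, h7, h8⟩ := exists_signs (neg_ne_zero.2 hc) h4 h5 s1 s2
      exact ⟨r, r', by rw [hc', ← h6]; exact e10', h7, h8⟩

/-- The two halves of a strand `A` that cross each other at two more places than before. -/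
lemma reidemeister2_AA (S : Strands M.hasB D 2) (hk : S.k 0 = true) (hk' : S.k 1 = true)
    (hp : Flat M.hasB p) (hp' : Flat M.hasB p') (o : ℝˣ) (hf : S.Fits p) (hf' : S.Fits p')
    (h : S.Agree p p') (hpos : 0 ≤ S.α 0) (hneg : S.β 1 ≤ 0)
    (h1 : ∀ τ ∈ Ioo (S.α 0) (S.β 0), p τ ≠ p (-τ)) {z z' : ℝ}
    (h3 : ∀ τ, τ ∈ Ioo (S.α 0) (S.β 0) ∧ -τ ∈ Ioo (S.α 1) (S.β 1) ∧ p' τ = p' (-τ) ↔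
      τ = z ∨ τ = z')
    (h4 : 0 < deriv p' z + deriv p' (-z)) (h5 : deriv p' z' + deriv p' (-z') < 0) :
    Reidemeister2 (M.mod p hp o) (M.mod p' hp' o) := by
  obtain ⟨z1, z2, z3⟩ := (h3 z).2 (Or.inl rfl)
  obtain ⟨z1', z2', z3'⟩ := (h3 z').2 (Or.inr rfl)
  have hz := abs_lt_of_mem S hk z1
  have hz' := abs_lt_of_mem S hk z1'
  have hc : M.orient * o ≠ 0 := mul_ne_zero M.orient_ne o.ne_zero
  have m0 : ∀ {τ}, τ ∈ Ioo (S.α 0) (S.β 0) → 0 < τ := fun hτ => hpos.trans_lt hτ.1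
  have m1 : ∀ {τ}, τ ∈ Ioo (S.α 1) (S.β 1) → τ < 0 := fun hτ => hτ.2.trans_le hneg
  have hempty : ∀ {p} (hp : Flat M.hasB p) (i : Fin 2), cross S hp o i i = ∅ := fun hp i =>
    eq_empty_of_forall_notMem fun q hq => by
      fin_cases i
      · obtain ⟨τ, n1, n2, -⟩ := (mem_cross_AA S hp o hk hk q).1 hq
        linarith [m0 n1, m0 n2]
      · obtain ⟨τ, n1, n2, -⟩ := (mem_cross_AA S hp o hk' hk' q).1 hq
        linarith [m1 n1, m1 n2]
  have e01 : cross S hp o 0 1 = ∅ := eq_empty_of_forall_notMem fun q hq => by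
    obtain ⟨τ, n1, n2, -, n3, -⟩ := (mem_cross_AA S hp o hk hk' q).1 hq
    exact h1 τ n1 n3
  have e10 : cross S hp o 1 0 = ∅ := eq_empty_of_forall_notMem fun q hq => by
    obtain ⟨τ, n1, n2, -, n3, -⟩ := (mem_cross_AA S hp o hk' hk q).1 hq
    exact h1 (-τ) n2 (by rw [neg_neg, n3])
  rcases lt_or_gt_of_ne o.ne_zero with ho | ho
  · obtain ⟨W, hW, hc1, hc', -⟩ := M.exists_replaces S (Equiv.swap 0 1) hp hp' o hf hf' h
    have e01' : cross S hp' o 0 1 = ∅ := eq_empty_of_forall_notMem fun q hq => by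
      obtain ⟨τ, n1, n2, -, n3, n4, -⟩ := (mem_cross_AA S hp' o hk hk' q).1 hq
      nlinarith [m0 n1]
    have e10' : cross S hp' o 1 0 = {(M.A (-z), M.A z), (M.A (-z'), M.A z')} := by
      ext q
      refine (mem_cross_AA S hp' o hk' hk q).trans ⟨?_, ?_⟩
      · rintro ⟨τ, n1, n2, -, n3, -, rfl⟩
        rcases (h3 (-τ)).1 ⟨n2, by rwa [neg_neg], by rw [neg_neg, n3]⟩ with h | h
        · left; rw [← h, neg_neg]
        · right; rw [← h, neg_neg]; rfl
      · rintro (rfl | rfl)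
        · exact ⟨-z, z2, by rwa [neg_neg], by linarith [m0 z1], by rw [neg_neg, z3],
            by nlinarith [m0 z1], by rw [neg_neg]⟩
        · exact ⟨-z', z2', by rwa [neg_neg], by linarith [m0 z1'], by rw [neg_neg, z3'],
            by nlinarith [m0 z1'], by rw [neg_neg]⟩
    refine ⟨W, hW, ?_, ?_, ?_⟩
    · intro i j
      rw [hc1]
      fin_cases i <;> fin_cases j
      exacts [hempty hp 1, e10, e01, hempty hp 0]
    · intro i j hij
      rw [hc']
      fin_cases i <;> fin_cases j
      exacts [hempty hp' 1, absurd rfl hij, e01', hempty hp' 0]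
    · have s1 := crossingSign_self hp' o (τ := -z) (by rwa [abs_neg]) (by rw [neg_neg, z3])
        (by nlinarith [m0 z1])
      have s2 := crossingSign_self hp' o (τ := -z') (by rwa [abs_neg]) (by rw [neg_neg, z3'])
        (by nlinarith [m0 z1'])
      rw [neg_neg, add_comm (deriv p' _), ← mul_assoc] at s1 s2
      obtain ⟨r, r', h6, h7, h8⟩ := exists_signs hc h4 h5 s1 s2
      exact ⟨r, r', by rw [hc', ← h6]; exact e10', h7, h8⟩
  · obtain ⟨W, hW, hc1, hc', -⟩ := M.exists_replaces S (Equiv.refl _) hp hp' o hf hf' h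
    have e10' : cross S hp' o 1 0 = ∅ := eq_empty_of_forall_notMem fun q hq => by
      obtain ⟨τ, n1, n2, -, n3, n4, -⟩ := (mem_cross_AA S hp' o hk' hk q).1 hq
      nlinarith [m1 n1]
    have e01' : cross S hp' o 0 1 = {(M.A z, M.A (-z)), (M.A z', M.A (-z'))} := by
      ext q
      refine (mem_cross_AA S hp' o hk hk' q).trans ⟨?_, ?_⟩
      · rintro ⟨τ, n1, n2, -, n3, -, rfl⟩
        rcases (h3 τ).1 ⟨n1, n2, n3⟩ with rfl | rfl
        exacts [Or.inl rfl, Or.inr rfl]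
      · rintro (rfl | rfl)
        · exact ⟨z, z1, z2, (m0 z1).ne', z3, by nlinarith [m0 z1], rfl⟩
        · exact ⟨z', z1', z2', (m0 z1').ne', z3', by nlinarith [m0 z1'], rfl⟩
    refine ⟨W, hW, ?_, ?_, ?_⟩
    · intro i j
      rw [hc1]
      fin_cases i <;> fin_cases j
      exacts [hempty hp 0, e01, e10, hempty hp 1]
    · intro i j hij
      rw [hc']
      fin_cases i <;> fin_cases j
      exacts [hempty hp' 0, absurd rfl hij, e10', hempty hp' 1]
    · have s1 := crossingSign_self hp' o hz z3 (by nlinarith [m0 z1])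
      have s2 := crossingSign_self hp' o hz' z3' (by nlinarith [m0 z1'])
      rw [← mul_assoc] at s1 s2
      obtain ⟨r, r', h6, h7, h8⟩ := exists_signs hc h4 h5 s1 s2
      exact ⟨r, r', by rw [hc', ← h6]; exact e01', h7, h8⟩

/-- The two halves of the strand `A` and the strand `B` form a triangle. -/
structure Triangle (S : Strands M.hasB D 3) (p : ℝ → ℝ) where
  σ : ℝ
  self : ∀ τ, τ ∈ Ioo (S.α 0) (S.β 0) ∧ -τ ∈ Ioo (S.α 1) (S.β 1) ∧ p τ = p (-τ) ↔ τ = σ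
  self_pos : 0 < deriv p σ + deriv p (-σ)
  z : Fin 3 → ℝ
  zero : ∀ i : Fin 3, i ≠ 2 → ∀ τ, τ ∈ Ioo (S.α i) (S.β i) ∧ -τ ^ 2 ∈ Ioo (S.α 2) (S.β 2) ∧
    p τ = 0 ↔ τ = z i
  zero_pos : ∀ i : Fin 3, i ≠ 2 → 0 < deriv p (z i)

/-- A triangle is replaced by another one. Which of the three strands is on top, and which at the
bottom, depends on the sign of `o` and on whether `A` passes over `B`. -/
lemma reidemeister3_mod (S : Strands M.hasB D 3) (hk : ∀ i, i ≠ 2 → S.k i = true)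
    (hk' : S.k 2 = false)
    (hp : Flat M.hasB p) (hp' : Flat M.hasB p') (o : ℝˣ) (hf : S.Fits p) (hf' : S.Fits p')
    (h : S.Agree p p') (hpos : 0 ≤ S.α 0) (hneg : S.β 1 ≤ 0)
    (T : Triangle S p) (T' : Triangle S p') :
    Reidemeister3 (M.mod p hp o) (M.mod p' hp' o) := by
  have hb := (S.rangeB 2 hk').1
  have m0 : ∀ {τ}, τ ∈ Ioo (S.α 0) (S.β 0) → 0 < τ := fun hτ => hpos.trans_lt hτ.1
  have m1 : ∀ {τ}, τ ∈ Ioo (S.α 1) (S.β 1) → τ < 0 := fun hτ => hτ.2.trans_le hneg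
  have k0 := hk 0 (by decide)
  have k1 := hk 1 (by decide)
  have hempty : ∀ {p} (hp : Flat M.hasB p) (i : Fin 3), cross S hp o i i = ∅ := fun hp i =>
    eq_empty_of_forall_notMem fun q hq => by
      fin_cases i
      · obtain ⟨τ, n1, n2, -⟩ := (mem_cross_AA S hp o k0 k0 q).1 hq
        linarith [m0 n1, m0 n2]
      · obtain ⟨τ, n1, n2, -⟩ := (mem_cross_AA S hp o k1 k1 q).1 hq
        linarith [m1 n1, m1 n2]
      · exact (cross_BB S hp o hk' hk').le hq
  -- the crossing of the two halves of `A`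
  have c01 : ∀ {p} (hp : Flat M.hasB p) (T : Triangle S p), 0 < (o : ℝ) →
      cross S hp o 1 0 = ∅ ∧ ∃ q, cross S hp o 0 1 = {q} ∧
        (M.mod p hp o).crossingSign q = (SignType.sign (M.orient * o) : SignType) := by
    intro p hp T ho
    obtain ⟨z1, z2, z3⟩ := (T.self T.σ).2 rfl
    refine ⟨eq_empty_of_forall_notMem fun q hq => ?_, (M.A T.σ, M.A (-T.σ)), ?_, ?_⟩
    · obtain ⟨τ, n1, n2, -, n3, n4, -⟩ := (mem_cross_AA S hp o k1 k0 q).1 hq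
      nlinarith [m1 n1]
    · ext q
      refine (mem_cross_AA S hp o k0 k1 q).trans ⟨?_, ?_⟩
      · rintro ⟨τ, n1, n2, -, n3, -, rfl⟩
        rw [(T.self τ).1 ⟨n1, n2, n3⟩]; rfl
      · rintro rfl
        exact ⟨T.σ, z1, z2, (m0 z1).ne', z3, by nlinarith [m0 z1], rfl⟩
    · rw [crossingSign_self hp o (abs_lt_of_mem S k0 z1) z3 (by nlinarith [m0 z1]), ← mul_assoc,
        sign_mul _ (deriv p _ + _), sign_pos T.self_pos, mul_one]
  -- the same for `o < 0`, where the other half is over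
  have c10 : ∀ {p} (hp : Flat M.hasB p) (T : Triangle S p), (o : ℝ) < 0 →
      cross S hp o 0 1 = ∅ ∧ ∃ q, cross S hp o 1 0 = {q} ∧
        (M.mod p hp o).crossingSign q = (SignType.sign (M.orient * o) : SignType) := by
    intro p hp T ho
    obtain ⟨z1, z2, z3⟩ := (T.self T.σ).2 rfl
    refine ⟨eq_empty_of_forall_notMem fun q hq => ?_, (M.A (-T.σ), M.A T.σ), ?_, ?_⟩
    · obtain ⟨τ, n1, n2, -, n3, n4, -⟩ := (mem_cross_AA S hp o k0 k1 q).1 hq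
      nlinarith [m0 n1]
    · ext q
      refine (mem_cross_AA S hp o k1 k0 q).trans ⟨?_, ?_⟩
      · rintro ⟨τ, n1, n2, -, n3, -, rfl⟩
        rw [← (T.self (-τ)).1 ⟨n2, by rwa [neg_neg], by rw [neg_neg, n3]⟩, neg_neg]; rfl
      · rintro rfl
        exact ⟨-T.σ, z2, by rwa [neg_neg], by linarith [m0 z1], by rw [neg_neg, z3],
          by nlinarith [m0 z1], by rw [neg_neg]⟩
    · have := crossingSign_self hp o (τ := -T.σ) (by rw [abs_neg]; exact abs_lt_of_mem S k0 z1)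
        (by rw [neg_neg, z3]) (by nlinarith [m0 z1])
      rw [neg_neg] at this
      rw [this, ← mul_assoc, sign_mul _ (deriv p _ + _), add_comm (deriv p _),
        sign_pos T.self_pos, mul_one]
  -- the crossings of the halves of `A` with `B`
  have cA : ∀ {p} (hp : Flat M.hasB p) (T : Triangle S p) (i : Fin 3), i ≠ 2 → M.t₀ ∈ K.upper →
      cross S hp o 2 i = ∅ ∧ ∃ q, cross S hp o i 2 = {q} ∧ (M.mod p hp o).crossingSign q =
        (SignType.sign (M.orient * M.lam * M.mu) : SignType) := by
    intro p hp T i hi hu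
    obtain ⟨z1, z2, z3⟩ := (T.zero i hi _).2 rfl
    refine ⟨eq_empty_of_forall_notMem fun q hq => ((mem_cross_BA S hp o (hk i hi) hk' q).1 hq).1 hu,
      (M.A (T.z i), M.B (-(T.z i) ^ 2)), ?_, ?_⟩
    · ext q
      refine (mem_cross_AB S hp o (hk i hi) hk' q).trans ⟨?_, ?_⟩
      · rintro ⟨-, τ, n1, n2, n3, rfl⟩
        rw [(T.zero i hi τ).1 ⟨n1, n2, n3⟩]; rfl
      · rintro rfl
        exact ⟨hu, _, z1, z2, z3, rfl⟩
    · rw [crossingSign_AB hp o hb (abs_lt_of_mem S (hk i hi) z1) z3, sign_mul,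
        sign_pos (T.zero_pos i hi), mul_one]
  have cB : ∀ {p} (hp : Flat M.hasB p) (T : Triangle S p) (i : Fin 3), i ≠ 2 → M.t₀ ∉ K.upper →
      cross S hp o i 2 = ∅ ∧ ∃ q, cross S hp o 2 i = {q} ∧ (M.mod p hp o).crossingSign q =
        (SignType.sign (-(M.orient * M.lam * M.mu)) : SignType) := by
    intro p hp T i hi hu
    obtain ⟨z1, z2, z3⟩ := (T.zero i hi _).2 rfl
    refine ⟨eq_empty_of_forall_notMem fun q hq => hu ((mem_cross_AB S hp o (hk i hi) hk' q).1 hq).1,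
      (M.B (-(T.z i) ^ 2), M.A (T.z i)), ?_, ?_⟩
    · ext q
      refine (mem_cross_BA S hp o (hk i hi) hk' q).trans ⟨?_, ?_⟩
      · rintro ⟨-, τ, n1, n2, n3, rfl⟩
        rw [(T.zero i hi τ).1 ⟨n1, n2, n3⟩]; rfl
      · rintro rfl
        exact ⟨hu, _, z1, z2, z3, rfl⟩
    · rw [crossingSign_BA hp o hb (abs_lt_of_mem S (hk i hi) z1) z3, ← neg_mul, sign_mul,
        sign_pos (T.zero_pos i hi), mul_one]
  -- it remains to list the strands from top to bottom
  have key : ∀ e : Equiv.Perm (Fin 3), (∀ {p} (hp : Flat M.hasB p), Triangle S p →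
      ∀ i j, i < j → cross S hp o (e j) (e i) = ∅) →
      (∀ i j, i < j → ∃ s : ℤ, ∀ {p} (hp : Flat M.hasB p), Triangle S p →
        ∃ q, cross S hp o (e i) (e j) = {q} ∧ (M.mod p hp o).crossingSign q = s) →
      Reidemeister3 (M.mod p hp o) (M.mod p' hp' o) := by
    intro e he1 he2
    obtain ⟨W, hW, hc, hc', -⟩ := M.exists_replaces S e hp hp' o hf hf' h
    refine ⟨W, hW, fun i j hij => ?_, fun i j hij => ?_⟩
    · rw [hc, hc']
      rcases hij.eq_or_lt with rfl | hij
      · exact ⟨hempty hp _, hempty hp' _⟩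
      · exact ⟨he1 hp T j i hij, he1 hp' T' j i hij⟩
    · obtain ⟨s, hs⟩ := he2 i j hij
      obtain ⟨q, h1, h2⟩ := hs hp T
      obtain ⟨q', h1', h2'⟩ := hs hp' T'
      exact ⟨q, q', by rw [hc, h1], by rw [hc', h1'], h2.trans h2'.symm⟩
  have n0 : (0 : Fin 3) ≠ 2 := by decide
  have n1 : (1 : Fin 3) ≠ 2 := by decide
  rcases lt_or_gt_of_ne o.ne_zero with ho | ho <;> by_cases hu : M.t₀ ∈ K.upper
  · refine key ⟨![1, 0, 2], ![1, 0, 2], by decide, by decide⟩ (fun hp T i j hij => ?_)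
      fun i j hij => ?_
    · fin_cases i <;> fin_cases j <;> first | exact absurd hij (by decide) | skip
      exacts [(c10 hp T ho).1, (cA hp T 1 n1 hu).1, (cA hp T 0 n0 hu).1]
    · fin_cases i <;> fin_cases j <;> first | exact absurd hij (by decide) | skip
      exacts [⟨_, fun hp T => (c10 hp T ho).2⟩, ⟨_, fun hp T => (cA hp T 1 n1 hu).2⟩,
        ⟨_, fun hp T => (cA hp T 0 n0 hu).2⟩]
  · refine key ⟨![2, 1, 0], ![2, 1, 0], by decide, by decide⟩ (fun hp T i j hij => ?_)
      fun i j hij => ?_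
    · fin_cases i <;> fin_cases j <;> first | exact absurd hij (by decide) | skip
      exacts [(cB hp T 1 n1 hu).1, (cB hp T 0 n0 hu).1, (c10 hp T ho).1]
    · fin_cases i <;> fin_cases j <;> first | exact absurd hij (by decide) | skip
      exacts [⟨_, fun hp T => (cB hp T 1 n1 hu).2⟩, ⟨_, fun hp T => (cB hp T 0 n0 hu).2⟩,
        ⟨_, fun hp T => (c10 hp T ho).2⟩]
  · refine key (Equiv.refl _) (fun hp T i j hij => ?_) fun i j hij => ?_
    · fin_cases i <;> fin_cases j <;> first | exact absurd hij (by decide) | skip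
      exacts [(c01 hp T ho).1, (cA hp T 0 n0 hu).1, (cA hp T 1 n1 hu).1]
    · fin_cases i <;> fin_cases j <;> first | exact absurd hij (by decide) | skip
      exacts [⟨_, fun hp T => (c01 hp T ho).2⟩, ⟨_, fun hp T => (cA hp T 0 n0 hu).2⟩,
        ⟨_, fun hp T => (cA hp T 1 n1 hu).2⟩]
  · refine key ⟨![2, 0, 1], ![1, 2, 0], by decide, by decide⟩ (fun hp T i j hij => ?_)
      fun i j hij => ?_
    · fin_cases i <;> fin_cases j <;> first | exact absurd hij (by decide) | skip
      exacts [(cB hp T 0 n0 hu).1, (cB hp T 1 n1 hu).1, (c01 hp T ho).1]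
    · fin_cases i <;> fin_cases j <;> first | exact absurd hij (by decide) | skip
      exacts [⟨_, fun hp T => (cB hp T 0 n0 hu).2⟩, ⟨_, fun hp T => (cB hp T 1 n1 hu).2⟩,
        ⟨_, fun hp T => (c01 hp T ho).2⟩]

/-- The flat function `5τ` gives back the diagram. -/
lemma same_mod_base (hp : Flat M.hasB p) (h : ∀ τ, p τ = 5 * τ) (o : ℝˣ) :
    K.Same (M.mod p hp o) := by
  have hc : ∀ t, M.modCurve p t = K.curve t := fun t => by
    by_cases h1 : |M.invA t| < 5
    · have h2 := modCurve_A hp h1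
      have h3 := M.A_curve _ h1
      rw [M.A_invA, h] at h2
      rw [h2, ← h3]
      exact congrArg K.curve (M.A_invA t)
    · exact modCurve_of_le hp (by linarith)
  have z5 : |(0 : ℝ)| < 5 := by simp
  have z25 : |(0 : ℝ)| < 25 := by simp
  have A0 : M.A 0 = M.t₀ := by simp [A]
  have hself : ∀ τ, ¬ (τ ≠ 0 ∧ p τ = p (-τ)) := fun τ ⟨h0, h1⟩ => by
    rw [h, h] at h1; exact h0 (by linarith)
  refine ⟨fun t _ => hc t, ?_⟩
  rintro t ⟨ht, s, hs, hne, hst⟩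
  show t ∈ M.modUpper p o ↔ _
  rcases modCurve_coincidence hp ht hs hne.symm hst.symm with ⟨τ, -, h0, hpτ, -, -⟩ |
    ⟨hb, τ, hτ, hpτ, rfl, rfl⟩ | ⟨hb, τ, hτ, hpτ, rfl, rfl⟩ | ⟨ho, -, -⟩
  · exact absurd ⟨h0, hpτ⟩ (hself τ)
  · have : τ = 0 := by rw [h] at hpτ; linarith
    subst this
    rw [A_mem_modUpper o hτ, A0]
    have := hself 0
    tauto
  · have : τ = 0 := by rw [h] at hpτ; linarith
    subst this
    have hK : K.curve (M.B (-0 ^ 2)) = K.curve (M.A 0) := by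
      rw [← hc, ← hc]; exact hst.symm
    rw [B_mem_modUpper o hb (sq_lt_25 hτ), K.upper_iff _ ht _ hs hne.symm hK, A0]
  · exact ho.mem_modUpper o

end LocalModel

/-! ### Flat functions -/

/-- A smooth increasing function that is `0` up to `a` and `1` from `b` on. -/
noncomputable def step (a b t : ℝ) : ℝ := Real.smoothTransition ((t - a) / (b - a))

section step

variable {a b t : ℝ}

lemma step_of_le (h : a < b) (ht : t ≤ a) : step a b t = 0 :=
  Real.smoothTransition.zero_of_nonpos (div_nonpos_of_nonpos_of_nonneg (by linarith) (by linarith))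

lemma step_of_ge (h : a < b) (ht : b ≤ t) : step a b t = 1 :=
  Real.smoothTransition.one_of_one_le ((one_le_div (by linarith)).2 (by linarith))

lemma step_nonneg (a b t : ℝ) : 0 ≤ step a b t := Real.smoothTransition.nonneg _

lemma step_le_one (a b t : ℝ) : step a b t ≤ 1 := Real.smoothTransition.le_one _

lemma contDiff_step (a b : ℝ) : ContDiff ℝ ∞ (step a b) :=
  Real.smoothTransition.contDiff.comp (by fun_prop)

lemma monotone_step (h : a < b) : Monotone (step a b) := fun s t hst =>
  Real.smoothTransition.monotone (by have := sub_pos.2 h; gcongr)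

lemma deriv_step_nonneg (h : a < b) (t : ℝ) : 0 ≤ deriv (step a b) t := (monotone_step h).deriv_nonneg

end step

lemma Flat.reflect {b : Prop} {p : ℝ → ℝ} (h : Flat b p) : Flat b fun t => -p (-t) := by
  have hd : ∀ t, deriv (fun t => -p (-t)) t = deriv p (-t) := fun t => by
    rw [deriv.fun_neg, deriv_comp_neg, neg_neg]
  have hs := h.smooth
  refine ⟨by fun_prop, fun τ hτ => ?_, fun τ hτ => ?_, ?_, fun τ hτ h1 => ?_, fun hb τ h1 => ?_,
    fun hb τ h0 h1 => ?_⟩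
  · rw [h.base _ (by rwa [abs_neg])]; ring
  · rw [abs_neg]; exact h.bound _ (by rwa [abs_neg])
  · rw [hd, neg_zero]; exact h.apex
  · rw [hd, hd, add_comm, neg_neg]
    rw [neg_neg, neg_inj] at h1
    exact h.self τ hτ h1.symm
  · rw [hd]; exact h.zero hb _ (neg_eq_zero.1 h1)
  · rw [neg_neg, neg_inj] at h1
    exact neg_ne_zero.2 (h.triple hb _ (neg_ne_zero.2 h0) (by rw [neg_neg, h1]))

/-- A smooth increasing function that is the identity on `(-∞, -1/8]` and negative on
`(-∞, 10)`. -/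
noncomputable def squeeze (X : ℝ) : ℝ :=
  (1 - step (-1/8) (-1/16) X) * X + step (-1/8) (-1/16) X * ((X - 10) / 200)

lemma squeeze_of_le {X : ℝ} (h : X ≤ -1/8) : squeeze X = X := by
  rw [squeeze, step_of_le (by norm_num) h]; ring

lemma squeeze_of_ge {X : ℝ} (h : -1/16 ≤ X) : squeeze X = (X - 10) / 200 := by
  rw [squeeze, step_of_ge (by norm_num) h]; ring

lemma contDiff_squeeze : ContDiff ℝ ∞ squeeze := by
  have := contDiff_step (-1/8) (-1/16)
  unfold squeeze
  fun_prop

lemma deriv_squeeze_pos (X : ℝ) : 0 < deriv squeeze X := by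
  have h1 : HasDerivAt (step (-1/8) (-1/16)) (deriv (step (-1/8) (-1/16)) X) X :=
    ((contDiff_step _ _).differentiable (by simp) X).hasDerivAt
  have h2 := ((h1.const_sub 1).mul (hasDerivAt_id X)).add
    (h1.mul (((hasDerivAt_id X).sub_const 10).div_const 200))
  have h3 : HasDerivAt squeeze _ X := h2
  rw [h3.deriv]
  simp only [id]
  have n0 := step_nonneg (-1/8) (-1/16) X
  have n1 := step_le_one (-1/8) (-1/16) X
  have nd := deriv_step_nonneg (by norm_num : (-1/8 : ℝ) < -1/16) X
  rcases le_or_gt X (-1/16) with h | h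
  · nlinarith [mul_nonneg nd (by linarith : 0 ≤ (X - 10) / 200 - X)]
  · have : deriv (step (-1/8) (-1/16)) X = 0 := by
      have : step (-1/8) (-1/16) =ᶠ[𝓝 X] fun _ => 1 := by
        filter_upwards [lt_mem_nhds h] with Y hY
        exact step_of_ge (by norm_num) hY.le
      rw [this.deriv_eq, deriv_const]
    rw [this, step_of_ge (by norm_num) h.le]
    norm_num

lemma strictMono_squeeze : StrictMono squeeze := strictMono_of_deriv_pos deriv_squeeze_pos

lemma squeeze_neg {X : ℝ} (h : X < 10) : squeeze X < 0 := by
  have := strictMono_squeeze h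
  rwa [squeeze_of_ge (X := 10) (by norm_num), sub_self, zero_div] at this

/-- The strand of `p` pushed to the left of the vertical axis, for parameters below `1`. -/
noncomputable def left (p : ℝ → ℝ) (t : ℝ) : ℝ := if t < 1 then squeeze (p t) else p t

section left

variable {b : Prop} {p : ℝ → ℝ}

lemma left_of_lt {t : ℝ} (h : t < 1) : left p t = squeeze (p t) := if_pos h

lemma left_of_ge {t : ℝ} (h : 1 ≤ t) : left p t = p t := if_neg (not_lt.2 h)

lemma left_of_le {t : ℝ} (h : p t ≤ -1/8) : left p t = p t := by
  unfold left
  split_ifs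
  exacts [squeeze_of_le h, rfl]

lemma left_eventuallyEq_squeeze {t : ℝ} (h : t < 1) : left p =ᶠ[𝓝 t] fun t => squeeze (p t) := by
  filter_upwards [gt_mem_nhds h] with u hu
  exact left_of_lt hu

lemma left_eventuallyEq (hp : Continuous p) {t : ℝ} (h : p t < -1/8 ∨ 1 < t) :
    left p =ᶠ[𝓝 t] p := by
  rcases h with h | h
  · filter_upwards [hp.continuousAt.eventually_lt_const h] with u hu
    exact left_of_le hu.le
  · filter_upwards [lt_mem_nhds h] with u hu
    exact left_of_ge hu.le

lemma left_neg (h2 : ∀ t < 1, p t < 10) {t : ℝ} (h : t < 1) : left p t < 0 := by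
  rw [left_of_lt h]; exact squeeze_neg (h2 t h)

lemma left_self_iff (h3 : ∀ t ≤ -1, p t < -1/8) {t : ℝ} (ht : 0 < t) :
    left p t = left p (-t) ↔ p t = p (-t) := by
  rw [left_of_lt (by linarith : -t < 1)]
  rcases lt_or_ge t 1 with h | h
  · rw [left_of_lt h]; exact strictMono_squeeze.injective.eq_iff
  · rw [left_of_ge h, squeeze_of_le (h3 _ (by linarith)).le]

lemma Flat.left (hp : Flat b p) (h1 : p 1 < -1/8) (h2 : ∀ t < 1, p t < 10)
    (h3 : ∀ t ≤ -1, p t < -1/8) : Flat b (left p) := by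
  have hc := hp.smooth.continuous
  have hE : ∀ t, 1 ≤ t → _root_.left p =ᶠ[𝓝 t] p := fun t ht => by
    rcases ht.eq_or_lt with rfl | h
    exacts [left_eventuallyEq hc (Or.inl h1), left_eventuallyEq hc (Or.inr h)]
  have hd : ∀ t < 1, deriv (_root_.left p) t = deriv squeeze (p t) * deriv p t := fun t ht => by
    rw [(left_eventuallyEq_squeeze ht).deriv_eq]
    exact deriv_comp (h₂ := squeeze) t (contDiff_squeeze.differentiable (by simp) _)
      (hp.smooth.differentiable (by simp) _)
  refine ⟨?_, fun τ hτ => ?_, fun τ hτ => ?_, ?_, fun τ hτ h => ?_, fun hb τ h => ?_,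
    fun hb τ h0 h h' => ?_⟩
  · rw [contDiff_iff_contDiffAt]
    intro t
    rcases lt_or_ge t 1 with h | h
    · exact (contDiff_squeeze.comp hp.smooth).contDiffAt.congr_of_eventuallyEq
        (left_eventuallyEq_squeeze h)
    · exact hp.smooth.contDiffAt.congr_of_eventuallyEq (hE t h)
  · rw [← hp.base τ hτ]
    rcases le_abs.1 hτ with h | h
    · exact left_of_ge (by linarith)
    · exact left_of_le (h3 _ (by linarith)).le
  · rcases lt_or_ge τ 1 with h | h
    · have h4 := left_neg h2 h
      have h5 := abs_lt.1 (hp.bound τ hτ)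
      rcases le_or_gt (p τ) (-1/8) with h6 | h6
      · rw [left_of_le h6]; exact hp.bound τ hτ
      · have h7 := strictMono_squeeze h6
        rw [squeeze_of_le (X := -1/8) le_rfl, ← left_of_lt h] at h7
        exact abs_lt.2 ⟨by linarith, by linarith⟩
    · rw [left_of_ge h]; exact hp.bound τ hτ
  · rw [hd 0 one_pos]; exact mul_ne_zero (deriv_squeeze_pos _).ne' hp.apex
  · have h4 := (left_self_iff h3 hτ).1 h
    have h5 := hp.self τ hτ h4
    rcases lt_or_ge τ 1 with h6 | h6
    · rw [hd τ h6, hd (-τ) (by linarith), ← h4, ← mul_add]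
      exact mul_ne_zero (deriv_squeeze_pos _).ne' h5
    · rw [(hE τ h6).deriv_eq,
        (left_eventuallyEq hc (Or.inl (h3 (-τ) (by linarith)))).deriv_eq]
      exact h5
  · rcases lt_or_ge τ 1 with h6 | h6
    · exact absurd h (left_neg h2 h6).ne
    · rw [(hE τ h6).deriv_eq]
      rw [left_of_ge h6] at h
      exact hp.zero hb τ h
  · rcases lt_or_ge τ 1 with h6 | h6
    · exact absurd h' (left_neg h2 h6).ne
    · rw [h] at h'
      exact absurd h' (left_neg h2 (by linarith : -τ < 1)).ne

end left

/-- The factor of `kink`. -/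
noncomputable def kinkFactor (t : ℝ) : ℝ :=
  (1 - step (169/100) (49/25) (t ^ 2)) * (4 * t ^ 2 - step (9/100) (4/25) (t ^ 2) * t - 4) +
    step (169/100) (49/25) (t ^ 2) * 5

/-- A strand with a kink whose loop is crossed by the vertical axis, its double point lying on the
left of that axis. It crosses the axis at `0` and at the roots of `4t² - t - 4`, and itself at
`±1`. -/
noncomputable def kink (t : ℝ) : ℝ := t * kinkFactor t

section kink

lemma contDiff_kinkFactor : ContDiff ℝ ∞ kinkFactor := by
  have h1 := (contDiff_step (169/100) (49/25)).comp (contDiff_id.pow 2 : ContDiff ℝ ∞ fun t : ℝ => t ^ 2)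
  have h2 := (contDiff_step (9/100) (4/25)).comp (contDiff_id.pow 2 : ContDiff ℝ ∞ fun t : ℝ => t ^ 2)
  simp only [Function.comp_def] at h1 h2
  unfold kinkFactor
  fun_prop

lemma contDiff_kink : ContDiff ℝ ∞ kink := contDiff_id.mul contDiff_kinkFactor

lemma kinkFactor_small {t : ℝ} (h : t ^ 2 ≤ 9/100) : kinkFactor t = 4 * t ^ 2 - 4 := by
  rw [kinkFactor, step_of_le (by norm_num) h, step_of_le (by norm_num) (by linarith)]; ring

lemma kinkFactor_mid {t : ℝ} (h : 4/25 ≤ t ^ 2) (h' : t ^ 2 ≤ 169/100) :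
    kinkFactor t = 4 * t ^ 2 - t - 4 := by
  rw [kinkFactor, step_of_ge (by norm_num) h, step_of_le (by norm_num) h']; ring

lemma kinkFactor_big {t : ℝ} (h : 49/25 ≤ t ^ 2) : kinkFactor t = 5 := by
  rw [kinkFactor, step_of_ge (by norm_num) h]; ring

lemma kinkFactor_neg {t : ℝ} (h : t ^ 2 ≤ 4/25) : kinkFactor t < 0 := by
  have n0 := step_nonneg (9/100) (4/25) (t ^ 2)
  have n1 := step_le_one (9/100) (4/25) (t ^ 2)
  rw [kinkFactor, step_of_le (a := 169/100) (by norm_num) (by linarith)]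
  have h2 : -1 ≤ t := by nlinarith
  nlinarith [mul_nonneg n0 (by linarith : 0 ≤ t + 1)]

lemma kinkFactor_pos {t : ℝ} (h : 169/100 ≤ t ^ 2) : 0 < kinkFactor t := by
  rw [kinkFactor, step_of_ge (a := 9/100) (by norm_num) (by linarith)]
  have n0 := step_nonneg (169/100) (49/25) (t ^ 2)
  have n1 := step_le_one (169/100) (49/25) (t ^ 2)
  have h2 : 0 < 4 * t ^ 2 - 1 * t - 4 := by nlinarith [sq_nonneg (t - 13/10)]
  rcases n1.eq_or_lt with h3 | h3
  · rw [h3]; norm_num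
  · have := mul_pos (by linarith : 0 < 1 - step (169/100) (49/25) (t ^ 2)) h2
    linarith

/-- The positive root of `4t² - t - 4`. -/
noncomputable def root : ℝ := (1 + √65) / 8

lemma root_mem : root ∈ Ioo (113/100 : ℝ) (114/100) := by
  have h1 : (8.06 : ℝ) < √65 := Real.lt_sqrt_of_sq_lt (by norm_num)
  have h2 : √65 < (8.063 : ℝ) := by
    rw [Real.sqrt_lt' (by norm_num)]; norm_num
  unfold root
  norm_num at h1 h2
  constructor <;> linarith

lemma root_quadratic (t : ℝ) : 4 * t ^ 2 - t - 4 = 4 * (t - root) * (t - (1/4 - root)) := by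
  have := Real.sq_sqrt (by norm_num : (0 : ℝ) ≤ 65)
  unfold root
  linear_combination (1/16 : ℝ) * this

lemma kink_eq_zero_iff {t : ℝ} : kink t = 0 ↔ t = 0 ∨ t = root ∨ t = 1/4 - root := by
  have hr := root_mem
  constructor
  · intro h
    rcases mul_eq_zero.1 h with h | h
    · exact Or.inl h
    rcases le_or_gt (t ^ 2) (4/25) with h1 | h1
    · exact absurd h (kinkFactor_neg h1).ne
    rcases le_or_gt (t ^ 2) (169/100) with h2 | h2
    · rw [kinkFactor_mid h1.le h2, root_quadratic] at h
      rcases mul_eq_zero.1 h with h | h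
      · right; left; linarith
      · right; right; linarith
    · exact absurd h (kinkFactor_pos h2.le).ne'
  · rintro (rfl | rfl | rfl)
    · simp [kink]
    · rw [kink, kinkFactor_mid (by nlinarith [hr.1]) (by nlinarith [hr.1, hr.2]), root_quadratic]
      ring
    · rw [kink, kinkFactor_mid (by nlinarith [hr.1]) (by nlinarith [hr.1, hr.2]), root_quadratic]
      ring

lemma kink_self_iff {t : ℝ} (ht : 0 < t) : kink t = kink (-t) ↔ t = 1 := by
  have n0 := step_nonneg (169/100) (49/25) (t ^ 2)
  have n1 := step_le_one (169/100) (49/25) (t ^ 2)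
  have h1 : kink t - kink (-t) = t * ((1 - step (169/100) (49/25) (t ^ 2)) * (8 * (t ^ 2 - 1)) +
      step (169/100) (49/25) (t ^ 2) * 10) := by
    simp only [kink, kinkFactor, neg_sq]; ring
  rw [← sub_eq_zero, h1, mul_eq_zero, or_iff_right ht.ne']
  constructor
  · intro h
    rcases le_or_gt t 1 with h2 | h2
    · rw [step_of_le (by norm_num) (by nlinarith)] at h
      nlinarith
    · exfalso
      rcases n1.eq_or_lt with h3 | h3
      · rw [h3] at h; norm_num at h
      · have := mul_pos (by linarith : 0 < 1 - step (169/100) (49/25) (t ^ 2))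
          (by nlinarith : 0 < 8 * (t ^ 2 - 1))
        linarith
  · rintro rfl
    rw [step_of_le (by norm_num) (by norm_num)]; norm_num

lemma hasDerivAt_kink_mid {t : ℝ} (h : 4/25 < t ^ 2) (h' : t ^ 2 < 169/100) :
    HasDerivAt kink (12 * t ^ 2 - 2 * t - 4) t := by
  have hc : ContinuousAt (fun u : ℝ => u ^ 2) t := by fun_prop
  have h1 : kink =ᶠ[𝓝 t] fun u => 4 * u ^ 3 - u ^ 2 - 4 * u := by
    filter_upwards [hc.eventually_const_lt h, hc.eventually_lt_const h'] with u h2 h3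
    rw [kink, kinkFactor_mid h2.le h3.le]; ring
  refine HasDerivAt.congr_of_eventuallyEq ?_ h1
  have := (((hasDerivAt_pow 3 t).const_mul 4).sub (hasDerivAt_pow 2 t)).sub
    ((hasDerivAt_id t).const_mul 4)
  refine this.congr_deriv ?_
  norm_num; ring

lemma hasDerivAt_kink_zero : HasDerivAt kink (-4) 0 := by
  have hc : ContinuousAt (fun u : ℝ => u ^ 2) 0 := by fun_prop
  have h1 : kink =ᶠ[𝓝 0] fun u => 4 * u ^ 3 - 4 * u := by
    filter_upwards [hc.eventually_lt_const (by norm_num : (0 : ℝ) ^ 2 < 9/100)] with u h2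
    rw [kink, kinkFactor_small h2.le]; ring
  refine HasDerivAt.congr_of_eventuallyEq ?_ h1
  have := ((hasDerivAt_pow 3 (0 : ℝ)).const_mul 4).sub ((hasDerivAt_id (0 : ℝ)).const_mul 4)
  refine this.congr_deriv ?_
  norm_num

lemma deriv_kink_root : 0 < deriv kink root := by
  have hr := root_mem
  rw [(hasDerivAt_kink_mid (by nlinarith [hr.1]) (by nlinarith [hr.1, hr.2])).deriv]
  nlinarith [hr.1]

lemma deriv_kink_root' : 0 < deriv kink (1/4 - root) := by
  have hr := root_mem
  rw [(hasDerivAt_kink_mid (by nlinarith [hr.1]) (by nlinarith [hr.1, hr.2])).deriv]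
  nlinarith [hr.1]

lemma deriv_kink_self : 0 < deriv kink 1 + deriv kink (-1) := by
  rw [(hasDerivAt_kink_mid (by norm_num) (by norm_num)).deriv,
    (hasDerivAt_kink_mid (by norm_num) (by norm_num)).deriv]
  norm_num

lemma kink_of_sq_ge {t : ℝ} (h : 49/25 ≤ t ^ 2) : kink t = 5 * t := by
  rw [kink, kinkFactor_big h, mul_comm]

lemma abs_kinkFactor {t : ℝ} (h : t ^ 2 ≤ 49/25) : -5 ≤ kinkFactor t ∧ kinkFactor t ≤ 11/2 := by
  have n0 := step_nonneg (169/100) (49/25) (t ^ 2)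
  have n1 := step_le_one (169/100) (49/25) (t ^ 2)
  have m0 := step_nonneg (9/100) (4/25) (t ^ 2)
  have m1 := step_le_one (9/100) (4/25) (t ^ 2)
  have ht : |t| ≤ 7/5 := abs_le_of_sq_le_sq (by linarith) (by norm_num)
  obtain ⟨t1, t2⟩ := abs_le.1 ht
  have hq : -5 ≤ 4 * t ^ 2 - step (9/100) (4/25) (t ^ 2) * t - 4 ∧
      4 * t ^ 2 - step (9/100) (4/25) (t ^ 2) * t - 4 ≤ 11/2 := by
    have h3 : |step (9/100) (4/25) (t ^ 2) * t| ≤ |t| := by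
      rw [abs_mul, abs_of_nonneg m0]
      exact mul_le_of_le_one_left (abs_nonneg t) m1
    obtain ⟨h4, h5⟩ := abs_le.1 h3
    have h6 := sq_abs t
    constructor
    · nlinarith [sq_nonneg (|t| - 1/8)]
    · nlinarith
  unfold kinkFactor
  constructor
  · nlinarith [mul_nonneg (sub_nonneg.2 n1) (sub_nonneg.2 hq.1)]
  · nlinarith [mul_nonneg (sub_nonneg.2 n1) (sub_nonneg.2 hq.2)]

lemma abs_kink_le {t : ℝ} (h : t ^ 2 ≤ 49/25) : |kink t| ≤ 77/10 := by
  obtain ⟨h1, h2⟩ := abs_kinkFactor h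
  have ht : |t| ≤ 7/5 := abs_le_of_sq_le_sq (by linarith) (by norm_num)
  have h3 : |kinkFactor t| ≤ 11/2 := abs_le.2 ⟨by linarith, h2⟩
  rw [kink, abs_mul]
  calc |t| * |kinkFactor t| ≤ 7/5 * (11/2) := by gcongr
    _ = 77/10 := by norm_num

lemma flat_kink (b : Prop) : Flat b kink where
  smooth := contDiff_kink
  base τ h := kink_of_sq_ge (by nlinarith [sq_abs τ])
  bound τ h := by
    rcases le_total (τ ^ 2) (49/25) with h1 | h1
    · exact (abs_kink_le h1).trans_lt (by norm_num)
    · rw [kink_of_sq_ge h1, abs_mul, abs_of_pos (by norm_num : (0 : ℝ) < 5)]; linarith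
  apex := by rw [hasDerivAt_kink_zero.deriv]; norm_num
  self τ h h1 := by
    rw [(kink_self_iff h).1 h1]; exact deriv_kink_self.ne'
  zero _ τ h := by
    rcases kink_eq_zero_iff.1 h with rfl | rfl | rfl
    · rw [hasDerivAt_kink_zero.deriv]; norm_num
    · exact deriv_kink_root.ne'
    · exact deriv_kink_root'.ne'
  triple _ τ h0 h h' := by
    have h1 : τ = 1 ∨ -τ = 1 := by
      rcases lt_or_gt_of_ne h0 with h1 | h1
      · exact Or.inr ((kink_self_iff (by linarith)).1 (by rw [neg_neg, h]))
      · exact Or.inl ((kink_self_iff h1).1 h)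
    have h2 : kinkFactor τ = 0 := (mul_eq_zero.1 h').resolve_left h0
    rw [kinkFactor_mid] at h2 <;> rcases h1 with h1 | h1 <;> nlinarith

end kink

/-- A strand that crosses the vertical axis at `0`, `1/2` and `root`, and that agrees with `kink`
from `4/5` on. It has no self-crossings. -/
noncomputable def detour (t : ℝ) : ℝ :=
  t * ((1 - step (7/10) (4/5) t) * (5 - 10 * (step (3/10) (2/5) t * t)) +
    step (7/10) (4/5) t * kinkFactor t)

section detour

lemma contDiff_detour : ContDiff ℝ ∞ detour := by
  have h1 := contDiff_step (7/10) (4/5)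
  have h2 := contDiff_step (3/10) (2/5)
  have h3 := contDiff_kinkFactor
  unfold detour
  fun_prop

lemma detour_of_le {t : ℝ} (h : t ≤ 3/10) : detour t = 5 * t := by
  rw [detour, step_of_le (by norm_num) (by linarith), step_of_le (by norm_num) h]; ring

lemma detour_mid {t : ℝ} (h : 2/5 ≤ t) (h' : t ≤ 7/10) : detour t = 5 * t - 10 * t ^ 2 := by
  rw [detour, step_of_le (by norm_num) h', step_of_ge (by norm_num) h]; ring

lemma detour_of_ge {t : ℝ} (h : 4/5 ≤ t) : detour t = kink t := by
  rw [detour, step_of_ge (by norm_num) h, kink]; ring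

/-- The transition between `5t` and `5t - 10t²`. -/
lemma detour_bounds_left {t : ℝ} (h : t ≤ 7/10) :
    5 * t - 10 * t ^ 2 ≤ detour t ∧ detour t ≤ 5 * t := by
  have n0 := step_nonneg (3/10) (2/5) t
  have n1 := step_le_one (3/10) (2/5) t
  rw [detour, step_of_le (by norm_num) h]
  constructor <;> nlinarith [mul_nonneg n0 (sq_nonneg t), mul_le_mul_of_nonneg_right n1 (sq_nonneg t)]

/-- The transition between `5t - 10t²` and `kink`. -/
lemma detour_bounds_right {t : ℝ} (h : 7/10 ≤ t) (h' : t ≤ 4/5) :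
    -12/5 ≤ detour t ∧ detour t ≤ -1 := by
  have n0 := step_nonneg (7/10) (4/5) t
  have n1 := step_le_one (7/10) (4/5) t
  rw [detour, step_of_ge (a := 3/10) (by norm_num) (by linarith),
    kinkFactor_mid (by nlinarith) (by nlinarith)]
  have a1 : -12/5 ≤ t * (5 - 10 * (1 * t)) := by nlinarith
  have a2 : t * (5 - 10 * (1 * t)) ≤ -1 := by nlinarith
  have b1 : -12/5 ≤ t * (4 * t ^ 2 - t - 4) := by
    nlinarith [mul_nonneg (by linarith : 0 ≤ t + 13/12) (sq_nonneg (t - 2/3))]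
  have b2 : t * (4 * t ^ 2 - t - 4) ≤ -1 := by
    nlinarith [mul_nonneg (mul_nonneg (by linarith : 0 ≤ 1 - t) (by linarith : 0 ≤ 1 + t))
      (by linarith : 0 ≤ 4 * t - 1)]
  have e : t * ((1 - step (7/10) (4/5) t) * (5 - 10 * (1 * t)) + step (7/10) (4/5) t *
      (4 * t ^ 2 - t - 4)) = (1 - step (7/10) (4/5) t) * (t * (5 - 10 * (1 * t))) +
      step (7/10) (4/5) t * (t * (4 * t ^ 2 - t - 4)) := by ring
  rw [e]
  constructor
  · nlinarith [mul_le_mul_of_nonneg_left a1 (sub_nonneg.2 n1), mul_le_mul_of_nonneg_left b1 n0]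
  · nlinarith [mul_le_mul_of_nonneg_left a2 (sub_nonneg.2 n1), mul_le_mul_of_nonneg_left b2 n0]

lemma kink_ge {t : ℝ} (h0 : 0 ≤ t) : -2 ≤ kink t := by
  rcases le_total (t ^ 2) (169/100) with h | h
  · have n0 := step_nonneg (9/100) (4/25) (t ^ 2)
    have n1 := step_le_one (9/100) (4/25) (t ^ 2)
    rw [kink, kinkFactor, step_of_le (a := 169/100) (by norm_num) h]
    nlinarith [mul_nonneg (by linarith : 0 ≤ t + 13/12) (sq_nonneg (t - 2/3)),
      mul_le_mul_of_nonneg_right n1 (sq_nonneg t)]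
  · nlinarith [mul_nonneg h0 (kinkFactor_pos h).le, show kink t = t * kinkFactor t from rfl]

lemma detour_self_ne {t : ℝ} (ht : 0 < t) : detour t ≠ detour (-t) := by
  rw [detour_of_le (by linarith : -t ≤ 3/10)]
  apply ne_of_gt
  rcases le_total t (7/10) with h | h
  · have := (detour_bounds_left h).1
    nlinarith
  rcases le_total t (4/5) with h' | h'
  · have := (detour_bounds_right h h').1
    linarith
  · rw [detour_of_ge h']
    have := kink_ge ht.le
    linarith

lemma detour_eq_zero_iff {t : ℝ} : detour t = 0 ↔ t = 0 ∨ t = 1/2 ∨ t = root := by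
  have hr := root_mem
  constructor
  · intro h
    rcases le_total t (3/10) with h1 | h1
    · rw [detour_of_le h1] at h
      left; linarith
    rcases le_or_gt t (2/5) with h2 | h2
    · have := (detour_bounds_left (t := t) (by linarith)).1
      nlinarith
    rcases le_total t (7/10) with h3 | h3
    · rw [detour_mid h2.le h3] at h
      have : t * (1 - 2 * t) = 0 := by linarith
      rcases mul_eq_zero.1 this with h | h
      · exact Or.inl h
      · right; left; linarith
    rcases le_total t (4/5) with h4 | h4
    · linarith [(detour_bounds_right h3 h4).2]
    · rw [detour_of_ge h4] at h
      rcases kink_eq_zero_iff.1 h with h | h | h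
      · exact Or.inl h
      · exact Or.inr (Or.inr h)
      · linarith [hr.1]
  · rintro (rfl | rfl | rfl)
    · simp [detour]
    · rw [detour_mid (by norm_num) (by norm_num)]; norm_num
    · rw [detour_of_ge (by linarith [hr.1])]
      exact kink_eq_zero_iff.2 (Or.inr (Or.inl rfl))

lemma deriv_detour_zero : 0 < deriv detour 0 := by
  have h : detour =ᶠ[𝓝 0] fun t => 5 * t := by
    filter_upwards [gt_mem_nhds (by norm_num : (0 : ℝ) < 3/10)] with u hu
    exact detour_of_le hu.le
  rw [h.deriv_eq, ((hasDerivAt_id' (0 : ℝ)).const_mul 5).deriv]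
  norm_num

lemma deriv_detour_half : deriv detour (1/2) < 0 := by
  have h : detour =ᶠ[𝓝 (1/2)] fun t => 5 * t - 10 * t ^ 2 := by
    filter_upwards [gt_mem_nhds (by norm_num : (1/2 : ℝ) < 7/10),
      lt_mem_nhds (by norm_num : (2/5 : ℝ) < 1/2)] with u hu hu'
    exact detour_mid hu'.le hu.le
  have hd : HasDerivAt (fun t : ℝ => 5 * t - 10 * t ^ 2) _ (1/2) :=
    ((hasDerivAt_id' (1/2 : ℝ)).const_mul 5).sub ((hasDerivAt_pow 2 (1/2 : ℝ)).const_mul 10)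
  rw [h.deriv_eq, hd.deriv]
  norm_num

lemma deriv_detour_root : 0 < deriv detour root := by
  have h : detour =ᶠ[𝓝 root] kink := by
    filter_upwards [lt_mem_nhds (by linarith [root_mem.1] : (4/5 : ℝ) < root)] with u hu
    exact detour_of_ge hu.le
  rw [h.deriv_eq]
  exact deriv_kink_root

lemma flat_detour (b : Prop) : Flat b detour where
  smooth := contDiff_detour
  base τ h := by
    rcases le_abs.1 h with h1 | h1
    · rw [detour_of_ge (by linarith), kink_of_sq_ge (by nlinarith)]
    · exact detour_of_le (by linarith)
  bound τ h := by
    obtain ⟨h1, h2⟩ := abs_le.1 h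
    rcases le_total τ (3/10) with h3 | h3
    · rw [detour_of_le h3]; exact abs_lt.2 ⟨by linarith, by linarith⟩
    rcases le_total τ (7/10) with h4 | h4
    · obtain ⟨h5, h6⟩ := detour_bounds_left h4
      exact abs_lt.2 ⟨by nlinarith, by linarith⟩
    rcases le_total τ (4/5) with h5 | h5
    · obtain ⟨h5, h6⟩ := detour_bounds_right h4 h5
      exact abs_lt.2 ⟨by linarith, by linarith⟩
    · rw [detour_of_ge h5]; exact (flat_kink b).bound τ h
  apex := deriv_detour_zero.ne'
  self τ h h1 := absurd h1 (detour_self_ne h)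
  zero _ τ h := by
    rcases detour_eq_zero_iff.1 h with rfl | rfl | rfl
    exacts [deriv_detour_zero.ne', deriv_detour_half.ne, deriv_detour_root.ne']
  triple _ τ h0 h h' := by
    rcases lt_or_gt_of_ne h0 with h1 | h1
    · exact absurd (by rw [neg_neg, h]) (detour_self_ne (neg_pos.2 h1))
    · exact absurd h (detour_self_ne h1)

end detour

lemma flat_base (b : Prop) : Flat b fun t => 5 * t where
  smooth := by fun_prop
  base _ _ := rfl
  bound τ h := by rw [abs_mul, abs_of_pos (by norm_num : (0 : ℝ) < 5)]; linarith
  apex := by rw [((hasDerivAt_id' (0 : ℝ)).const_mul 5).deriv]; norm_num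
  self τ h h1 := by linarith
  zero _ τ h := by rw [((hasDerivAt_id' τ).const_mul 5).deriv]; norm_num
  triple _ τ h0 h _ := absurd (by linarith) h0

lemma kink_le {t : ℝ} (h : t < 1) : kink t ≤ 2 := by
  rcases le_total (t ^ 2) (169/100) with h1 | h1
  · have n0 := step_nonneg (9/100) (4/25) (t ^ 2)
    have h2 : -13/10 ≤ t := by nlinarith
    rw [kink, kinkFactor, step_of_le (a := 169/100) (by norm_num) h1]
    have h3 : 4 * t ^ 3 - 4 * t ≤ 2 := by
      nlinarith [mul_nonneg (by linarith : 0 ≤ 1 - t) (sq_nonneg (t + 1/2))]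
    nlinarith [mul_nonneg n0 (sq_nonneg t)]
  · have h2 : t ≤ 0 := by nlinarith
    have := mul_nonneg (neg_nonneg.2 h2) (kinkFactor_pos h1).le
    rw [kink]; linarith

lemma kink_one : kink 1 = -1 := by
  rw [kink, kinkFactor_mid (by norm_num) (by norm_num)]; norm_num

lemma kink_of_le {t : ℝ} (h : t ≤ -1) : kink t ≤ -1 := by
  rcases le_total (t ^ 2) (169/100) with h1 | h1
  · rw [kink, kinkFactor_mid (by nlinarith) h1]
    nlinarith [mul_nonneg (by nlinarith : 0 ≤ t ^ 2 - 1) (by linarith : 0 ≤ 1 - 4 * t)]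
  · have n0 := step_nonneg (169/100) (49/25) (t ^ 2)
    have n1 := step_le_one (169/100) (49/25) (t ^ 2)
    have h2 : 1 ≤ kinkFactor t := by
      rw [kinkFactor, step_of_ge (a := 9/100) (by norm_num) (by linarith)]
      nlinarith [mul_nonneg (sub_nonneg.2 n1) (by nlinarith : 0 ≤ 4 * t ^ 2 - 1 * t - 4 - 1)]
    rw [kink]; nlinarith

lemma detour_le {t : ℝ} (h : t < 1) : detour t ≤ 2 := by
  rcases le_total t (2/5) with h1 | h1
  · linarith [(detour_bounds_left (t := t) (by linarith)).2]
  rcases le_total t (7/10) with h3 | h3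
  · rw [detour_mid h1 h3]; nlinarith
  rcases le_total t (4/5) with h4 | h4
  · linarith [(detour_bounds_right h3 h4).2]
  · rw [detour_of_ge h4]; exact kink_le h

lemma flat_left_kink (b : Prop) : Flat b (left kink) :=
  (flat_kink b).left (by rw [kink_one]; norm_num) (fun t h => by linarith [kink_le h])
    fun t h => by linarith [kink_of_le h]

lemma flat_left_detour (b : Prop) : Flat b (left detour) :=
  (flat_detour b).left (by rw [detour_of_ge (by norm_num), kink_one]; norm_num)
    (fun t h => by linarith [detour_le h])
    fun t h => by rw [detour_of_le (by linarith)]; linarith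

/-- The strand whose horizontal coordinate is `5τ`, multiplied by a function of `τ²`: it crosses
itself on the vertical axis, at the zeros of this function. -/
noncomputable def loops (w : ℝ → ℝ) (τ : ℝ) : ℝ := 5 * (τ * w (τ ^ 2))

section loops

variable {w : ℝ → ℝ}

lemma loops_neg (τ : ℝ) : loops w (-τ) = -loops w τ := by simp only [loops, neg_sq]; ring

lemma loops_self_iff {τ : ℝ} (h : 0 < τ) : loops w τ = loops w (-τ) ↔ w (τ ^ 2) = 0 := by
  rw [loops_neg]
  constructor
  · intro h1
    have h2 : τ * w (τ ^ 2) = 0 := by simp only [loops] at h1; linarith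
    exact (mul_eq_zero.1 h2).resolve_left h.ne'
  · intro h1
    simp [loops, h1]

lemma deriv_loops_self {τ d : ℝ} (h : w (τ ^ 2) = 0) (hd : HasDerivAt w d (τ ^ 2)) :
    deriv (loops w) τ + deriv (loops w) (-τ) = 20 * τ ^ 2 * d := by
  have key : ∀ σ : ℝ, σ ^ 2 = τ ^ 2 → deriv (loops w) σ = 10 * τ ^ 2 * d := by
    intro σ hσ
    have hd' : HasDerivAt w d (σ ^ 2) := by rwa [hσ]
    have h1 := ((hasDerivAt_id' σ).mul (HasDerivAt.comp (h := fun x : ℝ => x ^ 2) σ hd' (hasDerivAt_pow 2 σ))).const_mul 5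
    have h2 : HasDerivAt (loops w) _ σ := h1
    rw [h2.deriv]
    simp only [Function.comp, hσ, h]
    norm_num
    linear_combination 10 * d * hσ
  rw [key τ rfl, key (-τ) (neg_sq τ)]; ring

lemma deriv_loops_zero (hw : ContDiff ℝ ∞ w) : deriv (loops w) 0 = 5 * w 0 := by
  have hd : HasDerivAt w (deriv w (0 ^ 2)) ((0 : ℝ) ^ 2) :=
    (hw.differentiable (by simp) _).hasDerivAt
  have h1 := ((hasDerivAt_id' (0 : ℝ)).mul 
    (HasDerivAt.comp (h := fun x : ℝ => x ^ 2) (0 : ℝ) hd (hasDerivAt_pow 2 0))).const_mul 5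
  have h2 : HasDerivAt (loops w) _ 0 := h1
  rw [h2.deriv]
  simp [Function.comp]

lemma flat_loops {b : Prop} (hb : ¬ b) (hw : ContDiff ℝ ∞ w) (h1 : ∀ s, 4 ≤ s → w s = 1)
    (h2 : ∀ s, 0 ≤ s → s ≤ 4 → |w s| < 5/2) (h0 : w 0 ≠ 0)
    (h3 : ∀ s, w s = 0 → ∃ d ≠ 0, HasDerivAt w d s) : Flat b (loops w) where
  smooth := by unfold loops; fun_prop
  base τ h := by
    rw [loops, h1 _ (by nlinarith [sq_abs τ])]; ring
  bound τ h := by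
    have h4 := h2 (τ ^ 2) (sq_nonneg τ) (by nlinarith [sq_abs τ, abs_nonneg τ])
    rw [loops, abs_mul, abs_mul, abs_of_pos (by norm_num : (0 : ℝ) < 5)]
    nlinarith [abs_nonneg τ, abs_nonneg (w (τ ^ 2)),
      mul_nonneg (sub_nonneg.2 h) (abs_nonneg (w (τ ^ 2)))]
  apex := by rw [deriv_loops_zero hw]; exact mul_ne_zero (by norm_num) h0
  self τ h h4 := by
    rw [loops_self_iff h] at h4
    obtain ⟨d, hd, hd'⟩ := h3 _ h4
    rw [deriv_loops_self h4 hd']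
    positivity
  zero h := absurd h hb
  triple h := absurd h hb

end loops

/-- The factor for a strand with a single kink. -/
noncomputable def oneLoop (s : ℝ) : ℝ :=
  (1 - step (3/2) (5/2) s) * (s - 1) + step (3/2) (5/2) s

/-- The factor for a strand with two kinks, one inside the other. -/
noncomputable def twoLoops (s : ℝ) : ℝ :=
  (1 - step (3/5) (4/5) s) * ((1 - step (1/10) (3/10) s) + step (1/10) (3/10) s * (1/2 - s)) +
    step (3/5) (4/5) s * oneLoop s

section loopFactors

variable {s : ℝ}

lemma contDiff_oneLoop : ContDiff ℝ ∞ oneLoop := by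
  have := contDiff_step (3/2) (5/2)
  unfold oneLoop
  fun_prop

lemma contDiff_twoLoops : ContDiff ℝ ∞ twoLoops := by
  have := contDiff_step (3/5) (4/5)
  have := contDiff_step (1/10) (3/10)
  have := contDiff_oneLoop
  unfold twoLoops
  fun_prop

lemma oneLoop_of_le (h : s ≤ 3/2) : oneLoop s = s - 1 := by
  rw [oneLoop, step_of_le (by norm_num) h]; ring

lemma oneLoop_of_ge (h : 5/2 ≤ s) : oneLoop s = 1 := by
  rw [oneLoop, step_of_ge (by norm_num) h]; ring

lemma oneLoop_mem (h : 3/2 ≤ s) : oneLoop s ∈ Icc (1/2 : ℝ) (3/2) := by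
  rcases le_total s (5/2) with h1 | h1
  · have n0 := step_nonneg (3/2) (5/2) s
    have n1 := step_le_one (3/2) (5/2) s
    unfold oneLoop
    constructor <;> nlinarith
  · rw [oneLoop_of_ge h1]; constructor <;> norm_num

lemma oneLoop_eq_zero_iff : oneLoop s = 0 ↔ s = 1 := by
  constructor
  · intro h
    rcases le_total s (3/2) with h1 | h1
    · rw [oneLoop_of_le h1] at h; linarith
    · linarith [(oneLoop_mem h1).1]
  · rintro rfl; rw [oneLoop_of_le (by norm_num)]; norm_num

lemma hasDerivAt_oneLoop : HasDerivAt oneLoop 1 1 := by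
  refine ((hasDerivAt_id' (1 : ℝ)).sub_const 1).congr_of_eventuallyEq ?_
  filter_upwards [gt_mem_nhds (by norm_num : (1 : ℝ) < 3/2)] with u hu
  exact oneLoop_of_le hu.le

lemma twoLoops_of_le (h : s ≤ 1/10) : twoLoops s = 1 := by
  rw [twoLoops, step_of_le (a := 3/5) (by norm_num) (by linarith), step_of_le (by norm_num) h]; ring

lemma twoLoops_mid (h : 3/10 ≤ s) (h' : s ≤ 3/5) : twoLoops s = 1/2 - s := by
  rw [twoLoops, step_of_le (a := 3/5) (by norm_num) h', step_of_ge (by norm_num) h]; ring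

lemma twoLoops_of_ge (h : 4/5 ≤ s) : twoLoops s = oneLoop s := by
  rw [twoLoops, step_of_ge (by norm_num) h]; ring

lemma twoLoops_left (h0 : 0 ≤ s) (h : s ≤ 3/10) : twoLoops s ∈ Icc (1/5 : ℝ) 1 := by
  have n0 := step_nonneg (1/10) (3/10) s
  have n1 := step_le_one (1/10) (3/10) s
  rw [twoLoops, step_of_le (a := 3/5) (by norm_num) (by linarith)]
  constructor <;> nlinarith

lemma twoLoops_right (h : 3/5 ≤ s) (h' : s ≤ 4/5) : twoLoops s ∈ Icc (-1 : ℝ) (-1/10) := by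
  have n0 := step_nonneg (3/5) (4/5) s
  have n1 := step_le_one (3/5) (4/5) s
  rw [twoLoops, step_of_ge (a := 1/10) (by norm_num) (by linarith), oneLoop_of_le (by linarith)]
  constructor <;> nlinarith

lemma twoLoops_eq_zero_iff (h0 : 0 ≤ s) : twoLoops s = 0 ↔ s = 1/2 ∨ s = 1 := by
  constructor
  · intro h
    rcases le_total s (3/10) with h1 | h1
    · linarith [(twoLoops_left h0 h1).1]
    rcases le_total s (3/5) with h2 | h2
    · rw [twoLoops_mid h1 h2] at h; left; linarith
    rcases le_total s (4/5) with h3 | h3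
    · linarith [(twoLoops_right h2 h3).2]
    · rw [twoLoops_of_ge h3] at h; exact Or.inr (oneLoop_eq_zero_iff.1 h)
  · rintro (rfl | rfl)
    · rw [twoLoops_mid (by norm_num) (by norm_num)]; norm_num
    · rw [twoLoops_of_ge (by norm_num)]; exact oneLoop_eq_zero_iff.2 rfl

lemma hasDerivAt_twoLoops_half : HasDerivAt twoLoops (-1) (1/2) := by
  refine ((hasDerivAt_id' (1/2 : ℝ)).const_sub (1/2)).congr_of_eventuallyEq ?_
  filter_upwards [gt_mem_nhds (by norm_num : (1/2 : ℝ) < 3/5),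
    lt_mem_nhds (by norm_num : (3/10 : ℝ) < 1/2)] with u hu hu'
  exact twoLoops_mid hu'.le hu.le

lemma hasDerivAt_twoLoops_one : HasDerivAt twoLoops 1 1 := by
  refine hasDerivAt_oneLoop.congr_of_eventuallyEq ?_
  filter_upwards [lt_mem_nhds (by norm_num : (4/5 : ℝ) < 1)] with u hu
  exact twoLoops_of_ge hu.le

lemma abs_oneLoop_le (h0 : 0 ≤ s) : |oneLoop s| ≤ 3/2 := by
  rcases le_total s (3/2) with h | h
  · rw [oneLoop_of_le h]; exact abs_le.2 ⟨by linarith, by linarith⟩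
  · obtain ⟨h1, h2⟩ := oneLoop_mem h
    exact abs_le.2 ⟨by linarith, h2⟩

lemma abs_twoLoops_le_one (h0 : 0 ≤ s) (h : s ≤ 1) : |twoLoops s| ≤ 1 := by
  rcases le_total s (3/10) with h1 | h1
  · obtain ⟨h2, h3⟩ := twoLoops_left h0 h1
    exact abs_le.2 ⟨by linarith, by linarith⟩
  rcases le_total s (3/5) with h2 | h2
  · rw [twoLoops_mid h1 h2]; exact abs_le.2 ⟨by linarith, by linarith⟩
  rcases le_total s (4/5) with h3 | h3
  · obtain ⟨h4, h5⟩ := twoLoops_right h2 h3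
    exact abs_le.2 ⟨by linarith, by linarith⟩
  · rw [twoLoops_of_ge h3, oneLoop_of_le (by linarith)]; exact abs_le.2 ⟨by linarith, by linarith⟩

lemma abs_twoLoops_le (h0 : 0 ≤ s) : |twoLoops s| ≤ 3/2 := by
  rcases le_total s 1 with h | h
  · linarith [abs_twoLoops_le_one h0 h]
  · rw [twoLoops_of_ge (by linarith)]; exact abs_oneLoop_le h0

lemma flat_oneLoop {b : Prop} (hb : ¬ b) : Flat b (loops oneLoop) :=
  flat_loops hb contDiff_oneLoop (fun s h => oneLoop_of_ge (by linarith))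
    (fun s h _ => (abs_oneLoop_le h).trans_lt (by norm_num))
    (by rw [oneLoop_of_le (by norm_num)]; norm_num) fun s h => by
      rw [oneLoop_eq_zero_iff.1 h]; exact ⟨1, one_ne_zero, hasDerivAt_oneLoop⟩

lemma flat_twoLoops {b : Prop} (hb : ¬ b) : Flat b (loops twoLoops) :=
  flat_loops hb contDiff_twoLoops
    (fun s h => by rw [twoLoops_of_ge (by linarith), oneLoop_of_ge (by linarith)])
    (fun s h _ => (abs_twoLoops_le h).trans_lt (by norm_num))
    (by rw [twoLoops_of_le (by norm_num)]; norm_num) fun s h => by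
      rcases lt_or_ge s 0 with h0 | h0
      · rw [twoLoops_of_le (by linarith)] at h; norm_num at h
      rcases (twoLoops_eq_zero_iff h0).1 h with rfl | rfl
      exacts [⟨-1, by norm_num, hasDerivAt_twoLoops_half⟩,
        ⟨1, one_ne_zero, hasDerivAt_twoLoops_one⟩]

end loopFactors

/-! ### Strands that meet an ellipse in an interval -/

/-- On `T`, the function `N` is at most `1` exactly on `[α, β]`, and less than `1` exactly on
`(α, β)`. -/
def IsWell (T : Set ℝ) (N : ℝ → ℝ) (α β : ℝ) : Prop :=
  ∀ t ∈ T, (N t ≤ 1 ↔ t ∈ Icc α β) ∧ (N t < 1 ↔ t ∈ Ioo α β)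

/-- A function that descends below `1` on `[a, b]`, stays there on `[b, c]`, and ascends above `1`
on `[c, d]`; a second function that differs from the first one only on `[b, c]`, and is less than
`1` there, has the same well. -/
lemma exists_isWell {T : Set ℝ} {N N' : ℝ → ℝ} {a b c d : ℝ} (hab : a < b) (hbc : b ≤ c)
    (hcd : c < d) (hN : Continuous N) (hT : ∀ t ∈ T, t ∉ Icc a d → 1 < N t)
    (ha : 1 < N a) (hd : 1 < N d) (hanti : StrictAntiOn N (Icc a b))
    (hmono : StrictMonoOn N (Icc c d)) (hcore : ∀ t ∈ Icc b c, N t < 1)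
    (hcore' : ∀ t ∈ Icc b c, N' t < 1) (hag : ∀ t ∈ T, t ∉ Icc b c → N' t = N t) :
    ∃ α ∈ Ioo a b, ∃ β ∈ Ioo c d, IsWell T N α β ∧ IsWell T N' α β := by
  obtain ⟨α, hα, eα⟩ := intermediate_value_Ioo' hab.le hN.continuousOn
    ⟨hcore b ⟨le_rfl, hbc⟩, ha⟩
  obtain ⟨β, hβ, eβ⟩ := intermediate_value_Ioo hcd.le hN.continuousOn
    ⟨hcore c ⟨hbc, le_rfl⟩, hd⟩
  have key : IsWell (Icc a d ∪ T) N α β := by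
    intro t ht
    by_cases hmem : t ∈ Icc a d
    · rcases le_total t b with h1 | h1
      · have m : t ∈ Icc a b := ⟨hmem.1, h1⟩
        have m' : α ∈ Icc a b := Ioo_subset_Icc_self hα
        have hle := hanti.le_iff_ge m m'
        have hlt := hanti.lt_iff_gt m m'
        rw [eα] at hle hlt
        have : t < β := by linarith [hβ.1]
        rw [hle, hlt]
        exact ⟨⟨fun h => ⟨h, this.le⟩, fun h => h.1⟩, ⟨fun h => ⟨h, this⟩, fun h => h.1⟩⟩
      rcases le_total t c with h2 | h2
      · have h3 := hcore t ⟨h1, h2⟩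
        have h4 : t ∈ Ioo α β := ⟨hα.2.trans_le h1, h2.trans_lt hβ.1⟩
        exact ⟨iff_of_true h3.le (Ioo_subset_Icc_self h4), iff_of_true h3 h4⟩
      · have m : t ∈ Icc c d := ⟨h2, hmem.2⟩
        have m' : β ∈ Icc c d := Ioo_subset_Icc_self hβ
        have hle := hmono.le_iff_le m m'
        have hlt := hmono.lt_iff_lt m m'
        rw [eβ] at hle hlt
        have : α < t := by linarith [hα.2]
        rw [hle, hlt]
        exact ⟨⟨fun h => ⟨this.le, h⟩, fun h => h.2⟩, ⟨fun h => ⟨this, h⟩, fun h => h.2⟩⟩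
    · have h1 := hT t (ht.resolve_left hmem) hmem
      have h2 : t ∉ Icc α β := fun h => hmem ⟨hα.1.le.trans h.1, h.2.trans hβ.2.le⟩
      exact ⟨iff_of_false (not_le.2 h1) h2,
        iff_of_false (not_lt.2 h1.le) fun h => h2 (Ioo_subset_Icc_self h)⟩
  refine ⟨α, hα, β, hβ, fun t ht => key t (Or.inr ht), fun t ht => ?_⟩
  by_cases h : t ∈ Icc b c
  · have h3 := hcore' t h
    have h4 : t ∈ Ioo α β := ⟨hα.2.trans_le h.1, h.2.trans_lt hβ.1⟩
    exact ⟨iff_of_true h3.le (Ioo_subset_Icc_self h4), iff_of_true h3 h4⟩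
  · rw [hag t ht h]; exact key t (Or.inr ht)

namespace Ellipse

variable (D : Ellipse)

lemma E_lt_of_fst {x x' y y' : ℝ} (h : (x - D.X) ^ 2 < (x' - D.X) ^ 2)
    (h' : (y - D.Y) ^ 2 ≤ (y' - D.Y) ^ 2) : D.E x y < D.E x' y' := by
  have := D.w_pos
  have := D.h_pos
  simp only [E, div_pow]
  exact add_lt_add_of_lt_of_le (div_lt_div_of_pos_right h (by positivity))
    (div_le_div_of_nonneg_right h' (by positivity))

lemma E_zero {κ : ℝ} (hκ : 0 ≤ κ) (h : (D.X / D.w) ^ 2 = 1 - κ ^ 2) (v : ℝ) :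
    (D.E 0 v ≤ 1 ↔ v ∈ Icc (D.Y - κ * D.h) (D.Y + κ * D.h)) ∧
    (D.E 0 v < 1 ↔ v ∈ Ioo (D.Y - κ * D.h) (D.Y + κ * D.h)) := by
  have hh := D.h_pos
  have e : D.E 0 v = 1 - κ ^ 2 + ((v - D.Y) / D.h) ^ 2 := by
    rw [← h, E, zero_sub, neg_div, neg_sq]
  have e1 : ((v - D.Y) / D.h) ^ 2 ≤ κ ^ 2 ↔ |v - D.Y| ≤ κ * D.h := by
    rw [sq_le_sq, abs_div, abs_of_pos hh, abs_of_nonneg hκ, div_le_iff₀ hh]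
  have e2 : ((v - D.Y) / D.h) ^ 2 < κ ^ 2 ↔ |v - D.Y| < κ * D.h := by
    rw [sq_lt_sq, abs_div, abs_of_pos hh, abs_of_nonneg hκ, div_lt_iff₀ hh]
  constructor
  · rw [e, show 1 - κ ^ 2 + ((v - D.Y) / D.h) ^ 2 ≤ 1 ↔ ((v - D.Y) / D.h) ^ 2 ≤ κ ^ 2 by
      constructor <;> intro <;> linarith, e1, abs_le, mem_Icc]
    constructor <;> rintro ⟨h1, h2⟩ <;> constructor <;> linarith
  · rw [e, show 1 - κ ^ 2 + ((v - D.Y) / D.h) ^ 2 < 1 ↔ ((v - D.Y) / D.h) ^ 2 < κ ^ 2 by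
      constructor <;> intro <;> linarith, e2, abs_lt, mem_Ioo]
    constructor <;> rintro ⟨h1, h2⟩ <;> constructor <;> linarith

lemma continuous_E {p : ℝ → ℝ} (hp : Continuous p) : Continuous fun t => D.E (p t) (-t ^ 2) := by
  unfold E
  fun_prop

end Ellipse

/-- A single strand of type `A`, in a disc that avoids the vertical axis. -/
def strandsA (b : Prop) (D : Ellipse) {α β : ℝ} (h : α < β) (hα : -5 < α) (hβ : β < 5)
    (hD : b → ∀ v, 1 < D.E 0 v) : Strands b D 1 where
  k _ := true
  α _ := α
  β _ := β
  lt _ := h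
  rangeA _ _ := ⟨hα, hβ⟩
  rangeB _ h := by simp at h
  disj i j h := absurd (Subsingleton.elim i j) h
  B_le hb v _ := iff_of_false (not_le.2 (hD hb v)) (by simp)
  B_lt hb v _ := iff_of_false (not_lt.2 (hD hb v).le) (by simp)

/-- A strand of type `A` and the strand `B`. -/
def strandsAB {b : Prop} (hb : b) (D : Ellipse) {α β γ δ : ℝ} (h : α < β) (hα : -5 < α) (hβ : β < 5)
    (h' : γ < δ) (hγ : -25 < γ) (hδ : δ < 25)
    (hB : ∀ v, (D.E 0 v ≤ 1 ↔ v ∈ Icc γ δ) ∧ (D.E 0 v < 1 ↔ v ∈ Ioo γ δ)) : Strands b D 2 where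
  k := ![true, false]
  α := ![α, γ]
  β := ![β, δ]
  lt i := by fin_cases i; exacts [h, h']
  rangeA i hi := by fin_cases i; exacts [⟨hα, hβ⟩, by simp at hi]
  rangeB i hi := by fin_cases i; exacts [by simp at hi, ⟨hb, hγ, hδ⟩]
  disj i j h h' := by fin_cases i <;> fin_cases j <;> simp at h h'
  B_le _ v _ := by rw [(hB v).1]; simp [Fin.exists_fin_two]
  B_lt _ v _ := by rw [(hB v).2]; simp [Fin.exists_fin_two]

/-- Two strands of type `A`, in a disc that avoids the vertical axis or without a strand `B`. -/
def strandsAA {b : Prop} (hb : ¬ b) (D : Ellipse) {α β : ℝ} (h : α < β) (hα : 0 < α) (hβ : β < 5) :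
    Strands b D 2 where
  k := ![true, true]
  α := ![α, -β]
  β := ![β, -α]
  lt i := by fin_cases i; exacts [h, neg_lt_neg h]
  rangeA i _ := by
    fin_cases i
    · exact ⟨show -5 < α by linarith, hβ⟩
    · exact ⟨show -5 < -β by linarith, show -α < 5 by linarith⟩
  rangeB i hi := by fin_cases i <;> simp at hi
  disj i j h h' := by
    fin_cases i <;> fin_cases j <;> first | exact absurd rfl h | skip
    · exact disjoint_left.2 fun t h1 h2 => by
        have := h1.1; have := h2.2; simp at *; linarith
    · exact disjoint_left.2 fun t h1 h2 => by
        have := h1.2; have := h2.1; simp at *; linarith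
  B_le hb' := absurd hb' hb
  B_lt hb' := absurd hb' hb

/-- Two strands of type `A` and the strand `B`. -/
def strandsAAB {b : Prop} (hb : b) (D : Ellipse) {α β γ δ : ℝ} (h : α < β) (hα : 0 < α) (hβ : β < 5)
    (h' : γ < δ) (hγ : -25 < γ) (hδ : δ < 25)
    (hB : ∀ v, (D.E 0 v ≤ 1 ↔ v ∈ Icc γ δ) ∧ (D.E 0 v < 1 ↔ v ∈ Ioo γ δ)) : Strands b D 3 where
  k := ![true, true, false]
  α := ![α, -β, γ]
  β := ![β, -α, δ]
  lt i := by fin_cases i; exacts [h, neg_lt_neg h, h']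
  rangeA i hi := by
    fin_cases i
    · exact ⟨show -5 < α by linarith, hβ⟩
    · exact ⟨show -5 < -β by linarith, show -α < 5 by linarith⟩
    · simp at hi
  rangeB i hi := by fin_cases i; exacts [by simp at hi, by simp at hi, ⟨hb, hγ, hδ⟩]
  disj i j h h' := by
    fin_cases i <;> fin_cases j <;> first | exact absurd rfl h | (exact absurd h' (by decide)) | skip
    · exact disjoint_left.2 fun t h1 h2 => by
        have := h1.1; have := h2.2; simp at *; linarith
    · exact disjoint_left.2 fun t h1 h2 => by
        have := h1.2; have := h2.1; simp at *; linarith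
  B_le _ v _ := by rw [(hB v).1]; simp [Fin.exists_fin_succ]
  B_lt _ v _ := by rw [(hB v).2]; simp [Fin.exists_fin_succ]

section Fits

variable {b : Prop} {D : Ellipse} {p p' : ℝ → ℝ} {α β γ δ : ℝ}

lemma fits_strandsA (h : α < β) (hα : -5 < α) (hβ : β < 5) (hD : b → ∀ v, 1 < D.E 0 v)
    (hw : IsWell univ (fun t => D.E (p t) (-t ^ 2)) α β)
    (hs : ∀ τ, D.E (p τ) (-τ ^ 2) = 1 → τ ≠ 0 → p τ ≠ p (-τ)) :
    (strandsA b D h hα hβ hD).Fits p where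
  le τ _ := (hw τ trivial).1.trans (by simp [strandsA])
  lt τ _ := (hw τ trivial).2.trans (by simp [strandsA])
  self_ne τ _ := hs τ
  zero_ne hb τ _ h1 h2 := by rw [h2] at h1; exact (hD hb _).ne' h1

lemma fits_strandsAB (hb : b) (h : α < β) (hα : -5 < α) (hβ : β < 5) (h' : γ < δ) (hγ : -25 < γ)
    (hδ : δ < 25) (hB : ∀ v, (D.E 0 v ≤ 1 ↔ v ∈ Icc γ δ) ∧ (D.E 0 v < 1 ↔ v ∈ Ioo γ δ))
    (hw : IsWell univ (fun t => D.E (p t) (-t ^ 2)) α β)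
    (hs : ∀ τ, D.E (p τ) (-τ ^ 2) = 1 → (τ ≠ 0 → p τ ≠ p (-τ)) ∧ p τ ≠ 0) :
    (strandsAB hb D h hα hβ h' hγ hδ hB).Fits p where
  le τ _ := (hw τ trivial).1.trans (by simp [strandsAB, Fin.exists_fin_two])
  lt τ _ := (hw τ trivial).2.trans (by simp [strandsAB, Fin.exists_fin_two])
  self_ne τ _ h := (hs τ h).1
  zero_ne _ τ _ h := (hs τ h).2

lemma mem_neg_interval {s : ℝ} :
    (s ∈ Icc (-β) (-α) ↔ -s ∈ Icc α β) ∧ (s ∈ Ioo (-β) (-α) ↔ -s ∈ Ioo α β) := by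
  constructor <;> constructor <;> rintro ⟨h1, h2⟩ <;> constructor <;> linarith

/-- The condition on the strand, for a pair of symmetric intervals. -/
lemma mem_symm_iff (hα : 0 < α) (hw : IsWell (Ici 0) (fun t => D.E (p t) (-t ^ 2)) α β)
    (hw' : IsWell (Ici 0) (fun t => D.E (p (-t)) (-t ^ 2)) α β) (τ : ℝ) :
    (D.E (p τ) (-τ ^ 2) ≤ 1 ↔ τ ∈ Icc α β ∨ τ ∈ Icc (-β) (-α)) ∧
    (D.E (p τ) (-τ ^ 2) < 1 ↔ τ ∈ Ioo α β ∨ τ ∈ Ioo (-β) (-α)) := by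
  rcases le_total 0 τ with h | h
  · rw [(hw τ h).1, (hw τ h).2]
    constructor
    · exact ⟨Or.inl, fun h1 => h1.elim id fun h2 => by linarith [h2.2]⟩
    · exact ⟨Or.inl, fun h1 => h1.elim id fun h2 => by linarith [h2.2]⟩
  · have h3 := hw' (-τ) (neg_nonneg.2 h)
    simp only [neg_neg, neg_sq] at h3
    rw [h3.1, h3.2, mem_neg_interval.1, mem_neg_interval.2]
    constructor
    · exact ⟨Or.inr, fun h1 => h1.elim (fun h2 => by linarith [h2.1]) id⟩
    · exact ⟨Or.inr, fun h1 => h1.elim (fun h2 => by linarith [h2.1]) id⟩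

lemma fits_strandsAA (hb : ¬ b) (h : α < β) (hα : 0 < α) (hβ : β < 5)
    (hw : IsWell (Ici 0) (fun t => D.E (p t) (-t ^ 2)) α β)
    (hw' : IsWell (Ici 0) (fun t => D.E (p (-t)) (-t ^ 2)) α β)
    (hs : ∀ τ, D.E (p τ) (-τ ^ 2) = 1 → τ ≠ 0 → p τ ≠ p (-τ)) :
    (strandsAA hb D h hα hβ).Fits p where
  le τ _ := (mem_symm_iff hα hw hw' τ).1.trans (by simp [strandsAA, Fin.exists_fin_two])
  lt τ _ := (mem_symm_iff hα hw hw' τ).2.trans (by simp [strandsAA, Fin.exists_fin_two])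
  self_ne τ _ h := hs τ h
  zero_ne hb' := absurd hb' hb

lemma fits_strandsAAB (hb : b) (h : α < β) (hα : 0 < α) (hβ : β < 5) (h' : γ < δ) (hγ : -25 < γ)
    (hδ : δ < 25) (hB : ∀ v, (D.E 0 v ≤ 1 ↔ v ∈ Icc γ δ) ∧ (D.E 0 v < 1 ↔ v ∈ Ioo γ δ))
    (hw : IsWell (Ici 0) (fun t => D.E (p t) (-t ^ 2)) α β)
    (hw' : IsWell (Ici 0) (fun t => D.E (p (-t)) (-t ^ 2)) α β)
    (hs : ∀ τ, D.E (p τ) (-τ ^ 2) = 1 → (τ ≠ 0 → p τ ≠ p (-τ)) ∧ p τ ≠ 0) :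
    (strandsAAB hb D h hα hβ h' hγ hδ hB).Fits p where
  le τ _ := (mem_symm_iff hα hw hw' τ).1.trans (by simp [strandsAAB, Fin.exists_fin_succ])
  lt τ _ := (mem_symm_iff hα hw hw' τ).2.trans (by simp [strandsAAB, Fin.exists_fin_succ])
  self_ne τ _ h := (hs τ h).1
  zero_ne _ τ _ h := (hs τ h).2

end Fits

/-! ### Moving a strand through the vertical axis -/

/-- The disc for moving a strand through the vertical axis near the origin. -/
noncomputable def discOrigin : Ellipse where
  X := 1
  Y := 0
  w := 5/3
  h := 5/4
  w_pos := by norm_num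
  h_pos := by norm_num
  X_lt := by norm_num
  Y_lt := by norm_num

section discOrigin

lemma discOrigin_E (x t : ℝ) : discOrigin.E x (-t ^ 2) = (9 * (x - 1) ^ 2 + 16 * t ^ 4) / 25 := by
  simp only [Ellipse.E, discOrigin]; ring

lemma discOrigin_zero (v : ℝ) : (discOrigin.E 0 v ≤ 1 ↔ v ∈ Icc (-1 : ℝ) 1) ∧
    (discOrigin.E 0 v < 1 ↔ v ∈ Ioo (-1 : ℝ) 1) := by
  have := discOrigin.E_zero (κ := 4/5) (by norm_num) (by norm_num [discOrigin]) v
  norm_num [discOrigin] at this ⊢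
  exact this

/-- A strand that passes through the disc `discOrigin` from left to left, and its version that is
squeezed to the left of the vertical axis, meet the disc in the same interval. -/
lemma left_well {p : ℝ → ℝ} (hp : Continuous p) {a b c d : ℝ} (hab : a < b) (hbc : b ≤ c)
    (hcd : c < d) (hout : ∀ t, t ∉ Icc a d → 1 < discOrigin.E (p t) (-t ^ 2)) (ha : p a ≤ -1)
    (hd : p d ≤ -1) (ha0 : a ≠ 0) (hd0 : d ≠ 0) (hb0 : b ≤ 0) (hc0 : 0 ≤ c)
    (h1 : StrictMonoOn p (Icc a b))
    (h2 : StrictAntiOn p (Icc c d)) (hc1 : c < 1)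
    (hcore : ∀ t ∈ Icc b c, -17/100 ≤ p t ∧ p t ≤ 2 ∧ t ^ 2 ≤ 81/100)
    (hside : ∀ t ∉ Icc b c, t < 1 → p t ≤ -1/8) (hpb : p b ≤ 0) (hpc : p c ≤ 0) :
    ∃ α ∈ Ioo a b, ∃ β ∈ Ioo c d, IsWell univ (fun t => discOrigin.E (p t) (-t ^ 2)) α β ∧
      IsWell univ (fun t => discOrigin.E (left p t) (-t ^ 2)) α β := by
  have e4 : ∀ t : ℝ, t ^ 4 = (t ^ 2) ^ 2 := fun t => by ring
  have core : ∀ x t : ℝ, -17/100 ≤ x → x ≤ 2 → t ^ 2 ≤ 81/100 → discOrigin.E x (-t ^ 2) < 1 := by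
    intro x t h3 h4 h5
    rw [discOrigin_E, e4, div_lt_one (by norm_num)]
    nlinarith [mul_nonneg (sub_nonneg.2 h3) (sub_nonneg.2 h4), sq_nonneg t,
      mul_nonneg (sq_nonneg t) (sub_nonneg.2 h5)]
  have ends : ∀ x t : ℝ, x ≤ -1 → t ≠ 0 → 1 < discOrigin.E x (-t ^ 2) := by
    intro x t h3 h4
    have : 0 < t ^ 4 := by positivity
    rw [discOrigin_E, one_lt_div (by norm_num)]
    nlinarith
  refine exists_isWell hab hbc hcd (discOrigin.continuous_E hp) (fun t _ => hout t) (ends _ _ ha ha0)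
    (ends _ _ hd hd0) ?_ ?_ (fun t ht => ?_) (fun t ht => ?_) (fun t _ ht => ?_)
  · intro s hs t ht hst
    have h3 := h1 hs ht hst
    have h4 : p t ≤ p b := h1.monotoneOn ht ⟨hab.le, le_rfl⟩ ht.2
    have h5 := ht.2
    apply discOrigin.E_lt_of_fst
    · show (p t - 1) ^ 2 < (p s - 1) ^ 2
      nlinarith
    · show (-t ^ 2 - 0) ^ 2 ≤ (-s ^ 2 - 0) ^ 2
      have : t ^ 2 ≤ s ^ 2 := by nlinarith
      nlinarith [sq_nonneg t]
  · intro s hs t ht hst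
    have h3 := h2 hs ht hst
    have h4 : p s ≤ p c := h2.antitoneOn ⟨le_rfl, hcd.le⟩ hs hs.1
    have h5 := hs.1
    apply discOrigin.E_lt_of_fst
    · show (p s - 1) ^ 2 < (p t - 1) ^ 2
      nlinarith
    · show (-s ^ 2 - 0) ^ 2 ≤ (-t ^ 2 - 0) ^ 2
      have : s ^ 2 ≤ t ^ 2 := by nlinarith
      nlinarith [sq_nonneg s]
  · obtain ⟨h3, h4, h5⟩ := hcore t ht
    exact core _ _ h3 h4 h5
  · obtain ⟨h3, h4, h5⟩ := hcore t ht
    have ht1 : t < 1 := ht.2.trans_lt hc1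
    refine core _ _ ?_ ?_ h5
    · rw [left_of_lt ht1, ← squeeze_of_le (X := -17/100) (by norm_num)]
      exact strictMono_squeeze.monotone h3
    · rw [left_of_lt ht1]; linarith [squeeze_neg (X := p t) (by linarith)]
  · rcases lt_or_ge t 1 with h3 | h3
    · show discOrigin.E (left p t) _ = _
      rw [left_of_le (hside t ht h3)]
    · show discOrigin.E (left p t) _ = _
      rw [left_of_ge h3]

lemma kink_mid {t : ℝ} (h : 4/25 ≤ t ^ 2) (h' : t ^ 2 ≤ 169/100) :
    kink t = 4 * t ^ 3 - t ^ 2 - 4 * t := by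
  rw [kink, kinkFactor_mid h h']; ring

lemma kink_small {t : ℝ} (h : t ^ 2 ≤ 9/100) : kink t = 4 * t ^ 3 - 4 * t := by
  rw [kink, kinkFactor_small h]; ring

lemma kink_le_neg_one {t : ℝ} (h : 3/10 ≤ t) (h' : t ≤ 1) : kink t ≤ -1 := by
  rcases le_total t (2/5) with h1 | h1
  · have n0 := step_nonneg (9/100) (4/25) (t ^ 2)
    rw [kink, kinkFactor, step_of_le (a := 169/100) (by norm_num) (by nlinarith)]
    have h2 : 4 * t ^ 3 - 4 * t ≤ -1 := by
      nlinarith [mul_nonneg (sub_nonneg.2 h) (sub_nonneg.2 h1)]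
    nlinarith [mul_nonneg n0 (sq_nonneg t)]
  · rw [kink_mid (by nlinarith) (by nlinarith)]
    nlinarith [mul_nonneg (mul_nonneg (by linarith : 0 ≤ 1 - t) (by linarith : 0 ≤ 1 + t))
      (by linarith : 0 ≤ 4 * t - 1)]

/-- Right of the double point, the strand is outside the disc. -/
lemma kink_outside {t : ℝ} (h : 1 < t) : 1 < discOrigin.E (kink t) (-t ^ 2) := by
  have e4 : t ^ 4 = (t ^ 2) ^ 2 := by ring
  rw [discOrigin_E, one_lt_div (by norm_num), e4]
  rcases le_or_gt (t ^ 2) (5/4) with h1 | h1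
  · have h2 : kink t < 0 := by
      rw [kink_mid (by nlinarith) (by linarith)]
      nlinarith
    have h3 : 1 < t ^ 2 := by nlinarith
    nlinarith
  · nlinarith [sq_nonneg (kink t - 1)]

lemma kink_side_left {t : ℝ} (h : t < -9/10) : kink t ≤ -1/8 := by
  rcases le_total t (-1) with h1 | h1
  · linarith [kink_of_le h1]
  · rw [kink_mid (by nlinarith) (by nlinarith)]
    nlinarith [mul_nonneg (by linarith : 0 ≤ -9/10 - t) (by linarith : 0 ≤ 1 + t)]

/-- The part of `kink` that turns to the right of the axis and back, between its zeros `1/4 - root`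
and `0`. -/
lemma exists_well_kink : ∃ α ∈ Ioo (-1 : ℝ) (-9/10), ∃ β ∈ Ioo (1/25 : ℝ) (3/10),
    IsWell univ (fun t => discOrigin.E (kink t) (-t ^ 2)) α β ∧
      IsWell univ (fun t => discOrigin.E (left kink t) (-t ^ 2)) α β := by
  refine left_well contDiff_kink.continuous (by norm_num) (by norm_num) (by norm_num) ?_
    (kink_of_le le_rfl) (kink_le_neg_one le_rfl (by norm_num)) (by norm_num) (by norm_num)
    (by norm_num) (by norm_num) ?_ ?_ (by norm_num) ?_ ?_ ?_ ?_
  · intro t ht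
    have key : kink t ≤ -1 → t ≠ 0 → 1 < discOrigin.E (kink t) (-t ^ 2) := fun h3 h4 => by
      have : 0 < t ^ 4 := by positivity
      rw [discOrigin_E, one_lt_div (by norm_num)]
      nlinarith
    rcases lt_or_ge t (-1) with h | h
    · exact key (kink_of_le h.le) (by linarith)
    · have h1 : 3/10 < t := by by_contra hc; exact ht ⟨h, by linarith⟩
      rcases le_or_gt t 1 with h2 | h2
      · exact key (kink_le_neg_one h1.le h2) (by linarith)
      · exact kink_outside h2
  · intro s hs t ht hst
    have h1 := hs.1
    have h2 := ht.2
    rw [kink_mid (by nlinarith) (by nlinarith), kink_mid (by nlinarith) (by nlinarith)]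
    nlinarith [mul_pos (sub_pos.2 hst) (by nlinarith : 0 < 4 * (s ^ 2 + s * t + t ^ 2) - (s + t) - 4)]
  · intro s hs t ht hst
    have h1 := hs.1
    have h2 := ht.2
    rw [kink_small (by nlinarith), kink_small (by nlinarith)]
    nlinarith [mul_pos (sub_pos.2 hst) (by nlinarith : 0 < 4 - 4 * (s ^ 2 + s * t + t ^ 2))]
  · rintro t ⟨h1, h2⟩
    refine ⟨?_, kink_le (by linarith), by nlinarith⟩
    have n0 := step_nonneg (9/100) (4/25) (t ^ 2)
    have n1 := step_le_one (9/100) (4/25) (t ^ 2)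
    have h3 : t ^ 2 ≤ 81/100 := by nlinarith
    rw [kink, kinkFactor, step_of_le (a := 169/100) (by norm_num) (by linarith)]
    rcases le_total t 0 with h4 | h4
    · nlinarith [mul_nonneg (mul_nonneg (sub_nonneg.2 n1) (neg_nonneg.2 h4)) (neg_nonneg.2 h4),
        mul_nonneg (sub_nonneg.2 h3) (neg_nonneg.2 h4)]
    · nlinarith [mul_nonneg h4 (sq_nonneg t), mul_nonneg (sub_nonneg.2 n1) (sq_nonneg t)]
  · intro t ht h1
    rcases lt_or_ge t (-9/10) with h2 | h2
    · exact kink_side_left h2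
    · have h3 : 1/25 < t := by by_contra hc; exact ht ⟨h2, by linarith⟩
      rcases le_total t (3/10) with h4 | h4
      · rw [kink_small (by nlinarith)]
        nlinarith [mul_nonneg (by linarith : 0 ≤ t - 1/25) (by linarith : 0 ≤ 3/10 - t)]
      · linarith [kink_le_neg_one h4 h1.le]
  · rw [kink_mid (by norm_num) (by norm_num)]; norm_num
  · rw [kink_small (by norm_num)]; norm_num

/-- The part of `detour` that turns to the right of the axis and back, between its zeros `0` and
`1/2`. -/
lemma exists_well_detour : ∃ α ∈ Ioo (-1/5 : ℝ) (-3/100), ∃ β ∈ Ioo (53/100 : ℝ) (7/10),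
    IsWell univ (fun t => discOrigin.E (detour t) (-t ^ 2)) α β ∧
      IsWell univ (fun t => discOrigin.E (left detour t) (-t ^ 2)) α β := by
  refine left_well contDiff_detour.continuous (by norm_num) (by norm_num) (by norm_num) ?_
    (by rw [detour_of_le (by norm_num)]; norm_num)
    (by rw [detour_mid (by norm_num) (by norm_num)]; norm_num) (by norm_num) (by norm_num)
    (by norm_num) (by norm_num) ?_ ?_ (by norm_num) ?_ ?_ ?_ ?_
  · intro t ht
    have key : detour t ≤ -1 → t ≠ 0 → 1 < discOrigin.E (detour t) (-t ^ 2) := fun h3 h4 => by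
      have : 0 < t ^ 4 := by positivity
      rw [discOrigin_E, one_lt_div (by norm_num)]
      nlinarith
    rcases lt_or_ge t (-1/5) with h | h
    · exact key (by rw [detour_of_le (by linarith)]; linarith) (by linarith)
    · have h1 : 7/10 < t := by by_contra hc; exact ht ⟨h, by linarith⟩
      rcases le_total t (4/5) with h2 | h2
      · exact key (detour_bounds_right h1.le h2).2 (by linarith)
      · rcases le_or_gt t 1 with h3 | h3
        · exact key (by rw [detour_of_ge h2]; exact kink_le_neg_one (by linarith) h3) (by linarith)
        · rw [detour_of_ge h2]; exact kink_outside h3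
  · intro s hs t ht hst
    have h1 := hs.2
    have h2 := ht.2
    rw [detour_of_le (by linarith), detour_of_le (by linarith)]
    linarith
  · intro s hs t ht hst
    have h1 := hs.1
    have h2 := ht.2
    rw [detour_mid (by linarith) (by linarith), detour_mid (by linarith) (by linarith)]
    nlinarith
  · rintro t ⟨h1, h2⟩
    refine ⟨?_, detour_le (by linarith), by nlinarith⟩
    rcases le_total t (3/10) with h3 | h3
    · rw [detour_of_le h3]; linarith
    · have := (detour_bounds_left (t := t) (by linarith)).1
      nlinarith
  · intro t ht h1
    rcases lt_or_ge t (-3/100) with h2 | h2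
    · rw [detour_of_le (by linarith)]; linarith
    · have h3 : 53/100 < t := by by_contra hc; exact ht ⟨h2, by linarith⟩
      rcases le_total t (7/10) with h4 | h4
      · rw [detour_mid (by linarith) h4]; nlinarith
      rcases le_total t (4/5) with h5 | h5
      · linarith [(detour_bounds_right h4 h5).2]
      · rw [detour_of_ge h5]; linarith [kink_le_neg_one (by linarith) h1.le]
  · rw [detour_of_le (by norm_num)]; norm_num
  · rw [detour_mid (by norm_num) (by norm_num)]; norm_num

lemma discOrigin_zero_ne {p : ℝ → ℝ} (h : p 1 ≠ 0) (h' : p (-1) ≠ 0) {τ : ℝ}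
    (hE : discOrigin.E (p τ) (-τ ^ 2) = 1) : p τ ≠ 0 := by
  intro h0
  rw [discOrigin_E, h0] at hE
  have h1 : (τ ^ 2 - 1) * (τ ^ 2 + 1) = 0 := by linarith
  have h2 : τ ^ 2 = 1 := by nlinarith [(mul_eq_zero.1 h1).resolve_right (by positivity)]
  rcases sq_eq_sq_iff_eq_or_eq_neg.1 (h2.trans (one_pow 2).symm) with rfl | rfl
  exacts [h h0, h' h0]

lemma kink_neg_one : kink (-1) = -1 := by
  rw [kink_mid (by norm_num) (by norm_num)]; norm_num

lemma left_kink_one : left kink 1 = -1 := by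
  rw [left_of_ge le_rfl, kink_one]

lemma left_kink_neg_one : left kink (-1) = -1 := by
  rw [left_of_le (by rw [kink_neg_one]; norm_num), kink_neg_one]

lemma self_iff_of_pos {p : ℝ → ℝ} (h : ∀ t, 0 < t → (p t = p (-t) ↔ t = 1)) {τ : ℝ} (h0 : τ ≠ 0) :
    p τ = p (-τ) ↔ τ = 1 ∨ τ = -1 := by
  rcases lt_or_gt_of_ne h0 with h1 | h1
  · rw [eq_comm]
    have := h (-τ) (by linarith)
    rw [neg_neg] at this
    rw [this]
    constructor
    · intro h2; right; linarith
    · rintro (h2 | h2) <;> linarith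
  · rw [h τ h1]
    exact ⟨Or.inl, fun h2 => h2.elim id fun h3 => by linarith⟩

lemma left_kink_self_iff {t : ℝ} (h : 0 < t) : left kink t = left kink (-t) ↔ t = 1 :=
  (left_self_iff (fun _ h => by linarith [kink_of_le h]) h).trans (kink_self_iff h)

lemma left_detour_self_ne {t : ℝ} (h : 0 < t) : left detour t ≠ left detour (-t) := fun h1 =>
  detour_self_ne h ((left_self_iff (fun t h => by
    rw [detour_of_le (by linarith)]; linarith) h).1 h1)

lemma self_ne_of_pos {p : ℝ → ℝ} (h : ∀ t, 0 < t → p t ≠ p (-t)) {τ : ℝ} (h0 : τ ≠ 0) :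
    p τ ≠ p (-τ) := by
  rcases lt_or_gt_of_ne h0 with h1 | h1
  · intro h2; exact h (-τ) (by linarith) (by rw [neg_neg, h2])
  · exact h τ h1

end discOrigin

namespace LocalModel

variable {K : KnotoidDiagram} (M : LocalModel K)

/-- A kinked strand whose kink is on the left of the vertical axis is moved through the axis, so
that the axis then crosses the loop. -/
lemma reidemeister2_left_kink (hb : M.hasB) (o : ℝˣ) :
    Reidemeister2 (M.mod _ (flat_left_kink _) o) (M.mod _ (flat_kink _) o) := by
  obtain ⟨α, hα, β, hβ, hw, hw'⟩ := exists_well_kink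
  have hr := root_mem
  let S : Strands M.hasB discOrigin 2 := strandsAB hb discOrigin (α := α) (β := β) (γ := -1) (δ := 1)
    (by linarith [hα.2, hβ.1]) (by linarith [hα.1]) (by linarith [hβ.2]) (by norm_num)
    (by norm_num) (by norm_num) discOrigin_zero
  have e25 : discOrigin.E (-1) (-1 ^ 2) ≠ 1 := by rw [discOrigin_E]; norm_num
  have hs : ∀ p : ℝ → ℝ, p 1 = -1 → p (-1) = -1 → (∀ t, 0 < t → (p t = p (-t) ↔ t = 1)) →
      ∀ τ, discOrigin.E (p τ) (-τ ^ 2) = 1 → (τ ≠ 0 → p τ ≠ p (-τ)) ∧ p τ ≠ 0 := by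
    intro p h1 h2 h3 τ h4
    refine ⟨fun h0 h5 => ?_, discOrigin_zero_ne (by rw [h1]; norm_num) (by rw [h2]; norm_num) h4⟩
    rcases (self_iff_of_pos h3 h0).1 h5 with rfl | rfl
    · rw [h1] at h4; exact e25 h4
    · rw [h2, neg_sq] at h4; exact e25 h4
  have hf : S.Fits kink := fits_strandsAB hb _ _ _ _ _ _ _ hw
    (hs _ kink_one kink_neg_one fun t => kink_self_iff)
  have hf' : S.Fits (left kink) := fits_strandsAB hb _ _ _ _ _ _ _ hw'
    (hs _ left_kink_one left_kink_neg_one fun t => left_kink_self_iff)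
  refine Exists.imp (fun W h => h.1) (reidemeister2_AB S rfl rfl _ _ o hf' hf (fun τ hτ hi => ?_) (fun τ hτ hτ' h0 => ?_)
    (fun τ hτ => ?_) (z := 1/4 - root) (z' := 0) (fun τ => ?_) deriv_kink_root'
    (by rw [hasDerivAt_kink_zero.deriv]; norm_num))
  · have hi' : τ ∉ Ioo α β := hi 0 rfl
    rcases lt_or_ge τ 1 with h1 | h1
    · refine left_of_le ?_
      have h2 : τ ∉ Icc (-9/10) (1/25) := fun h =>
        hi' ⟨hα.2.trans_le h.1, h.2.trans_lt hβ.1⟩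
      rcases lt_or_ge τ (-9/10) with h3 | h3
      · exact kink_side_left h3
      · have h4 : 1/25 < τ := by by_contra hc; exact h2 ⟨h3, by linarith⟩
        rcases le_total τ (3/10) with h5 | h5
        · rw [kink_small (by nlinarith)]
          nlinarith [mul_nonneg (by linarith : 0 ≤ τ - 1/25) (by linarith : 0 ≤ 3/10 - τ)]
        · linarith [kink_le_neg_one h5 h1.le]
    · exact left_of_ge h1
  · have h1 : α < τ ∧ τ < β := hτ
    have h2 : α < -τ ∧ -τ < β := hτ'
    constructor
    · rw [Ne, self_iff_of_pos (fun t => left_kink_self_iff) h0]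
      rintro (rfl | rfl) <;> linarith [hα.1, hβ.2]
    · rw [Ne, self_iff_of_pos (fun t => kink_self_iff) h0]
      rintro (rfl | rfl) <;> linarith [hα.1, hβ.2]
  · have h1 : α < τ ∧ τ < β := hτ
    exact (left_neg (fun t h => by linarith [kink_le h]) (by linarith [hβ.2])).ne
  · show τ ∈ Ioo α β ∧ -τ ^ 2 ∈ Ioo (-1 : ℝ) 1 ∧ _ ↔ _
    constructor
    · rintro ⟨h1, -, h2⟩
      rcases kink_eq_zero_iff.1 h2 with h | h | h
      · exact Or.inr h
      · linarith [h1.2, hβ.2, hr.1]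
      · exact Or.inl h
    · have hm : ∀ t ∈ Icc (-9/10 : ℝ) (1/25), t ∈ Ioo α β ∧ -t ^ 2 ∈ Ioo (-1 : ℝ) 1 := fun t ht =>
        ⟨⟨hα.2.trans_le ht.1, ht.2.trans_lt hβ.1⟩, by nlinarith [ht.1, ht.2], by nlinarith⟩
      rintro (rfl | rfl)
      · obtain ⟨h1, h2⟩ := hm (1/4 - root) ⟨by linarith [hr.2], by linarith [hr.1]⟩
        exact ⟨h1, h2, kink_eq_zero_iff.2 (Or.inr (Or.inr rfl))⟩
      · obtain ⟨h1, h2⟩ := hm 0 ⟨by norm_num, by norm_num⟩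
        exact ⟨h1, h2, kink_eq_zero_iff.2 (Or.inl rfl)⟩

/-- The detour across the vertical axis is withdrawn completely to the left of it. The strand is
not affected at the coordinate `-4`. -/
lemma reidemeister2_left_detour (hb : M.hasB) (o : ℝˣ) :
    ∃ W : Window 2, W.Bigon (M.mod _ (flat_left_detour _) o) (M.mod _ (flat_detour _) o) ∧
      ∀ i, M.A (-4) ∉ Icc (W.a i) (W.b i) := by
  obtain ⟨α, hα, β, hβ, hw, hw'⟩ := exists_well_detour
  have hr := root_mem
  let S : Strands M.hasB discOrigin 2 := strandsAB hb discOrigin (α := α) (β := β) (γ := -1) (δ := 1)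
    (by linarith [hα.2, hβ.1]) (by linarith [hα.1]) (by linarith [hβ.2]) (by norm_num)
    (by norm_num) (by norm_num) discOrigin_zero
  have d1 : detour 1 = -1 := by rw [detour_of_ge (by norm_num), kink_one]
  have d2 : detour (-1) = -5 := by rw [detour_of_le (by norm_num)]; norm_num
  have hf : S.Fits detour := fits_strandsAB hb _ _ _ _ _ _ _ hw fun τ h =>
    ⟨self_ne_of_pos (fun t => detour_self_ne),
      discOrigin_zero_ne (by rw [d1]; norm_num) (by rw [d2]; norm_num) h⟩
  have hf' : S.Fits (left detour) := fits_strandsAB hb _ _ _ _ _ _ _ hw' fun τ h =>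
    ⟨self_ne_of_pos (fun t => left_detour_self_ne),
      discOrigin_zero_ne (by rw [left_of_ge le_rfl, d1]; norm_num)
        (by rw [left_of_le (by rw [d2]; norm_num), d2]; norm_num) h⟩
  refine Exists.imp (fun W h => ⟨h.1, h.2 (-4) (by norm_num [abs_lt]) fun hm =>
    absurd hm.1 (show ¬ α ≤ -4 by linarith [hα.1])⟩) (reidemeister2_AB S rfl rfl _ _ o hf' hf (fun τ hτ hi => ?_) (fun τ hτ hτ' h0 => ?_)
    (fun τ hτ => ?_) (z := 0) (z' := 1/2) (fun τ => ?_) deriv_detour_zero deriv_detour_half)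
  · have hi' : τ ∉ Ioo α β := hi 0 rfl
    rcases lt_or_ge τ 1 with h1 | h1
    · refine left_of_le ?_
      have h2 : τ ∉ Icc (-3/100) (53/100) := fun h =>
        hi' ⟨hα.2.trans_le h.1, h.2.trans_lt hβ.1⟩
      rcases lt_or_ge τ (-3/100) with h3 | h3
      · rw [detour_of_le (by linarith)]; linarith
      · have h4 : 53/100 < τ := by by_contra hc; exact h2 ⟨h3, by linarith⟩
        rcases le_total τ (7/10) with h5 | h5
        · rw [detour_mid (by linarith) h5]; nlinarith
        rcases le_total τ (4/5) with h6 | h6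
        · linarith [(detour_bounds_right h5 h6).2]
        · rw [detour_of_ge h6]; linarith [kink_le_neg_one (by linarith) h1.le]
    · exact left_of_ge h1
  · exact ⟨self_ne_of_pos (fun t => left_detour_self_ne) h0,
      self_ne_of_pos (fun t => detour_self_ne) h0⟩
  · have h1 : α < τ ∧ τ < β := hτ
    exact (left_neg (fun t h => by linarith [detour_le h]) (by linarith [hβ.2])).ne
  · show τ ∈ Ioo α β ∧ -τ ^ 2 ∈ Ioo (-1 : ℝ) 1 ∧ _ ↔ _
    constructor
    · rintro ⟨h1, -, h2⟩
      rcases detour_eq_zero_iff.1 h2 with h | h | h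
      · exact Or.inl h
      · exact Or.inr h
      · linarith [h1.2, hβ.2, hr.1]
    · have hm : ∀ t ∈ Icc (-3/100 : ℝ) (53/100), t ∈ Ioo α β ∧ -t ^ 2 ∈ Ioo (-1 : ℝ) 1 := fun t ht =>
        ⟨⟨hα.2.trans_le ht.1, ht.2.trans_lt hβ.1⟩, by nlinarith [ht.1, ht.2], by nlinarith⟩
      rintro (rfl | rfl)
      · obtain ⟨h1, h2⟩ := hm 0 ⟨by norm_num, by norm_num⟩
        exact ⟨h1, h2, detour_eq_zero_iff.2 (Or.inl rfl)⟩
      · obtain ⟨h1, h2⟩ := hm (1/2) ⟨by norm_num, by norm_num⟩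
        exact ⟨h1, h2, detour_eq_zero_iff.2 (Or.inr (Or.inl rfl))⟩

end LocalModel

/-! ### Sliding a kink through a crossing -/

/-- The disc for pulling the strand to the right and back over the vertical axis. -/
noncomputable def discDetour : Ellipse where
  X := 56/25
  Y := -2
  w := 8
  h := 199/100
  w_pos := by norm_num
  h_pos := by norm_num
  X_lt := by rw [abs_of_pos] <;> norm_num
  Y_lt := by rw [abs_of_neg] <;> norm_num

/-- The disc on the left of the vertical axis in which the kink is created. -/
noncomputable def discLeft : Ellipse where
  X := -5
  Y := 0
  w := 249/50
  h := 15
  w_pos := by norm_num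
  h_pos := by norm_num
  X_lt := by rw [abs_of_neg] <;> norm_num
  Y_lt := by norm_num

/-- The disc for moving the double point of the kink through the vertical axis. -/
noncomputable def discTriangle : Ellipse where
  X := 0
  Y := -103/100
  w := 24
  h := 1
  w_pos := by norm_num
  h_pos := by norm_num
  X_lt := by norm_num
  Y_lt := by rw [abs_of_neg] <;> norm_num

lemma discDetour_zero (v : ℝ) :
    (discDetour.E 0 v ≤ 1 ↔ v ∈ Icc (-2 - 24/25 * (199/100) : ℝ) (-2 + 24/25 * (199/100))) ∧
    (discDetour.E 0 v < 1 ↔ v ∈ Ioo (-2 - 24/25 * (199/100) : ℝ) (-2 + 24/25 * (199/100))) :=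
  discDetour.E_zero (κ := 24/25) (by norm_num) (by norm_num [discDetour]) v

lemma discTriangle_zero (v : ℝ) :
    (discTriangle.E 0 v ≤ 1 ↔ v ∈ Icc (-103/100 - 1 * 1 : ℝ) (-103/100 + 1 * 1)) ∧
    (discTriangle.E 0 v < 1 ↔ v ∈ Ioo (-103/100 - 1 * 1 : ℝ) (-103/100 + 1 * 1)) :=
  discTriangle.E_zero (κ := 1) (by norm_num) (by norm_num [discTriangle]) v

lemma one_lt_discLeft (v : ℝ) : 1 < discLeft.E 0 v := by
  simp only [Ellipse.E, discLeft]
  have : 0 ≤ ((v - 0) / 15) ^ 2 := sq_nonneg _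
  norm_num at this ⊢
  linarith

lemma discDetour_E (x t : ℝ) : discDetour.E x (-t ^ 2) =
    (x - 56/25) ^ 2 / 64 + (2 - t ^ 2) ^ 2 / (199/100) ^ 2 := by
  simp only [Ellipse.E, discDetour]; ring

lemma discLeft_E (x t : ℝ) : discLeft.E x (-t ^ 2) =
    (x + 5) ^ 2 / (249/50) ^ 2 + t ^ 4 / 225 := by
  simp only [Ellipse.E, discLeft]; ring

lemma discTriangle_E (x t : ℝ) : discTriangle.E x (-t ^ 2) =
    x ^ 2 / 576 + (103/100 - t ^ 2) ^ 2 := by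
  simp only [Ellipse.E, discTriangle]; ring

lemma discDetour_lt {x t : ℝ} {A B : ℝ} (h1 : (x - 56/25) ^ 2 ≤ A) (h2 : (2 - t ^ 2) ^ 2 ≤ B)
    (h : A / 64 + B / (199/100) ^ 2 < 1) : discDetour.E x (-t ^ 2) < 1 := by
  rw [discDetour_E]
  norm_num at h ⊢
  linarith

lemma kink_le_five_mul {t : ℝ} (h : 0 ≤ t) : kink t ≤ 5 * t := by
  rcases le_total (t ^ 2) (49/25) with h1 | h1
  · have n0 := step_nonneg (169/100) (49/25) (t ^ 2)
    have n1 := step_le_one (169/100) (49/25) (t ^ 2)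
    have m0 := step_nonneg (9/100) (4/25) (t ^ 2)
    have : kinkFactor t ≤ 5 := by
      unfold kinkFactor
      nlinarith [mul_nonneg (sub_nonneg.2 n1)
        (by nlinarith [mul_nonneg m0 h] : 0 ≤ 5 - (4 * t ^ 2 - step (9/100) (4/25) (t ^ 2) * t - 4))]
    rw [kink]; nlinarith
  · rw [kink_of_sq_ge h1]

lemma detour_core {t : ℝ} (h : 3/10 ≤ t) (h' : t ≤ 71/50) :
    discDetour.E (detour t) (-t ^ 2) < 1 := by
  have key : ∀ {l u A m : ℝ}, l ≤ detour t → detour t ≤ u → (l - 56/25) ^ 2 ≤ A →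
      (u - 56/25) ^ 2 ≤ A → m ^ 2 ≤ t ^ 2 → t ^ 2 ≤ 4 - m ^ 2 →
      A / 64 + (2 - m ^ 2) ^ 2 / (199/100) ^ 2 < 1 → discDetour.E (detour t) (-t ^ 2) < 1 := by
    intro l u A m h1 h2 h3 h4 h5 h6 h7
    refine discDetour_lt (A := A) ?_ ?_ h7
    · rcases le_total (detour t) (56/25) with h8 | h8 <;> nlinarith
    · nlinarith
  rcases le_total t (2/5) with h1 | h1
  · obtain ⟨h2, h3⟩ := detour_bounds_left (t := t) (by linarith)
    exact key (l := 2/5) (u := 2) (A := (46/25) ^ 2) (m := 3/10) (by nlinarith) (by linarith)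
      (by norm_num) (by norm_num) (by nlinarith) (by nlinarith) (by norm_num)
  rcases le_total t (1/2) with h2 | h2
  · obtain ⟨h3, h4⟩ := detour_bounds_left (t := t) (by linarith)
    exact key (l := 0) (u := 5/2) (A := (56/25) ^ 2) (m := 2/5) (by nlinarith) (by linarith)
      (by norm_num) (by norm_num) (by nlinarith) (by nlinarith) (by norm_num)
  rcases le_total t (3/5) with h3 | h3
  · rw [detour_mid h1 (by linarith)] at *
    exact key (l := -3/5) (u := 0) (A := (71/25) ^ 2) (m := 1/2) (by nlinarith) (by nlinarith)
      (by norm_num) (by norm_num) (by nlinarith) (by nlinarith) (by norm_num)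
  rcases le_total t (7/10) with h4 | h4
  · rw [detour_mid h1 (by linarith)] at *
    exact key (l := -7/5) (u := 0) (A := (91/25) ^ 2) (m := 3/5) (by nlinarith) (by nlinarith)
      (by norm_num) (by norm_num) (by nlinarith) (by nlinarith) (by norm_num)
  rcases le_total t (4/5) with h5 | h5
  · obtain ⟨h6, h7⟩ := detour_bounds_right h4 h5
    exact key (l := -12/5) (u := -1) (A := (116/25) ^ 2) (m := 7/10) h6 h7
      (by norm_num) (by norm_num) (by nlinarith) (by nlinarith) (by norm_num)
  · have h6 := kink_ge (t := t) (by linarith)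
    have h7 := kink_le_five_mul (t := t) (by linarith)
    rw [detour_of_ge h5] at *
    exact key (l := -2) (u := 71/10) (A := (243/50) ^ 2) (m := 4/5) h6 (by linarith)
      (by norm_num) (by norm_num) (by nlinarith) (by nlinarith) (by norm_num)

lemma base_core {t : ℝ} (h : 3/10 ≤ t) (h' : t ≤ 71/50) :
    discDetour.E (5 * t) (-t ^ 2) < 1 := by
  have h0 : 9/100 ≤ t ^ 2 := by nlinarith
  have h0' : t ^ 2 ≤ 21/10 := by nlinarith
  rcases le_total t (1/2) with h1 | h1
  · exact discDetour_lt (A := 1) (B := (191/100) ^ 2) (by nlinarith) (by nlinarith) (by norm_num)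
  rcases le_total t 1 with h2 | h2
  · have h3 : 1/4 ≤ t ^ 2 := by nlinarith
    exact discDetour_lt (A := 9) (B := (7/4) ^ 2) (by nlinarith) (by nlinarith) (by norm_num)
  · have h3 : 1 ≤ t ^ 2 := by nlinarith
    exact discDetour_lt (A := (243/50) ^ 2) (B := 1) (by nlinarith) (by nlinarith) (by norm_num)

lemma base_outside {t : ℝ} (h : t < 0) : 1 < discDetour.E (5 * t) (-t ^ 2) := by
  obtain ⟨u, rfl⟩ : ∃ u, t = -u := ⟨-t, by ring⟩
  have hu : 0 < u := by linarith
  rw [discDetour_E]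
  norm_num
  rcases le_total u (29/50) with h1 | h1
  · nlinarith [sq_nonneg u]
  rcases le_total u (247/100) with h2 | h2
  · nlinarith [sq_nonneg (u ^ 2 - 1), mul_nonneg (sub_nonneg.2 h1) (sub_nonneg.2 h2)]
  · nlinarith [mul_pos hu hu]

/-- The part of `detour` that turns back to the left of the axis, between its zeros `1/2` and
`root`, compared with the straight strand. -/
lemma exists_well_base : ∃ α ∈ Ioo (0 : ℝ) (3/10), ∃ β ∈ Ioo (71/50 : ℝ) 2,
    IsWell univ (fun t => discDetour.E (5 * t) (-t ^ 2)) α β ∧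
      IsWell univ (fun t => discDetour.E (detour t) (-t ^ 2)) α β := by
  refine exists_isWell (by norm_num) (by norm_num) (by norm_num)
    (discDetour.continuous_E (by fun_prop)) (fun t _ ht => ?_) ?_ ?_ ?_ ?_
    (fun t ht => base_core ht.1 ht.2) (fun t ht => detour_core ht.1 ht.2) (fun t _ ht => ?_)
  · rcases lt_or_ge t 0 with h | h
    · exact base_outside h
    · have h1 : 2 < t := by by_contra hc; exact ht ⟨h, by linarith⟩
      rw [discDetour_E]; norm_num; nlinarith [sq_nonneg (5 * t - 56/25), sq_nonneg (t ^ 2 - 4)]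
  · rw [discDetour_E]; norm_num
  · rw [discDetour_E]; norm_num
  · intro s hs t ht hst
    have h1 := hs.1
    have h2 := ht.2
    apply discDetour.E_lt_of_fst
    · show (5 * t - 56/25) ^ 2 < (5 * s - 56/25) ^ 2
      nlinarith
    · show (-t ^ 2 - -2) ^ 2 ≤ (-s ^ 2 - -2) ^ 2
      have h3 : s ^ 2 ≤ t ^ 2 := by nlinarith
      have h4 : t ^ 2 ≤ 1 := by nlinarith [ht.1]
      nlinarith [mul_nonneg (sub_nonneg.2 h3) (by linarith : 0 ≤ 4 - s ^ 2 - t ^ 2)]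
  · intro s hs t ht hst
    have h1 := hs.1
    have h2 := ht.2
    apply discDetour.E_lt_of_fst
    · show (5 * s - 56/25) ^ 2 < (5 * t - 56/25) ^ 2
      nlinarith
    · show (-s ^ 2 - -2) ^ 2 ≤ (-t ^ 2 - -2) ^ 2
      have h3 : s ^ 2 ≤ t ^ 2 := by nlinarith
      have h4 : 2 ≤ s ^ 2 := by nlinarith
      nlinarith [mul_nonneg (sub_nonneg.2 h3) (by linarith : 0 ≤ s ^ 2 + t ^ 2 - 4)]
  · show discDetour.E (detour t) _ = _
    rcases lt_or_ge t (3/10) with h | h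
    · rw [detour_of_le h.le]
    · have h1 : 71/50 < t := by by_contra hc; exact ht ⟨h, by linarith⟩
      rw [detour_of_ge (by linarith), kink_of_sq_ge (by nlinarith)]

lemma left_kink_core {x t : ℝ} (h1 : -9 ≤ x) (h2 : x ≤ -1/25)
    (h3 : t ^ 2 ≤ 121/100 ∨ x ≤ -1 ∧ t ^ 2 ≤ 49/25) : discLeft.E x (-t ^ 2) < 1 := by
  rw [discLeft_E]
  norm_num
  rcases h3 with h3 | ⟨h3, h4⟩
  · have : t ^ 4 ≤ (121/100) ^ 2 := by nlinarith [sq_nonneg t]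
    nlinarith
  · have : t ^ 4 ≤ (49/25) ^ 2 := by nlinarith [sq_nonneg t]
    nlinarith

/-- The part of the squeezed strands on the left of the axis, with or without the kink. -/
lemma exists_well_left : ∃ α ∈ Ioo (-2 : ℝ) (-7/5), ∃ β ∈ Ioo (1 : ℝ) (113/100),
    IsWell univ (fun t => discLeft.E (left kink t) (-t ^ 2)) α β ∧
      IsWell univ (fun t => discLeft.E (left detour t) (-t ^ 2)) α β := by
  have hlk : ∀ t ≤ (-7/5 : ℝ), left kink t = 5 * t := fun t ht => by
    rw [left_of_le (by linarith [kink_of_le (t := t) (by linarith)]), kink_of_sq_ge (by nlinarith)]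
  have d1 : detour 1 = -1 := by rw [detour_of_ge (by norm_num), kink_one]
  have core : ∀ (p : ℝ → ℝ) {t : ℝ}, -9 ≤ p t → (∀ t < 1, p t ≤ 2) → t ∈ Icc (-7/5 : ℝ) 1 →
      p 1 = -1 → (∀ t ≤ -1, p t ≤ -1) →
      discLeft.E (left p t) (-t ^ 2) < 1 := by
    intro p t h1 h2 ht h4 h3
    rcases ht.2.lt_or_eq with h6 | rfl
    · refine left_kink_core ?_ ?_ ?_
      · rw [left_of_lt h6, ← squeeze_of_le (X := -9) (by norm_num)]
        exact strictMono_squeeze.monotone h1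
      · rw [left_of_lt h6]
        have := strictMono_squeeze.monotone (h2 t h6)
        rw [squeeze_of_ge (X := 2) (by norm_num)] at this
        linarith
      · rcases le_total t (-11/10) with h7 | h7
        · have h8 := h3 t (by linarith)
          exact Or.inr ⟨by rw [left_of_le (by linarith)]; exact h8, by nlinarith [ht.1]⟩
        · exact Or.inl (by nlinarith)
    · rw [left_of_ge le_rfl, h4]
      exact left_kink_core (by norm_num) (by norm_num) (Or.inl (by norm_num))
  refine exists_isWell (by norm_num) (by norm_num) (by norm_num)
    (discLeft.continuous_E (flat_left_kink True).smooth.continuous) (fun t _ ht => ?_) ?_ ?_ ?_ ?_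
    (fun t ht => ?_) (fun t ht => ?_) (fun t _ ht => ?_)
  · rcases lt_or_ge t (-2) with h | h
    · rw [hlk t (by linarith), discLeft_E]
      have : (0 : ℝ) ≤ t ^ 4 := by positivity
      norm_num
      nlinarith
    · have h1 : 113/100 < t := by by_contra hc; exact ht ⟨h, by linarith⟩
      have h2 : -13/500 ≤ kink t := by
        rcases le_total (t ^ 2) (169/100) with h3 | h3
        · rw [kink_mid (by nlinarith) h3]
          nlinarith [mul_nonneg (sub_nonneg.2 h1.le) (by nlinarith : 0 ≤ 4 * t ^ 2 + t)]
        · linarith [mul_pos (by linarith : 0 < t) (kinkFactor_pos h3),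
            show kink t = t * kinkFactor t from rfl]
      rw [left_of_ge (by linarith), discLeft_E]
      have h3 : (127/100 : ℝ) ≤ t ^ 2 := by nlinarith
      have h4 : (161/100 : ℝ) ≤ t ^ 4 := by nlinarith
      norm_num
      nlinarith
  · rw [hlk _ (by norm_num), discLeft_E]; norm_num
  · rw [left_of_ge (by norm_num), kink_mid (by norm_num) (by norm_num), discLeft_E]; norm_num
  · intro s hs t ht hst
    have h1 := hs.1
    have h2 := ht.2
    apply discLeft.E_lt_of_fst
    · show (left kink t - -5) ^ 2 < (left kink s - -5) ^ 2
      rw [hlk _ hs.2, hlk _ ht.2]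
      nlinarith
    · show (-t ^ 2 - 0) ^ 2 ≤ (-s ^ 2 - 0) ^ 2
      have : t ^ 2 ≤ s ^ 2 := by nlinarith
      nlinarith [sq_nonneg t]
  · intro s hs t ht hst
    have h1 := hs.1
    have h2 := ht.2
    apply discLeft.E_lt_of_fst
    · show (left kink s - -5) ^ 2 < (left kink t - -5) ^ 2
      have h3 : kink s < kink t := by
        rw [kink_mid (by nlinarith) (by nlinarith [hs.2]),
          kink_mid (by nlinarith [ht.1]) (by nlinarith)]
        nlinarith [mul_pos (sub_pos.2 hst)
          (by nlinarith [ht.1] : 0 < 4 * (s ^ 2 + s * t + t ^ 2) - (s + t) - 4)]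
      rw [left_of_ge hs.1, left_of_ge ht.1]
      nlinarith [kink_ge (t := s) (by linarith)]
    · show (-s ^ 2 - 0) ^ 2 ≤ (-t ^ 2 - 0) ^ 2
      have : s ^ 2 ≤ t ^ 2 := by nlinarith
      nlinarith [sq_nonneg s]
  · refine core kink ?_ (fun _ h => kink_le h) ht kink_one fun _ h => kink_of_le h
    linarith [(abs_le.1 (abs_kink_le (t := t) (by nlinarith [ht.1, ht.2]))).1]
  · refine core detour ?_ (fun _ h => detour_le h) ht d1 ?_
    · rcases le_total t (3/10) with h | h
      · rw [detour_of_le h]; linarith [ht.1]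
      rcases le_total t (7/10) with h2 | h2
      · nlinarith [(detour_bounds_left h2).1]
      rcases le_total t (4/5) with h3 | h3
      · linarith [(detour_bounds_right h2 h3).1]
      · rw [detour_of_ge h3]; linarith [kink_ge (t := t) (by linarith)]
    · intro t h; rw [detour_of_le (by linarith)]; linarith
  · show discLeft.E (left detour t) _ = discLeft.E (left kink t) _
    rcases lt_or_ge t (-7/5) with h | h
    · rw [hlk _ h.le, left_of_le (by rw [detour_of_le (by linarith)]; linarith),
        detour_of_le (by linarith)]
    · have h1 : 1 < t := by by_contra hc; exact ht ⟨h, by linarith⟩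
      rw [left_of_ge h1.le, left_of_ge h1.le, detour_of_ge (by linarith)]

namespace LocalModel

variable {K : KnotoidDiagram} (M : LocalModel K)

/-- Behind its crossing with the vertical axis, the strand is pulled back over the axis. It is not
affected at the coordinate `-4`. -/
lemma reidemeister2_base_detour (hb : M.hasB) (o : ℝˣ) :
    ∃ W : Window 2, W.Bigon (M.mod _ (flat_base _) o) (M.mod _ (flat_detour _) o) ∧
      ∀ i, M.A (-4) ∉ Icc (W.a i) (W.b i) := by
  obtain ⟨α, hα, β, hβ, hw, hw'⟩ := exists_well_base
  have hr := root_mem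
  let S : Strands M.hasB discDetour 2 := strandsAB hb discDetour (α := α) (β := β)
    (by linarith [hα.2, hβ.1]) (by linarith [hα.1]) (by linarith [hβ.2]) (by norm_num)
    (by norm_num) (by norm_num) discDetour_zero
  have hmem : ∀ t ∈ Icc (3/10 : ℝ) (71/50), t ∈ Ioo α β := fun t ht =>
    ⟨hα.2.trans_le ht.1, ht.2.trans_lt hβ.1⟩
  have hf : S.Fits fun t => 5 * t := fits_strandsAB hb _ _ _ _ _ _ _ hw fun τ h =>
    ⟨fun h0 h1 => h0 (by linarith), fun h0 => by
      have : τ = 0 := by linarith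
      rw [this, discDetour_E] at h
      norm_num at h⟩
  have hf' : S.Fits detour := fits_strandsAB hb _ _ _ _ _ _ _ hw' fun τ h =>
    ⟨self_ne_of_pos (fun t => detour_self_ne), fun h0 => by
      rcases detour_eq_zero_iff.1 h0 with rfl | h1 | h1
      · rw [h0, discDetour_E] at h
        norm_num at h
      · exact (detour_core (t := τ) (by rw [h1]; norm_num) (by rw [h1]; norm_num)).ne h
      · exact (detour_core (t := τ) (by linarith [hr.1]) (by linarith [hr.2])).ne h⟩
  refine Exists.imp (fun W h => ⟨h.1, h.2 (-4) (by norm_num [abs_lt]) fun hm =>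
    absurd hm.1 (show ¬ α ≤ -4 by linarith [hα.1])⟩) (reidemeister2_AB S rfl rfl _ _ o hf hf' (fun τ hτ hi => ?_) (fun τ hτ hτ' h0 => ?_)
    (fun τ hτ => ?_) (z := root) (z' := 1/2) (fun τ => ?_) deriv_detour_root deriv_detour_half)
  · have hi' : τ ∉ Ioo α β := hi 0 rfl
    rcases lt_or_ge τ (3/10) with h | h
    · rw [detour_of_le h.le]
    · have h1 : 71/50 < τ := by by_contra hc; exact hi' (hmem τ ⟨h, by linarith⟩)
      rw [detour_of_ge (by linarith), kink_of_sq_ge (by nlinarith)]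
  · exact ⟨fun h => h0 (by linarith), self_ne_of_pos (fun t => detour_self_ne) h0⟩
  · have h1 : α < τ ∧ τ < β := hτ
    have := hα.1
    show 5 * τ ≠ 0
    linarith
  · show τ ∈ Ioo α β ∧ -τ ^ 2 ∈ Ioo (-2 - 24/25 * (199/100) : ℝ) (-2 + 24/25 * (199/100)) ∧ _ ↔ _
    constructor
    · rintro ⟨h1, -, h2⟩
      rcases detour_eq_zero_iff.1 h2 with h | h | h
      · linarith [h1.1, hα.1]
      · exact Or.inr h
      · exact Or.inl h
    · rintro (rfl | rfl)
      · exact ⟨hmem _ ⟨by linarith [hr.1], by linarith [hr.2]⟩,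
          ⟨by nlinarith [hr.1, hr.2], by nlinarith [hr.1, hr.2]⟩,
          detour_eq_zero_iff.2 (Or.inr (Or.inr rfl))⟩
      · exact ⟨hmem _ ⟨by norm_num, by norm_num⟩, ⟨by norm_num, by norm_num⟩,
          detour_eq_zero_iff.2 (Or.inr (Or.inl rfl))⟩

/-- A kink is created on the left of the vertical axis, which is not involved. -/
lemma kinkAt_left (o : ℝˣ) : KinkAt (SignType.sign (M.orient * o) : SignType)
    (M.mod _ (flat_left_detour _) o) M.t₀ (M.mod _ (flat_left_kink _) o) := by
  obtain ⟨α, hα, β, hβ, hw, hw'⟩ := exists_well_left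
  let S : Strands M.hasB discLeft 1 := strandsA M.hasB discLeft (α := α) (β := β)
    (by linarith [hα.2, hβ.1]) (by linarith [hα.1]) (by linarith [hβ.2]) fun _ => one_lt_discLeft
  have hmem : ∀ t ∈ Icc (-7/5 : ℝ) 1, t ∈ Ioo α β := fun t ht =>
    ⟨hα.2.trans_le ht.1, ht.2.trans_lt hβ.1⟩
  have hf : S.Fits (left kink) := fits_strandsA _ _ _ _ hw fun τ h h0 h1 => by
    rcases (self_iff_of_pos (fun t => left_kink_self_iff) h0).1 h1 with rfl | rfl
    · exact lt_irrefl _ (((hw 1 trivial).2.2 (hmem 1 ⟨by norm_num, le_rfl⟩)).trans_eq h.symm)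
    · exact lt_irrefl _ (((hw (-1) trivial).2.2
        (hmem (-1) ⟨by norm_num, by norm_num⟩)).trans_eq h.symm)
  have hf' : S.Fits (left detour) := fits_strandsA _ _ _ _ hw' fun τ _ =>
    self_ne_of_pos (fun t => left_detour_self_ne)
  have hd : ∀ t, kink t = -1 → deriv (left kink) t = deriv kink t := fun t ht =>
    (left_eventuallyEq contDiff_kink.continuous (Or.inl (by rw [ht]; norm_num))).deriv_eq
  have key := kinked_mod S rfl (flat_left_detour _) (flat_left_kink _) o hf' hf (fun τ hτ hi => ?_)
    (fun τ _ _ h0 => left_detour_self_ne h0) one_pos (hmem 1 ⟨by norm_num, le_rfl⟩)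
    (hmem (-1) ⟨by norm_num, by norm_num⟩) fun τ _ _ h0 => left_kink_self_iff h0
  · rwa [hd 1 kink_one, hd (-1) kink_neg_one, ← mul_assoc, sign_mul _ (_ + _),
      sign_pos deriv_kink_self, mul_one] at key
  · have hi' : τ ∉ Ioo α β := hi 0 rfl
    rcases lt_or_ge τ (-7/5) with h | h
    · rw [left_of_le (by rw [detour_of_le (by linarith)]; linarith), detour_of_le (by linarith),
        left_of_le (by linarith [kink_of_le (t := τ) (by linarith)]), kink_of_sq_ge (by nlinarith)]
    · have h1 : 1 < τ := by by_contra hc; exact hi' (hmem τ ⟨h, by linarith⟩)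
      rw [left_of_ge h1.le, left_of_ge h1.le, detour_of_ge (by linarith)]

lemma kink_neg_of_not_mem {t : ℝ} (h : t ∉ Icc (3/10 : ℝ) (7/5)) (h0 : 0 ≤ t) :
    kink (-t) = -kink t := by
  rcases lt_or_ge t (3/10) with h1 | h1
  · rw [kink_small (by nlinarith), kink_small (by nlinarith)]; ring
  · have h2 : 7/5 < t := by by_contra hc; exact h ⟨h1, by linarith⟩
    rw [kink_of_sq_ge (by nlinarith), kink_of_sq_ge (by nlinarith)]; ring

lemma discTriangle_neg (x t : ℝ) : discTriangle.E (-x) (-t ^ 2) = discTriangle.E x (-t ^ 2) := by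
  simp only [discTriangle_E, neg_sq]

lemma triangle_core {x t : ℝ} (h1 : |x| ≤ 77/10) (h2 : 9/100 ≤ t ^ 2) (h3 : t ^ 2 ≤ 49/25) :
    discTriangle.E x (-t ^ 2) < 1 := by
  have : x ^ 2 ≤ (77/10) ^ 2 := sq_le_sq' (abs_le.1 h1).1 (abs_le.1 h1).2
  rw [discTriangle_E]
  nlinarith

/-- The two halves of the kinked strand, around its double point at `±1` and its zeros. -/
lemma exists_well_triangle : ∃ α ∈ Ioo (0 : ℝ) (3/10), ∃ β ∈ Ioo (7/5 : ℝ) 2,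
    IsWell (Ici 0) (fun t => discTriangle.E (kink t) (-t ^ 2)) α β ∧
      IsWell (Ici 0) (fun t => discTriangle.E (kink (-t)) (-t ^ 2)) α β := by
  refine exists_isWell (by norm_num) (by norm_num) (by norm_num)
    (discTriangle.continuous_E contDiff_kink.continuous) (fun t ht0 ht => ?_) ?_ ?_ ?_ ?_
    (fun t ht => ?_) (fun t ht => ?_) (fun t ht0 ht => ?_)
  · have h1 : 2 < t := by by_contra hc; exact ht ⟨ht0, by linarith⟩
    have h2 : 4 ≤ t ^ 2 := by nlinarith
    rw [discTriangle_E]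
    nlinarith [sq_nonneg (kink t)]
  · rw [kink_small (by norm_num), discTriangle_E]; norm_num
  · rw [kink_of_sq_ge (by norm_num), discTriangle_E]; norm_num
  · intro s hs t ht hst
    have h1 := hs.1
    have h2 := ht.2
    show discTriangle.E (kink t) _ < discTriangle.E (kink s) _
    rw [kink_small (by nlinarith), kink_small (by nlinarith [hs.2]), discTriangle_E, discTriangle_E]
    have h3 : s ^ 2 < t ^ 2 := by nlinarith
    have h4 : t ^ 2 ≤ 9/100 := by nlinarith
    set S := s ^ 2 with hS
    set T := t ^ 2 with hT
    have e1 : (4 * t ^ 3 - 4 * t) ^ 2 = 16 * (T * (1 - T) ^ 2) := by rw [hT]; ring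
    have e2 : (4 * s ^ 3 - 4 * s) ^ 2 = 16 * (S * (1 - S) ^ 2) := by rw [hS]; ring
    have h5 : 0 ≤ S := sq_nonneg s
    have h6 : T * (1 - T) ^ 2 - S * (1 - S) ^ 2 ≤ T - S := by
      have : T * (1 - T) ^ 2 - S * (1 - S) ^ 2 =
        (T - S) * (1 - (T + S) * 2 + (T ^ 2 + T * S + S ^ 2)) := by ring
      rw [this]
      nlinarith [mul_nonneg (sub_nonneg.2 h3.le)
        (by nlinarith : 0 ≤ (T + S) * 2 - (T ^ 2 + T * S + S ^ 2))]
    rw [e1, e2]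
    nlinarith
  · intro s hs t ht hst
    have h1 := hs.1
    show discTriangle.E (kink s) _ < discTriangle.E (kink t) _
    rw [kink_of_sq_ge (by nlinarith), kink_of_sq_ge (by nlinarith [ht.1])]
    apply discTriangle.E_lt_of_fst
    · show (5 * s - 0) ^ 2 < (5 * t - 0) ^ 2
      nlinarith
    · show (-s ^ 2 - -103/100) ^ 2 ≤ (-t ^ 2 - -103/100) ^ 2
      have h3 : s ^ 2 ≤ t ^ 2 := by nlinarith
      have h4 : 49/25 ≤ s ^ 2 := by nlinarith
      nlinarith [mul_nonneg (sub_nonneg.2 h3) (by linarith : 0 ≤ s ^ 2 + t ^ 2 - 103/50)]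
  · exact triangle_core (abs_kink_le (by nlinarith [ht.1, ht.2])) (by nlinarith [ht.1])
      (by nlinarith [ht.1, ht.2])
  · exact triangle_core (abs_kink_le (by nlinarith [ht.1, ht.2])) (by nlinarith [ht.1])
      (by nlinarith [ht.1, ht.2])
  · show discTriangle.E (kink (-t)) _ = _
    rw [kink_neg_of_not_mem ht ht0, discTriangle_neg]

/-- The double point of the kink is moved through the vertical axis, which crosses the loop. -/
lemma reidemeister3_kink (hb : M.hasB) (o : ℝˣ) :
    Reidemeister3 (M.mod _ (flat_kink _) o) (M.mod _ (flat_kink _).reflect o) := by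
  obtain ⟨α, hα, β, hβ, hw, hw'⟩ := exists_well_triangle
  have hr := root_mem
  let S : Strands M.hasB discTriangle 3 := strandsAAB hb discTriangle (α := α) (β := β)
    (by linarith [hα.2, hβ.1]) hα.1 (by linarith [hβ.2]) (by norm_num)
    (by norm_num) (by norm_num) discTriangle_zero
  have hmem : ∀ t ∈ Icc (3/10 : ℝ) (7/5), t ∈ Ioo α β := fun t ht =>
    ⟨hα.2.trans_le ht.1, ht.2.trans_lt hβ.1⟩
  have hmem' : ∀ t, -t ∈ Icc (3/10 : ℝ) (7/5) → t ∈ Ioo (-β) (-α) := fun t ht =>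
    mem_neg_interval.2.2 (hmem _ ht)
  have hE : ∀ τ : ℝ, discTriangle.E (kink τ) (-τ ^ 2) = 1 →
      (τ ≠ 0 → kink τ ≠ kink (-τ)) ∧ kink τ ≠ 0 := by
    intro τ h
    have hne : ∀ t : ℝ, 9/100 ≤ t ^ 2 → t ^ 2 ≤ 49/25 → τ ≠ t := fun t h1 h2 h3 => by
      subst h3
      exact (triangle_core (abs_kink_le h2) h1 h2).ne h
    refine ⟨fun h0 h1 => ?_, fun h1 => ?_⟩
    · rcases (self_iff_of_pos (fun t => kink_self_iff) h0).1 h1 with h2 | h2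
      · exact hne 1 (by norm_num) (by norm_num) h2
      · exact hne (-1) (by norm_num) (by norm_num) h2
    · rcases kink_eq_zero_iff.1 h1 with h2 | h2 | h2
      · subst h2
        rw [h1, discTriangle_E] at h
        norm_num at h
      · exact hne root (by nlinarith [hr.1]) (by nlinarith [hr.1, hr.2]) h2
      · exact hne _ (by nlinarith [hr.1]) (by nlinarith [hr.1, hr.2]) h2
  have hf : S.Fits kink := fits_strandsAAB hb _ _ _ _ _ _ _ hw hw' hE
  have hf' : S.Fits fun t => -kink (-t) := by
    refine fits_strandsAAB hb _ _ _ _ _ _ _ ?_ ?_ fun τ h => ?_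
    · simpa only [discTriangle_neg] using hw'
    · simpa only [discTriangle_neg, neg_neg] using hw
    · have := hE (-τ) (by rw [neg_sq]; simpa only [discTriangle_neg] using h)
      rw [neg_neg] at this
      exact ⟨fun h0 h1 => this.1 (neg_ne_zero.2 h0) (by simp only [neg_neg] at h1; linarith),
        neg_ne_zero.2 this.2⟩
  have hd : ∀ t, deriv (fun t => -kink (-t)) t = deriv kink (-t) := fun t => by
    rw [deriv.fun_neg, deriv_comp_neg, neg_neg]
  let T : Triangle S kink :=
    { σ := 1
      self := fun τ => by
        show τ ∈ Ioo α β ∧ -τ ∈ Ioo (-β) (-α) ∧ _ ↔ _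
        constructor
        · rintro ⟨h1, -, h2⟩
          exact (kink_self_iff (hα.1.trans h1.1)).1 h2
        · rintro rfl
          exact ⟨hmem 1 ⟨by norm_num, by norm_num⟩, hmem' _ ⟨by norm_num, by norm_num⟩,
            (kink_self_iff one_pos).2 rfl⟩
      self_pos := deriv_kink_self
      z := ![root, 1/4 - root, 0]
      zero := fun i hi τ => by
        fin_cases i
        · show τ ∈ Ioo α β ∧ -τ ^ 2 ∈ Ioo (-103/100 - 1 * 1 : ℝ) (-103/100 + 1 * 1) ∧ _ ↔ τ = root
          constructor
          · rintro ⟨h1, -, h2⟩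
            rcases kink_eq_zero_iff.1 h2 with h | h | h
            · linarith [h1.1, hα.1]
            · exact h
            · linarith [h1.1, hα.1, hr.1]
          · rintro rfl
            exact ⟨hmem _ ⟨by linarith [hr.1], by linarith [hr.2]⟩,
              ⟨by nlinarith [hr.1, hr.2], by nlinarith [hr.1]⟩,
              kink_eq_zero_iff.2 (Or.inr (Or.inl rfl))⟩
        · show τ ∈ Ioo (-β) (-α) ∧ -τ ^ 2 ∈ Ioo (-103/100 - 1 * 1 : ℝ) (-103/100 + 1 * 1) ∧ _ ↔
            τ = 1/4 - root
          constructor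
          · rintro ⟨h1, -, h2⟩
            rcases kink_eq_zero_iff.1 h2 with h | h | h
            · linarith [h1.2, hα.1]
            · linarith [h1.2, hα.1, hr.1]
            · exact h
          · rintro rfl
            exact ⟨hmem' _ ⟨by linarith [hr.1], by linarith [hr.2]⟩,
              ⟨by nlinarith [hr.1, hr.2], by nlinarith [hr.1]⟩,
              kink_eq_zero_iff.2 (Or.inr (Or.inr rfl))⟩
        · exact absurd rfl hi
      zero_pos := fun i hi => by
        fin_cases i
        exacts [deriv_kink_root, deriv_kink_root', absurd rfl hi] }
  let T' : Triangle S fun t => -kink (-t) :=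
    { σ := 1
      self := fun τ => by
        show τ ∈ Ioo α β ∧ -τ ∈ Ioo (-β) (-α) ∧ _ ↔ _
        have e : -kink (-τ) = -kink (- -τ) ↔ kink τ = kink (-τ) := by
          rw [neg_inj, neg_neg, eq_comm]
        rw [e]
        constructor
        · rintro ⟨h1, -, h2⟩
          exact (kink_self_iff (hα.1.trans h1.1)).1 h2
        · rintro rfl
          exact ⟨hmem 1 ⟨by norm_num, by norm_num⟩, hmem' _ ⟨by norm_num, by norm_num⟩,
            (kink_self_iff one_pos).2 rfl⟩
      self_pos := by rw [hd, hd, add_comm, neg_neg]; exact deriv_kink_self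
      z := ![root - 1/4, -root, 0]
      zero := fun i hi τ => by
        fin_cases i
        · show τ ∈ Ioo α β ∧ -τ ^ 2 ∈ Ioo (-103/100 - 1 * 1 : ℝ) (-103/100 + 1 * 1) ∧
            -kink (-τ) = 0 ↔ τ = root - 1/4
          rw [neg_eq_zero]
          constructor
          · rintro ⟨h1, -, h2⟩
            rcases kink_eq_zero_iff.1 h2 with h | h | h
            · linarith [h1.1, hα.1]
            · linarith [h1.1, hα.1, hr.1]
            · linarith
          · rintro rfl
            exact ⟨hmem _ ⟨by linarith [hr.1], by linarith [hr.2]⟩,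
              ⟨by nlinarith [hr.1, hr.2], by nlinarith [hr.1]⟩,
              kink_eq_zero_iff.2 (Or.inr (Or.inr (by ring)))⟩
        · show τ ∈ Ioo (-β) (-α) ∧ -τ ^ 2 ∈ Ioo (-103/100 - 1 * 1 : ℝ) (-103/100 + 1 * 1) ∧
            -kink (-τ) = 0 ↔ τ = -root
          rw [neg_eq_zero]
          constructor
          · rintro ⟨h1, -, h2⟩
            rcases kink_eq_zero_iff.1 h2 with h | h | h
            · linarith [h1.2, hα.1]
            · linarith
            · linarith [h1.2, hα.1, hr.1]
          · rintro rfl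
            exact ⟨hmem' _ ⟨by linarith [hr.1], by linarith [hr.2]⟩,
              ⟨by nlinarith [hr.1, hr.2], by nlinarith [hr.1]⟩,
              kink_eq_zero_iff.2 (Or.inr (Or.inl (by ring)))⟩
        · exact absurd rfl hi
      zero_pos := fun i hi => by
        fin_cases i
        · show 0 < deriv (fun t => -kink (-t)) (root - 1/4)
          rw [hd, neg_sub]; exact deriv_kink_root'
        · show 0 < deriv (fun t => -kink (-t)) (-root)
          rw [hd, neg_neg]; exact deriv_kink_root
        · exact absurd rfl hi }
  refine reidemeister3_mod S (fun i hi => ?_) rfl _ _ o hf hf' (fun τ hτ hi => ?_) hα.1.le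
    (neg_nonpos.2 hα.1.le) T T'
  · fin_cases i
    exacts [rfl, rfl, absurd rfl hi]
  · have h0 : τ ∉ Ioo α β := hi 0 rfl
    have h1 : τ ∉ Ioo (-β) (-α) := hi 1 rfl
    rcases le_total 0 τ with h | h
    · rw [kink_neg_of_not_mem (fun h2 => h0 (hmem _ h2)) h, neg_neg]
    · have := kink_neg_of_not_mem (t := -τ) (fun h2 => h1 (hmem' _ h2)) (by linarith)
      rwa [neg_neg] at this

end LocalModel

/-! ### Creating two kinks by a second move -/

/-- A flat disc centred on the vertical axis. -/
noncomputable def discWide (Y h : ℝ) (hh : 0 < h) (hY : |Y| + h < 25) : Ellipse where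
  X := 0
  Y := Y
  w := 24
  h := h
  w_pos := by norm_num
  h_pos := hh
  X_lt := by norm_num
  Y_lt := hY

section

variable {Y h : ℝ} {hh : 0 < h} {hY : |Y| + h < 25}

lemma discWide_E (x t : ℝ) :
    (discWide Y h hh hY).E x (-t ^ 2) = x ^ 2 / 576 + (t ^ 2 + Y) ^ 2 / h ^ 2 := by
  simp only [Ellipse.E, discWide]; ring

lemma discWide_neg (x t : ℝ) :
    (discWide Y h hh hY).E (-x) (-t ^ 2) = (discWide Y h hh hY).E x (-t ^ 2) := by
  simp only [discWide_E, neg_sq]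

end

lemma abs_loops_le {w : ℝ → ℝ} {τ A B : ℝ} (h1 : |τ| ≤ A) (h2 : |w (τ ^ 2)| ≤ B) :
    loops w τ ^ 2 ≤ (5 * A * B) ^ 2 := by
  have h3 : |loops w τ| ≤ 5 * A * B := by
    rw [loops, abs_mul, abs_mul, abs_of_pos (by norm_num : (0 : ℝ) < 5)]
    nlinarith [abs_nonneg τ, abs_nonneg (w (τ ^ 2)), mul_le_mul h1 h2 (abs_nonneg _)
      ((abs_nonneg τ).trans h1)]
  exact sq_le_sq' (abs_le.1 h3).1 (abs_le.1 h3).2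

/-- The disc for creating the outer kink. -/
noncomputable def discOuter : Ellipse := discWide 0 (7/2) (by norm_num) (by norm_num)

/-- The disc for creating the inner kink. -/
noncomputable def discInner : Ellipse := discWide 0 (9/10) (by norm_num) (by norm_num)

/-- The disc for crossing the two halves of the strand over each other. -/
noncomputable def discBoth : Ellipse :=
  discWide (-2) (39/20) (by norm_num) (by rw [abs_of_neg] <;> norm_num)

lemma discOuter_E (x t : ℝ) : discOuter.E x (-t ^ 2) = x ^ 2 / 576 + (t ^ 2 + 0) ^ 2 / (7/2) ^ 2 :=
  discWide_E x t

lemma discInner_E (x t : ℝ) : discInner.E x (-t ^ 2) = x ^ 2 / 576 + (t ^ 2 + 0) ^ 2 / (9/10) ^ 2 :=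
  discWide_E x t

lemma discBoth_E (x t : ℝ) :
    discBoth.E x (-t ^ 2) = x ^ 2 / 576 + (t ^ 2 + -2) ^ 2 / (39/20) ^ 2 :=
  discWide_E x t

lemma loops_oneLoop_of_ge {t : ℝ} (h : 5/2 ≤ t ^ 2) : loops oneLoop t = 5 * t := by
  rw [loops, oneLoop_of_ge h, mul_one]

lemma loops_twoLoops_of_ge {t : ℝ} (h : 4/5 ≤ t ^ 2) : loops twoLoops t = loops oneLoop t := by
  rw [loops, loops, twoLoops_of_ge h]

lemma loops_twoLoops_of_le {t : ℝ} (h : t ^ 2 ≤ 1/10) : loops twoLoops t = 5 * t := by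
  rw [loops, twoLoops_of_le h, mul_one]

lemma exists_well_outer : ∃ α ∈ Ioo (-2 : ℝ) (-8/5), ∃ β ∈ Ioo (8/5 : ℝ) 2,
    IsWell univ (fun t => discOuter.E (5 * t) (-t ^ 2)) α β ∧
      IsWell univ (fun t => discOuter.E (loops oneLoop t) (-t ^ 2)) α β := by
  refine exists_isWell (by norm_num) (by norm_num) (by norm_num)
    (discOuter.continuous_E (by fun_prop)) (fun t _ ht => ?_) ?_ ?_ ?_ ?_
    (fun t ht => ?_) (fun t ht => ?_) (fun t _ ht => ?_)
  · have h : 4 ≤ t ^ 2 := by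
      by_contra hc
      have := abs_le.1 (abs_le_of_sq_le_sq (by linarith : t ^ 2 ≤ 2 ^ 2) (by norm_num))
      exact ht this
    rw [discOuter_E]
    norm_num
    nlinarith
  · rw [discOuter_E]; norm_num
  · rw [discOuter_E]; norm_num
  · intro s hs t ht hst
    have h2 := ht.2
    have h3 : t ^ 2 < s ^ 2 := by nlinarith
    have h4 : (t ^ 2) ^ 2 ≤ (s ^ 2) ^ 2 := by gcongr
    show discOuter.E (5 * t) _ < discOuter.E (5 * s) _
    rw [discOuter_E, discOuter_E]
    norm_num
    linarith
  · intro s hs t ht hst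
    have h2 := hs.1
    have h3 : s ^ 2 < t ^ 2 := by nlinarith
    have h4 : (s ^ 2) ^ 2 ≤ (t ^ 2) ^ 2 := by gcongr
    show discOuter.E (5 * s) _ < discOuter.E (5 * t) _
    rw [discOuter_E, discOuter_E]
    norm_num
    linarith
  · have h : t ^ 2 ≤ 64/25 := by nlinarith [ht.1, ht.2]
    rw [discOuter_E]
    norm_num
    nlinarith [sq_nonneg t]
  · have h : t ^ 2 ≤ 64/25 := by nlinarith [ht.1, ht.2]
    have h1 := abs_loops_le (w := oneLoop) (A := 8/5)
      (abs_le.2 ⟨by linarith [ht.1], ht.2⟩) (abs_oneLoop_le (sq_nonneg t))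
    rw [discOuter_E]
    norm_num at h1 ⊢
    nlinarith [sq_nonneg t]
  · have h : 64/25 ≤ t ^ 2 := by
      by_contra hc
      have := abs_le.1 (abs_le_of_sq_le_sq (by linarith : t ^ 2 ≤ (8/5) ^ 2) (by norm_num))
      exact ht ⟨by linarith, by linarith⟩
    show discOuter.E (loops oneLoop t) _ = _
    rw [loops_oneLoop_of_ge (by linarith)]

/-- The square of the horizontal coordinate changes slowly compared to that of the vertical
one. -/
lemma exists_well_inner : ∃ α ∈ Ioo (-19/20 : ℝ) (-9/10), ∃ β ∈ Ioo (9/10 : ℝ) (19/20),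
    IsWell univ (fun t => discInner.E (loops oneLoop t) (-t ^ 2)) α β ∧
      IsWell univ (fun t => discInner.E (loops twoLoops t) (-t ^ 2)) α β := by
  have hc : Continuous (loops oneLoop) := (flat_oneLoop (b := False) id).smooth.continuous
  have mono : ∀ s t : ℝ, 81/100 ≤ s ^ 2 → s ^ 2 < t ^ 2 → t ^ 2 ≤ 1 →
      discInner.E (loops oneLoop s) (-s ^ 2) < discInner.E (loops oneLoop t) (-t ^ 2) := by
    intro s t h1 h2 h3
    rw [loops, loops, oneLoop_of_le (by linarith), oneLoop_of_le (by linarith), discInner_E,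
      discInner_E]
    set S := s ^ 2 with hS
    set T := t ^ 2 with hT
    have e1 : (5 * (t * (T - 1))) ^ 2 = 25 * (T * (T - 1) ^ 2) := by rw [hT]; ring
    have e2 : (5 * (s * (S - 1))) ^ 2 = 25 * (S * (S - 1) ^ 2) := by rw [hS]; ring
    have e3 : T * (T - 1) ^ 2 - S * (S - 1) ^ 2 =
      (T - S) * (T ^ 2 + T * S + S ^ 2 - 2 * (T + S) + 1) := by ring
    have e4 : -(T - S) * 4 ≤ T * (T - 1) ^ 2 - S * (S - 1) ^ 2 := by
      rw [e3]
      nlinarith [mul_nonneg (sub_nonneg.2 h2.le)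
        (by nlinarith : 0 ≤ T ^ 2 + T * S + S ^ 2 - 2 * (T + S) + 1 + 4)]
    rw [e1, e2]
    norm_num
    nlinarith
  have core : ∀ (w : ℝ → ℝ) {t : ℝ}, |w (t ^ 2)| ≤ 3/2 → t ∈ Icc (-9/10 : ℝ) (9/10) →
      discInner.E (loops w t) (-t ^ 2) < 1 := by
    intro w t hw ht
    have h : t ^ 2 ≤ 81/100 := by nlinarith [ht.1, ht.2]
    have h1 := abs_loops_le (w := w) (A := 9/10) (abs_le.2 ⟨by linarith [ht.1], ht.2⟩) hw
    rw [discInner_E]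
    norm_num at h1 ⊢
    nlinarith [sq_nonneg t]
  refine exists_isWell (by norm_num) (by norm_num) (by norm_num)
    (discInner.continuous_E hc) (fun t _ ht => ?_) ?_ ?_ ?_ ?_
    (fun t ht => core _ (abs_oneLoop_le (sq_nonneg t)) ht)
    (fun t ht => core _ (abs_twoLoops_le (sq_nonneg t)) ht) (fun t _ ht => ?_)
  · have h : 361/400 ≤ t ^ 2 := by
      by_contra hc
      have := abs_le.1 (abs_le_of_sq_le_sq (by linarith : t ^ 2 ≤ (19/20) ^ 2) (by norm_num))
      exact ht ⟨by linarith, by linarith⟩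
    rw [discInner_E]
    norm_num
    nlinarith [sq_nonneg (loops oneLoop t)]
  · rw [discInner_E]
    norm_num
    nlinarith [sq_nonneg (loops oneLoop (-19/20))]
  · rw [discInner_E]
    norm_num
    nlinarith [sq_nonneg (loops oneLoop (19/20))]
  · intro s hs t ht hst
    exact mono t s (by nlinarith [ht.2]) (by nlinarith [ht.2]) (by nlinarith [hs.1, hs.2])
  · intro s hs t ht hst
    exact mono s t (by nlinarith [hs.1]) (by nlinarith [hs.1]) (by nlinarith [ht.1, ht.2])
  · have h : 81/100 ≤ t ^ 2 := by
      by_contra hc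
      have := abs_le.1 (abs_le_of_sq_le_sq (by linarith : t ^ 2 ≤ (9/10) ^ 2) (by norm_num))
      exact ht ⟨by linarith, by linarith⟩
    show discInner.E (loops twoLoops t) _ = _
    rw [loops_twoLoops_of_ge (by linarith)]

lemma exists_well_both : ∃ α ∈ Ioo (0 : ℝ) (31/100), ∃ β ∈ Ioo (8/5 : ℝ) 2,
    IsWell (Ici 0) (fun t => discBoth.E (5 * t) (-t ^ 2)) α β ∧
      IsWell (Ici 0) (fun t => discBoth.E (loops twoLoops t) (-t ^ 2)) α β := by
  refine exists_isWell (by norm_num) (by norm_num) (by norm_num)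
    (discBoth.continuous_E (by fun_prop)) (fun t ht0 ht => ?_) ?_ ?_ ?_ ?_
    (fun t ht => ?_) (fun t ht => ?_) (fun t ht0 ht => ?_)
  · have h : 2 < t := by by_contra hc; exact ht ⟨ht0, by linarith⟩
    have h2 : 4 ≤ t ^ 2 := by nlinarith
    rw [discBoth_E]
    norm_num
    nlinarith
  · rw [discBoth_E]; norm_num
  · rw [discBoth_E]; norm_num
  · intro s hs t ht hst
    have h1 := hs.1
    have h2 := ht.2
    have h3 : s ^ 2 < t ^ 2 := by nlinarith
    have h4 : t ^ 2 ≤ 1/10 := by nlinarith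
    show discBoth.E (5 * t) _ < discBoth.E (5 * s) _
    rw [discBoth_E, discBoth_E]
    norm_num
    nlinarith
  · intro s hs t ht hst
    have h1 := hs.1
    have h3 : s ^ 2 < t ^ 2 := by nlinarith
    have h4 : 2 ≤ s ^ 2 := by nlinarith
    show discBoth.E (5 * s) _ < discBoth.E (5 * t) _
    rw [discBoth_E, discBoth_E]
    norm_num
    nlinarith
  · have h1 : 961/10000 ≤ t ^ 2 := by nlinarith [ht.1]
    have h2 : t ^ 2 ≤ 64/25 := by nlinarith [ht.1, ht.2]
    rw [discBoth_E]
    norm_num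
    nlinarith
  · have h1 : 961/10000 ≤ t ^ 2 := by nlinarith [ht.1]
    have h2 : t ^ 2 ≤ 64/25 := by nlinarith [ht.1, ht.2]
    have h0 : 0 ≤ t := by linarith [ht.1]
    rcases le_total t 1 with h3 | h3
    · have h4 := abs_loops_le (w := twoLoops) (A := 1) (abs_le.2 ⟨by linarith, h3⟩)
        (abs_twoLoops_le_one (sq_nonneg t) (by nlinarith))
      have h5 : t ^ 2 ≤ 1 := by nlinarith
      rw [discBoth_E]
      norm_num at h4 ⊢
      nlinarith
    · have h4 := abs_loops_le (w := twoLoops) (A := 8/5) (abs_le.2 ⟨by linarith, ht.2⟩)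
        (abs_twoLoops_le (sq_nonneg t))
      have h5 : 1 ≤ t ^ 2 := by nlinarith
      rw [discBoth_E]
      norm_num at h4 ⊢
      nlinarith
  · show discBoth.E (loops twoLoops t) _ = _
    have h0 : 0 ≤ t := ht0
    rcases lt_or_ge t (31/100) with h | h
    · rw [loops_twoLoops_of_le (by nlinarith)]
    · have h1 : 8/5 < t := by by_contra hc; exact ht ⟨h, by linarith⟩
      rw [loops_twoLoops_of_ge (by nlinarith), loops_oneLoop_of_ge (by nlinarith)]

lemma loops_oneLoop_self_iff {t : ℝ} (h : 0 < t) :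
    loops oneLoop t = loops oneLoop (-t) ↔ t = 1 := by
  rw [loops_self_iff h, oneLoop_eq_zero_iff]
  exact ⟨fun h1 => by nlinarith, fun h1 => by rw [h1]; norm_num⟩

lemma loops_twoLoops_self_iff {t : ℝ} (h : 0 < t) :
    loops twoLoops t = loops twoLoops (-t) ↔ t ^ 2 = 1/2 ∨ t ^ 2 = 1 := by
  rw [loops_self_iff h, twoLoops_eq_zero_iff (sq_nonneg t)]

/-- At a self-crossing, a strand given by `loops` passes through the vertical axis. -/
lemma loops_self_ne {w : ℝ → ℝ} {Y h : ℝ} {hh : 0 < h} {hY : |Y| + h < 25}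
    (hw : ∀ s, 0 ≤ s → w s = 0 → (s + Y) ^ 2 ≠ h ^ 2) {τ : ℝ}
    (hE : (discWide Y h hh hY).E (loops w τ) (-τ ^ 2) = 1) (h0 : τ ≠ 0) :
    loops w τ ≠ loops w (-τ) := by
  intro h1
  have h2 : w (τ ^ 2) = 0 := by
    rcases lt_or_gt_of_ne h0 with h3 | h3
    · have := (loops_self_iff (w := w) (neg_pos.2 h3)).1 (by rw [neg_neg, h1])
      rwa [neg_sq] at this
    · exact (loops_self_iff h3).1 h1
  have h3 : loops w τ = 0 := by rw [loops, h2]; ring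
  rw [discWide_E, h3] at hE
  have h4 : h ^ 2 ≠ 0 := by positivity
  refine hw _ (sq_nonneg τ) h2 ?_
  have h5 : (τ ^ 2 + Y) ^ 2 / h ^ 2 = 1 := by linarith
  rwa [div_eq_one_iff_eq h4] at h5

namespace LocalModel

variable {K : KnotoidDiagram} (M : LocalModel K)

/-- A kink with its crossing at the coordinates `±1`. -/
lemma kinkAt_outer (hb : ¬ M.hasB) (o : ℝˣ) : KinkAt (SignType.sign (M.orient * o) : SignType)
    (M.mod _ (flat_base _) o) M.t₀ (M.mod _ (flat_oneLoop hb) o) := by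
  obtain ⟨α, hα, β, hβ, hw, hw'⟩ := exists_well_outer
  let S : Strands M.hasB discOuter 1 := strandsA M.hasB discOuter (α := α) (β := β)
    (by linarith [hα.2, hβ.1]) (by linarith [hα.1]) (by linarith [hβ.2]) fun h => absurd h hb
  have hmem : ∀ t ∈ Icc (-8/5 : ℝ) (8/5), t ∈ Ioo α β := fun t ht =>
    ⟨hα.2.trans_le ht.1, ht.2.trans_lt hβ.1⟩
  have hf : S.Fits fun t => 5 * t := fits_strandsA _ _ _ _ hw fun τ h h0 h1 => h0 (by linarith)
  have hf' : S.Fits (loops oneLoop) := fits_strandsA _ _ _ _ hw' fun τ h h0 =>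
    loops_self_ne (fun s _ hs => by rw [oneLoop_eq_zero_iff.1 hs]; norm_num) h h0
  have key := kinked_mod S rfl (flat_base _) (flat_oneLoop hb) o hf hf' (fun τ hτ hi => ?_)
    (fun τ _ _ h0 h1 => by linarith) one_pos (hmem 1 ⟨by norm_num, by norm_num⟩)
    (hmem (-1) ⟨by norm_num, by norm_num⟩) fun τ _ _ h0 => loops_oneLoop_self_iff h0
  · rwa [deriv_loops_self (d := 1) (by rw [one_pow]; exact oneLoop_eq_zero_iff.2 rfl)
      (by rw [one_pow]; exact hasDerivAt_oneLoop), ← mul_assoc, sign_mul _ (20 * _ * _),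
      sign_pos (by norm_num : (0 : ℝ) < 20 * 1 ^ 2 * 1), mul_one] at key
  · have hi' : τ ∉ Ioo α β := hi 0 rfl
    refine (loops_oneLoop_of_ge ?_).symm
    by_contra hc
    have := abs_le.1 (abs_le_of_sq_le_sq (by linarith : τ ^ 2 ≤ (8/5) ^ 2) (by norm_num))
    exact hi' (hmem _ ⟨by linarith, by linarith⟩)

/-- A second kink of opposite sign on the loop of the first one, with its crossing at the
coordinates `±1/√2`. -/
lemma kinkAt_inner (hb : ¬ M.hasB) (o : ℝˣ) : KinkAt (SignType.sign (-(M.orient * o)) : SignType)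
    (M.mod _ (flat_oneLoop hb) o) M.t₀ (M.mod _ (flat_twoLoops hb) o) := by
  obtain ⟨α, hα, β, hβ, hw, hw'⟩ := exists_well_inner
  let S : Strands M.hasB discInner 1 := strandsA M.hasB discInner (α := α) (β := β)
    (by linarith [hα.2, hβ.1]) (by linarith [hα.1]) (by linarith [hβ.2]) fun h => absurd h hb
  have hmem : ∀ t ∈ Icc (-9/10 : ℝ) (9/10), t ∈ Ioo α β := fun t ht =>
    ⟨hα.2.trans_le ht.1, ht.2.trans_lt hβ.1⟩
  have hf : S.Fits (loops oneLoop) := fits_strandsA _ _ _ _ hw fun τ h h0 =>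
    loops_self_ne (fun s _ hs => by rw [oneLoop_eq_zero_iff.1 hs]; norm_num) h h0
  have hf' : S.Fits (loops twoLoops) := fits_strandsA _ _ _ _ hw' fun τ h h0 =>
    loops_self_ne (fun s h hs => by
      rcases (twoLoops_eq_zero_iff h).1 hs with rfl | rfl <;> norm_num) h h0
  -- the inner self-crossing is at `τ = ±1 / √2`
  set σ : ℝ := √(1/2) with hσ
  have hσ2 : σ ^ 2 = 1/2 := Real.sq_sqrt (by norm_num)
  have hσ0 : 0 < σ := Real.sqrt_pos.2 (by norm_num)
  have hσ1 : σ ≤ 9/10 := by nlinarith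
  have hlt : ∀ τ ∈ Ioo α β, |τ| < 19/20 := fun τ h => abs_lt.2 ⟨by linarith [h.1, hα.1],
    h.2.trans hβ.2⟩
  have key := kinked_mod S rfl (flat_oneLoop hb) (flat_twoLoops hb) o hf hf' (fun τ hτ hi => ?_)
    (fun τ hτ _ h0 h1 => ?_) hσ0 (hmem σ ⟨by linarith, hσ1⟩)
    (hmem (-σ) ⟨by linarith, by linarith⟩) fun τ hτ _ h0 => ?_
  · rw [deriv_loops_self (d := -1) (by rw [hσ2, twoLoops_eq_zero_iff (by norm_num)]; simp)
      (by rw [hσ2]; exact hasDerivAt_twoLoops_half), hσ2] at key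
    have e : M.orient * (o * (20 * (1/2) * -1)) = 10 * -(M.orient * o) := by ring
    rwa [e, sign_mul, sign_pos (by norm_num), one_mul] at key
  · have hi' : τ ∉ Ioo α β := hi 0 rfl
    refine (loops_twoLoops_of_ge ?_).symm
    by_contra hc
    have := abs_le.1 (abs_le_of_sq_le_sq (by linarith : τ ^ 2 ≤ (9/10) ^ 2) (by norm_num))
    exact hi' (hmem _ ⟨by linarith, by linarith⟩)
  · have h2 := (abs_lt.1 (hlt τ hτ)).2
    linarith [(loops_oneLoop_self_iff h0).1 h1]
  · have h2 := (abs_lt.1 (hlt τ hτ)).2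
    rw [loops_twoLoops_self_iff h0]
    constructor
    · rintro (h3 | h3)
      · exact (pow_left_inj₀ h0.le hσ0.le two_ne_zero).1 (h3.trans hσ2.symm)
      · nlinarith
    · rintro rfl
      exact Or.inl hσ2

/-- Both crossings of the two kinks arise at once, when the two halves of the strand are moved
across each other. -/
lemma reidemeister2_base_twoLoops (hb : ¬ M.hasB) (o : ℝˣ) :
    Reidemeister2 (M.mod _ (flat_base _) o) (M.mod _ (flat_twoLoops hb) o) := by
  obtain ⟨α, hα, β, hβ, hw, hw'⟩ := exists_well_both
  let S : Strands M.hasB discBoth 2 := strandsAA hb discBoth (α := α) (β := β)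
    (by linarith [hα.2, hβ.1]) hα.1 (by linarith [hβ.2])
  have hmem : ∀ t ∈ Icc (31/100 : ℝ) (8/5), t ∈ Ioo α β := fun t ht =>
    ⟨hα.2.trans_le ht.1, ht.2.trans_lt hβ.1⟩
  have hmem' : ∀ t, -t ∈ Icc (31/100 : ℝ) (8/5) → t ∈ Ioo (-β) (-α) := fun t ht =>
    mem_neg_interval.2.2 (hmem _ ht)
  have hneg : ∀ x t : ℝ, discBoth.E (-x) (-t ^ 2) = discBoth.E x (-t ^ 2) := discWide_neg
  have hf : S.Fits fun t => 5 * t := fits_strandsAA hb _ _ _ hw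
    (by simpa only [mul_neg, hneg] using hw) fun τ h h0 h1 => h0 (by linarith)
  have hf' : S.Fits (loops twoLoops) := fits_strandsAA hb _ _ _ hw'
    (by simpa only [loops_neg, hneg] using hw') fun τ h h0 =>
    loops_self_ne (fun s h hs => by
      rcases (twoLoops_eq_zero_iff h).1 hs with rfl | rfl <;> norm_num) h h0
  set σ : ℝ := √(1/2) with hσ
  have hσ2 : σ ^ 2 = 1/2 := Real.sq_sqrt (by norm_num)
  have hσ0 : 0 < σ := Real.sqrt_pos.2 (by norm_num)
  have hσ1 : σ ≤ 8/5 := by nlinarith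
  have hσ3 : 31/100 ≤ σ := by nlinarith
  refine reidemeister2_AA S rfl rfl (flat_base _) (flat_twoLoops hb) o hf hf' (fun τ hτ hi => ?_)
    hα.1.le (neg_nonpos.2 hα.1.le) (fun τ hτ h1 => ?_) (z := 1) (z' := σ) (fun τ => ?_) ?_ ?_
  · have h0 : τ ∉ Ioo α β := hi 0 rfl
    have h1 : τ ∉ Ioo (-β) (-α) := hi 1 rfl
    have key : ∀ t : ℝ, 0 ≤ t → t ∉ Ioo α β → loops twoLoops t = 5 * t := by
      intro t h2 h3
      rcases lt_or_ge t (31/100) with h | h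
      · rw [loops_twoLoops_of_le (by nlinarith)]
      · have h1 : 8/5 < t := by by_contra hc; exact h3 (hmem t ⟨h, by linarith⟩)
        rw [loops_twoLoops_of_ge (by nlinarith), loops_oneLoop_of_ge (by nlinarith)]
    rcases le_total 0 τ with h | h
    · exact (key τ h h0).symm
    · have := key (-τ) (by linarith) fun h2 => h1 (mem_neg_interval.2.2 h2)
      rw [loops_neg] at this
      linarith
  · have h2 : α < τ ∧ τ < β := hτ
    linarith [hα.1, h2.1]
  · show τ ∈ Ioo α β ∧ -τ ∈ Ioo (-β) (-α) ∧ _ ↔ _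
    constructor
    · rintro ⟨h1, -, h2⟩
      have h0 : 0 < τ := hα.1.trans h1.1
      rcases (loops_twoLoops_self_iff h0).1 h2 with h3 | h3
      · exact Or.inr ((pow_left_inj₀ h0.le hσ0.le two_ne_zero).1 (h3.trans hσ2.symm))
      · exact Or.inl (by nlinarith)
    · rintro (rfl | rfl)
      · exact ⟨hmem 1 ⟨by norm_num, by norm_num⟩, hmem' _ ⟨by norm_num, by norm_num⟩,
          (loops_twoLoops_self_iff one_pos).2 (Or.inr (by norm_num))⟩
      · exact ⟨hmem σ ⟨hσ3, hσ1⟩, hmem' _ (by rw [neg_neg]; exact ⟨hσ3, hσ1⟩),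
          (loops_twoLoops_self_iff hσ0).2 (Or.inl hσ2)⟩
  · rw [deriv_loops_self (d := 1) (by rw [one_pow, twoLoops_eq_zero_iff (by norm_num)]; simp)
      (by rw [one_pow]; exact hasDerivAt_twoLoops_one)]
    norm_num
  · rw [deriv_loops_self (d := -1) (by rw [hσ2, twoLoops_eq_zero_iff (by norm_num)]; simp)
      (by rw [hσ2]; exact hasDerivAt_twoLoops_half), hσ2]
    norm_num

end LocalModel

/-! ### Existence of local models -/

/-- The radial projection to the sphere, with an arbitrary value `c` at the origin. -/
noncomputable def toSphere (c : S2) (z : E3) : S2 :=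
  open Classical in if h : z = 0 then c else ⟨‖z‖⁻¹ • z, normalize_mem h⟩

lemma coe_toSphere (c : S2) {z : E3} (h : z ≠ 0) : (toSphere c z : E3) = ‖z‖⁻¹ • z := by
  simp [toSphere, h]

lemma toSphere_coe (c x : S2) : toSphere c (x : E3) = x := by
  ext1
  rw [coe_toSphere c (norm_ne_zero_iff.1 (by rw [S2.norm_coe]; exact one_ne_zero)), S2.norm_coe]
  simp

lemma contDiffAt_toSphere (c : S2) {z : E3} (h : z ≠ 0) :
    ContDiffAt ℝ ∞ (fun z => (toSphere c z : E3)) z := by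
  refine (contDiffAt_normalize h).congr_of_eventuallyEq ?_
  filter_upwards [isOpen_ne.mem_nhds h] with u hu
  exact coe_toSphere c hu

/-- Two transverse curves through a point of the sphere are the axes of local coordinates. -/
lemma exists_axes {γ δ : ℝ → S2} (hγ : ContDiff ℝ ∞ fun t => (γ t : E3))
    (hδ : ContDiff ℝ ∞ fun t => (δ t : E3)) (h0 : γ 0 = δ 0)
    (hd : det3 (γ 0) (velocity γ 0) (velocity δ 0) ≠ 0) :
    ∃ (Φ : ℝ × ℝ → S2) (r : ℝ), 0 < r ∧
      (∀ z ∈ Metric.ball (0 : ℝ × ℝ) r, ContDiffAt ℝ ∞ (fun z => (Φ z : E3)) z) ∧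
      InjOn Φ (Metric.ball 0 r) ∧
      (∀ z ∈ Metric.ball (0 : ℝ × ℝ) r, 0 < det3 (γ 0) (velocity γ 0) (velocity δ 0) *
        det3 (Φ z) (fderiv ℝ (fun z => (Φ z : E3)) z (1, 0))
          (fderiv ℝ (fun z => (Φ z : E3)) z (0, 1))) ∧
      (∀ u, Φ (u, 0) = γ u) ∧ ∀ v, Φ (0, v) = δ v := by
  -- translate one curve along the other one in space, and project to the sphere
  let F : ℝ × ℝ → E3 := fun z => γ z.1 + δ z.2 - γ 0
  let Φ : ℝ × ℝ → S2 := fun z => toSphere (γ 0) (F z)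
  have hF : ContDiff ℝ ∞ F :=
    ((hγ.comp contDiff_fst).add (hδ.comp contDiff_snd)).sub contDiff_const
  have hu : ∀ u, Φ (u, 0) = γ u := fun u => by
    have : F (u, 0) = γ u := by simp [F, h0]
    simp only [Φ, this, toSphere_coe]
  have hv : ∀ v, Φ (0, v) = δ v := fun v => by
    have : F (0, v) = δ v := by simp [F]
    simp only [Φ, this, toSphere_coe]
  have hU : ∀ z, F z ≠ 0 → ContDiffAt ℝ ∞ (fun z => (Φ z : E3)) z := fun z hz =>
    (contDiffAt_toSphere (γ 0) hz).comp z hF.contDiffAt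
  have hF0 : F 0 ≠ 0 := by
    have : F 0 = γ 0 := by simp [F, h0]
    rw [this]
    exact norm_ne_zero_iff.1 (by rw [S2.norm_coe]; exact one_ne_zero)
  have hev : ∀ᶠ z in 𝓝 (0 : ℝ × ℝ), F z ≠ 0 := hF.continuous.continuousAt.eventually_ne hF0
  have hs := (hU 0 hF0).hasStrictFDerivAt (by simp)
  set D := fderiv ℝ (fun z => (Φ z : E3)) 0
  have hD1 : D (1, 0) = velocity γ 0 := by
    have h1 : HasDerivAt (fun u : ℝ => ((u, 0) : ℝ × ℝ)) (1, 0) 0 :=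
      (hasDerivAt_id 0).prodMk (hasDerivAt_const 0 0)
    have h2 := HasFDerivAt.comp_hasDerivAt (0 : ℝ) (f := fun u : ℝ => ((u, 0) : ℝ × ℝ))
      hs.hasFDerivAt h1
    simp only [Function.comp_def, hu] at h2
    exact h2.deriv.symm
  have hD2 : D (0, 1) = velocity δ 0 := by
    have h1 : HasDerivAt (fun u : ℝ => ((0, u) : ℝ × ℝ)) (0, 1) 0 :=
      (hasDerivAt_const 0 0).prodMk (hasDerivAt_id 0)
    have h2 := HasFDerivAt.comp_hasDerivAt (0 : ℝ) (f := fun u : ℝ => ((0, u) : ℝ × ℝ))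
      hs.hasFDerivAt h1
    simp only [Function.comp_def, hv] at h2
    exact h2.deriv.symm
  have hinj : Function.Injective D := by
    rw [injective_iff_map_eq_zero]
    rintro ⟨a, b⟩ hab
    have e : ((a, b) : ℝ × ℝ) = a • (1, 0) + b • (0, 1) := by simp
    rw [e, map_add, map_smul, map_smul, hD1, hD2] at hab
    obtain ⟨ha, hb⟩ := LinearIndependent.pair_iff.1 (linearIndependent_of_det3_ne_zero hd) a b hab
    rw [ha, hb]; rfl
  obtain ⟨N, hN, hNi⟩ := hs.exists_injOn hinj
  have hdet : ∀ᶠ z in 𝓝 (0 : ℝ × ℝ), 0 < det3 (γ 0) (velocity γ 0) (velocity δ 0) *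
        det3 (Φ z) (fderiv ℝ (fun z => (Φ z : E3)) z (1, 0))
          (fderiv ℝ (fun z => (Φ z : E3)) z (0, 1)) := by
    have hc : ContinuousAt (fderiv ℝ fun z => (Φ z : E3)) 0 :=
      ((hU 0 hF0).fderiv_right (m := 0) (by simp)).continuousAt
    have h1 := (continuousAt_const (y := det3 (γ 0) (velocity γ 0) (velocity δ 0))).mul
      (continuousAt_det3 (hU 0 hF0).continuousAt
        (hc.clm_apply (continuousAt_const (y := ((1, 0) : ℝ × ℝ))))
        (hc.clm_apply (continuousAt_const (y := ((0, 1) : ℝ × ℝ)))))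
    refine h1.eventually_const_lt ?_
    have e : Φ 0 = γ 0 := hu 0
    change 0 < _ * det3 (Φ 0) (D (1, 0)) (D (0, 1))
    rw [e, hD1, hD2]
    exact mul_self_pos.2 hd
  obtain ⟨r, hr, h⟩ := Metric.eventually_nhds_iff_ball.1 (hev.and (hdet.and hN))
  exact ⟨Φ, r, hr, fun z hz => hU z (h z hz).1, fun x hx y hy hxy =>
    hNi (h x hx).2.2 (h y hy).2.2 (congrArg Subtype.val hxy), fun z hz => (h z hz).2.1, hu, hv⟩

namespace KnotoidDiagram

variable (K : KnotoidDiagram)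

/-- Small local models exist at every parameter, for any choice of a transverse curve `δ`, which
is to be the strand `B` if there is one. -/
lemma exists_localModel_of_transverse {t₀ : ℝ} (ht₀ : t₀ ∈ Ioo (0 : ℝ) 1) {δ : ℝ → S2}
    (hδ : ContDiff ℝ ∞ fun t => (δ t : E3)) (h0 : δ 0 = K.curve t₀)
    (hd : det3 (K.curve t₀) (velocity K.curve t₀) (velocity δ 0) ≠ 0) {O : Set S2}
    (hO : O ∈ 𝓝 (K.curve t₀)) (b : Prop) (tB : ℝ)
    (hB : b → tB ∈ Ioo (0 : ℝ) 1 ∧ tB ≠ t₀ ∧ ∀ v, K.curve (tB + v) = δ v)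
    (hT : ∀ t ∈ Icc (0 : ℝ) 1, K.curve t = K.curve t₀ → t = t₀ ∨ (b ∧ t = tB)) :
    ∃ M : LocalModel K, M.t₀ = t₀ ∧ M.hasB = b ∧ M.tB = tB ∧ M.lam = M.mu ∧ 0 < M.mu ∧
      M.G '' box ⊆ O := by
  have hγ : ContDiff ℝ ∞ fun u => (K.curve (t₀ + u) : E3) :=
    K.smooth.comp (contDiff_const.add contDiff_id)
  have hvel : velocity (fun u => K.curve (t₀ + u)) 0 = velocity K.curve t₀ := by
    have := (K.hasDerivAt (t₀ + 0)).comp_const_add t₀ 0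
    rw [add_zero] at this
    exact this.deriv
  obtain ⟨Φ, r, hr, hΦ, hinj, hdet, hu, hv⟩ := exists_axes hγ hδ (by simp [h0])
    (by rw [hvel, add_zero]; exact hd)
  have hΦ0 : Φ 0 = K.curve t₀ := by
    have := hu 0
    rwa [add_zero] at this
  -- The rest of the curve stays away from the point, so a small model does not meet it.
  let T : Set ℝ := Icc 0 1 ∩ ({t | r ≤ |t - t₀|} ∩ {t | b → r ≤ |t - tB|})
  have hTc : IsCompact T := by
    refine isCompact_Icc.inter_right ((isClosed_le (f := fun _ : ℝ => r)
      (g := fun t => |t - t₀|) continuous_const (by fun_prop)).inter ?_)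
    by_cases hb : b
    · have : {t | b → r ≤ |t - tB|} = {t | r ≤ |t - tB|} := by ext; simp [hb]
      rw [this]
      exact isClosed_le continuous_const (by fun_prop)
    · have : {t | b → r ≤ |t - tB|} = univ := by ext; simp [hb]
      rw [this]
      exact isClosed_univ
  have hO' : (K.curve '' T)ᶜ ∩ O ∈ 𝓝 (Φ 0) := by
    rw [hΦ0]
    refine inter_mem ((hTc.image K.continuous_curve).isClosed.isOpen_compl.mem_nhds ?_) hO
    rintro ⟨t, ⟨ht, h1, h2⟩, h3⟩
    rcases hT t ht h3 with rfl | ⟨hb, rfl⟩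
    · rw [mem_ofPred_eq, sub_self, abs_zero] at h1; linarith
    · have : r ≤ |t - t| := h2 hb
      rw [sub_self, abs_zero] at this; linarith
  have hcont : ContinuousAt Φ 0 :=
    IsInducing.subtypeVal.continuousAt_iff.2 (hΦ 0 (Metric.mem_ball_self hr)).continuousAt
  obtain ⟨ρ, hρ, hρO⟩ := Metric.eventually_nhds_iff_ball.1 (hcont.eventually_mem hO')
  -- The scale of the model: small enough for all the coordinate ranges of a local model.
  have hB' : ∃ e > 0, ∀ η, 0 < η → η ≤ e → b → 25 * η < tB ∧ tB < 1 - 25 * η ∧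
      30 * η < |tB - t₀| := by
    by_cases hb : b
    · obtain ⟨h1, h2, -⟩ := hB hb
      have h3 : 0 < |tB - t₀| := abs_pos.2 (sub_ne_zero.2 h2)
      have h4 := h1.1
      have h5 := h1.2
      refine ⟨min (tB / 50) (min ((1 - tB) / 50) (|tB - t₀| / 50)), ?_, fun η h6 h7 _ => ?_⟩
      · exact lt_min (by linarith) (lt_min (by linarith) (by linarith))
      · have := le_min_iff.1 h7
        have := le_min_iff.1 this.2
        exact ⟨by linarith, by linarith, by linarith⟩
    · exact ⟨1, one_pos, fun _ _ _ h => absurd h hb⟩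
  obtain ⟨e, he, hB'⟩ := hB'
  obtain ⟨η, hη, hle⟩ : ∃ η > 0, η ≤ min (min e (min (r / 100) (ρ / 100)))
      (min (t₀ / 10) ((1 - t₀) / 10)) := by
    refine ⟨_, lt_min (lt_min he (lt_min (by linarith) (by linarith))) (lt_min ?_ ?_), le_rfl⟩
    · have := ht₀.1; linarith
    · have := ht₀.2; linarith
  simp only [le_min_iff] at hle
  obtain ⟨⟨le1, le2, le3⟩, le4, le5⟩ := hle
  have hB' := hB' η hη le1
  -- The parabola `(5τ, -τ²)` and the vertical axis become the axes of the coordinates `Φ`.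
  let θ : ℝ × ℝ → ℝ × ℝ := fun z => (η * (z.1 / 5), η * (z.2 + z.1 ^ 2 / 25))
  have hθ : ContDiff ℝ ∞ θ := by fun_prop
  have hθb : ∀ z ∈ box, ∀ R, 50 * η < R → θ z ∈ Metric.ball (0 : ℝ × ℝ) R := by
    rintro ⟨x, y⟩ hz R hR
    obtain ⟨h1, h2⟩ := mem_box.1 hz
    rw [abs_lt] at h1 h2
    have h3 : x ^ 2 < 25 ^ 2 := sq_lt_sq' h1.1 h1.2
    rw [Metric.mem_ball, dist_zero_right, Prod.norm_def, max_lt_iff]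
    simp only [θ, Real.norm_eq_abs, abs_lt]
    refine ⟨⟨by nlinarith, by nlinarith⟩, by nlinarith [sq_nonneg x], by nlinarith⟩
  have hθr : ∀ z ∈ box, θ z ∈ Metric.ball (0 : ℝ × ℝ) r := fun z hz => hθb z hz r (by linarith)
  have hθi : ∀ z z', θ z = θ z' → z = z' := by
    rintro ⟨x, y⟩ ⟨x', y'⟩ h
    simp only [θ, Prod.mk.injEq, mul_eq_mul_left_iff, hη.ne', or_false] at h
    obtain ⟨h1, h2⟩ := h
    have : x = x' := by linarith
    subst this
    rw [add_left_inj] at h2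
    rw [h2]
  have hG : ∀ z ∈ box, ContDiffAt ℝ ∞ (fun z => (Φ (θ z) : E3)) z := fun z hz =>
    ContDiffAt.comp (g := fun z => (Φ z : E3)) z (hΦ _ (hθr z hz)) hθ.contDiffAt
  have hsmall : ∀ u : ℝ, |u| < r → ((u, 0) : ℝ × ℝ) ∈ Metric.ball (0 : ℝ × ℝ) r ∧
      ((0, u) : ℝ × ℝ) ∈ Metric.ball (0 : ℝ × ℝ) r := fun u h => by
    simp [Prod.norm_def, h]
  refine ⟨{ G := fun z => Φ (θ z)
            smooth := fun z hz => (hG z hz).contDiffWithinAt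
            inj := fun z hz z' hz' h => hθi _ _ (hinj (hθr z hz) (hθr z' hz') h)
            orient := det3 (K.curve t₀) (velocity K.curve t₀) (velocity δ 0)
            orient_pos := ?_
            t₀ := t₀
            lam := η
            lam_ne := hη.ne'
            hasB := b
            tB := tB
            mu := η
            mu_ne := hη.ne'
            A_mem := ?_
            A_curve := ?_
            B_mem := ?_
            B_curve := ?_
            A_ne_B := ?_
            rest := ?_ }, rfl, rfl, rfl, rfl, hη, ?_⟩
  · rintro ⟨x, y⟩ hz
    have hφ := ((hΦ _ (hθr _ hz)).differentiableAt (by simp)).hasFDerivAt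
    have hg := ((hG _ hz).differentiableAt (by simp)).hasFDerivAt
    have hdet' := hdet _ (hθr _ hz)
    rw [hvel, add_zero] at hdet'
    set D := fderiv ℝ (fun z => (Φ z : E3)) (θ (x, y))
    have e1 : fderiv ℝ (fun z => (Φ (θ z) : E3)) (x, y) (1, 0) =
        (η / 5) • D (1, 0) + (η * (2 * x / 25)) • D (0, 1) := by
      have d1 : HasDerivAt (fun u : ℝ => ((u, y) : ℝ × ℝ)) (1, 0) x :=
        (hasDerivAt_id x).prodMk (hasDerivAt_const x y)
      have d2 : HasDerivAt (fun u : ℝ => θ (u, y)) (η / 5, η * (2 * x / 25)) x := by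
        exact HasDerivAt.prodMk
          ((((hasDerivAt_id' x).div_const 5).const_mul η).congr_deriv (by ring))
          (((((hasDerivAt_id' x).pow 2).div_const 25).const_add y).const_mul η
            |>.congr_deriv (by simp))
      rw [← map_smul, ← map_smul, ← map_add]
      convert (HasFDerivAt.comp_hasDerivAt x (f := fun u : ℝ => ((u, y) : ℝ × ℝ)) hg d1).unique
        (HasFDerivAt.comp_hasDerivAt x (f := fun u : ℝ => θ (u, y)) hφ d2) using 2
      simp
    have e2 : fderiv ℝ (fun z => (Φ (θ z) : E3)) (x, y) (0, 1) =
        (0 : ℝ) • D (1, 0) + η • D (0, 1) := by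
      have d1 : HasDerivAt (fun u : ℝ => ((x, u) : ℝ × ℝ)) (0, 1) y :=
        (hasDerivAt_const y x).prodMk (hasDerivAt_id y)
      have d2 : HasDerivAt (fun u : ℝ => θ (x, u)) (0, η) y := by
        exact HasDerivAt.prodMk (hasDerivAt_const y (η * (x / 5)))
          (((hasDerivAt_id' y).add_const (x ^ 2 / 25)).const_mul η |>.congr_deriv (by ring))
      rw [← map_smul, ← map_smul, ← map_add]
      convert (HasFDerivAt.comp_hasDerivAt y (f := fun u : ℝ => ((x, u) : ℝ × ℝ)) hg d1).unique
        (HasFDerivAt.comp_hasDerivAt y (f := fun u : ℝ => θ (x, u)) hφ d2) using 2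
      simp
    rw [e1, e2, det3_comb, mul_left_comm]
    exact mul_pos (by nlinarith) hdet'
  · intro τ hτ
    rw [abs_lt] at hτ
    constructor <;> nlinarith
  · intro τ hτ
    rw [← hu]
    congr 1
    simp only [θ]
    ext <;> dsimp only <;> ring
  · intro hb v hv'
    rw [abs_lt] at hv'
    have := hB' hb
    constructor <;> nlinarith
  · intro hb v hv'
    rw [(hB hb).2.2, ← hv]
    congr 1
    simp [θ]
  · intro hb τ v hτ hv' h
    have h1 := (hB' hb).2.2
    have h2 : tB - t₀ = η * (τ - v) := by linear_combination -h
    rw [abs_lt] at hτ hv'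
    have h3 : |τ - v| ≤ 30 := abs_le.2 ⟨by linarith, by linarith⟩
    rw [h2, abs_mul, abs_of_pos hη] at h1
    nlinarith
  · rintro t ht ⟨⟨x, y⟩, hz, h⟩
    have h1 : K.curve t ∈ (K.curve '' T)ᶜ := by
      rw [← h]
      exact (hρO _ (hθb _ hz ρ (by linarith))).1
    obtain ⟨hx, hy⟩ := mem_box.1 hz
    by_cases h2 : |t - t₀| < r
    · left
      have h3 := hu (t - t₀)
      rw [add_sub_cancel, ← h] at h3
      have h4 := hinj (hsmall _ h2).1 (hθr _ hz) h3
      simp only [θ, Prod.mk.injEq] at h4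
      refine ⟨x / 5, ?_, by linarith [h4.1]⟩
      rw [abs_div, abs_of_pos (by norm_num : (0 : ℝ) < 5)]
      linarith
    · right
      by_contra hc
      refine h1 ⟨t, ⟨ht, not_lt.1 h2, fun hb => not_lt.1 fun h5 => hc ?_⟩, rfl⟩
      have h3 := hv (t - tB)
      rw [← (hB hb).2.2, add_sub_cancel, ← h] at h3
      have h4 := hinj (hsmall _ h5).2 (hθr _ hz) h3
      simp only [θ, Prod.mk.injEq] at h4
      have hx0 : x = 0 := by
        rcases mul_eq_zero.1 h4.1.symm with h | h
        · exact absurd h hη.ne'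
        · linarith
      refine ⟨hb, y, hy, ?_⟩
      have := h4.2
      rw [hx0] at this
      linarith
  · rintro _ ⟨z, hz, rfl⟩
    exact (hρO _ (hθb _ hz ρ (by linarith))).2

/-- Small local models without a second strand exist at the parameters that are not those of
double points. -/
lemma exists_localModel {t : ℝ} (ht : t ∈ Ioo (0 : ℝ) 1) (hd : ¬ K.IsDoubleParam t) {O : Set S2}
    (hO : O ∈ 𝓝 (K.curve t)) :
    ∃ M : LocalModel K, M.t₀ = t ∧ ¬ M.hasB ∧ M.G '' box ⊆ O := by
  have ht' := Ioo_subset_Icc_self ht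
  set x : E3 := (K.curve t : E3)
  set v := velocity K.curve t
  have hv : v ≠ 0 := K.immersion t ht'
  -- the great circle in the direction of the turned velocity
  have hdet := det3_turn (S2.inner_self (K.curve t)) (K.inner_velocity t)
  have hw0 : turn x v ≠ 0 := fun h => by
    rw [show turn (K.curve t : E3) (velocity K.curve t) = 0 from h] at hdet
    have : inner ℝ v v = (0 : ℝ) := by rw [← hdet]; simp [det3_eq]
    exact hv (inner_self_eq_zero.1 this)
  set w : E3 := turn x v
  have hsum : ∀ u : ℝ, x + u • w ≠ 0 := fun u h => by
    have h1 : inner ℝ x (x + u • w) = (1 : ℝ) := by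
      rw [inner_add_right, inner_smul_right, inner_turn, S2.inner_self]; ring
    rw [h, inner_zero_right] at h1
    exact zero_ne_one h1
  let δ : ℝ → S2 := fun u => toSphere (K.curve t) (x + u • w)
  have hδ : ContDiff ℝ ∞ fun u => (δ u : E3) := contDiff_iff_contDiffAt.2 fun u =>
    ContDiffAt.comp u (f := fun u : ℝ => x + u • w) (contDiffAt_toSphere _ (hsum u)) (by fun_prop)
  have hδ0 : δ 0 = K.curve t := by
    have : x + (0 : ℝ) • w = K.curve t := by simp [x]
    simp only [δ, this, toSphere_coe]
  have hvel : velocity δ 0 = w := by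
    have hn : ∀ u : ℝ, ‖x + u • w‖ = √(1 + inner ℝ w w * u ^ 2) := fun u => by
      have h1 : inner ℝ x x = (1 : ℝ) := S2.inner_self _
      have h2 : inner ℝ x w = (0 : ℝ) := inner_turn _ _
      rw [norm_eq_sqrt_real_inner, inner_add_left, inner_add_right, inner_add_right,
        inner_smul_left, inner_smul_right, inner_smul_left, inner_smul_right,
        real_inner_comm x w, h1, h2]
      congr 1
      simp only [conj_trivial]
      ring
    have h1 : HasDerivAt (fun u : ℝ => 1 + inner ℝ w w * u ^ 2) 0 0 :=
      (((hasDerivAt_id' (0 : ℝ)).pow 2).const_mul (inner ℝ w w)).const_add 1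
        |>.congr_deriv (by simp)
    have h2 := (h1.sqrt (by simp)).inv (by simp)
    have h3 : HasDerivAt (fun u : ℝ => x + u • w) w 0 :=
      (((hasDerivAt_id' (0 : ℝ)).smul_const w).const_add x).congr_deriv (by simp)
    have h4 := h2.smul h3
    have h5 : (fun u => (δ u : E3)) = fun u : ℝ => (√(1 + inner ℝ w w * u ^ 2))⁻¹ • (x + u • w) :=
      funext fun u => by rw [← hn]; exact coe_toSphere _ (hsum u)
    show deriv (fun u => (δ u : E3)) 0 = w
    rw [h5]
    refine HasDerivAt.deriv (h4.congr_deriv ?_)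
    simp
  obtain ⟨M, h1, h2, -, -, -, h3⟩ := K.exists_localModel_of_transverse ht hδ hδ0
    (by rw [hvel, hdet]; exact fun h => hv (inner_self_eq_zero.1 h)) hO False 0 (fun h => h.elim)
    (fun s hs h => Or.inl (by_contra fun hne => hd ⟨ht', s, hs, hne, h⟩))
  exact ⟨M, h1, by rw [h2]; exact not_false, h3⟩

/-- Small local models exist at double points. -/
lemma exists_localModel_of_double {s t : ℝ} (hs : s ∈ Icc (0 : ℝ) 1) (ht : t ∈ Icc (0 : ℝ) 1)
    (hst : s ≠ t) (h : K.curve s = K.curve t) {O : Set S2} (hO : O ∈ 𝓝 (K.curve s)) :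
    ∃ M : LocalModel K, M.t₀ = s ∧ M.hasB ∧ M.tB = t ∧ M.lam = M.mu ∧ 0 < M.mu ∧
      M.G '' box ⊆ O := by
  have he := K.endpoints s hs t ht hst h
  have hvel : velocity (fun v => K.curve (t + v)) 0 = velocity K.curve t := by
    have := (K.hasDerivAt (t + 0)).comp_const_add t 0
    rw [add_zero] at this
    exact this.deriv
  obtain ⟨M, h1, h2, h3, h4⟩ := K.exists_localModel_of_transverse he.1
    (δ := fun v => K.curve (t + v)) (K.smooth.comp (contDiff_const.add contDiff_id))
    (by rw [add_zero, h]) (by rw [hvel]; exact K.det3_velocity_ne_zero hs ht hst h) hO True t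
    (fun _ => ⟨he.2, hst.symm, fun _ => rfl⟩) fun u hu hus => by
      rcases K.double u hu s hs t ht hus h with h1 | h1 | h1
      exacts [Or.inl h1, absurd h1 hst, Or.inr ⟨trivial, h1⟩]
  exact ⟨M, h1, by rw [h2]; exact trivial, h3, h4⟩

end KnotoidDiagram

/-! ### Modifications in small discs -/

namespace Window

variable {n : ℕ} {K : KnotoidDiagram} {W : Window n}

/-- The discs of windows are neighbourhoods of their points: the chart extends to a local
diffeomorphism of the space, and only its values on the plane lie on the sphere. -/
lemma chart_image_mem_nhds (W : Window n) {x : EuclideanSpace ℝ (Fin 2)}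
    {U : Set (EuclideanSpace ℝ (Fin 2))} (hU : U ∈ 𝓝 x) : W.chart '' U ∈ 𝓝 (W.chart x) := by
  let E2 := EuclideanSpace ℝ (Fin 2)
  let Ψ : E2 × ℝ → E3 := fun z => z.2 • (W.chart z.1 : E3)
  have hΨ : ContDiff ℝ ∞ Ψ := contDiff_snd.smul (W.chart_smooth.comp contDiff_fst)
  set D := fderiv ℝ (fun y => (W.chart y : E3)) x
  have hD : HasFDerivAt (fun y => (W.chart y : E3)) D x :=
    (W.chart_smooth.differentiable (by simp) x).hasFDerivAt
  have hs := hΨ.contDiffAt.hasStrictFDerivAt (x := (x, (1 : ℝ))) (by simp)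
  have hf : ∀ (a : E2) (b : ℝ), fderiv ℝ Ψ (x, 1) (a, b) = D a + b • (W.chart x : E3) := by
    have h1 : HasFDerivAt (fun z : E2 × ℝ => (W.chart z.1 : E3))
        (D.comp (ContinuousLinearMap.fst ℝ E2 ℝ)) (x, 1) :=
      HasFDerivAt.comp (x, (1 : ℝ)) (g := fun y => (W.chart y : E3)) hD hasFDerivAt_fst
    intro a b
    rw [show fderiv ℝ Ψ (x, 1) = _ from (hasFDerivAt_snd.smul h1).fderiv]
    simp
  have hinj : Function.Injective (fderiv ℝ Ψ (x, 1)) := by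
    rw [injective_iff_map_eq_zero]
    rintro ⟨a, b⟩ hab
    rw [hf] at hab
    -- the image of `D` is orthogonal to the point of the sphere
    have ho : inner ℝ (W.chart x : E3) (D a) = (0 : ℝ) := by
      have h1 : HasDerivAt (fun u : ℝ => x + u • a) a 0 :=
        (((hasDerivAt_id' (0 : ℝ)).smul_const a).const_add x).congr_deriv (by simp)
      have h2 : HasFDerivAt (fun y => (W.chart y : E3)) D (x + (0 : ℝ) • a) := by simpa using hD
      have h3 := inner_eq_zero_of_hasDerivAt (γ := fun u => W.chart (x + u • a))
        (HasFDerivAt.comp_hasDerivAt (0 : ℝ) (f := fun u : ℝ => x + u • a) h2 h1)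
      simpa using h3
    have hb : b = 0 := by
      have h1 : inner ℝ (W.chart x : E3) (D a + b • (W.chart x : E3)) = (0 : ℝ) := by
        rw [hab, inner_zero_right]
      rwa [inner_add_right, ho, inner_smul_right, S2.inner_self, zero_add, mul_one] at h1
    rw [hb, zero_smul, add_zero] at hab
    have ha : a = 0 := W.chart_immersion x (hab.trans (map_zero _).symm)
    rw [ha, hb]; rfl
  have hsurj : (fderiv ℝ Ψ (x, 1)).range = ⊤ := by
    have h1 : Module.finrank ℝ (E2 × ℝ) = Module.finrank ℝ E3 := by simp [E2]
    exact LinearMap.range_eq_top.2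
      ((LinearMap.injective_iff_surjective_of_finrank_eq_finrank h1
        (f := (fderiv ℝ Ψ (x, 1) : E2 × ℝ →ₗ[ℝ] E3))).1 hinj)
  have hmap := hs.map_nhds_eq_of_surj hsurj
  have hnb : U ×ˢ Ioi (0 : ℝ) ∈ 𝓝 (x, (1 : ℝ)) := prod_mem_nhds hU (Ioi_mem_nhds one_pos)
  have him : Ψ '' (U ×ˢ Ioi (0 : ℝ)) ∈ 𝓝 (W.chart x : E3) := by
    have h1 : Ψ (x, 1) = W.chart x := by simp [Ψ]
    rw [← h1, ← hmap]
    exact image_mem_map hnb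
  filter_upwards [continuous_subtype_val.continuousAt.preimage_mem_nhds him]
  rintro y ⟨⟨z, c⟩, ⟨hz, hc⟩, hy⟩
  have hc1 : c = 1 := by
    have h1 : ‖c • (W.chart z : E3)‖ = ‖(y : E3)‖ := congrArg norm hy
    rwa [norm_smul, S2.norm_coe, S2.norm_coe, mul_one, Real.norm_of_nonneg (le_of_lt hc)] at h1
  refine ⟨z, hz, Subtype.ext ?_⟩
  rw [← hy, hc1]
  simp [Ψ]

lemma Meets.image_ball_mem_nhds (hW : W.Meets K) {t : ℝ} {i : Fin n}
    (ht : t ∈ Ioo (W.a i) (W.b i)) : W.chart '' Metric.ball 0 1 ∈ 𝓝 (K.curve t) := by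
  obtain ⟨x, hx, h⟩ := (hW.2.1 t (W.Ioo_subset ht)).2 ⟨i, ht⟩
  rw [← h]
  exact W.chart_image_mem_nhds (Metric.isOpen_ball.mem_nhds hx)

lemma notMem_Ioo_of_endpoint (W : Window n) {t : ℝ} {i : Fin n} (ht : t = W.a i ∨ t = W.b i)
    (j : Fin n) : t ∉ Ioo (W.a j) (W.b j) := by
  intro h
  have hi : t ∈ Icc (W.a i) (W.b i) := by
    rcases ht with rfl | rfl
    exacts [left_mem_Icc.2 (W.a_lt_b i).le, right_mem_Icc.2 (W.a_lt_b i).le]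
  by_cases hij : i = j
  · subst hij
    rcases ht with rfl | rfl
    exacts [lt_irrefl _ h.1, lt_irrefl _ h.2]
  · exact Set.disjoint_left.1 (W.disjoint i j hij) hi (Ioo_subset_Icc_self h)

/-- A parameter inside a strand whose disc holds no crossing is not that of a double point. -/
lemma Kink.not_isDoubleParam {W : Window 1} {ε : ℤ} {L : KnotoidDiagram} (h : W.Kink ε K L)
    {t : ℝ} (ht : t ∈ Ioo (W.a 0) (W.b 0)) : ¬ K.IsDoubleParam t := by
  rintro ⟨ht', s, hs, hst, hc⟩
  obtain ⟨i, hi⟩ := (h.1.1.mem_Ioo_iff hs ht' hc).2 ⟨0, ht⟩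
  rw [Fin.fin_one_eq_zero i] at hi
  have hne : ∀ q, q ∉ W.crossings K 0 0 := fun q => by rw [h.2.1]; exact notMem_empty q
  by_cases hu : t ∈ K.upper
  · exact hne (t, s) ⟨⟨ht', hs, hst.symm, hc.symm, hu⟩, ht, hi⟩
  · exact hne (s, t) ⟨⟨hs, ht', hst, hc, (K.upper_iff s hs t ht' hst hc).2 hu⟩, hi, ht⟩

/-- Two loops of the same sign, created in possibly different discs, can be exchanged if the
second one also lies in the first disc. -/
lemma Kink.reidemeister1' {W W' : Window 1} {ε : ℤ} {K₁ K₂ : KnotoidDiagram} (h : W.Kink ε K K₁)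
    (h' : W'.Kink ε K K₂) (hr : W.Replaces K K₂)
    (hin : ∀ p ∈ W'.crossings K₂ 0 0, p.1 ∈ Ioo (W.a 0) (W.b 0) ∧ p.2 ∈ Ioo (W.a 0) (W.b 0)) :
    Reidemeister1' K₁ K₂ := by
  obtain ⟨hW, hc, p, hp, hpε⟩ := h
  obtain ⟨hW', hc', p', hp', hpε'⟩ := h'
  refine ⟨W, hW.symm.trans hr, p, p', hp, ?_, hpε.trans hpε'.symm⟩
  have hm : p' ∈ W'.crossings K₂ 0 0 := by rw [hp']; rfl
  refine eq_singleton_iff_unique_mem.2 ⟨⟨hm.1, hin p' hm⟩, fun q hq => ?_⟩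
  by_cases h1 : ∃ i, q.1 ∈ Ioo (W'.a i) (W'.b i)
  · obtain ⟨j, h2⟩ := (hW'.2.1.mem_Ioo_iff hq.1.1 hq.1.2.1 hq.1.2.2.2.1).1 h1
    obtain ⟨i, h1⟩ := h1
    rw [Fin.fin_one_eq_zero i] at h1
    rw [Fin.fin_one_eq_zero j] at h2
    have : q ∈ W'.crossings K₂ 0 0 := ⟨hq.1, h1, h2⟩
    rwa [hp'] at this
  · push Not at h1
    have h2 := hW'.symm.outside_subset ⟨hq.1, h1⟩
    have h3 : q ∈ W.crossings K 0 0 := ⟨h2.1, hq.2⟩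
    rw [hc] at h3
    exact h3.elim

end Window

lemma KinkAt.not_isDoubleParam {ε : ℤ} {K L : KnotoidDiagram} {s : ℝ} (h : KinkAt ε K s L) :
    ¬ K.IsDoubleParam s := by
  obtain ⟨W, hs, h⟩ := h
  exact h.not_isDoubleParam hs

lemma KinkAt.mem_Ioo {ε : ℤ} {K L : KnotoidDiagram} {s : ℝ} (h : KinkAt ε K s L) :
    s ∈ Ioo (0 : ℝ) 1 := by
  obtain ⟨W, hs, -⟩ := h
  exact W.Icc_subset (Ioo_subset_Icc_self hs)

namespace LocalModel

variable {K L : KnotoidDiagram} {M : LocalModel K} {p : ℝ → ℝ} {n : ℕ} {W : Window n}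

lemma A_mem_image {τ : ℝ} (hτ : |τ| < 5) : K.curve (M.A τ) ∈ M.G '' box := by
  refine ⟨_, ?_, (M.A_curve τ hτ).symm⟩
  rw [_root_.mem_box, abs_mul, abs_of_pos (by norm_num : (0 : ℝ) < 5)]
  exact ⟨by linarith, sq_lt_25 hτ⟩

lemma B_mem_image (hb : M.hasB) {v : ℝ} (hv : |v| < 25) : K.curve (M.B v) ∈ M.G '' box :=
  ⟨_, by rw [_root_.mem_box]; simpa using hv, (M.B_curve hb v hv).symm⟩

lemma out_of_notMem {t : ℝ} (h : K.curve t ∉ M.G '' box) : M.Out t :=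
  ⟨fun _ hτ e => h (e ▸ A_mem_image hτ), fun hb _ hv e => h (e ▸ B_mem_image hb hv)⟩

lemma mod_curve_of_notMem (hp : Flat M.hasB p) (o : ℝˣ) {t : ℝ} (h : K.curve t ∉ M.G '' box) :
    (M.mod p hp o).curve t = K.curve t :=
  ((out_of_notMem h).modCurve_eventuallyEq hp).eq_of_nhds

lemma mod_curve_mem_image_iff (hp : Flat M.hasB p) (o : ℝˣ) (t : ℝ) :
    (M.mod p hp o).curve t ∈ M.G '' box ↔ K.curve t ∈ M.G '' box := by
  show M.modCurve p t ∈ _ ↔ _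
  rcases M.cases t with ⟨τ, hτ, rfl⟩ | ⟨hb, v, hv, rfl⟩ | hto
  · rw [modCurve_A hp hτ]
    exact iff_of_true ⟨_, hp.mem_box hτ, rfl⟩ (A_mem_image hτ)
  · rw [(LocalModel.modCurve_eventuallyEq hp (B_ne_A hb hv)).eq_of_nhds]
  · rw [(hto.modCurve_eventuallyEq hp).eq_of_nhds]

/-- A modification inside the disc of a window, or away from it, does not change the strands. -/
lemma meets_mod (hW : W.Meets K) (hp : Flat M.hasB p) (o : ℝˣ)
    (h : M.G '' box ⊆ W.chart '' Metric.ball 0 1 ∨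
      Disjoint (M.G '' box) (W.chart '' Metric.closedBall 0 1)) : W.Meets (M.mod p hp o) := by
  have hsub : W.chart '' Metric.ball 0 1 ⊆ W.chart '' Metric.closedBall 0 1 :=
    image_mono Metric.ball_subset_closedBall
  have key : ∀ (S : Set S2), (M.G '' box ⊆ S ∨ Disjoint (M.G '' box) S) → ∀ t,
      ((M.mod p hp o).curve t ∈ S ↔ K.curve t ∈ S) := by
    intro S hS t
    by_cases ht : K.curve t ∈ M.G '' box
    · have ht' := (mod_curve_mem_image_iff hp o t).2 ht
      rcases hS with hS | hS
      · exact iff_of_true (hS ht') (hS ht)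
      · exact iff_of_false (Set.disjoint_left.1 hS ht') (Set.disjoint_left.1 hS ht)
    · rw [mod_curve_of_notMem hp o ht]
  refine ⟨fun t ht => ?_, fun t ht => ?_, fun i => ?_⟩
  · rw [key _ (h.imp_left fun h => h.trans hsub) t]; exact hW.1 t ht
  · rw [key _ (h.imp_right fun h => h.mono_right hsub) t]; exact hW.2.1 t ht
  · have hbd : ∀ t, t = W.a i ∨ t = W.b i → ¬ K.IsDoubleParam t →
        ¬ (M.mod p hp o).IsDoubleParam t := by
      rintro t ht hK ⟨ht', s, hs, hst, hc⟩
      have h1 : t ∈ Icc (W.a i) (W.b i) := by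
        rcases ht with rfl | rfl
        exacts [left_mem_Icc.2 (W.a_lt_b i).le, right_mem_Icc.2 (W.a_lt_b i).le]
      have h2 : K.curve t ∉ W.chart '' Metric.ball 0 1 := fun hm =>
        let ⟨j, hj⟩ := (hW.2.1 t ht').1 hm
        W.notMem_Ioo_of_endpoint ht j hj
      have h3 : K.curve t ∉ M.G '' box := fun hm => by
        rcases h with h | h
        · exact h2 (h hm)
        · exact Set.disjoint_left.1 h hm ((hW.1 t ht').2 ⟨i, h1⟩)
      have h4 : K.curve s ∉ M.G '' box := by
        rw [← mod_curve_mem_image_iff hp o, hc, mod_curve_mem_image_iff hp o]; exact h3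
      rw [mod_curve_of_notMem hp o h3, mod_curve_of_notMem hp o h4] at hc
      exact hK ⟨ht', s, hs, hst, hc⟩
    exact ⟨hbd _ (Or.inl rfl) (hW.2.2 i).1, hbd _ (Or.inr rfl) (hW.2.2 i).2⟩

lemma replaces_mod_self (hW : W.Meets K) (hp : Flat M.hasB p) (o : ℝˣ)
    (h : M.G '' box ⊆ W.chart '' Metric.ball 0 1) : W.Replaces K (M.mod p hp o) := by
  refine ⟨hW, meets_mod hW hp o (Or.inl h), fun t ht hi => ?_⟩
  have h1 : K.curve t ∉ M.G '' box := fun hm => by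
    obtain ⟨i, h2⟩ := (hW.2.1 t ht).1 (h hm)
    exact hi i h2
  exact ⟨(mod_curve_of_notMem hp o h1).symm, fun _ => ((out_of_notMem h1).mem_modUpper o).symm⟩

/-- Modifications away from the disc of a window do not affect the crossings in the disc. -/
lemma crossings_mod_of_disjoint (hW : W.Meets K) (hp : Flat M.hasB p) (o : ℝˣ)
    (h : Disjoint (M.G '' box) (W.chart '' Metric.closedBall 0 1)) (i j : Fin n) :
    W.crossings (M.mod p hp o) i j = W.crossings K i j ∧
      ∀ q ∈ W.crossings K i j, (M.mod p hp o).crossingSign q = K.crossingSign q := by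
  have hout : ∀ {i t}, t ∈ Ioo (W.a i) (W.b i) → M.Out t := fun {i t} ht =>
    out_of_notMem fun hm => Set.disjoint_left.1 h hm
      ((hW.1 t (W.Ioo_subset ht)).2 ⟨i, Ioo_subset_Icc_self ht⟩)
  constructor
  · ext q
    refine and_congr_left fun ⟨h1, h2⟩ => ?_
    refine and_congr_right fun _ => and_congr_right fun _ => and_congr_right fun _ => ?_
    refine and_congr ?_ ((hout h1).mem_modUpper o)
    show M.modCurve p q.1 = M.modCurve p q.2 ↔ _
    rw [((hout h1).modCurve_eventuallyEq hp).eq_of_nhds,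
      ((hout h2).modCurve_eventuallyEq hp).eq_of_nhds]
  · rintro q ⟨-, h1, h2⟩
    exact KnotoidDiagram.crossingSign_congr ((hout h1).modCurve_eventuallyEq hp)
      ((hout h2).modCurve_eventuallyEq hp)

/-- A local model of a diagram is one of any other diagram that is the same there. -/
def congr (M : LocalModel K) (h : ∀ t ∈ Icc (0 : ℝ) 1,
    K.curve t ∈ M.G '' box ∨ L.curve t ∈ M.G '' box → L.curve t = K.curve t) : LocalModel L :=
  { M with
    A_curve := fun τ hτ => (h _ (M.mem_Icc_A hτ) (Or.inl (A_mem_image hτ))).trans (M.A_curve τ hτ)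
    B_curve := fun hb v hv => (h _ (Ioo_subset_Icc_self (M.B_mem hb v hv))
      (Or.inl (B_mem_image hb hv))).trans (M.B_curve hb v hv)
    rest := fun t ht hm => M.rest t ht (h t ht (Or.inr hm) ▸ hm) }

/-- The same modification on both sides of a replacement, away from the disc. -/
lemma replaces_mod_congr (hW : W.Replaces K L)
    (h : ∀ t ∈ Icc (0 : ℝ) 1, K.curve t ∈ M.G '' box ∨ L.curve t ∈ M.G '' box →
      L.curve t = K.curve t) (hb : ¬ M.hasB) (hp : Flat M.hasB p) (o : ℝˣ)
    (hdis : Disjoint (M.G '' box) (W.chart '' Metric.closedBall 0 1)) :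
    W.Replaces (M.mod p hp o) ((M.congr h).mod p hp o) := by
  refine ⟨meets_mod hW.1 hp o (Or.inr hdis), meets_mod (M := M.congr h) hW.2.1 hp o (Or.inr hdis),
    fun t ht hi => ⟨?_, fun hd => ?_⟩⟩
  · show M.modCurve p t = (M.congr h).modCurve p t
    unfold modCurve
    split_ifs with h1 h2 h2
    exacts [rfl, absurd h1 h2, absurd h2 h1, (hW.2.2 t ht hi).1]
  · obtain ⟨-, s, hs, hst, hc⟩ := hd
    show t ∈ M.modUpper p o ↔ t ∈ (M.congr h).modUpper p o
    rcases modCurve_coincidence hp ht hs hst.symm hc.symm with ⟨τ, hτ, h0, hpτ, rfl, -⟩ |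
      ⟨hb', -⟩ | ⟨hb', -⟩ | ⟨ho, hos, hK⟩
    · have h1 := A_mem_modUpper (M := M) (p := p) o hτ
      have h2 := A_mem_modUpper (M := M.congr h) (p := p) o hτ
      refine h1.trans (Iff.trans ?_ h2.symm)
      simp only [ne_eq, h0, not_false_eq_true, hpτ, true_and, not_true_eq_false, false_and, or_false]
    · exact absurd hb' hb
    · exact absurd hb' hb
    · have ho' : (M.congr h).Out t := ho
      rw [ho.mem_modUpper, ho'.mem_modUpper]
      exact (hW.2.2 t ht hi).2 ⟨ht, s, hs, hst, hK.symm⟩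

/-- The local model with the opposite horizontal coordinate. -/
def mirror (M : LocalModel K) : LocalModel K where
  G z := M.G (-z.1, z.2)
  smooth := by
    refine M.smooth.comp (contDiff_fst.neg.prodMk contDiff_snd).contDiffOn ?_
    rintro ⟨x, y⟩ hz
    rw [_root_.mem_box] at hz
    exact _root_.mem_box.2 (by rwa [abs_neg])
  inj := by
    rintro ⟨x, y⟩ hz ⟨x', y'⟩ hz' h
    rw [_root_.mem_box] at hz hz'
    have := M.inj (_root_.mem_box.2 (by rwa [abs_neg])) (_root_.mem_box.2 (by rwa [abs_neg])) h
    simpa using this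
  orient := -M.orient
  orient_pos := by
    rintro ⟨x, y⟩ hz
    rw [_root_.mem_box] at hz
    have hz' : (-x, y) ∈ box := _root_.mem_box.2 (by rwa [abs_neg])
    have h1 : HasFDerivAt (fun z : ℝ × ℝ => (-z.1, z.2))
        ((-ContinuousLinearMap.fst ℝ ℝ ℝ).prod (ContinuousLinearMap.snd ℝ ℝ ℝ)) (x, y) :=
      hasFDerivAt_fst.neg.prodMk hasFDerivAt_snd
    have h2 := HasFDerivAt.comp (x, y) (f := fun z : ℝ × ℝ => (-z.1, z.2)) (M.hasFDerivAt hz') h1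
    have h3 : fderiv ℝ (fun z : ℝ × ℝ => (M.G (-z.1, z.2) : E3)) (x, y) = _ := h2.fderiv
    rw [h3]
    have h4 := M.orient_pos _ hz'
    have h5 := M.det3_DG (-x, y) (-1) 0 0 1
    simp only [ContinuousLinearMap.comp_apply, ContinuousLinearMap.prod_apply,
      neg_apply, ContinuousLinearMap.coe_fst', ContinuousLinearMap.coe_snd',
      neg_zero]
    rw [h5]
    simp only [DG]
    linarith
  t₀ := M.t₀
  lam := -M.lam
  lam_ne := neg_ne_zero.2 M.lam_ne
  hasB := M.hasB
  tB := M.tB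
  mu := M.mu
  mu_ne := M.mu_ne
  A_mem τ hτ := by
    rw [neg_mul_comm]; exact M.A_mem (-τ) (by rwa [abs_neg])
  A_curve τ hτ := by
    rw [neg_mul_comm, M.A_curve (-τ) (by rwa [abs_neg])]; simp
  B_mem := M.B_mem
  B_curve hb v hv := by rw [M.B_curve hb v hv]; simp
  A_ne_B hb τ v hτ hv := by
    rw [neg_mul_comm]; exact M.A_ne_B hb (-τ) v (by rwa [abs_neg]) hv
  rest := by
    rintro t ht ⟨⟨x, y⟩, hz, h⟩
    rw [_root_.mem_box] at hz
    refine (M.rest t ht ⟨(-x, y), _root_.mem_box.2 (by rwa [abs_neg]), h⟩).imp_left ?_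
    rintro ⟨τ, hτ, rfl⟩
    exact ⟨-τ, by rwa [abs_neg], by ring⟩

lemma mirror_A (τ : ℝ) : M.mirror.A τ = M.A (-τ) := by
  simp only [A, mirror]; ring

/-- In the mirrored model, a flat function describes the reflected strand. -/
lemma same_mod_mirror (hp : Flat M.hasB p) (o : ℝˣ) :
    (M.mod _ hp.reflect (-o)).Same (M.mirror.mod p hp o) := by
  have hinv : ∀ t, M.mirror.invA t = -M.invA t := fun t => by
    simp only [invA, mirror]; rw [div_neg]
  refine ⟨fun t _ => ?_, ?_⟩
  · show M.mirror.modCurve p t = M.modCurve (fun t => -p (-t)) t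
    unfold modCurve
    simp only [hinv, abs_neg]
    split_ifs
    · show M.G (-p (-M.invA t), -(-M.invA t) ^ 2) = _
      rw [neg_sq]
    · rfl
  · intro t _
    show t ∈ M.mirror.modUpper p o ↔ t ∈ M.modUpper (fun t => -p (-t)) (-o)
    rcases M.cases t with ⟨τ, hτ, rfl⟩ | ⟨hb, v, hv, rfl⟩ | hto
    · have h1 := A_mem_modUpper (M := M.mirror) (p := p) o (τ := -τ) (by rwa [abs_neg])
      rw [mirror_A, neg_neg] at h1
      rw [h1, A_mem_modUpper (-o) hτ, neg_neg, Units.val_neg, neg_mul_comm, neg_inj, neg_ne_zero]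
      rfl
    · exact (B_mem_modUpper (M := M.mirror) o hb hv).trans (B_mem_modUpper (-o) hb hv).symm
    · have h1 : M.mirror.Out t := ⟨fun τ hτ e => hto.1 (-τ) (by rwa [abs_neg]) (by rw [e, mirror_A]),
        hto.2⟩
      rw [h1.mem_modUpper, hto.mem_modUpper]

end LocalModel

/-! ### Kinks slide along the diagram -/

variable {n : ℕ} {ε : ℤ} {K L K₁ K₂ : KnotoidDiagram} {s t : ℝ}

lemma FramedKnotoidMove.toFramedKnotoid_eq (h : FramedKnotoidMove K L) :
    K.toFramedKnotoid = L.toFramedKnotoid :=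
  Quotient.sound (Relation.EqvGen.rel _ _ h)

lemma KnotoidDiagram.Isotopic.toFramedKnotoid_eq (h : K.Isotopic L) :
    K.toFramedKnotoid = L.toFramedKnotoid :=
  FramedKnotoidMove.toFramedKnotoid_eq (Or.inl h)

lemma Reidemeister1'.toFramedKnotoid_eq (h : Reidemeister1' K L) :
    K.toFramedKnotoid = L.toFramedKnotoid :=
  FramedKnotoidMove.toFramedKnotoid_eq (Or.inr (Or.inl h))

lemma Reidemeister2.toFramedKnotoid_eq (h : Reidemeister2 K L) :
    K.toFramedKnotoid = L.toFramedKnotoid :=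
  FramedKnotoidMove.toFramedKnotoid_eq (Or.inr (Or.inr (Or.inl h)))

lemma Reidemeister3.toFramedKnotoid_eq (h : Reidemeister3 K L) :
    K.toFramedKnotoid = L.toFramedKnotoid :=
  FramedKnotoidMove.toFramedKnotoid_eq (Or.inr (Or.inr (Or.inr h)))

lemma exists_unit_sign {x : ℝ} (hx : x ≠ 0) (hε : ε = 1 ∨ ε = -1) :
    ∃ o : ℝˣ, ((SignType.sign (x * o) : SignType) : ℤ) = ε := by
  have h : ∀ y : ℝ, 0 < y → ((SignType.sign y : SignType) : ℤ) = 1 ∧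
      ((SignType.sign (-y) : SignType) : ℤ) = -1 := fun y hy => by
    rw [sign_pos hy, sign_neg (neg_lt_zero.2 hy)]; exact ⟨rfl, rfl⟩
  rcases lt_or_gt_of_ne hx with h1 | h1 <;> rcases hε with rfl | rfl
  · exact ⟨-1, by simpa using (h (-x) (by linarith)).1⟩
  · exact ⟨1, by simpa using (h (-x) (by linarith)).2⟩
  · exact ⟨1, by simpa using (h x h1).1⟩
  · exact ⟨-1, by simpa using (h x h1).2⟩

namespace LocalModel

variable (M : LocalModel K)

/-- A small kink, created in a local model without a strand `B`. -/
lemma kinkAt_oneLoop (hb : ¬ M.hasB) (o : ℝˣ) : KinkAt (SignType.sign (M.orient * o) : SignType)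
    K M.t₀ (M.mod _ (flat_oneLoop hb) o) :=
  (same_mod_base (flat_base _) (fun _ => rfl) o).kinkAt (M.kinkAt_outer hb o)

/-- A kink is exchanged for a small one in the same disc. -/
lemma reidemeister1'_oneLoop (hb : ¬ M.hasB) (o : ℝˣ) {W : Window 1}
    (h : W.Kink (SignType.sign (M.orient * o) : SignType) K L)
    (hsub : M.G '' box ⊆ W.chart '' Metric.ball 0 1) :
    Reidemeister1' L (M.mod _ (flat_oneLoop hb) o) := by
  obtain ⟨W', -, hW'⟩ := M.kinkAt_oneLoop hb o
  refine h.reidemeister1' hW' (replaces_mod_self h.1.1 _ o hsub) fun q hq => ?_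
  have hin : ∀ {τ}, |τ| < 5 → M.A τ ∈ Ioo (W.a 0) (W.b 0) := fun {τ} hτ => by
    obtain ⟨i, hi⟩ := (h.1.1.2.1 _ (M.mem_Icc_A hτ)).1 (hsub (A_mem_image hτ))
    rwa [Fin.fin_one_eq_zero i] at hi
  rcases (mem_crossings_mod _ o q).1 hq.1 with ⟨τ, hτ, -, -, -, rfl⟩ | ⟨hb', -⟩ | ⟨hb', -⟩ |
    ⟨-, -, hK⟩
  · exact ⟨hin hτ, hin (by rwa [abs_neg])⟩
  · exact absurd hb' hb
  · exact absurd hb' hb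
  · have : q ∈ W'.crossings K 0 0 := ⟨hK, hq.2⟩
    rw [hW'.2.1] at this
    exact this.elim

end LocalModel

/-- A small local model at a parameter, with the over/under data that produce kinks of sign `ε`. -/
lemma exists_localModel_sign (hε : ε = 1 ∨ ε = -1) (hs : s ∈ Ioo (0 : ℝ) 1)
    (hd : ¬ K.IsDoubleParam s) {O : Set S2} (hO : O ∈ 𝓝 (K.curve s)) :
    ∃ (M : LocalModel K) (o : ℝˣ), M.t₀ = s ∧ ¬ M.hasB ∧ M.G '' box ⊆ O ∧
      ((SignType.sign (M.orient * o) : SignType) : ℤ) = ε := by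
  obtain ⟨M, h1, h2, h3⟩ := K.exists_localModel hs hd hO
  obtain ⟨o, ho⟩ := exists_unit_sign M.orient_ne hε
  exact ⟨M, o, h1, h2, h3, ho⟩

lemma exists_kinkAt (hε : ε = 1 ∨ ε = -1) (hs : s ∈ Ioo (0 : ℝ) 1) (hd : ¬ K.IsDoubleParam s) :
    ∃ L, KinkAt ε K s L := by
  obtain ⟨M, o, rfl, hb, -, rfl⟩ := exists_localModel_sign hε hs hd univ_mem
  exact ⟨_, M.kinkAt_oneLoop hb o⟩

/-- Two kinks of the same sign at the same place differ by moves of the type R1': both are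
exchanged for the same small kink. -/
lemma KinkAt.toFramedKnotoid_eq (hε : ε = 1 ∨ ε = -1) (h₁ : KinkAt ε K s K₁)
    (h₂ : KinkAt ε K s K₂) : K₁.toFramedKnotoid = K₂.toFramedKnotoid := by
  have hd := h₁.not_isDoubleParam
  have hs := h₁.mem_Ioo
  obtain ⟨W₁, hs₁, hW₁⟩ := h₁
  obtain ⟨W₂, hs₂, hW₂⟩ := h₂
  obtain ⟨M, o, rfl, hb, hsub, rfl⟩ := exists_localModel_sign hε hs hd
    (inter_mem (hW₁.1.1.image_ball_mem_nhds hs₁) (hW₂.1.1.image_ball_mem_nhds hs₂))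
  exact (M.reidemeister1'_oneLoop hb o hW₁ fun x hx => (hsub hx).1).toFramedKnotoid_eq.trans
    (M.reidemeister1'_oneLoop hb o hW₂ fun x hx => (hsub hx).2).toFramedKnotoid_eq.symm

/-- Kinks can be created outside the disc of a replacement, on both sides at once. -/
lemma Window.Replaces.exists_kinkAt {W : Window n} (hW : W.Replaces K L) (hε : ε = 1 ∨ ε = -1)
    (hs : s ∈ Ioo (0 : ℝ) 1) (hsW : ∀ i, s ∉ Icc (W.a i) (W.b i)) (hd : ¬ K.IsDoubleParam s) :
    ∃ K' L', KinkAt ε K s K' ∧ KinkAt ε L s L' ∧ W.Replaces K' L' ∧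
      (∀ i j, W.crossings K' i j = W.crossings K i j ∧
        ∀ q ∈ W.crossings K i j, K'.crossingSign q = K.crossingSign q) ∧
      ∀ i j, W.crossings L' i j = W.crossings L i j ∧
        ∀ q ∈ W.crossings L i j, L'.crossingSign q = L.crossingSign q := by
  have hs' := Ioo_subset_Icc_self hs
  have hcl : IsClosed (W.chart '' Metric.closedBall 0 1) :=
    ((isCompact_closedBall 0 1).image
      (continuous_induced_rng.2 W.chart_smooth.continuous)).isClosed
  obtain ⟨M, o, rfl, hb, hsub, rfl⟩ := exists_localModel_sign hε hs hd
    (hcl.isOpen_compl.mem_nhds fun hm => by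
      obtain ⟨i, hi⟩ := (hW.1.1 _ hs').1 hm
      exact hsW i hi)
  have hdis : Disjoint (M.G '' box) (W.chart '' Metric.closedBall 0 1) :=
    disjoint_left.2 fun x hx => hsub hx
  have hKL : ∀ t ∈ Icc (0 : ℝ) 1, K.curve t ∈ M.G '' box ∨ L.curve t ∈ M.G '' box →
      L.curve t = K.curve t := fun t ht hm => by
    refine (hW.2.2 t ht fun i hi => ?_).1.symm
    have hi' : ∃ i, t ∈ Icc (W.a i) (W.b i) := ⟨i, Ioo_subset_Icc_self hi⟩
    rcases hm with hm | hm
    exacts [disjoint_left.1 hdis hm ((hW.1.1 t ht).2 hi'),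
      disjoint_left.1 hdis hm ((hW.2.1.1 t ht).2 hi')]
  exact ⟨_, _, M.kinkAt_oneLoop hb o, (M.congr hKL).kinkAt_oneLoop hb o,
    LocalModel.replaces_mod_congr hW hKL hb _ o hdis,
    LocalModel.crossings_mod_of_disjoint hW.1 _ o hdis,
    LocalModel.crossings_mod_of_disjoint (M := M.congr hKL) hW.2.1 _ o hdis⟩

lemma Window.Bigon.exists_kinkAt {W : Window 2} (hW : W.Bigon K L) (hε : ε = 1 ∨ ε = -1)
    (hs : s ∈ Ioo (0 : ℝ) 1) (hsW : ∀ i, s ∉ Icc (W.a i) (W.b i)) (hd : ¬ K.IsDoubleParam s) :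
    ∃ K' L', KinkAt ε K s K' ∧ KinkAt ε L s L' ∧ W.Bigon K' L' := by
  obtain ⟨hW, h1, h2, p, q, hpq, hp, hq⟩ := hW
  obtain ⟨K', L', hK, hL, hW', cK, cL⟩ := hW.exists_kinkAt hε hs hsW hd
  refine ⟨K', L', hK, hL, hW', fun i j => (cK i j).1.trans (h1 i j),
    fun i j hij => (cL i j).1.trans (h2 i j hij), p, q, (cL 0 1).1.trans hpq, ?_, ?_⟩
  · rw [(cL 0 1).2 p (by rw [hpq]; simp), hp]
  · rw [(cL 0 1).2 q (by rw [hpq]; simp), hq]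

/-- All kinks of sign `ε` created on `K` sufficiently near to the parameter `t` represent the
framed knotoid `c`. -/
def KinkNear (ε : ℤ) (K : KnotoidDiagram) (c : FramedKnotoid) (t : ℝ) : Prop :=
  ∀ᶠ s in 𝓝 t, ∀ L, KinkAt ε K s L → L.toFramedKnotoid = c

lemma KinkNear.unique (hε : ε = 1 ∨ ε = -1) (ht : t ∈ Ioo (0 : ℝ) 1) {c c' : FramedKnotoid}
    (h : KinkNear ε K c t) (h' : KinkNear ε K c' t) : c = c' := by
  have hd : Dense {t | K.IsDoubleParam t}ᶜ := K.finite_isDoubleParam.countable.dense_compl ℝ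
  obtain ⟨u, hu, hud⟩ := hd.inter_nhds_nonempty
    (inter_mem (inter_mem h h') (Ioo_mem_nhds ht.1 ht.2))
  obtain ⟨L, hL⟩ := exists_kinkAt hε hud.2 hu
  exact (hud.1.1 L hL).symm.trans (hud.1.2 L hL)

lemma exists_kinkNear (hε : ε = 1 ∨ ε = -1) (ht : t ∈ Ioo (0 : ℝ) 1) (hd : ¬ K.IsDoubleParam t) :
    ∃ c, KinkNear ε K c t := by
  obtain ⟨L, W, hs, hW⟩ := exists_kinkAt hε ht hd
  refine ⟨L.toFramedKnotoid, ?_⟩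
  filter_upwards [Ioo_mem_nhds hs.1 hs.2] with u hu L' hL'
  exact hL'.toFramedKnotoid_eq hε ⟨W, hu, hW⟩

/-- The framed knotoid obtained by creating a kink depends locally constantly on the place. -/
lemma toFramedKnotoid_eq_of_isPreconnected (hε : ε = 1 ∨ ε = -1) {S : Set ℝ}
    (hS : IsPreconnected S) (hS' : S ⊆ Ioo 0 1) (hloc : ∀ t ∈ S, ∃ c, KinkNear ε K c t)
    (hs : s ∈ S) (ht : t ∈ S) (h₁ : KinkAt ε K s K₁) (h₂ : KinkAt ε K t K₂) :
    K₁.toFramedKnotoid = K₂.toFramedKnotoid := by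
  obtain ⟨c, hc, hc'⟩ := hS.induction₂' (fun x y => ∃ c, KinkNear ε K c x ∧ KinkNear ε K c y)
    (fun x hx => by
      obtain ⟨c, hc⟩ := hloc x hx
      filter_upwards [mem_nhdsWithin_of_mem_nhds (eventually_eventually_nhds.2 hc)] with y hy
      exact ⟨⟨c, hc, hy⟩, c, hy, hc⟩)
    (fun x y z _ hy _ ⟨c, h1, h2⟩ ⟨c', h3, h4⟩ =>
      ⟨c, h1, (h2.unique hε (hS' hy) h3) ▸ h4⟩) hs ht
  exact (hc.self_of_nhds K₁ h₁).trans (hc'.self_of_nhds K₂ h₂).symm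

namespace LocalModel

variable (M : LocalModel K)

lemma isPreconnected_image_A {S : Set ℝ} (hS : IsPreconnected S) : IsPreconnected (M.A '' S) :=
  hS.image _ (by unfold A; fun_prop : Continuous M.A).continuousOn

/-- A kink in front of a crossing is, up to framed moves, the kink whose loop is crossed by the
other strand. The strand is first pulled back and forth over the other one, which makes room for
the kink on the near side of the other strand. -/
lemma toFramedKnotoid_kink (hb : M.hasB) (o : ℝˣ) (hε : ε = 1 ∨ ε = -1)
    (ho : ((SignType.sign (M.orient * o) : SignType) : ℤ) = ε) {τ : ℝ} (hτ : τ ∈ Ioo (-5 : ℝ) 0)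
    (h : KinkAt ε K (M.A τ) L) : L.toFramedKnotoid = (M.mod _ (flat_kink _) o).toFramedKnotoid := by
  have h4 : |(-4 : ℝ)| < 5 := by norm_num [abs_lt]
  have hA4 : M.A (-4) ∈ Ioo (0 : ℝ) 1 := M.A_mem _ h4
  have hsame := same_mod_base (M := M) (flat_base _) (fun _ => rfl) o
  -- slide the kink on `K` away from the crossing
  have hK : ∀ σ ∈ Ioo (-5 : ℝ) 0, ¬ K.IsDoubleParam (M.A σ) := fun σ hσ hd =>
    not_isDoubleParam_A (flat_base _) o (abs_lt.2 ⟨hσ.1, by linarith [hσ.2]⟩)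
      (fun h0 h1 => h0 (by linarith)) (fun _ h0 => by linarith [hσ.2])
      ((hsame.isDoubleParam_iff _).2 hd)
  have hm4 : (-4 : ℝ) ∈ Ioo (-5 : ℝ) 0 := by norm_num
  have hsub : M.A '' Ioo (-5) 0 ⊆ Ioo 0 1 := by
    rintro _ ⟨σ, hσ, rfl⟩
    exact M.A_mem σ (abs_lt.2 ⟨hσ.1, by linarith [hσ.2]⟩)
  obtain ⟨L₁, D₁, hL₁, hD₁, e₁⟩ : ∃ L₁ D₁, KinkAt ε K (M.A (-4)) L₁ ∧
      KinkAt ε (M.mod _ (flat_detour _) o) (M.A (-4)) D₁ ∧ Reidemeister2 L₁ D₁ := by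
    obtain ⟨W, hW, hi⟩ := M.reidemeister2_base_detour hb o
    obtain ⟨L₁, D₁, h1, h2, h3⟩ := hW.exists_kinkAt hε hA4 hi
      fun hd => hK _ hm4 ((hsame.isDoubleParam_iff _).1 hd)
    exact ⟨L₁, D₁, hsame.kinkAt h1, h2, W, h3⟩
  have s₁ : L.toFramedKnotoid = L₁.toFramedKnotoid := by
    refine toFramedKnotoid_eq_of_isPreconnected hε (M.isPreconnected_image_A isPreconnected_Ioo)
      hsub ?_ (mem_image_of_mem _ hτ) (mem_image_of_mem _ hm4) h hL₁
    rintro _ ⟨σ, hσ, rfl⟩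
    exact exists_kinkNear hε (hsub (mem_image_of_mem _ hσ)) (hK σ hσ)
  -- after the detour has been withdrawn, the kink slides on towards the crossing
  have hE : ∀ σ ∈ Ioo (-5 : ℝ) 1, ¬ (M.mod _ (flat_left_detour _) o).IsDoubleParam (M.A σ) :=
    fun σ hσ => not_isDoubleParam_A (flat_left_detour _) o (abs_lt.2 ⟨hσ.1, by linarith [hσ.2]⟩)
      (fun h0 => self_ne_of_pos (fun t => left_detour_self_ne) h0)
      (fun _ => (left_neg (fun t h => by linarith [detour_le h]) hσ.2).ne)
  have hm4' : (-4 : ℝ) ∈ Ioo (-5 : ℝ) 1 := by norm_num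
  obtain ⟨E₂, D₂, hE₂, hD₂, e₂⟩ : ∃ E₂ D₂,
      KinkAt ε (M.mod _ (flat_left_detour _) o) (M.A (-4)) E₂ ∧
      KinkAt ε (M.mod _ (flat_detour _) o) (M.A (-4)) D₂ ∧ Reidemeister2 E₂ D₂ := by
    obtain ⟨W, hW, hi⟩ := M.reidemeister2_left_detour hb o
    obtain ⟨E₂, D₂, h1, h2, h3⟩ := hW.exists_kinkAt hε hA4 hi (hE _ hm4')
    exact ⟨E₂, D₂, h1, h2, W, h3⟩
  have s₂ : E₂.toFramedKnotoid = (M.mod _ (flat_left_kink _) o).toFramedKnotoid := by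
    have hsub' : M.A '' Ioo (-5) 1 ⊆ Ioo 0 1 := by
      rintro _ ⟨σ, hσ, rfl⟩
      exact M.A_mem σ (abs_lt.2 ⟨hσ.1, by linarith [hσ.2]⟩)
    refine toFramedKnotoid_eq_of_isPreconnected hε (M.isPreconnected_image_A isPreconnected_Ioo)
      hsub' ?_ (mem_image_of_mem _ hm4') ⟨0, by norm_num, by simp [A]⟩ hE₂ (ho ▸ M.kinkAt_left o)
    rintro _ ⟨σ, hσ, rfl⟩
    exact exists_kinkNear hε (hsub' (mem_image_of_mem _ hσ)) (hE σ hσ)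
  rw [s₁, e₁.toFramedKnotoid_eq, hD₁.toFramedKnotoid_eq hε hD₂, ← e₂.toFramedKnotoid_eq, s₂,
    (M.reidemeister2_left_kink hb o).toFramedKnotoid_eq]

end LocalModel

/-- A kink slides through a crossing: before the crossing it is the modification `kink`, after it
the mirror image of `kink`, and a third move exchanges the two. -/
lemma exists_kinkNear_of_isDoubleParam (hε : ε = 1 ∨ ε = -1) (hd : K.IsDoubleParam t) :
    ∃ c, KinkNear ε K c t := by
  obtain ⟨ht, s, hs, hst, hc⟩ := id hd
  obtain ⟨M, rfl, hb, -⟩ := K.exists_localModel_of_double ht hs hst.symm hc.symm univ_mem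
  obtain ⟨o, ho⟩ := exists_unit_sign M.orient_ne hε
  refine ⟨(M.mod _ (flat_kink _) o).toFramedKnotoid, ?_⟩
  have h0 : M.A 0 = M.t₀ := by simp [LocalModel.A]
  have hev := M.eventually_lt_A (τ := 0) (by simp)
  rw [h0] at hev
  filter_upwards [hev] with u hu L hL
  obtain ⟨τ, rfl⟩ : ∃ τ, u = M.A τ := ⟨M.invA u, (M.A_invA u).symm⟩
  rw [M.invA_A, abs_lt] at hu
  rcases lt_trichotomy τ 0 with h | rfl | h
  · exact M.toFramedKnotoid_kink hb o hε ho ⟨hu.1, h⟩ hL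
  · rw [h0] at hL
    exact absurd hd hL.not_isDoubleParam
  · have e : M.orient * o = M.mirror.orient * (-o : ℝˣ) := by
      rw [Units.val_neg]; exact (neg_mul_neg _ _).symm
    have e' : M.A τ = M.mirror.A (-τ) := by rw [LocalModel.mirror_A, neg_neg]
    rw [e'] at hL
    rw [M.mirror.toFramedKnotoid_kink hb (-o) hε (e ▸ ho) ⟨by linarith, by linarith⟩ hL,
      ← (LocalModel.same_mod_mirror (M := M) (flat_kink _) (-o)).isotopic.toFramedKnotoid_eq,
      (M.reidemeister3_kink hb o).toFramedKnotoid_eq]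
    simp only [neg_neg]

/-- All kinks of sign `ε` on a diagram represent the same framed knotoid. -/
lemma Kinked.toFramedKnotoid_eq (hε : ε = 1 ∨ ε = -1) (h₁ : Kinked ε K K₁) (h₂ : Kinked ε K K₂) :
    K₁.toFramedKnotoid = K₂.toFramedKnotoid := by
  obtain ⟨s, h₁⟩ := h₁.exists_kinkAt
  obtain ⟨t, h₂⟩ := h₂.exists_kinkAt
  refine toFramedKnotoid_eq_of_isPreconnected hε (isPreconnected_Ioo (a := (0 : ℝ)) (b := 1))
    subset_rfl (fun t ht => ?_) h₁.mem_Ioo h₂.mem_Ioo h₁ h₂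
  by_cases hd : K.IsDoubleParam t
  exacts [exists_kinkNear_of_isDoubleParam hε hd, exists_kinkNear hε ht hd]

/-- Away from the discs of given strands, there are parameters where kinks can be created. -/
lemma Window.exists_param (W : Window n) (K : KnotoidDiagram) :
    ∃ s ∈ Ioo (0 : ℝ) 1, (∀ i, s ∉ Icc (W.a i) (W.b i)) ∧ ¬ K.IsDoubleParam s := by
  have h1 : ∀ᶠ s in 𝓝[>] (0 : ℝ), s < 1 ∧ ∀ i, s < W.a i :=
    mem_nhdsWithin_of_mem_nhds ((gt_mem_nhds one_pos).and
      (eventually_all.2 fun i => gt_mem_nhds (W.a_pos i)))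
  have h2 : ∀ᶠ s in 𝓝[>] (0 : ℝ), ¬ K.IsDoubleParam s := by
    have h3 : {t | K.IsDoubleParam t}ᶜ ∈ 𝓝 (0 : ℝ) :=
      K.finite_isDoubleParam.isClosed.isOpen_compl.mem_nhds fun h => lt_irrefl _ h.mem_Ioo.1
    exact mem_nhdsWithin_of_mem_nhds h3
  obtain ⟨s, ⟨hs, hs'⟩, hd, h0⟩ := (h1.and (h2.and self_mem_nhdsWithin)).exists
  exact ⟨s, ⟨h0, hs⟩, fun i hi => (hs' i).not_ge hi.1, hd⟩

/-- The creation of kinks is compatible with the framed moves. -/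
lemma FramedKnotoidMove.kinked_toFramedKnotoid_eq (hε : ε = 1 ∨ ε = -1)
    (h : FramedKnotoidMove K L) (h₁ : Kinked ε K K₁) (h₂ : Kinked ε L K₂) :
    K₁.toFramedKnotoid = K₂.toFramedKnotoid := by
  suffices ∃ K' L', Kinked ε K K' ∧ Kinked ε L L' ∧ FramedKnotoidMove K' L' by
    obtain ⟨K', L', hK, hL, h⟩ := this
    rw [h₁.toFramedKnotoid_eq hε hK, h.toFramedKnotoid_eq, hL.toFramedKnotoid_eq hε h₂]
  rcases h with h | ⟨W, hW, p, q, hp, hq, hpq⟩ | ⟨W, hW⟩ | ⟨W, hW, h1, h2⟩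
  · obtain ⟨L', hL, h⟩ := h₁.exists_isotopic h
    exact ⟨_, L', h₁, hL, Or.inl h⟩
  · obtain ⟨s, hs, hsW, hd⟩ := W.exists_param K
    obtain ⟨K', L', hK, hL, hW', cK, cL⟩ := hW.exists_kinkAt hε hs hsW hd
    refine ⟨K', L', hK.kinked, hL.kinked, Or.inr (Or.inl ⟨W, hW', p, q, (cK 0 0).1.trans hp,
      (cL 0 0).1.trans hq, ?_⟩)⟩
    rw [(cK 0 0).2 p (by rw [hp]; rfl), (cL 0 0).2 q (by rw [hq]; rfl), hpq]
  · obtain ⟨s, hs, hsW, hd⟩ := W.exists_param K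
    obtain ⟨K', L', hK, hL, hW'⟩ := Window.Bigon.exists_kinkAt hW hε hs hsW hd
    exact ⟨K', L', hK.kinked, hL.kinked, Or.inr (Or.inr (Or.inl ⟨W, hW'⟩))⟩
  · obtain ⟨s, hs, hsW, hd⟩ := W.exists_param K
    obtain ⟨K', L', hK, hL, hW', cK, cL⟩ := hW.exists_kinkAt hε hs hsW hd
    refine ⟨K', L', hK.kinked, hL.kinked, Or.inr (Or.inr (Or.inr ⟨W, hW', fun i j hij => ?_,
      fun i j hij => ?_⟩))⟩
    · rw [(cK i j).1, (cL i j).1]; exact h1 i j hij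
    · obtain ⟨p, q, hp, hq, hpq⟩ := h2 i j hij
      refine ⟨p, q, (cK i j).1.trans hp, (cL i j).1.trans hq, ?_⟩
      rw [(cK i j).2 p (by rw [hp]; rfl), (cL i j).2 q (by rw [hq]; rfl), hpq]

lemma exists_kinked (hε : ε = 1 ∨ ε = -1) (K : KnotoidDiagram) : ∃ L, Kinked ε K L := by
  have hd : Dense {t | K.IsDoubleParam t}ᶜ := K.finite_isDoubleParam.countable.dense_compl ℝ
  obtain ⟨u, hu, hud⟩ := hd.inter_open_nonempty _ isOpen_Ioo (nonempty_Ioo.2 zero_lt_one)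
  obtain ⟨L, hL⟩ := exists_kinkAt hε hu hud
  exact ⟨L, hL.kinked⟩

/-- The framed knotoid obtained by creating a kink depends on that of the diagram only. -/
lemma kinked_toFramedKnotoid_eq_of_eqvGen (hε : ε = 1 ∨ ε = -1)
    (g : KnotoidDiagram → KnotoidDiagram) (hg : ∀ K, Kinked ε K (g K)) (h : Relation.EqvGen FramedKnotoidMove K L) :
    (g K).toFramedKnotoid = (g L).toFramedKnotoid := by
  induction h with
  | rel K L h => exact h.kinked_toFramedKnotoid_eq hε (hg K) (hg L)
  | refl => rfl
  | symm K L h ih => exact ih.symm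
  | trans K L M h h' ih ih' => exact ih.trans ih'

/-- The effect on framed knotoids of creating a kink of sign `ε`. -/
noncomputable def kinkMap (hε : ε = 1 ∨ ε = -1) (x : FramedKnotoid) : FramedKnotoid :=
  Quotient.lift (s := Relation.EqvGen.setoid FramedKnotoidMove)
    (fun K : KnotoidDiagram => (Classical.choose (exists_kinked hε K)).toFramedKnotoid)
    (fun _ _ h => kinked_toFramedKnotoid_eq_of_eqvGen hε _
      (fun K => Classical.choose_spec (exists_kinked hε K)) h) x

lemma Kinked.kinkMap_eq (hε : ε = 1 ∨ ε = -1) (h : Kinked ε K L) :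
    kinkMap hε K.toFramedKnotoid = L.toFramedKnotoid :=
  Kinked.toFramedKnotoid_eq hε (Classical.choose_spec (exists_kinked hε K)) h

/-- Two kinks of opposite signs cancel: if one is created on the loop of the other, the result
comes from a second move. -/
lemma kinkMap_kinkMap (hε : ε = 1 ∨ ε = -1) (hε' : -ε = 1 ∨ -ε = -1) (x : FramedKnotoid) :
    kinkMap hε' (kinkMap hε x) = x := by
  obtain ⟨K, rfl⟩ := Quotient.exists_rep x
  change kinkMap hε' (kinkMap hε K.toFramedKnotoid) = K.toFramedKnotoid
  have hd : Dense {t | K.IsDoubleParam t}ᶜ := K.finite_isDoubleParam.countable.dense_compl ℝ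
  obtain ⟨u, hu, hud⟩ := hd.inter_open_nonempty _ isOpen_Ioo (nonempty_Ioo.2 zero_lt_one)
  obtain ⟨M, o, rfl, hb, -, rfl⟩ := exists_localModel_sign hε hu hud univ_mem
  have h := (M.kinkAt_inner hb o).kinked
  rw [Left.sign_neg, SignType.coe_neg] at h
  rw [(M.kinkAt_oneLoop hb o).kinked.kinkMap_eq, h.kinkMap_eq,
    ← (M.reidemeister2_base_twoLoops hb o).toFramedKnotoid_eq,
    ← (LocalModel.same_mod_base (flat_base _) (fun _ => rfl) o).isotopic.toFramedKnotoid_eq]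

/-! ### Removing a loop -/

/-- A smooth embedded path that follows the negative first axis up to the time `t₀ - η`, turns at
the origin, and follows the positive second axis from the time `t₁ + η` on. -/
lemma exists_corner {t₀ t₁ η : ℝ} (ht : t₀ < t₁) (hη : 0 < η) : ∃ x y : ℝ → ℝ,
    ContDiff ℝ ∞ x ∧ ContDiff ℝ ∞ y ∧
    (∀ t ≤ t₀ - η, x t = (t - t₀) / η ∧ y t = 0) ∧
    (∀ t ≥ t₁ + η, x t = 0 ∧ y t = (t - t₁) / η) ∧
    ∀ t ∈ Ioo (t₀ - 2 * η) (t₁ + 2 * η), |x t| < 2 ∧ |y t| < 2 ∧ (deriv x t ≠ 0 ∨ deriv y t ≠ 0) ∧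
      ∀ s ∈ Ioo (t₀ - 2 * η) (t₁ + 2 * η), x s = x t → y s = y t → s = t := by
  -- Between the two turns the first coordinate grows slowly, with slope `κ / η`, towards a zero
  -- that it would reach at the time `t₁ + 2 * η`.
  set u : ℝ → ℝ := fun t => (t - t₀) / η with hu
  set v : ℝ → ℝ := fun t => (t - t₁) / η with hv
  set m : ℝ := (t₁ + 2 * η - t₀) / η with hm
  have hm2 : 2 < m := by rw [hm, lt_div_iff₀ hη]; linarith
  set κ : ℝ := 1 / (2 * (m + 2)) with hκ
  have hκ0 : 0 < κ := by rw [hκ]; positivity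
  have hκm : κ * (-2 - m) = -1 / 2 := by rw [hκ]; field_simp; ring
  have h1 : t₀ - η < t₀ - η / 2 := by linarith
  have h2 : t₁ + η / 2 < t₁ + η := by linarith
  set ω₁ := step (t₀ - η) (t₀ - η / 2) with hω₁
  set ω₂ := step (t₁ + η / 2) (t₁ + η) with hω₂
  have s1 : ContDiff ℝ ∞ ω₁ := contDiff_step _ _
  have s2 : ContDiff ℝ ∞ ω₂ := contDiff_step _ _
  set X : ℝ → ℝ := fun t => (1 - ω₁ t) * u t + ω₁ t * (κ * (u t - m)) with hX
  set x : ℝ → ℝ := fun t => (1 - ω₂ t) * X t with hx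
  set y : ℝ → ℝ := fun t => ω₂ t * v t with hy
  have du : ∀ t, HasDerivAt u (1 / η) t := fun t => ((hasDerivAt_id t).sub_const t₀).div_const η
  have dv : ∀ t, HasDerivAt v (1 / η) t := fun t => ((hasDerivAt_id t).sub_const t₁).div_const η
  have d1 : ∀ t, HasDerivAt ω₁ (deriv ω₁ t) t := fun t =>
    (s1.differentiable (by simp) t).hasDerivAt
  have d2 : ∀ t, HasDerivAt ω₂ (deriv ω₂ t) t := fun t =>
    (s2.differentiable (by simp) t).hasDerivAt
  have hη' : 0 < 1 / η := by positivity
  have dX : ∀ t, HasDerivAt X ((1 - ω₁ t) * (1 / η) + ω₁ t * (κ * (1 / η)) +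
      deriv ω₁ t * (κ * (u t - m) - u t)) t := fun t => by
    have h := (((d1 t).const_sub 1).mul (du t)).add ((d1 t).mul (((du t).sub_const m).const_mul κ))
    exact h.congr_deriv (by ring)
  have dx : ∀ t, HasDerivAt x ((1 - ω₂ t) * ((1 - ω₁ t) * (1 / η) + ω₁ t * (κ * (1 / η)) +
      deriv ω₁ t * (κ * (u t - m) - u t)) + deriv ω₂ t * -X t) t := fun t => by
    exact (((d2 t).const_sub 1).mul (dX t)).congr_deriv (by ring)
  have dy : ∀ t, HasDerivAt y (ω₂ t * (1 / η) + deriv ω₂ t * v t) t := fun t => by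
    exact ((d2 t).mul (dv t)).congr_deriv (by ring)
  have n1 : ∀ t, 0 ≤ ω₁ t := step_nonneg _ _
  have n1' : ∀ t, 0 ≤ 1 - ω₁ t := fun t => sub_nonneg.2 (step_le_one _ _ _)
  have n2 : ∀ t, 0 ≤ ω₂ t := step_nonneg _ _
  have n2' : ∀ t, 0 ≤ 1 - ω₂ t := fun t => sub_nonneg.2 (step_le_one _ _ _)
  have m1 : ∀ t, 0 ≤ deriv ω₁ t := deriv_step_nonneg h1
  have m2 : ∀ t, 0 ≤ deriv ω₂ t := deriv_step_nonneg h2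
  -- where the second coordinate moves
  have pv : ∀ t, ω₂ t = 0 ∧ deriv ω₂ t = 0 ∨ 0 < v t := fun t => by
    rcases lt_or_ge t (t₁ + η / 2) with h | h
    · refine Or.inl ⟨step_of_le h2 h.le, ?_⟩
      have : ω₂ =ᶠ[𝓝 t] fun _ => 0 := by
        filter_upwards [Iio_mem_nhds h] with s hs using step_of_le h2 (le_of_lt hs)
      rw [this.deriv_eq]; simp
    · exact Or.inr (div_pos (by linarith) hη)
  -- where the first coordinate has not yet turned
  have pu : ∀ t, ω₁ t = 1 ∧ deriv ω₁ t = 0 ∨ u t ≤ -1 / 2 := fun t => by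
    rcases le_or_gt t (t₀ - η / 2) with h | h
    · right
      rw [hu, div_le_iff₀ hη]; linarith
    · refine Or.inl ⟨step_of_ge h1 h.le, ?_⟩
      have : ω₁ =ᶠ[𝓝 t] fun _ => 1 := by
        filter_upwards [Ioi_mem_nhds h] with s hs using step_of_ge h1 (le_of_lt hs)
      rw [this.deriv_eq]; simp
  have hD : ∀ t ∈ Ioo (t₀ - 2 * η) (t₁ + 2 * η), -2 < u t ∧ u t < m ∧ v t < 2 := fun t h => by
    refine ⟨?_, ?_, ?_⟩
    · rw [hu, lt_div_iff₀ hη]; linarith [h.1]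
    · exact div_lt_div_of_pos_right (by linarith [h.2]) hη
    · rw [hv, div_lt_iff₀ hη]; linarith [h.2]
  have bX : ∀ t ∈ Ioo (t₀ - 2 * η) (t₁ + 2 * η), -2 < X t ∧ X t < 0 := fun t h => by
    obtain ⟨h3, h4, -⟩ := hD t h
    have h5 : κ * (u t - m) < 0 := mul_neg_of_pos_of_neg hκ0 (by linarith)
    have h6 : -1 / 2 < κ * (u t - m) := by rw [← hκm]; gcongr
    rcases pu t with ⟨h7, -⟩ | h7
    · rw [hX]; simp only [h7]; constructor <;> linarith
    · have a1 := n1 t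
      have a2 := n1' t
      constructor
      · have : 0 < (1 - ω₁ t) * (u t + 2) + ω₁ t * (κ * (u t - m) + 2) := by
          rcases a1.eq_or_lt with h8 | h8
          · rw [← h8]; linarith
          · exact add_pos_of_nonneg_of_pos (mul_nonneg a2 (by linarith))
              (mul_pos h8 (by linarith))
        simp only [hX]; linarith
      · have : 0 < (1 - ω₁ t) * (-u t) + ω₁ t * (-(κ * (u t - m))) := by
          rcases a1.eq_or_lt with h8 | h8
          · rw [← h8]; linarith
          · exact add_pos_of_nonneg_of_pos (mul_nonneg a2 (by linarith))
              (mul_pos h8 (by linarith))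
        simp only [hX]; linarith
  have dpos : ∀ t ∈ Ioo (t₀ - 2 * η) (t₁ + 2 * η), 0 < deriv x t + deriv y t := fun t h => by
    rw [(dx t).deriv, (dy t).deriv]
    obtain ⟨h3, h4, -⟩ := hD t h
    have b1 : 0 < (1 - ω₁ t) * (1 / η) + ω₁ t * (κ * (1 / η)) := by
      rcases (n1 t).eq_or_lt with h8 | h8
      · rw [← h8]; linarith
      · exact add_pos_of_nonneg_of_pos (mul_nonneg (n1' t) hη'.le) (by positivity)
    have b2 : 0 ≤ deriv ω₁ t * (κ * (u t - m) - u t) := by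
      rcases pu t with ⟨-, h7⟩ | h7
      · rw [h7, zero_mul]
      · have h6 : -1 / 2 < κ * (u t - m) := by rw [← hκm]; gcongr
        exact mul_nonneg (m1 t) (by linarith)
    have b3 : 0 ≤ deriv ω₂ t * -X t := mul_nonneg (m2 t) (by linarith [(bX t h).2])
    have b4 : 0 ≤ deriv ω₂ t * v t := by
      rcases pv t with ⟨-, h7⟩ | h7
      · rw [h7, zero_mul]
      · exact mul_nonneg (m2 t) h7.le
    rcases (n2 t).eq_or_lt with h8 | h8
    · rw [← h8]; linarith
    · have := mul_nonneg (n2' t) (add_pos_of_pos_of_nonneg b1 b2).le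
      have := mul_pos h8 hη'
      linarith
  have hmono : StrictMonoOn (fun t => x t + y t) (Ioo (t₀ - 2 * η) (t₁ + 2 * η)) := by
    refine strictMonoOn_of_deriv_pos (convex_Ioo _ _)
      (fun t _ => ((dx t).add (dy t)).continuousAt.continuousWithinAt) fun t h => ?_
    rw [interior_Ioo] at h
    have hs : HasDerivAt (fun t => x t + y t) _ t := (dx t).add (dy t)
    rw [hs.deriv, ← (dx t).deriv, ← (dy t).deriv]
    exact dpos t h
  refine ⟨x, y, by fun_prop, by fun_prop, fun t h => ?_, fun t h => ?_, fun t h => ⟨?_, ?_, ?_,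
    fun s hs e1 e2 => hmono.injOn hs h (by simp only [e1, e2])⟩⟩
  · have e1 : ω₁ t = 0 := step_of_le h1 h
    have e2 : ω₂ t = 0 := step_of_le h2 (by linarith)
    simp [hx, hy, hX, e1, e2, hu]
  · have e2 : ω₂ t = 1 := step_of_ge h2 h
    simp [hx, hy, e2, hv]
  · obtain ⟨h3, h4⟩ := bX t h
    have := n2 t
    have := n2' t
    rw [abs_lt]
    constructor <;> simp only [hx] <;> nlinarith
  · have h3 := (hD t h).2.2
    have := n2 t
    have := n2' t
    rcases pv t with ⟨h7, -⟩ | h7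
    · simp [hy, h7]
    · rw [abs_lt]
      constructor <;> simp only [hy] <;> nlinarith
  · by_contra! hc
    have := dpos t h
    rw [hc.1, hc.2] at this
    linarith

/-- Replacing an arc of a diagram, parametrized by `I`, by an embedded arc that is disjoint from
the rest of the diagram. -/
lemma KnotoidDiagram.exists_replace_arc (K : KnotoidDiagram) {I : Set ℝ} {γ : ℝ → S2}
    (hγ : ContDiff ℝ ∞ fun t => (γ t : E3)) (hv : ∀ t ∈ I, velocity γ t ≠ 0) (hK : ∀ t ∉ I, γ =ᶠ[𝓝 t] K.curve)
    (hi : ∀ s ∈ I, ∀ t ∈ Icc (0 : ℝ) 1, γ s = γ t → s = t) :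
    ∃ N : KnotoidDiagram, N.curve = γ ∧ N.upper = K.upper := by
  have hc : ∀ s ∈ Icc (0 : ℝ) 1, ∀ t ∈ Icc (0 : ℝ) 1, s ≠ t → γ s = γ t →
      s ∉ I ∧ t ∉ I ∧ K.curve s = K.curve t := fun s hs t ht hst h => by
    have h1 : s ∉ I := fun h' => hst (hi s h' t ht h)
    have h2 : t ∉ I := fun h' => hst (hi t h' s hs h.symm).symm
    exact ⟨h1, h2, by rw [← (hK s h1).eq_of_nhds, ← (hK t h2).eq_of_nhds, h]⟩
  refine ⟨⟨γ, K.upper, hγ, fun t ht => ?_, fun s hs t ht hst h => ?_, fun s hs t ht u hu h h' => ?_,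
    fun s hs t ht hst h => ?_, fun s hs t ht hst h => ?_⟩, rfl, rfl⟩
  · by_cases h : t ∈ I
    · exact hv t h
    · rw [velocity_congr (hK t h)]; exact K.immersion t ht
  · exact K.endpoints s hs t ht hst (hc s hs t ht hst h).2.2
  · by_contra! hne
    have := K.double s hs t ht u hu (hc s hs t ht hne.1 h).2.2 (hc t ht u hu hne.2.1 h').2.2
    tauto
  · obtain ⟨h1, h2, h3⟩ := hc s hs t ht hst h
    rw [velocity_congr (hK s h1), velocity_congr (hK t h2)]
    exact K.transversal s hs t ht hst h3
  · exact K.upper_iff s hs t ht hst (hc s hs t ht hst h).2.2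

namespace Window

variable {K : KnotoidDiagram} {W : Window 1}

/-- A loop at a double point `K s = K t` can be cut off in a disc that contains it: near the double
point the curve turns from one branch to the other, and the loop is skipped. -/
lemma Meets.exists_replaces_of_double (hW : W.Meets K) {s t : ℝ} (hs : s ∈ Ioo (W.a 0) (W.b 0))
    (ht : t ∈ Ioo (W.a 0) (W.b 0)) (hst : s < t) (h : K.curve s = K.curve t)
    (hc : ∀ q ∈ W.crossings K 0 0, q.1 ∈ Icc s t) :
    ∃ N, W.Replaces N K ∧ W.crossings N 0 0 = ∅ := by
  obtain ⟨M, e1, hb, e2, e3, hη, hO⟩ := K.exists_localModel_of_double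
    (W.Ioo_subset hs) (W.Ioo_subset ht) hst.ne h (hW.image_ball_mem_nhds hs)
  set η := M.mu with hηdef
  obtain ⟨x, y, sx, sy, h0, h1, hxy⟩ := exists_corner hst hη
  set I := Ioo (s - 2 * η) (t + 2 * η) with hI
  set γ : ℝ → S2 := by
    classical exact fun r => if r ∈ I then M.G (5 * x r, y r - x r ^ 2) else K.curve r with hγ
  have hAc : ∀ τ, |τ| < 5 → K.curve (s + η * τ) = M.G (5 * τ, -τ ^ 2) := fun τ hτ => by
    rw [← e1, ← e3]; exact M.A_curve τ hτ
  have hBc : ∀ v, |v| < 25 → K.curve (t + η * v) = M.G (0, v) := fun v hv => by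
    rw [← e2]; exact M.B_curve hb v hv
  have hmem : ∀ {r : ℝ}, r ∈ Icc (0 : ℝ) 1 → K.curve r ∈ M.G '' box →
      r ∈ Ioo (W.a 0) (W.b 0) := fun hr hm => by
    obtain ⟨i, hi⟩ := (hW.2.1 _ hr).1 (hO hm)
    rwa [Subsingleton.elim i 0] at hi
  have hbox : ∀ {a b : ℝ}, |a| < 2 → |b| < 2 → (5 * a, b - a ^ 2) ∈ box := fun ha hb => by
    rw [abs_lt] at ha hb
    rw [mem_box, abs_lt, abs_lt]
    refine ⟨⟨by linarith, by linarith⟩, by nlinarith, by nlinarith⟩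
  have hIW : I ⊆ Ioo (W.a 0) (W.b 0) := fun r hr => by
    have a1 : |(-2 : ℝ)| < 5 := by norm_num
    have a2 : |(2 : ℝ)| < 25 := by norm_num
    have m1 := hmem (M.mem_Icc_A a1) (M.A_mem_image a1)
    have m2 := hmem (Ioo_subset_Icc_self (M.B_mem hb _ a2)) (M.B_mem_image hb a2)
    simp only [LocalModel.A, e1, e2, e3] at m1 m2
    exact ⟨by linarith [m1.1, hr.1], by linarith [m2.2, hr.2]⟩
  have hI1 : ∀ r ∈ I, γ r = M.G (5 * x r, y r - x r ^ 2) := fun r hr => if_pos hr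
  have hI2 : ∀ r ∉ I, γ r = K.curve r := fun r hr => if_neg hr
  -- the new arc continues the curve
  have hend : ∀ r, r < s - η ∨ t + η < r → γ r = K.curve r := fun r hr => by
    by_cases hrI : r ∈ I
    · rw [hI1 r hrI]
      rcases hr with hr | hr
      · obtain ⟨ex, ey⟩ := h0 r hr.le
        have hτ : |(r - s) / η| < 5 := by
          have := (hxy r hrI).1
          rw [ex] at this; linarith
        rw [ex, ey, zero_sub, ← hAc _ hτ]
        congr 1; field_simp; ring
      · obtain ⟨ex, ey⟩ := h1 r hr.le
        have hv : |(r - t) / η| < 25 := by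
          have := (hxy r hrI).2.1
          rw [ey] at this; linarith
        rw [ex, ey, mul_zero, zero_pow two_ne_zero, sub_zero, ← hBc _ hv]
        congr 1; field_simp; ring
    · exact hI2 r hrI
  have hK : ∀ r ∉ I, γ =ᶠ[𝓝 r] K.curve := fun r hr => by
    rw [hI, mem_Ioo, not_and_or, not_lt, not_lt] at hr
    rcases hr with hr | hr
    · filter_upwards [Iio_mem_nhds (by linarith : r < s - η)] with r' hr' using hend r' (Or.inl hr')
    · filter_upwards [Ioi_mem_nhds (by linarith : t + η < r)] with r' hr' using hend r' (Or.inr hr')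
  have hev : ∀ r ∈ I, (fun r => (γ r : E3)) =ᶠ[𝓝 r] fun r => (M.G (5 * x r, y r - x r ^ 2) : E3) :=
    fun r hr => by
      filter_upwards [isOpen_Ioo.mem_nhds hr] with r' hr'
      rw [hI1 r' hr']
  have hbx : ∀ r ∈ I, (5 * x r, y r - x r ^ 2) ∈ box := fun r hr => hbox (hxy r hr).1 (hxy r hr).2.1
  have hsm : ContDiff ℝ ∞ fun r => (γ r : E3) := contDiff_iff_contDiffAt.2 fun r => by
    by_cases hr : r ∈ I
    · refine ContDiffAt.congr_of_eventuallyEq ?_ (hev r hr)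
      have hg : ContDiffAt ℝ ∞ (fun r => (5 * x r, y r - x r ^ 2)) r := by
        have : ContDiff ℝ ∞ (fun r => (5 * x r, y r - x r ^ 2)) := by fun_prop
        exact this.contDiffAt
      exact ContDiffAt.comp (g := fun z => (M.G z : E3)) r
        (M.smooth.contDiffAt (isOpen_box.mem_nhds (hbx r hr))) hg
    · refine K.smooth.contDiffAt.congr_of_eventuallyEq ?_
      filter_upwards [hK r hr] with r' hr'
      rw [hr']
  have hvel : ∀ r ∈ I, velocity γ r ≠ 0 := fun r hr => by
    have dx := (sx.differentiable (by simp) r).hasDerivAt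
    have dy := (sy.differentiable (by simp) r).hasDerivAt
    have d := (M.hasFDerivAt (hbx r hr)).comp_hasDerivAt r
      ((dx.const_mul 5).prodMk (dy.sub (dx.pow 2)))
    have hd : velocity γ r = _ := ((hev r hr).hasDerivAt_iff.2 d).deriv
    rw [hd]
    refine M.DG_ne_zero (hbx r hr) ?_
    by_cases h5 : deriv x r = 0
    · right
      rw [h5]
      simpa using (hxy r hr).2.2.1.resolve_left (not_not.2 h5)
    · exact Or.inl (mul_ne_zero (by norm_num) h5)
  have hpsi : ∀ {a b a' b' : ℝ}, |a| < 2 → |b| < 2 → (5 * a', b' - a' ^ 2) ∈ box →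
      M.G (5 * a, b - a ^ 2) = M.G (5 * a', b' - a' ^ 2) → a = a' ∧ b = b' := fun ha hb h' he => by
    obtain ⟨h2, h3⟩ := Prod.mk.inj (M.inj (hbox ha hb) h' he)
    have h4 := mul_left_cancel₀ (by norm_num : (5 : ℝ) ≠ 0) h2
    rw [h4] at h3
    exact ⟨h4, sub_left_injective h3⟩
  have hinj : ∀ r ∈ I, ∀ r' ∈ Icc (0 : ℝ) 1, γ r = γ r' → r = r' := fun r hr r' hr' he => by
    obtain ⟨hx, hy, -⟩ := hxy r hr
    by_cases hrI : r' ∈ I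
    · rw [hI1 r hr, hI1 r' hrI] at he
      obtain ⟨e4, e5⟩ := hpsi hx hy (hbx r' hrI) he
      exact (hxy r' hrI).2.2.2 r hr e4 e5
    · exfalso
      apply hrI
      rw [hI1 r hr, hI2 r' hrI] at he
      have hlam := e3
      rcases M.rest r' hr' ⟨_, hbx r hr, he⟩ with ⟨τ, hτ, rfl⟩ | ⟨-, v, hv, rfl⟩
      · rw [M.A_curve τ hτ, ← zero_sub] at he
        have hm : (5 * τ, 0 - τ ^ 2) ∈ box := by
          rw [abs_lt] at hτ
          rw [mem_box, abs_lt, abs_lt]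
          refine ⟨⟨by linarith, by linarith⟩, by nlinarith, by nlinarith⟩
        obtain ⟨e4, -⟩ := hpsi hx hy hm he
        rw [e4, abs_lt] at hx
        rw [e1, e3]
        constructor <;> nlinarith
      · have he' : M.G (5 * x r, y r - x r ^ 2) = M.G (5 * 0, v - 0 ^ 2) := by
          rw [he, M.B_curve hb v hv]; norm_num
        obtain ⟨-, e5⟩ := hpsi hx hy (by
          rw [mem_box]; norm_num; exact hv) he'
        rw [e5, abs_lt] at hy
        rw [e2, ← hηdef]
        constructor <;> nlinarith
  obtain ⟨N, hN, hNu⟩ := K.exists_replace_arc hsm hvel hK hinj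
  have hNK : ∀ r ∉ I, N.curve r = K.curve r := fun r hr => by rw [hN, hI2 r hr]
  have hpair : ∀ r ∈ Icc (0 : ℝ) 1, ∀ r' ∈ Icc (0 : ℝ) 1, r ≠ r' → N.curve r = N.curve r' →
      r ∉ I ∧ K.curve r = K.curve r' := fun r hr r' hr' hne he => by
    rw [hN] at he
    have i1 : r ∉ I := fun h' => hne (hinj r h' r' hr' he)
    have i2 : r' ∉ I := fun h' => hne (hinj r' h' r hr he.symm).symm
    exact ⟨i1, by rw [← hI2 r i1, ← hI2 r' i2, he]⟩
  have hNW : ∀ r ∈ I, N.curve r ∈ W.chart '' Metric.ball 0 1 := fun r hr => by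
    rw [hN, hI1 r hr]
    exact hO ⟨_, hbx r hr, rfl⟩
  have hNd : ∀ {r}, N.IsDoubleParam r → K.IsDoubleParam r := fun {r} ⟨hr, r', hr', hne, he⟩ =>
    ⟨hr, r', hr', hne, ((hpair r hr r' hr' hne.symm he.symm).2).symm⟩
  refine ⟨N, ⟨⟨fun r hr => ?_, fun r hr => ?_, fun i => ⟨fun hd => (hW.2.2 i).1 (hNd hd),
    fun hd => (hW.2.2 i).2 (hNd hd)⟩⟩, hW, fun r hr hi => ⟨hNK r fun h' => hi 0 (hIW h'),
    fun _ => by rw [hNu]⟩⟩, ?_⟩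
  · by_cases hrI : r ∈ I
    · exact iff_of_true (image_mono Metric.ball_subset_closedBall (hNW r hrI))
        ⟨0, Ioo_subset_Icc_self (hIW hrI)⟩
    · rw [hNK r hrI]; exact hW.1 r hr
  · by_cases hrI : r ∈ I
    · exact iff_of_true (hNW r hrI) ⟨0, hIW hrI⟩
    · rw [hNK r hrI]; exact hW.2.1 r hr
  · refine Set.eq_empty_of_forall_notMem fun q ⟨⟨q1, q2, q3, q4, q5⟩, hq⟩ => ?_
    obtain ⟨i1, i2⟩ := hpair _ q1 _ q2 q3 q4
    have := hc q ⟨⟨q1, q2, q3, i2, by rwa [← hNu]⟩, hq⟩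
    exact i1 ⟨by linarith [this.1], by linarith [this.2]⟩

end Window

/-- A weakened first move is the deletion of a loop followed by the creation of another one. -/
lemma Reidemeister1'.exists_reidemeister1 {K L : KnotoidDiagram} (h : Reidemeister1' K L) :
    ∃ N, Reidemeister1 N K ∧ Reidemeister1 N L := by
  obtain ⟨W, hW, p, q, hp, hq, -⟩ := h
  have hpm : p ∈ W.crossings K 0 0 := by rw [hp]; rfl
  obtain ⟨⟨-, -, hne, he, -⟩, h1, h2⟩ := hpm
  have hN : ∃ N, W.Replaces N K ∧ W.crossings N 0 0 = ∅ := by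
    rcases lt_or_gt_of_ne hne with hlt | hlt
    · exact hW.1.exists_replaces_of_double h1 h2 hlt he fun r hr => by
        rw [hp] at hr; rw [hr]; exact left_mem_Icc.2 hlt.le
    · exact hW.1.exists_replaces_of_double h2 h1 hlt he.symm fun r hr => by
        rw [hp] at hr; rw [hr]; exact right_mem_Icc.2 hlt.le
  obtain ⟨N, hr, hc⟩ := hN
  exact ⟨N, ⟨W, hr, hc, p, hp⟩, ⟨W, hr.trans hW, hc, q, hq⟩⟩

/-! ### Framed knotoids are knotoids with an integer -/

variable {K L : KnotoidDiagram}

lemma KnotoidMove.toKnotoid_eq (h : KnotoidMove K L) : K.toKnotoid = L.toKnotoid :=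
  Quotient.sound (Relation.EqvGen.rel _ _ h)

lemma Reidemeister1'.toKnotoid_eq (h : Reidemeister1' K L) : K.toKnotoid = L.toKnotoid := by
  obtain ⟨N, hK, hL⟩ := h.exists_reidemeister1
  rw [← KnotoidMove.toKnotoid_eq (Or.inr (Or.inl hK)),
    ← KnotoidMove.toKnotoid_eq (Or.inr (Or.inl hL))]

lemma FramedKnotoidMove.toKnotoid_eq (h : FramedKnotoidMove K L) :
    K.toKnotoid = L.toKnotoid := by
  rcases h with h | h | h | h
  exacts [KnotoidMove.toKnotoid_eq (Or.inl h), h.toKnotoid_eq,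
    KnotoidMove.toKnotoid_eq (Or.inr (Or.inr (Or.inl h))),
    KnotoidMove.toKnotoid_eq (Or.inr (Or.inr (Or.inr h)))]

lemma FramedKnotoidMove.writhe_eq (h : FramedKnotoidMove K L) : K.writhe = L.writhe := by
  rcases h with h | h | h | h
  exacts [h.writhe_eq, h.writhe_eq, h.writhe_eq, h.writhe_eq]

namespace FramedKnotoid

lemma toKnotoid_writhe_eq_of_eqvGen (h : Relation.EqvGen FramedKnotoidMove K L) :
    (K.toKnotoid, K.writhe) = (L.toKnotoid, L.writhe) := by
  induction h with
  | rel K L h => exact Prod.ext h.toKnotoid_eq h.writhe_eq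
  | refl => rfl
  | symm K L h ih => exact ih.symm
  | trans K L M h h' ih ih' => exact ih.trans ih'

/-- The knotoid and the writhe of a framed knotoid. -/
noncomputable def toKnotoidWrithe (x : FramedKnotoid) : Knotoid × ℤ :=
  Quotient.lift (s := Relation.EqvGen.setoid FramedKnotoidMove)
    (fun K : KnotoidDiagram => (K.toKnotoid, K.writhe))
    (fun _ _ h => toKnotoid_writhe_eq_of_eqvGen h) x

/-- The creation of a positive kink, with the creation of a negative kink as inverse. -/
noncomputable def kinkEquiv : Equiv.Perm FramedKnotoid where
  toFun := kinkMap (ε := 1) (Or.inl rfl)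
  invFun := kinkMap (ε := -1) (Or.inr rfl)
  left_inv := kinkMap_kinkMap _ _
  right_inv := kinkMap_kinkMap (ε := -1) _ (Or.inl rfl)

lemma toKnotoidWrithe_kinkEquiv (x : FramedKnotoid) : (kinkEquiv x).toKnotoidWrithe =
    (x.toKnotoidWrithe.1, x.toKnotoidWrithe.2 + 1) := by
  obtain ⟨K, rfl⟩ := Quotient.exists_rep x
  obtain ⟨L, hL⟩ := exists_kinked (ε := 1) (Or.inl rfl) K
  change (kinkMap (Or.inl rfl) K.toFramedKnotoid).toKnotoidWrithe = (K.toKnotoid, K.writhe + 1)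
  rw [hL.kinkMap_eq, ← hL.writhe_eq, KnotoidMove.toKnotoid_eq (Or.inr (Or.inl hL.reidemeister1))]
  rfl

lemma toKnotoidWrithe_zpow (n : ℤ) (x : FramedKnotoid) : ((kinkEquiv ^ n) x).toKnotoidWrithe =
    (x.toKnotoidWrithe.1, x.toKnotoidWrithe.2 + n) := by
  induction n using Int.induction_on with
  | zero => simp
  | succ n ih => rw [zpow_add_one, Equiv.Perm.mul_apply, ← Equiv.Perm.mul_apply, ← zpow_add_one,
      add_comm (n : ℤ) 1, zpow_one_add, Equiv.Perm.mul_apply, toKnotoidWrithe_kinkEquiv, ih,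
      add_assoc, add_comm (n : ℤ) 1]
  | pred n ih =>
    have h := toKnotoidWrithe_kinkEquiv ((kinkEquiv ^ (-(n : ℤ) - 1)) x)
    rw [← Equiv.Perm.mul_apply, ← zpow_one_add, add_sub_cancel, ih, Prod.mk.injEq] at h
    exact Prod.ext h.1.symm (by linarith [h.2])

/-- Diagrams of the same knotoid differ, as framed knotoids, by a number of kinks. -/
lemma exists_zpow_of_toKnotoid_eq (h : K.toKnotoid = L.toKnotoid) :
    ∃ n : ℤ, L.toFramedKnotoid = (kinkEquiv ^ n) K.toFramedKnotoid := by
  have h' : Relation.EqvGen KnotoidMove K L := Quotient.exact h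
  clear h
  induction h' with
  | rel K L h =>
    rcases h with h | h | h | h
    · exact ⟨0, h.toFramedKnotoid_eq.symm⟩
    · rcases h.exists_kinked with h | h
      · exact ⟨1, (h.kinkMap_eq (Or.inl rfl)).symm⟩
      · exact ⟨-1, by rw [zpow_neg_one]; exact (h.kinkMap_eq (Or.inr rfl)).symm⟩
    · exact ⟨0, h.toFramedKnotoid_eq.symm⟩
    · exact ⟨0, h.toFramedKnotoid_eq.symm⟩
  | refl K => exact ⟨0, rfl⟩
  | symm K L h ih =>
    obtain ⟨n, hn⟩ := ih
    exact ⟨-n, by rw [hn, ← Equiv.Perm.mul_apply, ← zpow_add, neg_add_cancel, zpow_zero]; rfl⟩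
  | trans K L M h h' ih ih' =>
    obtain ⟨n, hn⟩ := ih
    obtain ⟨m, hm⟩ := ih'
    exact ⟨m + n, by rw [hm, hn, ← Equiv.Perm.mul_apply, ← zpow_add]⟩

end FramedKnotoid

/-- The assignment `K ↦ (K, writhe K)` is a well-defined map from framed knotoids to pairs of a
knotoid and an integer, and it is bijective. -/
theorem lemma2p4 :
    ∃ f : FramedKnotoid → Knotoid × ℤ,
      (∀ K : KnotoidDiagram, f K.toFramedKnotoid = (K.toKnotoid, K.writhe)) ∧
      Function.Bijective f := by
  refine ⟨FramedKnotoid.toKnotoidWrithe, fun K => rfl, fun x y hxy => ?_, fun ⟨k, m⟩ => ?_⟩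
  · obtain ⟨K, rfl⟩ := Quotient.exists_rep x
    obtain ⟨L, rfl⟩ := Quotient.exists_rep y
    obtain ⟨n, hn⟩ := FramedKnotoid.exists_zpow_of_toKnotoid_eq (K := K) (L := L) (congrArg Prod.fst hxy)
    have hn' : (⟦L⟧ : FramedKnotoid) = (FramedKnotoid.kinkEquiv ^ n) ⟦K⟧ := hn
    have h := FramedKnotoid.toKnotoidWrithe_zpow n ⟦K⟧
    rw [← hn', ← hxy, Prod.ext_iff] at h
    have h0 : n = 0 := by have := h.2; simp only at this; linarith
    rw [hn', h0]; rfl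
  · obtain ⟨K, rfl⟩ := Quotient.exists_rep k
    refine ⟨(FramedKnotoid.kinkEquiv ^ (m - K.writhe)) K.toFramedKnotoid, ?_⟩
    rw [FramedKnotoid.toKnotoidWrithe_zpow]
    exact Prod.ext rfl (add_sub_cancel K.writhe m)
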